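/- **Theorem.** For every dimension $d$ there are two fixed real-RAM programs (a preprocessing program and a query program) and a constant $C=C(d)$ with the following properties. Let $Z$ be any polygonal curve with $n\ge 2$ vertices in $\mathbb R^d$ (nothing else, such as packedness, is assumed; degenerate edges are allowed), and let $0<\varepsilon\le 1$. Write $\lg x=\max(1,\log_2 x)$ and $\chi=\varepsilon^{-d}\lg(1/\varepsilon)$. 1. Given $n$, $\varepsilon$ and the vertices of $Z$, the preprocessing program builds, in at most $C\chi^2 n\lg^2 n$ steps, a data structure in a memory of at most $C n\chi^2$ cells. 2. Using this data structure, given a query consisting of the endpoints $p,q\in\mathbb R^d$ of an oriented segment $pq$, two points $u,v$ on $Z$, and the indices of edges of $Z$ containing $u$ and $v$, the query program computes, in at most $C\varepsilon^{-2}\,\lg n\,\lg(\lg n)$ steps and within the same memory bound, a number $\Delta$ with $$\Delta\;\le\; d_{\mathcal F}\bigl(Z[u,v],\,pq\bigr)\;\le\;(1+\varepsilon)\,\Delta ,$$ and it leaves the data structure unchanged, so that any number of queries can be answered. Here $Z[u,v]$ is the subcurve of $Z$ from $u$ to $v$ (traversed backwards if $v$ comes before $u$), and $d_{\mathcal F}(X,Y)=\inf_f\max_{\alpha\in[0,1]}\|X(f(\alpha))-Y(\alpha)\|$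 is the Fréchet distance, the infimum being over all continuous one-to-one $f:[0,1]\to[0,1]$ with $f(0)=0$, $f(1)=1$. The real RAM has registers and memory cells holding real numbers; assignment of rational constants, copying, $+,-,\cdot,/$, $\sqrt{\ }$, comparison, indirect reading and writing of a cell, and rounding down a number in $[0,S)$, where $S$ is the number of memory cells, each cost one step. -/

import Mathlib

noncomputable section

/-! ### Polygonal curves and the Fréchet distance -/

/-- The `k`-th vertex of a vertex sequence (the value for `k ≥ n` is never used with a nonzero
weight on the parameter range of the curve). -/
def polyVertex {d n : ℕ} (Z : Fin n → EuclideanSpace ℝ (Fin d)) (k : ℕ) :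
    EuclideanSpace ℝ (Fin d) :=
  if h : k < n then Z ⟨k, h⟩ else 0

/-- The polygonal curve with vertices `Z 0, …, Z (n - 1)`, parametrized over `[0, n - 1]`: on
`[i, i + 1]` it runs along the `i`-th edge at constant speed, from `Z i` to `Z (i + 1)`. -/
def polyCurve {d n : ℕ} (Z : Fin n → EuclideanSpace ℝ (Fin d)) (x : ℝ) :
    EuclideanSpace ℝ (Fin d) :=
  AffineMap.lineMap (polyVertex Z ⌊x⌋₊) (polyVertex Z (⌊x⌋₊ + 1)) (x - (⌊x⌋₊ : ℝ))

/-- The subcurve of a polygonal curve from the point with parameter `a` to the point with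
parameter `b`, as a curve on `[0, 1]`. -/
def subCurve {d n : ℕ} (Z : Fin n → EuclideanSpace ℝ (Fin d)) (a b : ℝ) (t : unitInterval) :
    EuclideanSpace ℝ (Fin d) :=
  polyCurve Z (a + (t : ℝ) * (b - a))

/-- The oriented segment from `p` to `q`, as a curve on `[0, 1]`. -/
def segmentCurve {d : ℕ} (p q : EuclideanSpace ℝ (Fin d)) (t : unitInterval) :
    EuclideanSpace ℝ (Fin d) :=
  AffineMap.lineMap p q (t : ℝ)

/-- Orientation-preserving reparametrizations of `[0, 1]`. -/
structure Reparam where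
  toFun : unitInterval → unitInterval
  continuous' : Continuous toFun
  injective' : Function.Injective toFun
  map_zero' : toFun 0 = 0
  map_one' : toFun 1 = 1

/-- The width of a reparametrization with respect to two curves. -/
def reparamWidth {E : Type*} [PseudoMetricSpace E] (f : Reparam) (X Y : unitInterval → E) : ℝ :=
  ⨆ α : unitInterval, dist (X (f.toFun α)) (Y α)

/-- The Fréchet distance of two curves. -/
def frechetDist {E : Type*} [PseudoMetricSpace E] (X Y : unitInterval → E) : ℝ :=
  ⨅ f : Reparam, reparamWidth f X Y

/-! ### The real RAM -/

namespace RealRAM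

/-- A configuration: registers and memory cells, all of which hold real numbers.  A program names
its registers explicitly, so it uses only a constant number of them. -/
structure Config where
  reg : ℕ → ℝ
  mem : ℕ → ℝ

/-- Unit-cost instructions.  The first register is the target, except in `store`. -/
inductive Instr where
  | const (a : ℕ) (c : ℚ)
  | move (a b : ℕ)
  | add (a b c : ℕ)
  | sub (a b c : ℕ)
  | mul (a b c : ℕ)
  | div (a b c : ℕ)
  | sqrt (a b : ℕ)
  | floor (a b : ℕ)
  | load (a b : ℕ)
  | store (a b : ℕ)

/-- Assign a register. -/
def Config.setReg (σ : Config) (a : ℕ) (x : ℝ) : Config :=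
  { σ with reg := Function.update σ.reg a x }

/-- Assign a memory cell. -/
def Config.setMem (σ : Config) (k : ℕ) (x : ℝ) : Config :=
  { σ with mem := Function.update σ.mem k x }

/-- `Instr.Step S I σ σ'`: on a machine with the `S` memory cells `0, …, S - 1`, the instruction
`I` leads from `σ` to `σ'`.  There is no successor (the machine faults) on a division by zero, on
the square root of a negative number, on an access outside of the memory, and on an attempt to
round a number outside of `[0, S)`: rounding only serves to compute memory addresses.
`load a b` copies to register `a` the cell whose address is in register `b`, and `store a b`
copies register `b` to the cell whose address is in register `a`. -/
inductive Instr.Step (S : ℕ) : Instr → Config → Config → Prop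
  | const (a : ℕ) (c : ℚ) (σ : Config) : Step S (.const a c) σ (σ.setReg a (c : ℝ))
  | move (a b : ℕ) (σ : Config) : Step S (.move a b) σ (σ.setReg a (σ.reg b))
  | add (a b c : ℕ) (σ : Config) : Step S (.add a b c) σ (σ.setReg a (σ.reg b + σ.reg c))
  | sub (a b c : ℕ) (σ : Config) : Step S (.sub a b c) σ (σ.setReg a (σ.reg b - σ.reg c))
  | mul (a b c : ℕ) (σ : Config) : Step S (.mul a b c) σ (σ.setReg a (σ.reg b * σ.reg c))
  | div (a b c : ℕ) (σ : Config) (h : σ.reg c ≠ 0) :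
      Step S (.div a b c) σ (σ.setReg a (σ.reg b / σ.reg c))
  | sqrt (a b : ℕ) (σ : Config) (h : 0 ≤ σ.reg b) :
      Step S (.sqrt a b) σ (σ.setReg a (Real.sqrt (σ.reg b)))
  | floor (a b : ℕ) (σ : Config) (h : 0 ≤ σ.reg b) (h' : σ.reg b < (S : ℝ)) :
      Step S (.floor a b) σ (σ.setReg a ((⌊σ.reg b⌋₊ : ℕ) : ℝ))
  | load (a b k : ℕ) (σ : Config) (h : σ.reg b = (k : ℝ)) (hk : k < S) :
      Step S (.load a b) σ (σ.setReg a (σ.mem k))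
  | store (a b k : ℕ) (σ : Config) (h : σ.reg a = (k : ℝ)) (hk : k < S) :
      Step S (.store a b) σ (σ.setMem k (σ.reg b))

/-- Programs: finite combinations of instructions by sequencing, the test
`if (register a) < (register b) then P else Q`, and the loop
`while (register a) < (register b) do P`. -/
inductive Program where
  | instr (I : Instr)
  | seq (P Q : Program)
  | ite (a b : ℕ) (P Q : Program)
  | loop (a b : ℕ) (P : Program)

/-- `Exec S P σ t σ'`: on a machine with `S` memory cells, the program `P` started in `σ` halts
without a fault after exactly `t` steps in `σ'`.  Each instruction and each evaluation of a test
is one step. -/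
inductive Exec (S : ℕ) : Program → Config → ℕ → Config → Prop
  | instr {I : Instr} {σ σ' : Config} (h : I.Step S σ σ') : Exec S (.instr I) σ 1 σ'
  | seq {P Q : Program} {σ σ' σ'' : Config} {t t' : ℕ}
      (h : Exec S P σ t σ') (h' : Exec S Q σ' t' σ'') : Exec S (.seq P Q) σ (t + t') σ''
  | ite_pos {a b : ℕ} {P Q : Program} {σ σ' : Config} {t : ℕ}
      (hc : σ.reg a < σ.reg b) (h : Exec S P σ t σ') : Exec S (.ite a b P Q) σ (t + 1) σ'
  | ite_neg {a b : ℕ} {P Q : Program} {σ σ' : Config} {t : ℕ}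
      (hc : ¬ σ.reg a < σ.reg b) (h : Exec S Q σ t σ') : Exec S (.ite a b P Q) σ (t + 1) σ'
  | loop_done {a b : ℕ} {P : Program} {σ : Config}
      (hc : ¬ σ.reg a < σ.reg b) : Exec S (.loop a b P) σ 1 σ
  | loop_step {a b : ℕ} {P : Program} {σ σ' σ'' : Config} {t t' : ℕ}
      (hc : σ.reg a < σ.reg b) (h : Exec S P σ t σ') (h' : Exec S (.loop a b P) σ' t' σ'') :
      Exec S (.loop a b P) σ (t + t' + 1) σ''

end RealRAM

/-! ### Input conventions and resource bounds -/

/-- The input of the preprocessing: `n` in register `0`, `ε` in register `1`, and the coordinates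
of the vertices, one vertex after the other, in the first `n * d` memory cells.  All other
registers and cells have arbitrary contents. -/
def IsCurveInput {d n : ℕ} (σ : RealRAM.Config) (Z : Fin n → EuclideanSpace ℝ (Fin d))
    (ε : ℝ) : Prop :=
  σ.reg 0 = (n : ℝ) ∧ σ.reg 1 = ε ∧
    ∀ (i : Fin n) (k : Fin d), σ.mem ((i : ℕ) * d + (k : ℕ)) = Z i k

/-- The input of a query: the indices `i`, `j` of the edges that contain `u` and `v` in registers
`0` and `1`, followed by the coordinates of `u`, `v`, `p` and `q`.  All other registers have
arbitrary contents. -/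
def IsQueryInput {d : ℕ} (σ : RealRAM.Config) (i j : ℕ)
    (u v p q : EuclideanSpace ℝ (Fin d)) : Prop :=
  σ.reg 0 = (i : ℝ) ∧ σ.reg 1 = (j : ℝ) ∧
    ∀ k : Fin d, σ.reg (2 + (k : ℕ)) = u k ∧ σ.reg (2 + d + (k : ℕ)) = v k ∧
      σ.reg (2 + 2 * d + (k : ℕ)) = p k ∧ σ.reg (2 + 3 * d + (k : ℕ)) = q k

/-- The logarithm in resource bounds, with the usual convention that it is at least `1`. -/
def lg (x : ℝ) : ℝ := max 1 (Real.logb 2 x)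

/-- `χ = ε ^ (-d) * log (1 / ε)`. -/
def chi (d : ℕ) (ε : ℝ) : ℝ := (1 / ε) ^ d * lg (1 / ε)

end

noncomputable section

namespace RealRAM

/-! ### Expressions and their compilation -/

/-! A matching of a polygonal curve with a segment may be taken linear between vertices, and the
norm is convex. So the Fréchet distance to a segment is the infimum of the `δ` for which the
vertices have monotone parameters on the segment, from `0` to `1`, with each vertex within `δ` of
its point. This is the predicate `Traverse`; the two directions are `frechetDist_le_of_traverse` and
`traverse_of_frechetDist_lt`. It turns the problem into one about finite sequences. Matchings of
consecutive pieces concatenate, and their error is a maximum, not a sum (`Traverse.trans`); moving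
the ends of the segment by `e` costs `e` (`Traverse.move`).

Data structure. A canonical piece runs from vertex `x` to vertex `x + 2 ^ t` with `2 ^ t ∣ x`. Each
one stores a number `R` that bounds its distance from its chord and is at most six times its
distance from any segment. It also stores tables for the scales `ρ = R, 2R, …, 2 ^ J * R`: for each
pair of grid points around its two ends (extent `11 ρ`, spacing `ρ / N`, with `N` of order `1 / ε`),
the distance of the piece from the segment between them, up to `ρ / N`. An entry is found by `J`
bisections with an exact greedy decision that is linear in the length of the piece. There are about
`J * N ^ (2 * d)` entries per piece, the pieces of one length together have at most `n` edges, and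
there are about `log n` lengths; this gives the preprocessing bounds.

Query. Reversing both curves puts `u` before `v`, and on a single edge the distance is the larger
endpoint distance. Otherwise the vertices between `u` and `v` split into `O(log n)` canonical
pieces. A scan that replaces each piece by its chord and matches vertices at the running maximum of
their projections yields a number `A` with `A ≤ distance ≤ 9 * A` (`ScanInv`, `ScanInv.isBound`).
Then the thresholds `A + k * A / N` are tested in turn, up to `10 * A`.

The test of `δ` advances a parameter greedily from piece to piece, through candidates spaced `A / N`
along the segment. Any matching parameter of a vertex is within `δ ≤ 10 * A` of its projection, so
`O(N)` candidates suffice. A piece with `R ≤ A / N` is treated as its chord; any other piece has a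
tabulated scale `ρ` between `A` and `54 * A`, so rounding to the grid costs `O(A / N)`. The greedy
parameter never exceeds that of any matching at `δ` (`ApproxInv.exists_candidate`,
`ApproxInv.step`). Hence a failure refutes `δ`, and a success gives a matching at `δ + O(A / N)`.
The first success determines the distance up to `O(A / N)`, which is at most `ε` times the output
(`IsDist.approx`). There are `O(N)` thresholds, `O(log n)` pieces and `O(N + J)` steps for each
piece.

On the machine side, expressions are compiled into straight-line code that uses scratch registers
above a bound `W`, and `Runs` is a logic of total correctness with time bounds in which the scratch
registers are invisible. All programs are verified in it. -/

/-- Arithmetic expressions over registers and memory; `ite a b c e` is `c` if `a < b`, else `e`. -/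
inductive Expr where
  | reg (a : ℕ)
  | const (c : ℚ)
  | add (a b : Expr)
  | sub (a b : Expr)
  | mul (a b : Expr)
  | div (a b : Expr)
  | sqrt (a : Expr)
  | floor (a : Expr)
  | load (a : Expr)
  | ite (a b c e : Expr)

namespace Expr

/-- The value of an expression. -/
def eval (σ : Config) : Expr → ℝ
  | reg a => σ.reg a
  | const c => c
  | add a b => a.eval σ + b.eval σ
  | sub a b => a.eval σ - b.eval σ
  | mul a b => a.eval σ * b.eval σ
  | div a b => a.eval σ / b.eval σ
  | sqrt a => Real.sqrt (a.eval σ)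
  | floor a => (⌊a.eval σ⌋₊ : ℕ)
  | load a => σ.mem ⌊a.eval σ⌋₊
  | ite a b c e => if a.eval σ < b.eval σ then c.eval σ else e.eval σ

/-- The evaluation of an expression does not fault. -/
def Ok (S : ℕ) (σ : Config) : Expr → Prop
  | reg _ => True
  | const _ => True
  | add a b => a.Ok S σ ∧ b.Ok S σ
  | sub a b => a.Ok S σ ∧ b.Ok S σ
  | mul a b => a.Ok S σ ∧ b.Ok S σ
  | div a b => a.Ok S σ ∧ b.Ok S σ ∧ b.eval σ ≠ 0
  | sqrt a => a.Ok S σ ∧ 0 ≤ a.eval σ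
  | floor a => a.Ok S σ ∧ 0 ≤ a.eval σ ∧ a.eval σ < S
  | load a => a.Ok S σ ∧ ∃ k < S, a.eval σ = (k : ℝ)
  | ite a b c e => a.Ok S σ ∧ b.Ok S σ ∧ (a.eval σ < b.eval σ → c.Ok S σ) ∧
      (¬ a.eval σ < b.eval σ → e.Ok S σ)

/-- All registers of an expression are below `W`. -/
def Below (W : ℕ) : Expr → Prop
  | reg a => a < W
  | const _ => True
  | add a b => a.Below W ∧ b.Below W
  | sub a b => a.Below W ∧ b.Below W
  | mul a b => a.Below W ∧ b.Below W
  | div a b => a.Below W ∧ b.Below W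
  | sqrt a => a.Below W
  | floor a => a.Below W
  | load a => a.Below W
  | ite a b c e => a.Below W ∧ b.Below W ∧ c.Below W ∧ e.Below W

/-- A bound for the number of steps of the evaluation. -/
def cost : Expr → ℕ
  | reg _ => 1
  | const _ => 1
  | add a b => a.cost + b.cost + 1
  | sub a b => a.cost + b.cost + 1
  | mul a b => a.cost + b.cost + 1
  | div a b => a.cost + b.cost + 1
  | sqrt a => a.cost + 1
  | floor a => a.cost + 1
  | load a => a.cost + 1
  | ite a b c e => a.cost + b.cost + c.cost + e.cost + 1

/-- Evaluate an expression into register `r`, with the registers above `r` as scratch space. -/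
def compile : Expr → ℕ → Program
  | reg a, r => .instr (.move r a)
  | const c, r => .instr (.const r c)
  | add a b, r => .seq (a.compile r) (.seq (b.compile (r + 1)) (.instr (.add r r (r + 1))))
  | sub a b, r => .seq (a.compile r) (.seq (b.compile (r + 1)) (.instr (.sub r r (r + 1))))
  | mul a b, r => .seq (a.compile r) (.seq (b.compile (r + 1)) (.instr (.mul r r (r + 1))))
  | div a b, r => .seq (a.compile r) (.seq (b.compile (r + 1)) (.instr (.div r r (r + 1))))
  | sqrt a, r => .seq (a.compile r) (.instr (.sqrt r r))
  | floor a, r => .seq (a.compile r) (.instr (.floor r r))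
  | load a, r => .seq (a.compile r) (.instr (.load r r))
  | ite a b c e, r => .seq (a.compile r) (.seq (b.compile (r + 1))
      (.ite r (r + 1) (c.compile r) (e.compile r)))

end Expr

/-- Two configurations agree on the memory and on the registers below `W`. -/
def Agree (W : ℕ) (σ τ : Config) : Prop := (∀ a < W, σ.reg a = τ.reg a) ∧ σ.mem = τ.mem

theorem Agree.refl (W : ℕ) (σ : Config) : Agree W σ σ := ⟨fun _ _ => rfl, rfl⟩

theorem Agree.trans {W : ℕ} {σ τ υ : Config} (h : Agree W σ τ) (h' : Agree W τ υ) :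
    Agree W σ υ :=
  ⟨fun a ha => (h.1 a ha).trans (h'.1 a ha), h.2.trans h'.2⟩

theorem Agree.mono {W W' : ℕ} {σ τ : Config} (h : Agree W σ τ) (hW : W' ≤ W) : Agree W' σ τ :=
  ⟨fun a ha => h.1 a (ha.trans_le hW), h.2⟩

namespace Expr

theorem eval_congr {W : ℕ} {σ τ : Config} (h : Agree W σ τ) :
    ∀ e : Expr, e.Below W → e.eval σ = e.eval τ
  | reg a, hb => h.1 a hb
  | const _, _ => rfl
  | add a b, hb => by simp only [eval, eval_congr h a hb.1, eval_congr h b hb.2]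
  | sub a b, hb => by simp only [eval, eval_congr h a hb.1, eval_congr h b hb.2]
  | mul a b, hb => by simp only [eval, eval_congr h a hb.1, eval_congr h b hb.2]
  | div a b, hb => by simp only [eval, eval_congr h a hb.1, eval_congr h b hb.2]
  | sqrt a, hb => by simp only [eval, eval_congr h a hb]
  | floor a, hb => by simp only [eval, eval_congr h a hb]
  | load a, hb => by simp only [eval, eval_congr h a hb, h.2]
  | ite a b c e, hb => by
      simp only [eval, eval_congr h a hb.1, eval_congr h b hb.2.1, eval_congr h c hb.2.2.1,
        eval_congr h e hb.2.2.2]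

theorem ok_congr {S W : ℕ} {σ τ : Config} (h : Agree W σ τ) :
    ∀ e : Expr, e.Below W → (e.Ok S σ ↔ e.Ok S τ)
  | reg a, _ => Iff.rfl
  | const _, _ => Iff.rfl
  | add a b, hb => by simp only [Ok, ok_congr h a hb.1, ok_congr h b hb.2]
  | sub a b, hb => by simp only [Ok, ok_congr h a hb.1, ok_congr h b hb.2]
  | mul a b, hb => by simp only [Ok, ok_congr h a hb.1, ok_congr h b hb.2]
  | div a b, hb => by
      simp only [Ok, ok_congr h a hb.1, ok_congr h b hb.2, eval_congr h b hb.2]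
  | sqrt a, hb => by simp only [Ok, ok_congr h a hb, eval_congr h a hb]
  | floor a, hb => by simp only [Ok, ok_congr h a hb, eval_congr h a hb]
  | load a, hb => by simp only [Ok, ok_congr h a hb, eval_congr h a hb]
  | ite a b c e, hb => by
      simp only [Ok, ok_congr h a hb.1, ok_congr h b hb.2.1, ok_congr h c hb.2.2.1,
        ok_congr h e hb.2.2.2, eval_congr h a hb.1, eval_congr h b hb.2.1]

theorem Below.mono {W W' : ℕ} (hW : W ≤ W') : ∀ e : Expr, e.Below W → e.Below W'
  | reg _, h => lt_of_lt_of_le h hW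
  | const _, _ => trivial
  | add a b, h => ⟨Below.mono hW a h.1, Below.mono hW b h.2⟩
  | sub a b, h => ⟨Below.mono hW a h.1, Below.mono hW b h.2⟩
  | mul a b, h => ⟨Below.mono hW a h.1, Below.mono hW b h.2⟩
  | div a b, h => ⟨Below.mono hW a h.1, Below.mono hW b h.2⟩
  | sqrt a, h => Below.mono hW a h
  | floor a, h => Below.mono hW a h
  | load a, h => Below.mono hW a h
  | ite a b c e, h => ⟨Below.mono hW a h.1, Below.mono hW b h.2.1, Below.mono hW c h.2.2.1,
      Below.mono hW e h.2.2.2⟩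

end Expr

/-! ### Updates of configurations and correctness of the compilation -/

theorem Config.setReg_reg (σ : Config) (a b : ℕ) (x : ℝ) :
    (σ.setReg a x).reg b = if b = a then x else σ.reg b := by
  simp [Config.setReg, Function.update_apply]

@[simp] theorem Config.setReg_mem (σ : Config) (a : ℕ) (x : ℝ) :
    (σ.setReg a x).mem = σ.mem := rfl

@[simp] theorem Config.setMem_reg (σ : Config) (a : ℕ) (x : ℝ) :
    (σ.setMem a x).reg = σ.reg := rfl

theorem Config.setMem_mem (σ : Config) (a b : ℕ) (x : ℝ) :
    (σ.setMem a x).mem b = if b = a then x else σ.mem b := by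
  simp [Config.setMem, Function.update_apply]

theorem agree_setReg {W a : ℕ} (h : W ≤ a) (σ : Config) (x : ℝ) : Agree W (σ.setReg a x) σ :=
  ⟨fun b hb => by rw [Config.setReg_reg, if_neg (by omega)], rfl⟩

theorem Agree.setReg {W : ℕ} {σ τ : Config} (h : Agree W σ τ) (a : ℕ) (x : ℝ) :
    Agree W (σ.setReg a x) (τ.setReg a x) :=
  ⟨fun b hb => by simp only [Config.setReg_reg, h.1 b hb], h.2⟩

theorem Agree.setMem {W : ℕ} {σ τ : Config} (h : Agree W σ τ) (a : ℕ) (x : ℝ) :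
    Agree W (σ.setMem a x) (τ.setMem a x) :=
  ⟨h.1, by simp [Config.setMem, h.2]⟩

/-- The effect of the evaluation of an expression into register `r`. -/
def Evaluates (S : ℕ) (P : Program) (σ : Config) (r T : ℕ) (x : ℝ) : Prop :=
  ∃ t σ', Exec S P σ t σ' ∧ t ≤ T ∧ Agree r σ' σ ∧ σ'.reg r = x

/-- The first value waits in register `r` while the second operand is evaluated into `r + 1`, which
touches no register below `r + 1`. -/
theorem Evaluates.bin {S : ℕ} {a b : Expr} {σ : Config} {r : ℕ} {I : Instr} {x : ℝ}
    (ha : Evaluates S (a.compile r) σ r a.cost (a.eval σ))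
    (hb : ∀ σ', Agree r σ' σ → σ'.reg r = a.eval σ →
      Evaluates S (b.compile (r + 1)) σ' (r + 1) b.cost (b.eval σ))
    (hI : ∀ σ', Agree r σ' σ → σ'.reg r = a.eval σ → σ'.reg (r + 1) = b.eval σ →
      I.Step S σ' (σ'.setReg r x)) :
    Evaluates S (.seq (a.compile r) (.seq (b.compile (r + 1)) (.instr I))) σ r
      (a.cost + b.cost + 1) x := by
  obtain ⟨t₁, σ₁, h₁, ht₁, hA₁, hr₁⟩ := ha
  obtain ⟨t₂, σ₂, h₂, ht₂, hA₂, hr₂⟩ := hb σ₁ hA₁ hr₁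
  have hA : Agree r σ₂ σ := (hA₂.mono (Nat.le_succ r)).trans hA₁
  refine ⟨_, _, .seq h₁ (.seq h₂ (.instr (hI σ₂ hA ?_ hr₂))), by omega, ?_, ?_⟩
  · rw [hA₂.1 r (Nat.lt_succ_self r), hr₁]
  · exact (agree_setReg le_rfl _ _).trans hA
  · simp [Config.setReg_reg]

theorem Evaluates.un {S : ℕ} {a : Expr} {σ : Config} {r : ℕ} {I : Instr} {x : ℝ}
    (ha : Evaluates S (a.compile r) σ r a.cost (a.eval σ))
    (hI : ∀ σ', Agree r σ' σ → σ'.reg r = a.eval σ → I.Step S σ' (σ'.setReg r x)) :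
    Evaluates S (.seq (a.compile r) (.instr I)) σ r (a.cost + 1) x := by
  obtain ⟨t₁, σ₁, h₁, ht₁, hA₁, hr₁⟩ := ha
  exact ⟨_, _, .seq h₁ (.instr (hI σ₁ hA₁ hr₁)), by omega,
    (agree_setReg le_rfl _ _).trans hA₁, by simp [Config.setReg_reg]⟩

/-- The expression reads registers below `W ≤ r` and its code writes only to `r` and above. So no
operand can spoil another one, and values and absence of faults carry over to the intermediate
configurations. -/
theorem Expr.evaluates {S W : ℕ} : ∀ (e : Expr) (r : ℕ) (σ : Config), W ≤ r → e.Below W →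
    e.Ok S σ → Evaluates S (e.compile r) σ r e.cost (e.eval σ) := by
  have key : ∀ {W r : ℕ} {σ σ' : Config} {b : Expr}, W ≤ r → Agree r σ' σ → b.Below W →
      b.eval σ' = b.eval σ := fun hW hA hb => Expr.eval_congr (hA.mono hW) _ hb
  intro e
  induction e with
  | reg a =>
    intro r σ _ _ _
    exact ⟨1, _, .instr (.move r a σ), le_rfl, agree_setReg le_rfl _ _,
      by simp [Config.setReg_reg, Expr.eval]⟩
  | const c =>
    intro r σ _ _ _
    exact ⟨1, _, .instr (.const r c σ), le_rfl, agree_setReg le_rfl _ _,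
      by simp [Config.setReg_reg, Expr.eval]⟩
  | add a b iha ihb =>
    intro r σ hW hb hk
    refine .bin (iha r σ hW hb.1 hk.1) (fun σ' hA _ => ?_) (fun σ' _ h₁ h₂ => ?_)
    · rw [← key hW hA hb.2]
      exact ihb _ _ (by omega) hb.2 ((Expr.ok_congr (hA.mono hW) _ hb.2).2 hk.2)
    · have := Instr.Step.add (S := S) r r (r + 1) σ'
      rwa [h₁, h₂] at this
  | sub a b iha ihb =>
    intro r σ hW hb hk
    refine .bin (iha r σ hW hb.1 hk.1) (fun σ' hA _ => ?_) (fun σ' _ h₁ h₂ => ?_)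
    · rw [← key hW hA hb.2]
      exact ihb _ _ (by omega) hb.2 ((Expr.ok_congr (hA.mono hW) _ hb.2).2 hk.2)
    · have := Instr.Step.sub (S := S) r r (r + 1) σ'
      rwa [h₁, h₂] at this
  | mul a b iha ihb =>
    intro r σ hW hb hk
    refine .bin (iha r σ hW hb.1 hk.1) (fun σ' hA _ => ?_) (fun σ' _ h₁ h₂ => ?_)
    · rw [← key hW hA hb.2]
      exact ihb _ _ (by omega) hb.2 ((Expr.ok_congr (hA.mono hW) _ hb.2).2 hk.2)
    · have := Instr.Step.mul (S := S) r r (r + 1) σ'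
      rwa [h₁, h₂] at this
  | div a b iha ihb =>
    intro r σ hW hb hk
    refine .bin (iha r σ hW hb.1 hk.1) (fun σ' hA _ => ?_) (fun σ' _ h₁ h₂ => ?_)
    · rw [← key hW hA hb.2]
      exact ihb _ _ (by omega) hb.2 ((Expr.ok_congr (hA.mono hW) _ hb.2).2 hk.2.1)
    · have := Instr.Step.div (S := S) r r (r + 1) σ' (by rw [h₂]; exact hk.2.2)
      rwa [h₁, h₂] at this
  | sqrt a iha =>
    intro r σ hW hb hk
    refine .un (iha r σ hW hb hk.1) (fun σ' _ h₁ => ?_)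
    have := Instr.Step.sqrt (S := S) r r σ' (by rw [h₁]; exact hk.2)
    rwa [h₁] at this
  | floor a iha =>
    intro r σ hW hb hk
    refine .un (iha r σ hW hb hk.1) (fun σ' _ h₁ => ?_)
    have := Instr.Step.floor (S := S) r r σ' (by rw [h₁]; exact hk.2.1)
      (by rw [h₁]; exact hk.2.2)
    rwa [h₁] at this
  | load a iha =>
    intro r σ hW hb hk
    refine .un (iha r σ hW hb hk.1) (fun σ' hA h₁ => ?_)
    obtain ⟨k, hkS, hk'⟩ := hk.2
    have := Instr.Step.load (S := S) r r k σ' (by rw [h₁, hk']) hkS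
    rwa [hA.2, show σ.mem k = (Expr.load a).eval σ by simp [Expr.eval, hk']] at this
  | ite a b c e iha ihb ihc ihe =>
    intro r σ hW hb hk
    obtain ⟨hba, hbb, hbc, hbe⟩ := hb
    obtain ⟨t₁, σ₁, h₁, ht₁, hA₁, hr₁⟩ := iha r σ hW hba hk.1
    obtain ⟨t₂, σ₂, h₂, ht₂, hA₂, hr₂⟩ := ihb (r + 1) σ₁ (by omega) hbb
      ((Expr.ok_congr (hA₁.mono hW) _ hbb).2 hk.2.1)
    have hA : Agree r σ₂ σ := (hA₂.mono (Nat.le_succ r)).trans hA₁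
    have e₁ : σ₂.reg r = a.eval σ := by rw [hA₂.1 r (Nat.lt_succ_self r), hr₁]
    have e₂ : σ₂.reg (r + 1) = b.eval σ := by rw [hr₂, key hW hA₁ hbb]
    by_cases hc : a.eval σ < b.eval σ
    · obtain ⟨t₃, σ₃, h₃, ht₃, hA₃, hr₃⟩ := ihc r σ₂ hW hbc
        ((Expr.ok_congr (hA.mono hW) _ hbc).2 (hk.2.2.1 hc))
      refine ⟨_, σ₃, .seq h₁ (.seq h₂ (.ite_pos (by rwa [e₁, e₂]) h₃)), ?_, hA₃.trans hA, ?_⟩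
      · simp only [Expr.cost]; omega
      · rw [hr₃, key hW hA hbc]; simp [Expr.eval, hc]
    · obtain ⟨t₃, σ₃, h₃, ht₃, hA₃, hr₃⟩ := ihe r σ₂ hW hbe
        ((Expr.ok_congr (hA.mono hW) _ hbe).2 (hk.2.2.2 hc))
      refine ⟨_, σ₃, .seq h₁ (.seq h₂ (.ite_neg (by rwa [e₁, e₂]) h₃)), ?_, hA₃.trans hA, ?_⟩
      · simp only [Expr.cost]; omega
      · rw [hr₃, key hW hA hbe]; simp [Expr.eval, hc]

/-! ### Total correctness with time bounds -/

/-- Started in a configuration that agrees with `s` below `W`, the program `P` halts within `T`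
steps in a configuration that agrees below `W` with one that satisfies `Q`. -/
def Runs (S W : ℕ) (P : Program) (s : Config) (T : ℕ) (Q : Config → Prop) : Prop :=
  ∀ σ, Agree W σ s → ∃ t σ' s', Exec S P σ t σ' ∧ Agree W σ' s' ∧ t ≤ T ∧ Q s'

variable {S W : ℕ}

theorem Runs.mono {P : Program} {s : Config} {T T' : ℕ} {Q Q' : Config → Prop}
    (h : Runs S W P s T Q) (hT : T ≤ T') (hQ : ∀ s', Q s' → Q' s') : Runs S W P s T' Q' := by
  intro σ hσ
  obtain ⟨t, σ', s', h₁, h₂, h₃, h₄⟩ := h σ hσ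
  exact ⟨t, σ', s', h₁, h₂, h₃.trans hT, hQ _ h₄⟩

theorem Runs.imp {P : Program} {s : Config} {T : ℕ} {Q Q' : Config → Prop}
    (h : Runs S W P s T Q) (hQ : ∀ s', Q s' → Q' s') : Runs S W P s T Q' :=
  h.mono le_rfl hQ

theorem Runs.le {P : Program} {s : Config} {T T' : ℕ} {Q : Config → Prop}
    (h : Runs S W P s T Q) (hT : T ≤ T') : Runs S W P s T' Q :=
  h.mono hT fun _ => id

/-- Composition works because `Runs` quantifies over all configurations that agree with `s` below
`W`: the second program may start with arbitrary scratch registers. -/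
theorem Runs.seq {P P' : Program} {s : Config} {T T' : ℕ} {Q : Config → Prop}
    (h : Runs S W P s T (fun s' => Runs S W P' s' T' Q)) :
    Runs S W (.seq P P') s (T + T') Q := by
  intro σ hσ
  obtain ⟨t, σ', s', h₁, h₂, h₃, h₄⟩ := h σ hσ
  obtain ⟨t', σ'', s'', h₁', h₂', h₃', h₄'⟩ := h₄ σ' h₂
  exact ⟨_, σ'', s'', .seq h₁ h₁', h₂', by omega, h₄'⟩

/-- Assign the value of an expression to a register. -/
def assign (W a : ℕ) (e : Expr) : Program := .seq (e.compile W) (.instr (.move a W))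

theorem Runs.assign {a : ℕ} {e : Expr} {s : Config} {Q : Config → Prop}
    (hb : e.Below W) (ho : e.Ok S s) (hQ : Q (s.setReg a (e.eval s))) :
    Runs S W (assign W a e) s (e.cost + 1) Q := by
  intro σ hσ
  obtain ⟨t, σ', h, ht, hA, hr⟩ := e.evaluates W σ le_rfl hb ((Expr.ok_congr hσ e hb).2 ho)
  refine ⟨_, _, _, .seq h (.instr (.move a W σ')), ?_, by omega, hQ⟩
  rw [hr, Expr.eval_congr hσ e hb]
  exact (hA.trans hσ).setReg a _

/-- Store the value of the second expression in the cell addressed by the first one. -/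
def storeAt (W : ℕ) (e f : Expr) : Program :=
  .seq (e.compile W) (.seq (f.compile (W + 1)) (.instr (.store W (W + 1))))

theorem Runs.storeAt {e f : Expr} {s : Config} {Q : Config → Prop} {k : ℕ}
    (hb : e.Below W) (hb' : f.Below W) (ho : e.Ok S s) (ho' : f.Ok S s)
    (hk : e.eval s = k) (hkS : k < S) (hQ : Q (s.setMem k (f.eval s))) :
    Runs S W (storeAt W e f) s (e.cost + f.cost + 1) Q := by
  intro σ hσ
  obtain ⟨t, σ', h, ht, hA, hr⟩ := e.evaluates W σ le_rfl hb ((Expr.ok_congr hσ e hb).2 ho)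
  have hσ' : Agree W σ' s := hA.trans hσ
  obtain ⟨t₂, σ₂, h₂, ht₂, hA₂, hr₂⟩ := f.evaluates (W := W) (W + 1) σ' (Nat.le_succ _) hb'
    ((Expr.ok_congr hσ' f hb').2 ho')
  refine ⟨_, _, _, .seq h (.seq h₂ (.instr (.store W (W + 1) k σ₂ ?_ hkS))), ?_, by omega, hQ⟩
  · rw [hA₂.1 W (Nat.lt_succ_self W), hr, Expr.eval_congr hσ e hb, hk]
  · rw [hr₂, Expr.eval_congr hσ' f hb']
    exact ((hA₂.mono (Nat.le_succ W)).trans hσ').setMem k _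

/-- Branch on the comparison of two expressions. -/
def ifLt (W : ℕ) (e f : Expr) (P P' : Program) : Program :=
  .seq (e.compile W) (.seq (f.compile (W + 1)) (.ite W (W + 1) P P'))

theorem Expr.evaluates_two {e f : Expr} {σ s : Config} (hσ : Agree W σ s)
    (hb : e.Below W) (hb' : f.Below W) (ho : e.Ok S s) (ho' : f.Ok S s) :
    ∃ t t' σ₁ σ₂, Exec S (e.compile W) σ t σ₁ ∧ Exec S (f.compile (W + 1)) σ₁ t' σ₂ ∧
      t ≤ e.cost ∧ t' ≤ f.cost ∧ Agree W σ₂ s ∧ σ₂.reg W = e.eval s ∧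
      σ₂.reg (W + 1) = f.eval s := by
  obtain ⟨t, σ', h, ht, hA, hr⟩ := e.evaluates W σ le_rfl hb ((Expr.ok_congr hσ e hb).2 ho)
  have hσ' : Agree W σ' s := hA.trans hσ
  obtain ⟨t₂, σ₂, h₂, ht₂, hA₂, hr₂⟩ := f.evaluates (W := W) (W + 1) σ' (Nat.le_succ _) hb'
    ((Expr.ok_congr hσ' f hb').2 ho')
  refine ⟨t, t₂, σ', σ₂, h, h₂, ht, ht₂, (hA₂.mono (Nat.le_succ W)).trans hσ', ?_, ?_⟩
  · rw [hA₂.1 W (Nat.lt_succ_self W), hr, Expr.eval_congr hσ e hb]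
  · rw [hr₂, Expr.eval_congr hσ' f hb']

theorem Runs.ifLt {e f : Expr} {P P' : Program} {s : Config} {T : ℕ} {Q : Config → Prop}
    (hb : e.Below W) (hb' : f.Below W) (ho : e.Ok S s) (ho' : f.Ok S s)
    (h₁ : e.eval s < f.eval s → Runs S W P s T Q)
    (h₂ : ¬ e.eval s < f.eval s → Runs S W P' s T Q) :
    Runs S W (ifLt W e f P P') s (e.cost + f.cost + T + 1) Q := by
  intro σ hσ
  obtain ⟨t, t', σ₁, σ₂, x₁, x₂, ht, ht', hA, r₁, r₂⟩ :=
    Expr.evaluates_two (S := S) hσ hb hb' ho ho'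
  by_cases hc : e.eval s < f.eval s
  · obtain ⟨t₃, σ₃, s₃, x₃, A₃, ht₃, q₃⟩ := h₁ hc σ₂ hA
    exact ⟨_, σ₃, s₃, .seq x₁ (.seq x₂ (.ite_pos (by rwa [r₁, r₂]) x₃)), A₃, by omega, q₃⟩
  · obtain ⟨t₃, σ₃, s₃, x₃, A₃, ht₃, q₃⟩ := h₂ hc σ₂ hA
    exact ⟨_, σ₃, s₃, .seq x₁ (.seq x₂ (.ite_neg (by rwa [r₁, r₂]) x₃)), A₃, by omega, q₃⟩

/-- Repeat `P` as long as the first expression is less than the second one. -/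
def whileLt (W : ℕ) (e f : Expr) (P : Program) : Program :=
  .seq (e.compile W) (.seq (f.compile (W + 1))
    (.loop W (W + 1) (.seq P (.seq (e.compile W) (f.compile (W + 1))))))

/-- The invariant is indexed by the number of completed rounds. Whenever the test succeeds, this
index must be below `m`, which gives termination. The factor `m + 1` pays for the first evaluation
of the test as well. -/
theorem Runs.whileLt {e f : Expr} {P : Program} {s : Config} {T m : ℕ} {Q : Config → Prop}
    (I : ℕ → Config → Prop) (hb : e.Below W) (hb' : f.Below W) (h₀ : I 0 s)
    (ho : ∀ k s, I k s → e.Ok S s ∧ f.Ok S s)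
    (hs : ∀ k s, I k s → e.eval s < f.eval s → k < m ∧ Runs S W P s T (I (k + 1)))
    (hQ : ∀ k s, I k s → ¬ e.eval s < f.eval s → Q s) :
    Runs S W (whileLt W e f P) s ((m + 1) * (T + e.cost + f.cost + 1)) Q := by
  -- Induction on the number `r` of rounds that may still follow; the loop itself starts with both
  -- sides of the test already in the scratch registers.
  have main : ∀ r k s σ, m ≤ k + r → I k s → Agree W σ s → σ.reg W = e.eval s →
      σ.reg (W + 1) = f.eval s → ∃ t σ' s',
        Exec S (.loop W (W + 1) (.seq P (.seq (e.compile W) (f.compile (W + 1))))) σ t σ' ∧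
        Agree W σ' s' ∧ t ≤ r * (T + e.cost + f.cost + 1) + 1 ∧ Q s' := by
    intro r
    induction r with
    | zero =>
      intro k s σ hk hI hA r₁ r₂
      by_cases hc : e.eval s < f.eval s
      · have := (hs k s hI hc).1; omega
      · exact ⟨1, σ, s, .loop_done (by rwa [r₁, r₂]), hA, by omega, hQ k s hI hc⟩
    | succ r ih =>
      intro k s σ hk hI hA r₁ r₂
      by_cases hc : e.eval s < f.eval s
      · obtain ⟨t₁, σ₁, s₁, x₁, A₁, l₁, I₁⟩ := (hs k s hI hc).2 σ hA
        obtain ⟨t, t', σ₂, σ₃, x₂, x₃, ht, ht', hA₃, r₁', r₂'⟩ :=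
          Expr.evaluates_two (S := S) A₁ hb hb' (ho _ _ I₁).1 (ho _ _ I₁).2
        obtain ⟨t₄, σ₄, s₄, x₄, A₄, l₄, q₄⟩ := ih (k + 1) s₁ σ₃ (by omega) I₁ hA₃ r₁' r₂'
        refine ⟨_, σ₄, s₄, .loop_step (by rwa [r₁, r₂]) (.seq x₁ (.seq x₂ x₃)) x₄, A₄, ?_, q₄⟩
        rw [Nat.succ_mul]; omega
      · exact ⟨1, σ, s, .loop_done (by rwa [r₁, r₂]), hA, by omega, hQ k s hI hc⟩
  intro σ hσ
  obtain ⟨t, t', σ₁, σ₂, x₁, x₂, ht, ht', hA, r₁, r₂⟩ :=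
    Expr.evaluates_two (S := S) hσ hb hb' (ho _ _ h₀).1 (ho _ _ h₀).2
  obtain ⟨t₃, σ₃, s₃, x₃, A₃, l₃, q₃⟩ := main m 0 s σ₂ (by omega) h₀ hA r₁ r₂
  refine ⟨_, σ₃, s₃, .seq x₁ (.seq x₂ x₃), A₃, ?_, q₃⟩
  rw [Nat.succ_mul]; omega

/-- Run `P` for the values `0, 1, …` of register `c` below `f`. -/
def forLt (W c : ℕ) (f : Expr) (P : Program) : Program :=
  .seq (assign W c (.const 0))
    (whileLt W (.reg c) f (.seq P (assign W c (.add (.reg c) (.const 1)))))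

/-- The body must preserve the counter, and has to establish the next invariant only for the state
after the increment. The limit is evaluated again in each round, hence its value is part of the
requirements on the invariant. -/
theorem Runs.forLt {c : ℕ} {f : Expr} {P : Program} {s : Config} {T m : ℕ} {Q : Config → Prop}
    (I : ℕ → Config → Prop) (hc : c < W) (hb' : f.Below W)
    (h₀ : I 0 (s.setReg c 0))
    (hI : ∀ k s, I k s → s.reg c = k ∧ f.Ok S s ∧ f.eval s = m)
    (hs : ∀ k s, k < m → I k s → Runs S W P s T
      (fun s' => s'.reg c = k ∧ I (k + 1) (s'.setReg c ((k + 1 : ℕ) : ℝ))))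
    (hQ : ∀ s, I m s → Q s) :
    Runs S W (forLt W c f P) s ((m + 1) * (T + f.cost + 8)) Q := by
  have key : Runs S W (RealRAM.forLt W c f P) s
      (((Expr.const 0).cost + 1) +
        (m + 1) * (T + ((Expr.add (.reg c) (.const 1)).cost + 1) +
          (Expr.reg c).cost + f.cost + 1)) Q := by
    refine Runs.seq (Runs.assign trivial trivial ?_)
    refine Runs.whileLt (m := m) (fun k s => k ≤ m ∧ I k s) hc hb' ?_ ?_ ?_ ?_
    · simpa [Expr.eval] using h₀
    · exact fun k s h => ⟨trivial, (hI k s h.2).2.1⟩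
    · intro k s h hlt
      obtain ⟨h₁, h₂, h₃⟩ := hI k s h.2
      have hk : k < m := by
        rw [h₃] at hlt
        simp only [Expr.eval, h₁] at hlt
        exact_mod_cast hlt
      refine ⟨hk, .seq ((hs k s hk h.2).imp fun s' hs' => ?_)⟩
      refine Runs.assign ⟨hc, trivial⟩ ⟨trivial, trivial⟩ ⟨hk, ?_⟩
      have := hs'.2
      simpa [Expr.eval, hs'.1] using this
    · intro k s h hlt
      obtain ⟨h₁, h₂, h₃⟩ := hI k s h.2
      rw [h₃] at hlt
      simp only [Expr.eval, h₁, Nat.cast_lt] at hlt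
      obtain rfl : k = m := by omega
      exact hQ s h.2
  -- A round adds 4 steps for the increment, 1 for reading the counter and 1 for the comparison; the
  -- 2 steps of the initialization fit into the remaining slack of the 8.
  refine key.le ?_
  simp only [Expr.cost]
  nlinarith

/-! ### Blocks of assignments -/

/-- A sequence of assignments. -/
def assigns (W : ℕ) : List (ℕ × Expr) → Program
  | [] => .instr (.move W W)
  | x :: l => .seq (assign W x.1 x.2) (assigns W l)

/-- The effect of a sequence of assignments. -/
def evalList : List (ℕ × Expr) → Config → Config
  | [], s => s
  | x :: l, s => evalList l (s.setReg x.1 (x.2.eval s))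

/-- A sequence of assignments does not fault. -/
def OkList (S : ℕ) : List (ℕ × Expr) → Config → Prop
  | [], _ => True
  | x :: l, s => x.2.Ok S s ∧ OkList S l (s.setReg x.1 (x.2.eval s))

/-- The registers of a sequence of assignments are below `W`. -/
def BelowList (W : ℕ) : List (ℕ × Expr) → Prop
  | [] => True
  | x :: l => x.2.Below W ∧ BelowList W l

/-- A bound for the number of steps of a sequence of assignments. -/
def costList : List (ℕ × Expr) → ℕ
  | [] => 1
  | x :: l => x.2.cost + 1 + costList l

theorem Runs.assigns {l : List (ℕ × Expr)} {s : Config} {Q : Config → Prop}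
    (hb : BelowList W l) (ho : OkList S l s) (hQ : Q (evalList l s)) :
    Runs S W (assigns W l) s (costList l) Q := by
  induction l generalizing s with
  -- There is no empty program; the empty block copies a scratch register to itself.
  | nil =>
    exact fun σ hσ =>
      ⟨1, _, s, .instr (.move W W σ), (agree_setReg le_rfl _ _).trans hσ, le_rfl, hQ⟩
  | cons x l ih => exact .seq (Runs.assign hb.1 ho.1 (ih hb.2 ho.2 hQ))

end RealRAM

end
noncomputable section

open Set

/-! ### Monotone matchings of vertex sequences with a segment -/

section Traverse

variable {E : Type*} [NormedAddCommGroup E] [NormedSpace ℝ E]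

/-- The parameters `σ` match the points `z l, …, z h` in order with points of the line through `p`
and `q`, from parameter `a` to parameter `b`, at distance at most `δ`. -/
def IsMatching (z : ℕ → E) (l h : ℕ) (p q : E) (a b δ : ℝ) (σ : ℕ → ℝ) : Prop :=
  σ l = a ∧ σ h = b ∧ MonotoneOn σ (Icc l h) ∧
    ∀ i ∈ Icc l h, dist (z i) (AffineMap.lineMap p q (σ i)) ≤ δ

/-- The points `z l, …, z h` can be matched in order with points of the line through `p` and `q`,
from parameter `a` to parameter `b`, at distance at most `δ`. -/
def Traverse (z : ℕ → E) (l h : ℕ) (p q : E) (a b δ : ℝ) : Prop :=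
  ∃ σ : ℕ → ℝ, IsMatching z l h p q a b δ σ

/-- Convexity of the norm. This is what reduces matchings of curves to matchings of vertices. -/
theorem dist_lineMap_lineMap_le {x x' y y' : E} {δ t : ℝ} (ht : t ∈ Icc (0 : ℝ) 1)
    (h : dist x y ≤ δ) (h' : dist x' y' ≤ δ) :
    dist (AffineMap.lineMap x x' t) (AffineMap.lineMap y y' t) ≤ δ := by
  have e : (AffineMap.lineMap x x' t : E) - AffineMap.lineMap y y' t
      = (1 - t) • (x - y) + t • (x' - y') := by
    simp only [AffineMap.lineMap_apply_module]
    module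
  rw [dist_eq_norm] at *
  rw [e]
  calc _ ≤ ‖(1 - t) • (x - y)‖ + ‖t • (x' - y')‖ := norm_add_le _ _
    _ = (1 - t) * ‖x - y‖ + t * ‖x' - y'‖ := by
        rw [norm_smul, norm_smul, Real.norm_of_nonneg (by linarith [ht.2]),
          Real.norm_of_nonneg ht.1]
    _ ≤ (1 - t) * δ + t * δ := by
        gcongr
        · linarith [ht.2]
        · exact ht.1
    _ = δ := by ring

theorem Traverse.mono {z : ℕ → E} {l h : ℕ} {p q : E} {a b δ δ' : ℝ}
    (H : Traverse z l h p q a b δ) (hδ : δ ≤ δ') : Traverse z l h p q a b δ' := by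
  obtain ⟨σ, h₁, h₂, h₃, h₄⟩ := H
  exact ⟨σ, h₁, h₂, h₃, fun i hi => (h₄ i hi).trans hδ⟩

theorem Traverse.congr {z z' : ℕ → E} {l h : ℕ} {p q : E} {a b δ : ℝ}
    (H : Traverse z l h p q a b δ) (hz : ∀ i ∈ Icc l h, z i = z' i) :
    Traverse z' l h p q a b δ := by
  obtain ⟨σ, h₁, h₂, h₃, h₄⟩ := H
  exact ⟨σ, h₁, h₂, h₃, fun i hi => hz i hi ▸ h₄ i hi⟩

theorem Traverse.refl {z : ℕ → E} {l : ℕ} {p q : E} {a δ : ℝ}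
    (H : dist (z l) (AffineMap.lineMap p q a) ≤ δ) : Traverse z l l p q a a δ := by
  refine ⟨fun _ => a, rfl, rfl, fun _ _ _ _ _ => le_rfl, fun i hi => ?_⟩
  rw [Icc_self] at hi
  rw [hi]; exact H

theorem Traverse.le {z : ℕ → E} {l h : ℕ} {p q : E} {a b δ : ℝ}
    (H : Traverse z l h p q a b δ) (hlh : l ≤ h) : a ≤ b := by
  obtain ⟨σ, h₁, h₂, h₃, -⟩ := H
  rw [← h₁, ← h₂]
  exact h₃ ⟨le_rfl, hlh⟩ ⟨hlh, le_rfl⟩ hlh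

/-- Both matchings send `m` to `b`, so they can be glued there; the error does not grow. -/
theorem Traverse.trans {z : ℕ → E} {l m h : ℕ} {p q : E} {a b c δ : ℝ} (hlm : l ≤ m)
    (hmh : m ≤ h) (H : Traverse z l m p q a b δ) (H' : Traverse z m h p q b c δ) :
    Traverse z l h p q a c δ := by
  obtain ⟨σ, h₁, h₂, h₃, h₄⟩ := H
  obtain ⟨τ, k₁, k₂, k₃, k₄⟩ := H'
  refine ⟨fun i => if i ≤ m then σ i else τ i, by simp [hlm, h₁], ?_, ?_, ?_⟩
  · rcases hmh.eq_or_lt with rfl | hlt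
    · simp [h₂, ← k₂, k₁]
    · simp [not_le.2 hlt, k₂]
  · intro i hi j hj hij
    by_cases hjm : j ≤ m
    · simp only [hjm, hij.trans hjm, if_true]
      exact h₃ ⟨hi.1, hij.trans hjm⟩ ⟨hj.1, hjm⟩ hij
    · by_cases him : i ≤ m
      · simp only [hjm, him, if_true, if_false]
        calc σ i ≤ σ m := h₃ ⟨hi.1, him⟩ ⟨hlm, le_rfl⟩ him
          _ = τ m := by rw [h₂, k₁]
          _ ≤ τ j := k₃ ⟨le_rfl, hmh⟩ ⟨by omega, hj.2⟩ (by omega)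
      · simp only [hjm, him, if_false]
        exact k₃ ⟨by omega, hi.2⟩ ⟨by omega, hj.2⟩ hij
  · intro i hi
    by_cases him : i ≤ m
    · simp only [him, if_true]; exact h₄ i ⟨hi.1, him⟩
    · simp only [him, if_false]; exact k₄ i ⟨by omega, hi.2⟩

theorem Traverse.step {z : ℕ → E} {l : ℕ} {p q : E} {a b δ : ℝ} (hab : a ≤ b)
    (H : dist (z l) (AffineMap.lineMap p q a) ≤ δ)
    (H' : dist (z (l + 1)) (AffineMap.lineMap p q b) ≤ δ) :
    Traverse z l (l + 1) p q a b δ := by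
  refine ⟨fun i => if i ≤ l then a else b, by simp, by simp, ?_, ?_⟩
  · intro i _ j _ hij
    simp only
    split_ifs <;> first | exact le_rfl | exact hab | omega
  · intro i hi
    obtain rfl | rfl : i = l ∨ i = l + 1 := by have := hi.1; have := hi.2; omega
    · simpa using H
    · simpa using H'

theorem lineMap_lineMap_lineMap (p q : E) (a b t : ℝ) :
    AffineMap.lineMap (AffineMap.lineMap p q a) (AffineMap.lineMap p q b) t
      = (AffineMap.lineMap p q (AffineMap.lineMap a b t) : E) := by
  simp only [AffineMap.lineMap_apply_module, smul_eq_mul]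
  module

/-- A matching with a subsegment is a matching with a part of the segment. -/
theorem Traverse.of_subsegment {z : ℕ → E} {l h : ℕ} {p q : E} {a b δ : ℝ} (hab : a ≤ b)
    (H : Traverse z l h (AffineMap.lineMap p q a) (AffineMap.lineMap p q b) 0 1 δ) :
    Traverse z l h p q a b δ := by
  obtain ⟨σ, h₁, h₂, h₃, h₄⟩ := H
  refine ⟨fun i => AffineMap.lineMap a b (σ i), by simp [h₁], by simp [h₂], ?_, ?_⟩
  · intro i hi j hj hij
    have := h₃ hi hj hij
    simp only [AffineMap.lineMap_apply_module, smul_eq_mul]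
    nlinarith
  · intro i hi
    rw [← lineMap_lineMap_lineMap]
    exact h₄ i hi

/-- The parameters are rescaled. If `a = b`, all points are near one single point and may get any
parameter, but the first index needs `0` and the last one needs `1`; this uses `l < h`. -/
theorem Traverse.to_subsegment {z : ℕ → E} {l h : ℕ} {p q : E} {a b δ : ℝ} (hlh : l < h)
    (H : Traverse z l h p q a b δ) :
    Traverse z l h (AffineMap.lineMap p q a) (AffineMap.lineMap p q b) 0 1 δ := by
  have hab := H.le hlh.le
  obtain ⟨σ, h₁, h₂, h₃, h₄⟩ := H
  rcases hab.eq_or_lt with rfl | hlt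
  · refine ⟨fun i => if i ≤ l then 0 else 1, by simp, by simp [hlh], ?_, ?_⟩
    · intro i _ j _ hij
      simp only
      split_ifs <;> first | exact le_rfl | exact zero_le_one | omega
    · intro i hi
      have e : σ i = a := le_antisymm
        (h₂ ▸ h₃ hi ⟨hlh.le, le_rfl⟩ hi.2) (h₁ ▸ h₃ ⟨le_rfl, hlh.le⟩ hi hi.1)
      have := h₄ i hi
      rw [e] at this
      simpa using this
  · have hne : b - a ≠ 0 := by linarith
    refine ⟨fun i => (σ i - a) / (b - a), by simp [h₁], by simp [h₂, hne], ?_, ?_⟩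
    · intro i hi j hj hij
      have := h₃ hi hj hij
      simp only
      gcongr
    · intro i hi
      rw [lineMap_lineMap_lineMap]
      have e : AffineMap.lineMap a b ((σ i - a) / (b - a)) = σ i := by
        simp only [AffineMap.lineMap_apply_module, smul_eq_mul]
        field_simp
        ring
      rw [e]
      exact h₄ i hi

/-- Moving the endpoints of the segment. -/
theorem Traverse.move {z : ℕ → E} {l h : ℕ} {p q p' q' : E} {δ e : ℝ} (hlh : l ≤ h)
    (H : Traverse z l h p q 0 1 δ) (hp : dist p p' ≤ e) (hq : dist q q' ≤ e) :
    Traverse z l h p' q' 0 1 (δ + e) := by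
  obtain ⟨σ, h₁, h₂, h₃, h₄⟩ := H
  refine ⟨σ, h₁, h₂, h₃, fun i hi => (dist_triangle _ _ _).trans (add_le_add (h₄ i hi) ?_)⟩
  exact dist_lineMap_lineMap_le ⟨h₁ ▸ h₃ ⟨le_rfl, hlh⟩ hi hi.1,
    h₂ ▸ h₃ hi ⟨hlh, le_rfl⟩ hi.2⟩ hp hq

end Traverse

/-! ### The Fréchet distance to a segment in terms of matchings -/

theorem reparamWidth_nonneg {E : Type*} [PseudoMetricSpace E] (f : Reparam)
    (X Y : unitInterval → E) : 0 ≤ reparamWidth f X Y :=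
  Real.iSup_nonneg fun _ => dist_nonneg

theorem frechetDist_le_reparamWidth {E : Type*} [PseudoMetricSpace E] (f : Reparam)
    (X Y : unitInterval → E) : frechetDist X Y ≤ reparamWidth f X Y :=
  ciInf_le ⟨0, by rintro _ ⟨g, rfl⟩; exact reparamWidth_nonneg g X Y⟩ f

instance : Nonempty Reparam := ⟨⟨id, continuous_id, Function.injective_id, rfl, rfl⟩⟩

theorem unitInterval.surjective_of_continuous {φ : unitInterval → unitInterval}
    (hφ : Continuous φ) (h₀ : φ 0 = 0) (h₁ : φ 1 = 1) : Function.Surjective φ := fun y => by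
  have := intermediate_value_univ (0 : unitInterval) 1 hφ
  rw [h₀, h₁] at this
  exact this ⟨y.2.1, y.2.2⟩

/-- A pair of monotone reparametrizations, one for each curve, bounds the Fréchet distance. -/
theorem frechetDist_le_of_pair {E : Type*} [PseudoMetricSpace E] {X Y : unitInterval → E}
    (hX : Continuous X) (hY : Continuous Y) {φ ψ : unitInterval → unitInterval}
    (hφ : Continuous φ) (hψ : Continuous ψ) (mφ : Monotone φ) (mψ : Monotone ψ)
    (φ₀ : φ 0 = 0) (φ₁ : φ 1 = 1) (ψ₀ : ψ 0 = 0) (ψ₁ : ψ 1 = 1) {δ : ℝ}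
    (h : ∀ t, dist (X (φ t)) (Y (ψ t)) ≤ δ) : frechetDist X Y ≤ δ := by
  -- Mixing a monotone map with the fraction `κ` of the identity makes it strictly monotone, hence
  -- an order isomorphism, and moves it by at most `κ`.
  have approx : ∀ κ : ℝ, 0 < κ → κ ≤ 1 → ∀ φ : unitInterval → unitInterval, Continuous φ →
      Monotone φ → φ 0 = 0 → φ 1 = 1 →
      ∃ g : unitInterval ≃o unitInterval, ∀ t, dist (g t) (φ t) ≤ κ := by
    intro κ hκ hκ' φ hφ mφ φ₀ φ₁
    have hm : ∀ t : unitInterval, (1 - κ) * (φ t : ℝ) + κ * t ∈ Icc (0 : ℝ) 1 := fun t => by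
      have h₁ := (φ t).2.1; have h₂ := (φ t).2.2; have h₃ := t.2.1; have h₄ := t.2.2
      constructor <;> nlinarith
    let g : unitInterval → unitInterval := fun t => ⟨(1 - κ) * (φ t : ℝ) + κ * t, hm t⟩
    have hg : Continuous g := by
      refine Continuous.subtype_mk ?_ _
      fun_prop
    have sg : StrictMono g := fun s t hst => by
      have h₁ : (φ s : ℝ) ≤ φ t := mφ hst.le
      have h₂ : (s : ℝ) < t := hst
      change (1 - κ) * (φ s : ℝ) + κ * s < (1 - κ) * (φ t : ℝ) + κ * t
      nlinarith
    have g₀ : g 0 = 0 := Subtype.ext (by simp [g, φ₀])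
    have g₁ : g 1 = 1 := Subtype.ext (by simp [g, φ₁])
    refine ⟨sg.orderIsoOfSurjective g (unitInterval.surjective_of_continuous hg g₀ g₁),
      fun t => ?_⟩
    rw [StrictMono.coe_orderIsoOfSurjective, Subtype.dist_eq, Real.dist_eq]
    have h₁ := (φ t).2.1; have h₂ := (φ t).2.2; have h₃ := t.2.1; have h₄ := t.2.2
    have e : ((g t : unitInterval) : ℝ) - φ t = κ * (t - φ t) := by simp only [g]; ring
    rw [e, abs_mul, abs_of_pos hκ]
    have : |(t : ℝ) - φ t| ≤ 1 := abs_le.2 ⟨by linarith, by linarith⟩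
    nlinarith
  refine le_of_forall_pos_le_add fun η hη => ?_
  obtain ⟨r₁, hr₁, H₁⟩ := Metric.uniformContinuous_iff.1
    (CompactSpace.uniformContinuous_of_continuous hX) (η / 2) (by positivity)
  obtain ⟨r₂, hr₂, H₂⟩ := Metric.uniformContinuous_iff.1
    (CompactSpace.uniformContinuous_of_continuous hY) (η / 2) (by positivity)
  set κ := min 1 (min r₁ r₂ / 2) with hκ
  have κ0 : 0 < κ := by have := lt_min hr₁ hr₂; rw [hκ]; positivity
  have κr : κ < min r₁ r₂ := by
    have := lt_min hr₁ hr₂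
    exact (min_le_right _ _).trans_lt (by linarith)
  obtain ⟨g, hg⟩ := approx κ κ0 (min_le_left _ _) φ hφ mφ φ₀ φ₁
  obtain ⟨k, hk⟩ := approx κ κ0 (min_le_left _ _) ψ hψ mψ ψ₀ ψ₁
  -- With both maps replaced by isomorphisms `g` and `k`, the pair becomes the single
  -- reparametrization `g ∘ k⁻¹`. Uniform continuity of the curves bounds the change of the
  -- distances by `η`.
  let f : Reparam :=
    { toFun := fun t => g (k.symm t)
      continuous' := g.continuous.comp k.symm.continuous
      injective' := g.injective.comp k.symm.injective
      map_zero' := by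
        change g (k.symm ⊥) = ⊥
        rw [k.symm.map_bot, g.map_bot]
      map_one' := by
        change g (k.symm ⊤) = ⊤
        rw [k.symm.map_top, g.map_top] }
  refine (frechetDist_le_reparamWidth f X Y).trans (ciSup_le fun α => ?_)
  have e : Y α = Y (k (k.symm α)) := by simp
  change dist (X (g (k.symm α))) (Y α) ≤ _
  rw [e]
  set t := k.symm α
  have a₁ := (H₁ ((hg t).trans_lt (κr.trans_le (min_le_left _ _)))).le
  have a₂ := (H₂ ((hk t).trans_lt (κr.trans_le (min_le_right _ _)))).le
  rw [dist_comm] at a₂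
  calc _ ≤ dist (X (g t)) (X (φ t)) + dist (X (φ t)) (Y (ψ t)) + dist (Y (ψ t)) (Y (k t)) :=
        dist_triangle4 _ _ _ _
    _ ≤ η / 2 + δ + η / 2 := by gcongr; exact h t
    _ = δ + η := by ring

/-- The piecewise linear interpolation of `c 0, …, c m` at the integers. -/
def interp {E : Type*} [AddCommGroup E] [Module ℝ E] (c : ℕ → E) (m : ℕ) (x : ℝ) : E :=
  c 0 + ∑ k ∈ Finset.range m, max 0 (min 1 (x - k)) • (c (k + 1) - c k)

/-- On the interval from `r` to `r + 1`, the ramps before `r` are saturated and telescope to `c r`,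
the ramp `r` is active, and the later ones vanish. -/
theorem interp_eq {E : Type*} [AddCommGroup E] [Module ℝ E] (c : ℕ → E) {m r : ℕ} (hr : r < m)
    {x : ℝ} (h₁ : (r : ℝ) ≤ x) (h₂ : x ≤ r + 1) :
    interp c m x = AffineMap.lineMap (c r) (c (r + 1)) (x - r) := by
  have low : ∀ j ≤ r, interp c j x = c j := by
    intro j
    induction j with
    | zero => simp [interp]
    | succ j ih =>
      intro hj
      have hx : (j : ℝ) + 1 ≤ x := le_trans (by exact_mod_cast hj) h₁
      have := ih (by omega)
      rw [interp, Finset.sum_range_succ, ← add_assoc, ← interp, this,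
        min_eq_left (by linarith), max_eq_right zero_le_one, one_smul]
      abel
  have mid : interp c (r + 1) x = AffineMap.lineMap (c r) (c (r + 1)) (x - r) := by
    rw [interp, Finset.sum_range_succ, ← add_assoc, ← interp, low r le_rfl,
      min_eq_right (by linarith), max_eq_right (by linarith), AffineMap.lineMap_apply_module']
    abel
  rw [← mid]
  obtain ⟨k, rfl⟩ := Nat.exists_eq_add_of_le (Nat.succ_le_of_lt hr)
  clear hr
  induction k with
  | zero => rfl
  | succ k ih =>
    rw [← ih, show r.succ + (k + 1) = (r.succ + k) + 1 from rfl, interp, Finset.sum_range_succ,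
      ← add_assoc, ← interp]
    have : max 0 (min 1 (x - ((r.succ + k : ℕ) : ℝ))) = 0 := by
      refine max_eq_left (min_le_of_right_le ?_)
      push_cast
      have : (0 : ℝ) ≤ k := Nat.cast_nonneg k
      linarith
    rw [this, zero_smul, add_zero]

theorem continuous_interp {E : Type*} [NormedAddCommGroup E] [NormedSpace ℝ E] (c : ℕ → E)
    (m : ℕ) : Continuous (interp c m) := by
  unfold interp
  fun_prop

theorem monotone_interp {c : ℕ → ℝ} {m : ℕ} (hc : MonotoneOn c (Icc 0 m)) :
    Monotone (interp c m) := fun x y hxy => by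
  unfold interp
  gcongr with k hk
  · have hk := Finset.mem_range.1 hk
    exact sub_nonneg.2 (hc ⟨Nat.zero_le _, hk.le⟩ ⟨Nat.zero_le _, hk⟩ (Nat.le_succ k))

theorem interp_zero {E : Type*} [AddCommGroup E] [Module ℝ E] (c : ℕ → E) {m : ℕ} (hm : 0 < m) :
    interp c m 0 = c 0 := by
  rw [interp_eq c hm (by simp) (by simp)]; simp

theorem interp_last {E : Type*} [AddCommGroup E] [Module ℝ E] (c : ℕ → E) {m : ℕ} (hm : 0 < m) :
    interp c m m = c m := by
  obtain ⟨k, rfl⟩ : ∃ k, m = k + 1 := ⟨m - 1, by omega⟩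
  rw [interp_eq c (Nat.lt_succ_self k) (by simp) (by simp)]; simp

/-- The right end `x = m` belongs to the last interval, although its floor is `m`. -/
theorem exists_floor_interval {m : ℕ} (hm : 0 < m) {x : ℝ} (h₀ : 0 ≤ x) (h₁ : x ≤ m) :
    ∃ r < m, (r : ℝ) ≤ x ∧ x ≤ r + 1 := by
  rcases h₁.eq_or_lt with rfl | h
  · exact ⟨m - 1, by omega, by simp, by
      rw [Nat.cast_sub hm]; simp⟩
  · exact ⟨⌊x⌋₊, (Nat.floor_lt h₀).2 h, Nat.floor_le h₀, (Nat.lt_floor_add_one x).le⟩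

/-! ### Vertices and parameters of a subcurve -/

section Curve

variable {d n : ℕ} (Z : Fin n → EuclideanSpace ℝ (Fin d))

/-- At the right end `r + 1` the definition already uses the next edge; both formulas give the
common vertex. -/
theorem polyCurve_eq {r : ℕ} {x : ℝ} (h₁ : (r : ℝ) ≤ x) (h₂ : x ≤ r + 1) :
    polyCurve Z x = AffineMap.lineMap (polyVertex Z r) (polyVertex Z (r + 1)) (x - r) := by
  rcases h₂.eq_or_lt with rfl | h
  · have : ⌊(r : ℝ) + 1⌋₊ = r + 1 := by exact_mod_cast Nat.floor_natCast (R := ℝ) (r + 1)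
    simp [polyCurve, this]
  · have : ⌊x⌋₊ = r := (Nat.floor_eq_iff (by linarith [Nat.cast_nonneg (α := ℝ) r])).2 ⟨h₁, h⟩
    simp [polyCurve, this]

theorem polyCurve_natCast (r : ℕ) : polyCurve Z r = polyVertex Z r := by
  rw [polyCurve_eq Z (r := r) le_rfl (by simp)]; simp

theorem continuousOn_polyCurve (m : ℕ) : ContinuousOn (polyCurve Z) (Icc 0 m) := by
  rcases Nat.eq_zero_or_pos m with rfl | hm
  · simp
  · refine (continuous_interp (polyVertex Z) m).continuousOn.congr fun x hx => ?_
    obtain ⟨r, hr, h₁, h₂⟩ := exists_floor_interval hm hx.1 hx.2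
    rw [interp_eq _ hr h₁ h₂, polyCurve_eq Z h₁ h₂]

theorem continuous_subCurve {a b : ℝ} (ha : 0 ≤ a) (hb : 0 ≤ b) :
    Continuous (subCurve Z a b) := by
  obtain ⟨m, hm⟩ := exists_nat_ge (max a b)
  refine (continuousOn_polyCurve Z m).comp_continuous (by fun_prop) fun t => ?_
  have h₁ := t.2.1; have h₂ := t.2.2
  have h₃ := (le_max_left a b).trans hm; have h₄ := (le_max_right a b).trans hm
  constructor <;> nlinarith

theorem continuous_segmentCurve (p q : EuclideanSpace ℝ (Fin d)) :
    Continuous (segmentCurve p q) := by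
  unfold segmentCurve
  exact AffineMap.lineMap_continuous.comp continuous_subtype_val

/-- The vertices `u, z (i + 1), …, z j, v` of a subcurve, indexed by `i, …, j + 1`. -/
def subVertex {E : Type*} (z : ℕ → E) (i j : ℕ) (u v : E) (k : ℕ) : E :=
  if k ≤ i then u else if k ≤ j then z k else v

/-- The parameters of the vertices of a subcurve. -/
theorem exists_subCurve_parameters {i j : ℕ} (hij : i < j) {a b : ℝ}
    (ha : a ∈ Icc (i : ℝ) (i + 1)) (hb : b ∈ Icc (j : ℝ) (j + 1)) :
    ∃ θ : ℕ → unitInterval, MonotoneOn θ (Icc i (j + 1)) ∧ θ i = 0 ∧ θ (j + 1) = 1 ∧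
      ∀ k ∈ Icc i (j + 1),
        subCurve Z a b (θ k) = subVertex (polyVertex Z) i j (polyCurve Z a) (polyCurve Z b) k ∧
        (k ≤ j → a + (θ k : ℝ) * (b - a) ∈ Icc (k : ℝ) (k + 1) ∧
          a + (θ (k + 1) : ℝ) * (b - a) ∈ Icc (k : ℝ) (k + 1)) := by
  -- The parameters on the whole curve: `a` at index `i`, the index itself at a vertex in between,
  -- and `b` at index `j + 1`.
  let T : ℕ → ℝ := subVertex (fun k => (k : ℝ)) i j a b
  have hij' : (i : ℝ) + 1 ≤ j := by exact_mod_cast hij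
  have hab : a ≤ b := by linarith [ha.2, hb.1]
  have Ti : T i = a := by simp [T, subVertex]
  have Tj : T (j + 1) = b := by
    simp only [T, subVertex]; rw [if_neg (by omega), if_neg (by omega)]
  have Tm : MonotoneOn T (Icc i (j + 1)) := by
    intro k hk l hl hkl
    simp only [T, subVertex]
    have hkl' : (k : ℝ) ≤ l := by exact_mod_cast hkl
    split_ifs with h₁ h₂ h₃ h₄ h₅ h₆ h₇ <;>
      first
      | exact le_rfl
      | exact hab
      | exact hkl'
      | omega
      | (have : ((i + 1 : ℕ) : ℝ) ≤ (l : ℝ) := by exact_mod_cast (by omega)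
         push_cast at this; linarith [ha.2])
      | (have : (k : ℝ) ≤ (j : ℝ) := by exact_mod_cast (by omega)
         linarith [hb.1])
  have Tab : ∀ k ∈ Icc i (j + 1), T k ∈ Icc a b := fun k hk =>
    ⟨Ti ▸ Tm ⟨le_rfl, by omega⟩ hk hk.1, Tj ▸ Tm hk ⟨by omega, le_rfl⟩ hk.2⟩
  obtain ⟨θ, θm, θi, θj, hθ⟩ : ∃ θ : ℕ → unitInterval, MonotoneOn θ (Icc i (j + 1)) ∧
      θ i = 0 ∧ θ (j + 1) = 1 ∧ ∀ k ∈ Icc i (j + 1), a + (θ k : ℝ) * (b - a) = T k := by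
    -- If `a = b`, the subcurve is a single point and the normalization would divide by zero; any
    -- monotone choice from `0` to `1` serves.
    rcases hab.eq_or_lt with rfl | hlt
    · refine ⟨fun k => if k ≤ i then 0 else 1, ?_, by simp, by simp [hij.le], ?_⟩
      · intro k _ l _ hkl
        simp only
        split_ifs <;> first | exact le_rfl | exact unitInterval.le_one' | omega
      · intro k hk
        have := Tab k hk
        simp only [Icc_self, mem_singleton_iff] at this
        simp [this]
    · have pos : 0 < b - a := by linarith
      refine ⟨fun k => projIcc 0 1 zero_le_one ((T k - a) / (b - a)), ?_, ?_, ?_, ?_⟩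
      · intro k hk l hl hkl
        refine monotone_projIcc _ ?_
        have := Tm hk hl hkl
        gcongr
      · simp [Ti]
      · simp [Tj, pos.ne']
      · intro k hk
        obtain ⟨h₁, h₂⟩ := Tab k hk
        have hm : (T k - a) / (b - a) ∈ Icc (0 : ℝ) 1 :=
          ⟨div_nonneg (by linarith) pos.le, (div_le_one pos).2 (by linarith)⟩
        simp only
        rw [projIcc_of_mem _ hm]
        field_simp
        ring
  refine ⟨θ, θm, θi, θj, fun k hk => ⟨?_, fun hkj => ?_⟩⟩
  · rw [subCurve, hθ k hk]
    simp only [T, subVertex]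
    split_ifs
    · rfl
    · exact polyCurve_natCast Z k
    · rfl
  · rw [hθ k hk, hθ (k + 1) ⟨by have := hk.1; omega, by omega⟩]
    simp only [T, subVertex]
    rw [if_neg (show ¬ k + 1 ≤ i by have := hk.1; omega)]
    rcases eq_or_lt_of_le hk.1 with rfl | hik
    · rw [if_pos le_rfl, if_pos (by omega)]
      exact ⟨ha, by push_cast; simp⟩
    · rw [if_neg (by omega), if_pos hkj]
      refine ⟨by simp, ?_⟩
      rcases eq_or_lt_of_le hkj with rfl | hkj
      · rw [if_neg (by omega)]; exact hb
      · rw [if_pos (by omega)]; push_cast; simp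

variable {Z}

/-- Both curves are run through simultaneously, so that matched vertices are reached at the same
integer times. Between two such times both move linearly along one edge and along the segment, and
convexity bounds the distance by its values at the ends. -/
theorem frechetDist_le_of_traverse {i j : ℕ} (hij : i < j) {a b : ℝ}
    (ha : a ∈ Icc (i : ℝ) (i + 1)) (hb : b ∈ Icc (j : ℝ) (j + 1))
    {p q : EuclideanSpace ℝ (Fin d)} {δ : ℝ}
    (H : Traverse (subVertex (polyVertex Z) i j (polyCurve Z a) (polyCurve Z b)) i (j + 1)
      p q 0 1 δ) :
    frechetDist (subCurve Z a b) (segmentCurve p q) ≤ δ := by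
  obtain ⟨θ, θm, θi, θj, hθ⟩ := exists_subCurve_parameters Z hij ha hb
  obtain ⟨σ, σi, σj, σm, hσ⟩ := H
  have ha0 : 0 ≤ a := (Nat.cast_nonneg i).trans ha.1
  have hb0 : 0 ≤ b := (Nat.cast_nonneg j).trans hb.1
  set m := j + 1 - i with hm
  have hm0 : 0 < m := by omega
  have him : i + m = j + 1 := by omega
  let c : ℕ → ℝ := fun k => θ (i + k)
  let e : ℕ → ℝ := fun k => σ (i + k)
  have mem : ∀ k ∈ Icc 0 m, i + k ∈ Icc i (j + 1) := fun k hk => ⟨by omega, by have := hk.2; omega⟩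
  have cm : MonotoneOn c (Icc 0 m) := fun k hk l hl hkl => θm (mem k hk) (mem l hl) (by omega)
  have em : MonotoneOn e (Icc 0 m) := fun k hk l hl hkl => σm (mem k hk) (mem l hl) (by omega)
  have wrap : ∀ c : ℕ → ℝ, MonotoneOn c (Icc 0 m) → c 0 = 0 → c m = 1 →
      ∃ φ : unitInterval → unitInterval, Continuous φ ∧ Monotone φ ∧ φ 0 = 0 ∧ φ 1 = 1 ∧
        ∀ t, (φ t : ℝ) = interp c m (m * t) := by
    intro c cm c0 c1
    have mono : Monotone fun t : unitInterval => interp c m (m * t) := fun s t hst =>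
      monotone_interp cm (mul_le_mul_of_nonneg_left hst (Nat.cast_nonneg m))
    have e0 : interp c m (m * (0 : unitInterval)) = 0 := by
      simp [interp_zero c hm0, c0]
    have e1 : interp c m (m * (1 : unitInterval)) = 1 := by
      simp [interp_last c hm0, c1]
    refine ⟨fun t => ⟨interp c m (m * t), ?_, ?_⟩, ?_, fun s t hst => mono hst,
      Subtype.ext e0, Subtype.ext e1, fun t => rfl⟩
    · rw [← e0]; exact mono t.2.1
    · rw [← e1]; exact mono t.2.2
    · refine Continuous.subtype_mk ((continuous_interp c m).comp (by fun_prop)) _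
  obtain ⟨φ, φc, φm, φ₀, φ₁, hφ⟩ := wrap c cm (by simp [c, θi]) (by simp [c, him, θj])
  obtain ⟨ψ, ψc, ψm, ψ₀, ψ₁, hψ⟩ := wrap e em (by simp [e, σi]) (by simp [e, him, σj])
  refine frechetDist_le_of_pair (continuous_subCurve Z ha0 hb0) (continuous_segmentCurve p q)
    φc ψc φm ψm φ₀ φ₁ ψ₀ ψ₁ fun t => ?_
  obtain ⟨r, hr, h₁, h₂⟩ := exists_floor_interval hm0 (x := m * t)
    (mul_nonneg (Nat.cast_nonneg m) t.2.1) (mul_le_of_le_one_right (Nat.cast_nonneg m) t.2.2)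
  have hr' := mem r ⟨Nat.zero_le _, hr.le⟩
  have hr'' := mem (r + 1) ⟨Nat.zero_le _, hr⟩
  rw [subCurve, segmentCurve, hφ, hψ, interp_eq c hr h₁ h₂, interp_eq e hr h₁ h₂]
  set x := (m : ℝ) * t - r with hx
  have hx' : x ∈ Icc (0 : ℝ) 1 := ⟨by linarith, by linarith⟩
  obtain ⟨v₁, f₁⟩ := hθ _ hr'
  obtain ⟨v₂, -⟩ := hθ _ hr''
  obtain ⟨f₁, f₂⟩ := f₁ (by omega)
  have conv : a + AffineMap.lineMap (c r) (c (r + 1)) x * (b - a)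
      = AffineMap.lineMap (a + c r * (b - a)) (a + c (r + 1) * (b - a)) x := by
    simp only [AffineMap.lineMap_apply_module, smul_eq_mul]; ring
  -- A convex combination of two parameters of one edge stays on this edge, where the curve is
  -- affine.
  have f₃ := (convex_Icc ((i + r : ℕ) : ℝ) ((i + r : ℕ) + 1)).lineMap_mem f₁ f₂ hx'
  have key : polyCurve Z (a + AffineMap.lineMap (c r) (c (r + 1)) x * (b - a))
      = AffineMap.lineMap (subCurve Z a b (θ (i + r))) (subCurve Z a b (θ (i + r + 1))) x := by
    rw [conv, subCurve, subCurve, polyCurve_eq Z f₁.1 f₁.2, polyCurve_eq Z f₂.1 f₂.2,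
      lineMap_lineMap_lineMap]
    change polyCurve Z (AffineMap.lineMap (a + (θ (i + r) : ℝ) * (b - a))
      (a + (θ (i + r + 1) : ℝ) * (b - a)) x) = _
    rw [polyCurve_eq Z (r := i + r) f₃.1 f₃.2]
    congr 1
    simp only [AffineMap.lineMap_apply_module, smul_eq_mul]
    ring
  rw [key, v₁, show i + r + 1 = i + (r + 1) from rfl, v₂, ← lineMap_lineMap_lineMap]
  exact dist_lineMap_lineMap_le hx' (hσ _ hr') (hσ _ hr'')

/-- Strictness provides an actual reparametrization of width below `δ`. It is continuous and
injective, hence increasing, and its inverse tells when each vertex is passed; these times are the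
parameters of the matching. -/
theorem traverse_of_frechetDist_lt {i j : ℕ} (hij : i < j) {a b : ℝ}
    (ha : a ∈ Icc (i : ℝ) (i + 1)) (hb : b ∈ Icc (j : ℝ) (j + 1))
    {p q : EuclideanSpace ℝ (Fin d)} {δ : ℝ}
    (H : frechetDist (subCurve Z a b) (segmentCurve p q) < δ) :
    Traverse (subVertex (polyVertex Z) i j (polyCurve Z a) (polyCurve Z b)) i (j + 1)
      p q 0 1 δ := by
  obtain ⟨θ, θm, θi, θj, hθ⟩ := exists_subCurve_parameters Z hij ha hb
  have ha0 : 0 ≤ a := (Nat.cast_nonneg i).trans ha.1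
  have hb0 : 0 ≤ b := (Nat.cast_nonneg j).trans hb.1
  obtain ⟨f, hf⟩ := exists_lt_of_ciInf_lt H
  have hc : Continuous fun α => dist (subCurve Z a b (f.toFun α)) (segmentCurve p q α) :=
    ((continuous_subCurve Z ha0 hb0).comp f.continuous').dist (continuous_segmentCurve p q)
  -- The supremum dominates its terms only because they are bounded, by compactness; an unbounded
  -- real supremum would be `0` by default.
  have hle : ∀ α, dist (subCurve Z a b (f.toFun α)) (segmentCurve p q α) ≤ δ := fun α =>
    (le_ciSup (isCompact_range hc).bddAbove α).trans hf.le
  have hmono : StrictMono f.toFun := by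
    rcases f.continuous'.strictMono_of_inj f.injective' with h | h
    · exact h
    · have := h (show (0 : unitInterval) < 1 from zero_lt_one)
      rw [f.map_zero', f.map_one'] at this
      exact absurd this (not_lt.2 unitInterval.nonneg')
  let g := hmono.orderIsoOfSurjective f.toFun
    (unitInterval.surjective_of_continuous f.continuous' f.map_zero' f.map_one')
  have hg : ∀ x, f.toFun (g.symm x) = x := fun x => g.apply_symm_apply x
  refine ⟨fun k => (g.symm (θ k) : unitInterval), ?_, ?_, ?_, ?_⟩
  · have := g.symm.map_bot
    simp only [θi]
    exact congrArg Subtype.val this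
  · have := g.symm.map_top
    simp only [θj]
    exact congrArg Subtype.val this
  · exact fun k hk l hl hkl => g.symm.monotone (θm hk hl hkl)
  · intro k hk
    have := hle (g.symm (θ k))
    rwa [hg, (hθ k hk).1] at this

end Curve

end
noncomputable section

open Set

/-! ### Projection to a segment -/

section Geometry

variable {E : Type*} [NormedAddCommGroup E] [InnerProductSpace ℝ E]

/-- The parameter of the point of the segment from `p` to `q` that is nearest to `z`. -/
def projParam (p q z : E) : ℝ :=
  if 0 < inner ℝ (q - p) (q - p) then
    max 0 (min 1 (inner ℝ (z - p) (q - p) / inner ℝ (q - p) (q - p)))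
  else 0

theorem projParam_mem (p q z : E) : projParam p q z ∈ Icc (0 : ℝ) 1 := by
  unfold projParam
  split_ifs
  · exact ⟨le_max_left _ _, max_le zero_le_one (min_le_left _ _)⟩
  · simp

theorem dist_lineMap_sq (p q z : E) (s : ℝ) :
    dist z (AffineMap.lineMap p q s) ^ 2 = inner ℝ (q - p) (q - p) * s ^ 2
      - 2 * inner ℝ (z - p) (q - p) * s + inner ℝ (z - p) (z - p) := by
  have e : z - AffineMap.lineMap p q s = (z - p) - s • (q - p) := by
    rw [AffineMap.lineMap_apply_module]; module
  rw [dist_eq_norm, e, norm_sub_sq_real, inner_smul_right, norm_smul, mul_pow,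
    real_inner_self_eq_norm_sq, real_inner_self_eq_norm_sq, Real.norm_eq_abs, sq_abs]
  ring

theorem eq_of_not_pos_inner {p q : E} (h : ¬ 0 < inner ℝ (q - p) (q - p)) : q = p := by
  have h0 : inner ℝ (q - p) (q - p) = 0 := le_antisymm (not_lt.1 h) real_inner_self_nonneg
  exact sub_eq_zero.1 (inner_self_eq_zero.1 h0)

/-- Clamping to the unit interval does not increase distances, and it fixes `s`. -/
theorem abs_clamp_sub_le {x s : ℝ} (hs : s ∈ Icc (0 : ℝ) 1) :
    |max 0 (min 1 x) - s| ≤ |x - s| := by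
  obtain ⟨h₀, h₁⟩ := hs
  rcases le_total x 0 with h | h
  · rw [min_eq_right (by linarith), max_eq_left h, abs_of_nonpos (by linarith),
      abs_of_nonpos (by linarith)]; linarith
  · rcases le_total x 1 with h' | h'
    · rw [min_eq_right h', max_eq_right h]
    · rw [min_eq_left h', max_eq_right zero_le_one, abs_of_nonneg (by linarith),
        abs_of_nonneg (by linarith)]; linarith

theorem abs_clamp_sub_le' {x s : ℝ} (hs : s ∈ Icc (0 : ℝ) 1) :
    |max 0 (min 1 x) - x| ≤ |s - x| := by
  obtain ⟨h₀, h₁⟩ := hs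
  rcases le_total x 0 with h | h
  · rw [min_eq_right (by linarith), max_eq_left h, abs_of_nonneg (by linarith),
      abs_of_nonneg (by linarith)]; linarith
  · rcases le_total x 1 with h' | h'
    · rw [min_eq_right h', max_eq_right h]; simp
    · rw [min_eq_left h', max_eq_right zero_le_one, abs_of_nonpos (by linarith),
        abs_of_nonpos (by linarith)]; linarith

/-- The squared distance is a quadratic polynomial in the parameter. It grows with the distance from
its vertex, and the clamped vertex is the closest point of the unit interval. -/
theorem dist_projParam_le (p q z : E) {s : ℝ} (hs : s ∈ Icc (0 : ℝ) 1) :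
    dist z (AffineMap.lineMap p q (projParam p q z)) ≤ dist z (AffineMap.lineMap p q s) := by
  unfold projParam
  split_ifs with h
  · have key := sq_le_sq.2 (abs_clamp_sub_le' (x := inner ℝ (z - p) (q - p) /
      inner ℝ (q - p) (q - p)) hs)
    refine (sq_le_sq₀ dist_nonneg dist_nonneg).1 ?_
    rw [dist_lineMap_sq, dist_lineMap_sq]
    generalize inner ℝ (q - p) (q - p) = L at *
    generalize inner ℝ (z - p) (q - p) = b at *
    have hb : b = L * (b / L) := by field_simp
    generalize b / L = τ at *
    subst hb
    nlinarith [mul_le_mul_of_nonneg_left key h.le]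
  · obtain rfl := eq_of_not_pos_inner h
    simp

/-- Neither orthogonal projection nor clamping increases distances. So the parameter of `z` in any
matching is tied to its projection, up to the error of the matching. -/
theorem abs_projParam_sub_mul_le (p q z : E) {s : ℝ} (hs : s ∈ Icc (0 : ℝ) 1) :
    |projParam p q z - s| * dist p q ≤ dist z (AffineMap.lineMap p q s) := by
  unfold projParam
  split_ifs with h
  · have key := sq_le_sq.2 (abs_clamp_sub_le (x := inner ℝ (z - p) (q - p) /
      inner ℝ (q - p) (q - p)) hs)
    refine (sq_le_sq₀ (by positivity) dist_nonneg).1 ?_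
    have cs : (inner ℝ (z - p) (q - p)) ^ 2 ≤
        inner ℝ (z - p) (z - p) * inner ℝ (q - p) (q - p) := by
      have := real_inner_mul_inner_self_le (z - p) (q - p)
      nlinarith
    rw [dist_lineMap_sq, mul_pow, sq_abs, dist_comm p q, dist_eq_norm q p,
      ← real_inner_self_eq_norm_sq]
    generalize inner ℝ (q - p) (q - p) = L at *
    generalize inner ℝ (z - p) (q - p) = b at *
    generalize inner ℝ (z - p) (z - p) = c at *
    have hb : b = L * (b / L) := by field_simp
    generalize b / L = τ at *
    subst hb
    have : L * τ ^ 2 ≤ c := by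
      by_contra! hc
      nlinarith
    nlinarith [mul_le_mul_of_nonneg_left key h.le]
  · obtain rfl := eq_of_not_pos_inner h
    simp

theorem dist_lineMap_lineMap_of_le (p q : E) {a b : ℝ} (h : a ≤ b) :
    dist (AffineMap.lineMap p q a) (AffineMap.lineMap p q b) = (b - a) * dist p q := by
  rw [dist_lineMap_lineMap, Real.dist_eq, abs_sub_comm, abs_of_nonneg (by linarith)]

/-! ### A constant-factor approximation in one pass -/

/-- The state of the pass over `z l, …, z i`: `M` is the largest projection parameter, `B` the
largest backward distance of projections, `D` the largest distance from the segment, and `R` the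
largest error of the shortcuts that have been used. -/
structure ScanInv (z : ℕ → E) (l h : ℕ) (p q : E) (i : ℕ) (M B D R : ℝ) : Prop where
  mem : M ∈ Icc (0 : ℝ) 1
  nonneg : 0 ≤ B ∧ 0 ≤ D ∧ 0 ≤ R
  last : dist (z h) q ≤ D
  near : dist (z i) (AffineMap.lineMap p q M) ≤ D + B
  upper : Traverse z l i p q 0 M (D + B + R)
  lower : ∀ δ σ, IsMatching z l h p q 0 1 δ σ →
    D ≤ δ ∧ B ≤ 2 * δ ∧ R ≤ 6 * δ ∧ M * dist p q ≤ σ i * dist p q + δ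

theorem IsMatching.nonneg {z : ℕ → E} {l h : ℕ} {p q : E} {a b δ : ℝ} {σ : ℕ → ℝ}
    (H : IsMatching z l h p q a b δ σ) (hlh : l ≤ h) : 0 ≤ δ :=
  dist_nonneg.trans (H.2.2.2 l ⟨le_rfl, hlh⟩)

theorem IsMatching.mem {z : ℕ → E} {l h : ℕ} {p q : E} {a b δ : ℝ} {σ : ℕ → ℝ}
    (H : IsMatching z l h p q a b δ σ) {i : ℕ} (hl : l ≤ i) (hh : i ≤ h) : σ i ∈ Icc a b := by
  obtain ⟨h₁, h₂, h₃, -⟩ := H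
  exact ⟨h₁ ▸ h₃ ⟨le_rfl, hl.trans hh⟩ ⟨hl, hh⟩ hl,
    h₂ ▸ h₃ ⟨hl, hh⟩ ⟨hl.trans hh, le_rfl⟩ hh⟩

theorem IsMatching.first {z : ℕ → E} {l h : ℕ} {p q : E} {δ : ℝ} {σ : ℕ → ℝ}
    (H : IsMatching z l h p q 0 1 δ σ) (hlh : l ≤ h) : dist (z l) p ≤ δ := by
  have := H.2.2.2 l ⟨le_rfl, hlh⟩
  rwa [H.1, AffineMap.lineMap_apply_zero] at this

theorem IsMatching.last {z : ℕ → E} {l h : ℕ} {p q : E} {δ : ℝ} {σ : ℕ → ℝ}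
    (H : IsMatching z l h p q 0 1 δ σ) (hlh : l ≤ h) : dist (z h) q ≤ δ := by
  have := H.2.2.2 h ⟨hlh, le_rfl⟩
  rwa [H.2.1, AffineMap.lineMap_apply_one] at this

theorem IsMatching.restrict {z : ℕ → E} {l h : ℕ} {p q : E} {a b δ : ℝ} {σ : ℕ → ℝ}
    (H : IsMatching z l h p q a b δ σ) {i k : ℕ} (hl : l ≤ i) (hh : k ≤ h) :
    IsMatching z i k p q (σ i) (σ k) δ σ :=
  ⟨rfl, rfl, H.2.2.1.mono (Icc_subset_Icc hl hh), fun m hm =>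
    H.2.2.2 m ⟨hl.trans hm.1, hm.2.trans hh⟩⟩

theorem ScanInv.start {z : ℕ → E} {l h : ℕ} {p q : E} {D : ℝ} (hlh : l ≤ h)
    (hD : D = max (dist (z l) p) (dist (z h) q)) : ScanInv z l h p q l 0 0 D 0 := by
  have h₁ : dist (z l) p ≤ D := hD ▸ le_max_left _ _
  have h₂ : dist (z h) q ≤ D := hD ▸ le_max_right _ _
  refine ⟨by simp, ⟨le_rfl, dist_nonneg.trans h₁, le_rfl⟩, h₂, by simpa using h₁,
    .refl (by simpa using h₁), fun δ σ H => ?_⟩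
  have hδ := H.nonneg hlh
  refine ⟨hD ▸ max_le (H.first hlh) (H.last hlh), by linarith, by linarith, ?_⟩
  rw [H.1]; linarith

/-- Upper bound: `z k` is matched at the running maximum, which is within `D` of it up to the
backward distance `B`; the shortcut adds `R`. Lower bound: in a matching at `δ`, earlier projections
are at most `δ` ahead of `σ i`, the new one is at most `δ` behind `σ k`, and `σ` is monotone. So
projections run backwards by at most `2 * δ`. -/
theorem ScanInv.step {z : ℕ → E} {l h : ℕ} {p q : E} {i k : ℕ} {M B D R t r : ℝ}
    (H : ScanInv z l h p q i M B D R) (hli : l ≤ i) (hik : i < k) (hkh : k ≤ h)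
    (ht : t = projParam p q (z k)) (hr : Traverse z i k (z i) (z k) 0 1 r)
    (hr' : ∀ p' q' δ, Traverse z i k p' q' 0 1 δ → r ≤ 6 * δ) :
    ScanInv z l h p q k (max M t) (max B ((max M t - t) * dist p q))
      (max D (dist (z k) (AffineMap.lineMap p q t))) (max R r) := by
  have hℓ : 0 ≤ dist p q := dist_nonneg
  have htm : t ∈ Icc (0 : ℝ) 1 := ht ▸ projParam_mem p q _
  have near : dist (z k) (AffineMap.lineMap p q (max M t)) ≤
      max D (dist (z k) (AffineMap.lineMap p q t)) + max B ((max M t - t) * dist p q) := by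
    refine (dist_triangle _ (AffineMap.lineMap p q t) _).trans
      (add_le_add (le_max_right _ _) ?_)
    rw [dist_lineMap_lineMap_of_le p q (le_max_right _ _)]
    exact le_max_right _ _
  refine ⟨⟨H.mem.1.trans (le_max_left _ _), max_le H.mem.2 htm.2⟩,
    ⟨H.nonneg.1.trans (le_max_left _ _), H.nonneg.2.1.trans (le_max_left _ _),
      H.nonneg.2.2.trans (le_max_left _ _)⟩, H.last.trans (le_max_left _ _), near, ?_, ?_⟩
  · refine Traverse.trans hli hik.le (H.upper.mono ?_) (.of_subsegment (le_max_left _ _) ?_)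
    · gcongr <;> exact le_max_left _ _
    · refine (hr.move hik.le (e := max D (dist (z k) (AffineMap.lineMap p q t)) +
        max B ((max M t - t) * dist p q)) (H.near.trans ?_) near).mono ?_
      · gcongr <;> exact le_max_left _ _
      · linarith [le_max_right R r]
  · intro δ σ hσ
    obtain ⟨h₁, h₂, h₃, h₄⟩ := H.lower δ σ hσ
    have hk := hσ.mem (hli.trans hik.le) hkh
    have hd := hσ.2.2.2 k ⟨hli.trans hik.le, hkh⟩
    have hproj := (abs_projParam_sub_mul_le p q (z k) hk).trans hd
    have hmono := hσ.2.2.1 ⟨hli, by omega⟩ ⟨hli.trans hik.le, hkh⟩ hik.le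
    rw [← ht] at hproj
    have a₁ : (t - σ k) * dist p q ≤ δ :=
      (mul_le_mul_of_nonneg_right (le_abs_self _) hℓ).trans hproj
    have a₂ : (σ k - t) * dist p q ≤ δ := by
      refine (mul_le_mul_of_nonneg_right ?_ hℓ).trans hproj
      rw [abs_sub_comm]; exact le_abs_self _
    have a₃ : σ i * dist p q ≤ σ k * dist p q := mul_le_mul_of_nonneg_right hmono hℓ
    have a₄ : max M t * dist p q ≤ σ k * dist p q + δ := by
      rw [max_mul_of_nonneg _ _ hℓ]
      exact max_le (by linarith) (by linarith)
    refine ⟨max_le h₁ ((ht ▸ dist_projParam_le p q (z k) hk).trans hd), max_le h₂ ?_,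
      max_le h₃ ?_, a₄⟩
    · linarith
    · exact hr' _ _ _ (Traverse.to_subsegment hik ⟨σ, hσ.restrict hli hkh⟩)

/-- The last vertex is not scanned: it has to be matched with `q`, and its distance from `q` is
included in `D` from the start. -/
theorem ScanInv.finish {z : ℕ → E} {l i : ℕ} {p q : E} {M B D R : ℝ}
    (H : ScanInv z l (i + 1) p q i M B D R) (hli : l ≤ i) :
    Traverse z l (i + 1) p q 0 1 (D + B + R) := by
  obtain ⟨h₁, h₂, h₃⟩ := H.nonneg
  refine Traverse.trans hli (Nat.le_succ i) H.upper (Traverse.step H.mem.2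
    (H.near.trans (by linarith)) ?_)
  rw [AffineMap.lineMap_apply_one]
  linarith [H.last]

theorem traverse_edge (z : ℕ → E) (i : ℕ) : Traverse z i (i + 1) (z i) (z (i + 1)) 0 1 0 :=
  .step zero_le_one (by simp) (by simp)

theorem Traverse.nonneg {z : ℕ → E} {l h : ℕ} {p q : E} {a b δ : ℝ}
    (H : Traverse z l h p q a b δ) (hlh : l ≤ h) : 0 ≤ δ := by
  obtain ⟨σ, hσ⟩ := H
  exact hσ.nonneg hlh

/-- The result of the pass along the chord of a curve bounds the distance of the curve from any
other segment from below. -/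
theorem ScanInv.le_of_traverse {z : ℕ → E} {l h : ℕ} {i : ℕ} {M B D R : ℝ}
    (H : ScanInv z l h (z l) (z h) i M B D R) (hlh : l ≤ h) {p q : E} {δ : ℝ}
    (hT : Traverse z l h p q 0 1 δ) : D + B ≤ 6 * δ := by
  obtain ⟨σ, hσ⟩ := hT
  have h₁ := hσ.first hlh
  have h₂ := hσ.last hlh
  rw [dist_comm] at h₁ h₂
  -- Moving `p` and `q` to the ends of the chord gives a matching with the chord at `2 * δ`. Then `D
  -- ≤ 2 * δ` and `B ≤ 4 * δ`, which explains the factor 6.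
  obtain ⟨τ, hτ⟩ := Traverse.move hlh ⟨σ, hσ⟩ h₁ h₂
  obtain ⟨a, b, -⟩ := H.lower _ τ hτ
  linarith

/-! ### The exact greedy decision procedure -/

/-- The smallest parameter that is at least `s` of a point of the line through `p` and `q` within
distance `δ` of `z`, if there is one. -/
def reach (p q z : E) (δ s : ℝ) : ℝ :=
  if 0 < inner ℝ (q - p) (q - p) then
    if (inner ℝ (z - p) (q - p)) ^ 2 - inner ℝ (q - p) (q - p) *
        (inner ℝ (z - p) (z - p) - δ ^ 2) < 0 then s
    else max s ((inner ℝ (z - p) (q - p) - Real.sqrt ((inner ℝ (z - p) (q - p)) ^ 2 -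
      inner ℝ (q - p) (q - p) * (inner ℝ (z - p) (z - p) - δ ^ 2))) / inner ℝ (q - p) (q - p))
  else s

theorem le_reach (p q z : E) (δ s : ℝ) : s ≤ reach p q z δ s := by
  unfold reach
  split_ifs
  · exact le_rfl
  · exact le_max_left _ _
  · exact le_rfl

/-- The parameters within `δ` of `z` form an interval. If some `t ≥ s` lies in it, so does the
larger one of `s` and its left end, which is given by the quadratic formula. -/
theorem reach_spec {p q z : E} {δ s t : ℝ} (hst : s ≤ t)
    (ht : dist z (AffineMap.lineMap p q t) ≤ δ) :
    reach p q z δ s ≤ t ∧ dist z (AffineMap.lineMap p q (reach p q z δ s)) ≤ δ := by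
  have hδ : 0 ≤ δ := dist_nonneg.trans ht
  have key : ∀ x, dist z (AffineMap.lineMap p q x) ≤ δ ↔ inner ℝ (q - p) (q - p) * x ^ 2
      - 2 * inner ℝ (z - p) (q - p) * x + inner ℝ (z - p) (z - p) ≤ δ ^ 2 := fun x => by
    rw [← dist_lineMap_sq, sq_le_sq₀ dist_nonneg hδ]
  unfold reach
  split_ifs with h₁ h₂
  -- A negative discriminant is incompatible with the feasible parameter `t`.
  · rw [key] at ht
    nlinarith [sq_nonneg (inner ℝ (q - p) (q - p) * t - inner ℝ (z - p) (q - p))]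
  · rw [key] at ht ⊢
    generalize inner ℝ (q - p) (q - p) = L at *
    generalize inner ℝ (z - p) (q - p) = b at *
    generalize inner ℝ (z - p) (z - p) = c at *
    have hr := Real.sq_sqrt (not_lt.1 h₂)
    have hr0 := Real.sqrt_nonneg (b ^ 2 - L * (c - δ ^ 2))
    generalize Real.sqrt (b ^ 2 - L * (c - δ ^ 2)) = w at *
    have hsq : ∀ x, L * x ^ 2 - 2 * b * x + c ≤ δ ^ 2 ↔ |L * x - b| ≤ w := fun x => by
      rw [← abs_of_nonneg hr0, ← sq_le_sq]
      constructor
      · intro h; nlinarith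
      · intro h; nlinarith
    rw [hsq, abs_le] at ht ⊢
    have hle : max s ((b - w) / L) ≤ t := max_le hst ((div_le_iff₀ h₁).2 (by nlinarith [ht.1]))
    refine ⟨hle, ?_, ?_⟩
    · have : (b - w) / L ≤ max s ((b - w) / L) := le_max_right _ _
      rw [div_le_iff₀ h₁] at this
      linarith
    · nlinarith [ht.2]
  · obtain rfl := eq_of_not_pos_inner h₁
    simpa using And.intro hst ht

/-- The state of the greedy matching of `z l, …, z i` with the segment from `p` to `q`. -/
structure GreedyInv (z : ℕ → E) (l h : ℕ) (p q : E) (δ : ℝ) (i : ℕ) (s : ℝ) : Prop where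
  mem : s ∈ Icc (0 : ℝ) 1
  last : dist (z h) q ≤ δ
  upper : Traverse z l i p q 0 s δ
  lower : ∀ σ, IsMatching z l h p q 0 1 δ σ → s ≤ σ i

theorem GreedyInv.start {z : ℕ → E} {l h : ℕ} {p q : E} {δ : ℝ} (h₁ : dist (z l) p ≤ δ)
    (h₂ : dist (z h) q ≤ δ) : GreedyInv z l h p q δ l 0 :=
  ⟨by simp, h₂, .refl (by simpa using h₁), fun _ hσ => hσ.1.ge⟩

theorem Traverse.last_dist {z : ℕ → E} {l h : ℕ} {p q : E} {a b δ : ℝ}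
    (H : Traverse z l h p q a b δ) (hlh : l ≤ h) : dist (z h) (AffineMap.lineMap p q b) ≤ δ := by
  obtain ⟨σ, h₁, h₂, h₃, h₄⟩ := H
  have := h₄ h ⟨hlh, le_rfl⟩
  rwa [h₂] at this

/-- Taking the smallest feasible parameter keeps the greedy matching at or behind every other
matching, so it loses nothing. Hence a failure, in `GreedyInv.fail`, excludes all matchings. -/
theorem GreedyInv.step {z : ℕ → E} {l h : ℕ} {p q : E} {δ : ℝ} {i : ℕ} {s : ℝ}
    (H : GreedyInv z l h p q δ i s) (hli : l ≤ i) (hih : i < h)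
    (h₁ : reach p q (z (i + 1)) δ s ≤ 1)
    (h₂ : dist (z (i + 1)) (AffineMap.lineMap p q (reach p q (z (i + 1)) δ s)) ≤ δ) :
    GreedyInv z l h p q δ (i + 1) (reach p q (z (i + 1)) δ s) := by
  refine ⟨⟨H.mem.1.trans (le_reach _ _ _ _ _), h₁⟩, H.last, ?_, fun σ hσ => ?_⟩
  · exact Traverse.trans hli (Nat.le_succ i) H.upper
      (.step (le_reach _ _ _ _ _) (H.upper.last_dist hli) h₂)
  · refine (reach_spec ((H.lower σ hσ).trans ?_) (hσ.2.2.2 (i + 1) ⟨by omega, hih⟩)).1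
    exact hσ.2.2.1 ⟨hli, hih.le⟩ ⟨by omega, hih⟩ (Nat.le_succ i)

theorem GreedyInv.fail {z : ℕ → E} {l h : ℕ} {p q : E} {δ : ℝ} {i : ℕ} {s : ℝ}
    (H : GreedyInv z l h p q δ i s) (hli : l ≤ i) (hih : i < h)
    (h₁ : 1 < reach p q (z (i + 1)) δ s ∨
      δ < dist (z (i + 1)) (AffineMap.lineMap p q (reach p q (z (i + 1)) δ s))) :
    ¬ Traverse z l h p q 0 1 δ := by
  rintro ⟨σ, hσ⟩
  have := reach_spec ((H.lower σ hσ).trans (hσ.2.2.1 ⟨hli, hih.le⟩ ⟨by omega, hih⟩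
    (Nat.le_succ i))) (hσ.2.2.2 (i + 1) ⟨by omega, hih⟩)
  rcases h₁ with h₁ | h₁
  · linarith [this.1, (hσ.mem (show l ≤ i + 1 by omega) hih).2]
  · linarith [this.2]

theorem GreedyInv.finish {z : ℕ → E} {l i : ℕ} {p q : E} {δ s : ℝ}
    (H : GreedyInv z l (i + 1) p q δ i s) (hli : l ≤ i) : Traverse z l (i + 1) p q 0 1 δ := by
  refine Traverse.trans hli (Nat.le_succ i) H.upper (.step H.mem.2 (H.upper.last_dist hli) ?_)
  rw [AffineMap.lineMap_apply_one]
  exact H.last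

/-! ### The approximate greedy decision procedure -/

/-- The candidates for the next parameter in the approximate greedy matching. -/
def candidate (st base : ℝ) (a : ℕ) : ℝ := min 1 (base + a * st)

theorem candidate_mono {st base : ℝ} (hst : 0 ≤ st) {a b : ℕ} (hab : a ≤ b) :
    candidate st base a ≤ candidate st base b := by
  unfold candidate
  gcongr

/-- The state of the approximate greedy matching of `z l, …, z i`, for the threshold `δ` with
tolerance `α`; the result of the matching is within `β` of `δ`. -/
structure ApproxInv (z : ℕ → E) (l h : ℕ) (p q : E) (δ α β : ℝ) (i : ℕ) (s : ℝ) : Prop where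
  mem : s ∈ Icc (0 : ℝ) 1
  near : dist (z i) (AffineMap.lineMap p q s) ≤ δ + α
  upper : Traverse z l i p q 0 s (δ + β)
  lower : ∀ σ, IsMatching z l h p q 0 1 δ σ → s ≤ σ i

theorem ApproxInv.start {z : ℕ → E} {l h : ℕ} {p q : E} {δ α β : ℝ} (hα : 0 ≤ α) (hβ : 0 ≤ β)
    (h₁ : dist (z l) p ≤ δ) : ApproxInv z l h p q δ α β l 0 :=
  ⟨by simp, by rw [AffineMap.lineMap_apply_zero]; linarith,
    .refl (by rw [AffineMap.lineMap_apply_zero]; linarith), fun _ hσ => hσ.1.ge⟩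

/-- A rule that accepts or rejects parameters for the end of a piece of the curve. -/
structure AcceptRule (z : ℕ → E) (p q : E) (δ α β : ℝ) (i k : ℕ) (s : ℝ) (acc : ℝ → Prop) :
    Prop where
  near : ∀ c, acc c → dist (z k) (AffineMap.lineMap p q c) ≤ δ + α
  sound : ∀ c, acc c → s ≤ c → Traverse z i k p q s c (δ + β)
  complete : ∀ c, s ≤ c → dist (z k) (AffineMap.lineMap p q c) ≤ δ + α →
    Traverse z i k p q s c (δ + α) → acc c

/-- Let `σ` be a matching at `δ`. The largest candidate below `σ k` misses it by less than one step,
that is, by at most `α` along the segment. Cutting `σ` off at this candidate gives a matching of the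
piece at `δ + α` that starts at the current parameter `s`. By completeness the rule accepts it. -/
theorem ApproxInv.exists_candidate {z : ℕ → E} {l h : ℕ} {p q : E} {δ α β A : ℝ} {i k N : ℕ}
    {s st : ℝ} {acc : ℝ → Prop} (H : ApproxInv z l h p q δ α β i s)
    (hacc : AcceptRule z p q δ α β i k s acc)
    (hst : 0 < st) (hst' : st * dist p q ≤ α) (hN : 0 < N)
    (hA : dist p q = 0 ∧ st = 1 ∨ A ≤ N * st * dist p q ∧ 0 < dist p q) (hδ : δ ≤ 10 * A)
    (hli : l ≤ i) (hik : i < k) (hkh : k ≤ h) {σ : ℕ → ℝ}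
    (hσ : IsMatching z l h p q 0 1 δ σ) :
    ∃ a < 21 * N + 1,
      acc (candidate st (max s (projParam p q (z k) - 11 * N * st)) a) ∧
      candidate st (max s (projParam p q (z k) - 11 * N * st)) a ≤ σ k := by
  have hk := hσ.mem (hli.trans hik.le) hkh
  have hd := hσ.2.2.2 k ⟨hli.trans hik.le, hkh⟩
  have hproj := (abs_projParam_sub_mul_le p q (z k) hk).trans hd
  have htm := projParam_mem p q (z k)
  set t := projParam p q (z k)
  have hℓ : 0 ≤ dist p q := dist_nonneg
  have hs := H.lower σ hσ
  have hmono := hσ.2.2.1 ⟨hli, by omega⟩ ⟨hli.trans hik.le, hkh⟩ hik.le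
  have hN' : (1 : ℝ) ≤ N := by exact_mod_cast hN
  -- Along the segment the difference is at most `δ ≤ 10 * A`, and `A` is at most the length of `N`
  -- steps. On a degenerate segment the step is 1, and parameters in the unit interval differ by at
  -- most 1.
  have bound : |t - σ k| ≤ 10 * N * st := by
    rcases hA with ⟨h₀, rfl⟩ | ⟨h₁, h₂⟩
    · rw [abs_le]; constructor <;> linarith [hk.1, hk.2, htm.1, htm.2]
    · refine le_of_mul_le_mul_right ?_ h₂
      calc _ ≤ δ := hproj
        _ ≤ 10 * A := hδ
        _ ≤ 10 * (N * st * dist p q) := by linarith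
        _ = _ := by ring
  obtain ⟨b₁, b₂⟩ := abs_le.1 bound
  have hbase : max s (t - 11 * N * st) ≤ σ k :=
    max_le (hs.trans hmono) (by nlinarith [mul_pos (show (0 : ℝ) < N by linarith) hst])
  have hbase' := le_max_right s (t - 11 * N * st)
  have hbase'' := le_max_left s (t - 11 * N * st)
  set base := max s (t - 11 * N * st)
  have h0 : 0 ≤ (σ k - base) / st := div_nonneg (by linarith) hst.le
  set a := ⌊(σ k - base) / st⌋₊ with ha
  have f₁ : a * st ≤ σ k - base := (le_div_iff₀ hst).1 (Nat.floor_le h0)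
  have f₂ : σ k - base < (a + 1) * st := (div_lt_iff₀ hst).1 (Nat.lt_floor_add_one _)
  have hc : candidate st base a = base + a * st := min_eq_right (by linarith [hk.2])
  have ha' : a < 21 * N + 1 := by
    -- The candidates start at least at `11 * N` steps before the projection, and `σ k` is at most
    -- `10 * N` steps after it; hence 21.
    refine Nat.lt_succ_of_le (Nat.floor_le_of_le ?_)
    rw [div_le_iff₀ hst]
    push_cast
    linarith
  have hsc : s ≤ base + a * st := by
    have : 0 ≤ (a : ℝ) * st := by positivity
    linarith
  have hclose : ∀ x, base + a * st ≤ x → x ≤ σ k →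
      dist (AffineMap.lineMap p q x : E) (AffineMap.lineMap p q (base + a * st)) ≤ α := by
    intro x hx hx'
    rw [dist_comm, dist_lineMap_lineMap_of_le p q hx]
    refine le_trans (mul_le_mul_of_nonneg_right ?_ hℓ) hst'
    linarith
  refine ⟨a, ha', ?_, by rw [hc]; linarith⟩
  rw [hc]
  refine hacc.complete _ hsc ?_ ?_
  · exact (dist_triangle _ _ _).trans (add_le_add hd (hclose _ (by linarith) le_rfl))
  -- The cut-off matching. Its first index is sent to `s`, which does not exceed `σ i`, and `H.near`
  -- bounds the distance there.
  · refine ⟨fun m => if m ≤ i then s else min (σ m) (base + a * st), by simp, ?_, ?_, ?_⟩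
    · simp only [not_le.2 hik, if_false]
      exact min_eq_right (by linarith)
    · intro m hm m' hm' hmm
      have e₁ := hσ.2.2.1 ⟨hli, by omega⟩ ⟨hli.trans hm'.1, hm'.2.trans hkh⟩ hm'.1
      have e₂ := hσ.2.2.1 ⟨hli.trans hm.1, hm.2.trans hkh⟩ ⟨hli.trans hm'.1, hm'.2.trans hkh⟩ hmm
      simp only
      split_ifs
      · exact le_rfl
      · exact le_min (by linarith) hsc
      · omega
      · exact min_le_min_right _ e₂
    · intro m hm
      rcases eq_or_lt_of_le hm.1 with rfl | him
      · simpa using H.near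
      · simp only [not_le.2 him, if_false]
        have hdm := hσ.2.2.2 m ⟨hli.trans hm.1, hm.2.trans hkh⟩
        have hα : 0 ≤ α := le_trans (by positivity) hst'
        rcases le_total (σ m) (base + a * st) with hle | hle
        · rw [min_eq_left hle]; linarith
        · rw [min_eq_right hle]
          refine (dist_triangle _ _ _).trans (add_le_add hdm (hclose _ hle ?_))
          exact hσ.2.2.1 ⟨hli.trans hm.1, hm.2.trans hkh⟩ ⟨hli.trans hik.le, hkh⟩ hm.2

/-- The first accepted candidate comes no later than the one from `ApproxInv.exists_candidate`, so
by monotonicity it stays behind every matching at `δ`. -/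
theorem ApproxInv.step {z : ℕ → E} {l h : ℕ} {p q : E} {δ α β A : ℝ} {i k N : ℕ}
    {s st : ℝ} {acc : ℝ → Prop} (H : ApproxInv z l h p q δ α β i s)
    (hacc : AcceptRule z p q δ α β i k s acc)
    (hst : 0 < st) (hst' : st * dist p q ≤ α) (hN : 0 < N)
    (hA : dist p q = 0 ∧ st = 1 ∨ A ≤ N * st * dist p q ∧ 0 < dist p q) (hδ : δ ≤ 10 * A)
    (hli : l ≤ i) (hik : i < k) (hkh : k ≤ h) {a : ℕ}
    (ha : acc (candidate st (max s (projParam p q (z k) - 11 * N * st)) a))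
    (ha' : ∀ b < a, ¬ acc (candidate st (max s (projParam p q (z k) - 11 * N * st)) b)) :
    ApproxInv z l h p q δ α β k
      (candidate st (max s (projParam p q (z k) - 11 * N * st)) a) := by
  have hsc : s ≤ candidate st (max s (projParam p q (z k) - 11 * N * st)) a := by
    refine le_min H.mem.2 ?_
    have : 0 ≤ (a : ℝ) * st := by positivity
    linarith [le_max_left s (projParam p q (z k) - 11 * N * st)]
  refine ⟨⟨H.mem.1.trans hsc, min_le_left _ _⟩, hacc.near _ ha,
    Traverse.trans hli hik.le H.upper (hacc.sound _ ha hsc), fun σ hσ => ?_⟩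
  obtain ⟨b, -, hb, hb'⟩ := H.exists_candidate hacc hst hst' hN hA hδ hli hik hkh hσ
  exact (candidate_mono hst.le (not_lt.1 fun h => ha' b h hb)).trans hb'

theorem ApproxInv.finish {z : ℕ → E} {l i : ℕ} {p q : E} {δ α β s : ℝ}
    (H : ApproxInv z l (i + 1) p q δ α β i s) (hli : l ≤ i) (hβ : α ≤ β) (hα : 0 ≤ α)
    (h : dist (z (i + 1)) q ≤ δ) : Traverse z l (i + 1) p q 0 1 (δ + β) := by
  refine Traverse.trans hli (Nat.le_succ i) H.upper (.step H.mem.2 (H.near.trans (by linarith)) ?_)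
  rw [AffineMap.lineMap_apply_one]
  linarith

/-- Pieces that are close to their chords need no further information. -/
theorem AcceptRule.of_chord {z : ℕ → E} {p q : E} {δ α β r : ℝ} {i k : ℕ} {s : ℝ} (hik : i ≤ k)
    (hs : dist (z i) (AffineMap.lineMap p q s) ≤ δ + α)
    (hr : Traverse z i k (z i) (z k) 0 1 r) (hrα : r ≤ α) (hβ : 2 * α ≤ β) :
    AcceptRule z p q δ α β i k s (fun c => dist (z k) (AffineMap.lineMap p q c) ≤ δ + α) :=
  ⟨fun _ h => h, fun _ h hsc => .of_subsegment hsc ((hr.move hik hs h).mono (by linarith)),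
    fun _ _ h _ => h⟩

/-- Tabulated approximate distances of a piece from segments between grid points. -/
theorem AcceptRule.of_table {z : ℕ → E} {p q : E} {δ α β e e' : ℝ} {i k : ℕ} {s : ℝ} (hik : i < k)
    {g : E} {g' : ℝ → E} {V : ℝ → ℝ} (hg : dist g (AffineMap.lineMap p q s) ≤ e)
    (hg' : ∀ c, dist (z k) (AffineMap.lineMap p q c) ≤ δ + α →
      dist (g' c) (AffineMap.lineMap p q c) ≤ e)
    (hV : ∀ c, dist (z k) (AffineMap.lineMap p q c) ≤ δ + α →
      Traverse z i k g (g' c) 0 1 (V c) ∧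
      ∀ δ', Traverse z i k g (g' c) 0 1 δ' → V c ≤ δ' + e')
    (hβ : α + e + e' + e ≤ β) :
    AcceptRule z p q δ α β i k s (fun c => dist (z k) (AffineMap.lineMap p q c) ≤ δ + α ∧
      V c ≤ δ + α + e + e') := by
  refine ⟨fun _ h => h.1, fun c h hsc => .of_subsegment hsc ?_, fun c hsc h hT => ⟨h, ?_⟩⟩
  -- An accepted value is at most `δ + α + e + e'`; moving the grid points back to the segment costs
  -- another `e`.
  · exact ((hV c h.1).1.move hik.le hg (hg' c h.1)).mono (by linarith [h.2])
  -- Conversely, moving the ends of a matching at `δ + α` to the grid points costs `e`, and the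
  -- entry exceeds the true value by at most `e'`.
  · refine (hV c h).2 _ ((hT.to_subsegment hik).move hik.le ?_ ?_)
    · rwa [dist_comm]
    · rw [dist_comm]; exact hg' c h

end Geometry

end
noncomputable section

open Set

/-! ### Grids around a point -/

section Grid

variable {d : ℕ}

/-- A grid point is encoded by one number, with the coordinates as its digits in base `G`. -/
theorem sum_digits {G : ℕ} (f : Fin d → ℕ) (hf : ∀ k, f k < G) :
    ∑ k, f k * G ^ (k : ℕ) < G ^ d ∧ ∀ k : Fin d, (∑ k, f k * G ^ (k : ℕ)) / G ^ (k : ℕ) % G = f k := by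
  let g : Fin d → Fin G := fun k => ⟨f k, hf k⟩
  have e : ((finFunctionFinEquiv g : Fin (G ^ d)) : ℕ) = ∑ k, f k * G ^ (k : ℕ) :=
    finFunctionFinEquiv_apply g
  refine ⟨e ▸ (finFunctionFinEquiv g).2, fun k => ?_⟩
  have := congrArg (fun h : Fin d → Fin G => (h k : ℕ)) (finFunctionFinEquiv.symm_apply_apply g)
  rw [← e]
  exact this

/-- The grid point with index `i` around `x`, at scale `ρ`. -/
def gridPt (x : EuclideanSpace ℝ (Fin d)) (ρ : ℝ) (N G i : ℕ) : EuclideanSpace ℝ (Fin d) :=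
  WithLp.toLp 2 fun k => x k + ρ * (((i / G ^ (k : ℕ) % G : ℕ) : ℝ) / N - 11)

/-- The index of a grid point near `P`. -/
def gridIdx (x : EuclideanSpace ℝ (Fin d)) (ρ : ℝ) (N G : ℕ) (P : EuclideanSpace ℝ (Fin d)) : ℕ :=
  ∑ k, ⌊((P k - x k) / ρ + 11) * N⌋₊ * G ^ (k : ℕ)

/-- The crude estimate `d ≤ d ^ 2` replaces the factor `√d` by `d`. -/
theorem EuclideanSpace.dist_le_of_forall {x y : EuclideanSpace ℝ (Fin d)} {r : ℝ} (hr : 0 ≤ r)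
    (h : ∀ k, |x k - y k| ≤ r) : dist x y ≤ d * r := by
  rw [EuclideanSpace.dist_eq]
  refine Real.sqrt_le_iff.2 ⟨by positivity, ?_⟩
  have : ∀ k ∈ Finset.univ, dist (x.ofLp k) (y.ofLp k) ^ 2 ≤ r ^ 2 := fun k _ => by
    rw [Real.dist_eq]
    exact pow_le_pow_left₀ (abs_nonneg _) (h k) 2
  refine (Finset.sum_le_card_nsmul _ _ _ this).trans ?_
  rw [Finset.card_univ, Fintype.card_fin, nsmul_eq_mul, mul_pow]
  have : (d : ℝ) ≤ d ^ 2 := by exact_mod_cast Nat.le_self_pow two_ne_zero d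
  exact mul_le_mul_of_nonneg_right this (sq_nonneg r)

theorem EuclideanSpace.abs_sub_le_dist (x y : EuclideanSpace ℝ (Fin d)) (k : Fin d) :
    |x k - y k| ≤ dist x y := by
  rw [dist_eq_norm]
  exact PiLp.norm_apply_le (x - y) k

theorem gridCoord_mem {x P : EuclideanSpace ℝ (Fin d)} {ρ : ℝ} (hρ : 0 < ρ)
    (h : dist x P ≤ 11 * ρ) {N : ℕ} (k : Fin d) :
    0 ≤ ((P k - x k) / ρ + 11) * N ∧ ((P k - x k) / ρ + 11) * N ≤ 22 * N := by
  have := (EuclideanSpace.abs_sub_le_dist P x k).trans ((dist_comm P x).trans_le h)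
  obtain ⟨h₁, h₂⟩ := abs_le.1 this
  have a₁ : (P k - x k) / ρ ≤ 11 := (div_le_iff₀ hρ).2 h₂
  have a₂ : -11 ≤ (P k - x k) / ρ := (le_div_iff₀ hρ).2 (by linarith)
  have : (0 : ℝ) ≤ N := Nat.cast_nonneg N
  constructor
  · exact mul_nonneg (by linarith) this
  · nlinarith

/-- Each coordinate of `P` differs from that of `x` by at most `11 * ρ`, so after shifting and
scaling it lies between `0` and `22 * N`; rounding down costs `ρ / N` per coordinate. -/
theorem gridIdx_spec {x P : EuclideanSpace ℝ (Fin d)} {ρ : ℝ} (hρ : 0 < ρ)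
    (h : dist x P ≤ 11 * ρ) {N : ℕ} (hN : 0 < N) :
    gridIdx x ρ N (22 * N + 1) P < (22 * N + 1) ^ d ∧
      dist (gridPt x ρ N (22 * N + 1) (gridIdx x ρ N (22 * N + 1) P)) P ≤ d * (ρ / N) := by
  have hN' : (0 : ℝ) < N := by exact_mod_cast hN
  have hlt : ∀ k : Fin d, ⌊((P k - x k) / ρ + 11) * N⌋₊ < 22 * N + 1 := fun k =>
    Nat.lt_succ_of_le (Nat.floor_le_of_le (by push_cast; exact (gridCoord_mem hρ h k).2))
  obtain ⟨h₁, h₂⟩ := sum_digits _ hlt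
  refine ⟨h₁, EuclideanSpace.dist_le_of_forall (by positivity) fun k => ?_⟩
  have e : gridPt x ρ N (22 * N + 1) (gridIdx x ρ N (22 * N + 1) P) k
      = x k + ρ * ((⌊((P k - x k) / ρ + 11) * N⌋₊ : ℝ) / N - 11) := by
    simp only [gridPt, gridIdx, h₂ k]
  rw [e]
  have f₁ := Nat.floor_le (gridCoord_mem (N := N) hρ h k).1
  have f₂ := Nat.lt_floor_add_one (((P k - x k) / ρ + 11) * N)
  set y := (⌊((P k - x k) / ρ + 11) * N⌋₊ : ℝ)
  have e₁ : x k + ρ * (y / N - 11) - P k = ρ * (y / N - ((P k - x k) / ρ + 11)) := by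
    field_simp; ring
  have b₁ : y / N ≤ (P k - x k) / ρ + 11 := (div_le_iff₀ hN').2 f₁
  have b₂ : (P k - x k) / ρ + 11 < y / N + 1 / N := by
    rw [← add_div, lt_div_iff₀ hN']; exact f₂
  rw [e₁, abs_mul, abs_of_pos hρ, show ρ / N = ρ * (1 / N) by ring]
  refine mul_le_mul_of_nonneg_left (abs_le.2 ⟨?_, ?_⟩) hρ.le <;> linarith [one_div_pos.2 hN']

/-- Valid for every index: the tables are filled for all pairs of grid points, and the bisection
needs a feasible initial value for each of them. -/
theorem dist_gridPt_le (x : EuclideanSpace ℝ (Fin d)) {ρ : ℝ} (hρ : 0 ≤ ρ) {N : ℕ} (hN : 0 < N)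
    (i : ℕ) : dist x (gridPt x ρ N (22 * N + 1) i) ≤ d * (11 * ρ) := by
  refine EuclideanSpace.dist_le_of_forall (by positivity) fun k => ?_
  simp only [gridPt]
  have hN' : (0 : ℝ) < N := by exact_mod_cast hN
  have h := Nat.mod_lt (i / (22 * N + 1) ^ (k : ℕ)) (Nat.succ_pos (22 * N))
  set y := i / (22 * N + 1) ^ (k : ℕ) % (22 * N + 1)
  have h₁ : (y : ℝ) ≤ 22 * N := by exact_mod_cast Nat.lt_succ_iff.1 h
  have h₂ : (y : ℝ) / N ≤ 22 := (div_le_iff₀ hN').2 h₁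
  have h₃ : 0 ≤ (y : ℝ) / N := by positivity
  rw [sub_add_cancel_left, abs_neg, abs_mul, abs_of_nonneg hρ, mul_comm]
  gcongr
  rw [abs_le]
  constructor <;> linarith

end Grid

namespace RealRAM

/-! ### Derived expressions -/

variable {d : ℕ} {S W : ℕ} {s : Config}

/-- Working registers: the first `2 + 4 d` registers hold the input of a query. -/
def rv (d c : ℕ) : ℕ := 2 + 4 * d + c

@[simp] theorem rv_inj {a b : ℕ} : rv d a = rv d b ↔ a = b := by simp [rv]

@[simp] theorem rv_lt {a b : ℕ} : rv d a < rv d b ↔ a < b := by simp [rv]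

@[simp] theorem rv_le {a b : ℕ} : rv d a ≤ rv d b ↔ a ≤ b := by simp [rv]

/-- The working register `c` as an expression. -/
abbrev rg (d c : ℕ) : Expr := .reg (rv d c)

namespace Expr

/-- The larger one of two values. -/
def maxE (a b : Expr) : Expr := ite a b b a

/-- The smaller one of two values. -/
def minE (a b : Expr) : Expr := ite a b a b

/-- A power with a constant exponent. -/
def powE (e : Expr) : ℕ → Expr
  | 0 => const 1
  | k + 1 => mul (powE e k) e

/-- A sum over the coordinates. -/
def sumE (f : Fin d → Expr) : Expr := (List.ofFn f).foldr add (const 0)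

@[simp] theorem eval_maxE (a b : Expr) : (maxE a b).eval s = max (a.eval s) (b.eval s) := by
  simp only [maxE, eval]
  split_ifs with h
  · exact (max_eq_right h.le).symm
  · exact (max_eq_left (not_lt.1 h)).symm

@[simp] theorem eval_minE (a b : Expr) : (minE a b).eval s = min (a.eval s) (b.eval s) := by
  simp only [minE, eval]
  split_ifs with h
  · exact (min_eq_left h.le).symm
  · exact (min_eq_right (not_lt.1 h)).symm

@[simp] theorem ok_maxE (a b : Expr) : (maxE a b).Ok S s ↔ a.Ok S s ∧ b.Ok S s := by
  simp only [maxE, Ok]; tauto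

@[simp] theorem ok_minE (a b : Expr) : (minE a b).Ok S s ↔ a.Ok S s ∧ b.Ok S s := by
  simp only [minE, Ok]; tauto

@[simp] theorem below_maxE (a b : Expr) : (maxE a b).Below W ↔ a.Below W ∧ b.Below W := by
  simp only [maxE, Below]; tauto

@[simp] theorem below_minE (a b : Expr) : (minE a b).Below W ↔ a.Below W ∧ b.Below W := by
  simp only [minE, Below]; tauto

@[simp] theorem eval_powE (e : Expr) (k : ℕ) : (powE e k).eval s = e.eval s ^ k := by
  induction k with
  | zero => simp [powE, eval]
  | succ k ih => simp [powE, eval, ih, pow_succ]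

theorem ok_powE {e : Expr} (h : e.Ok S s) (k : ℕ) : (powE e k).Ok S s := by
  induction k with
  | zero => trivial
  | succ k ih => exact ⟨ih, h⟩

theorem below_powE {e : Expr} (h : e.Below W) (k : ℕ) : (powE e k).Below W := by
  induction k with
  | zero => trivial
  | succ k ih => exact ⟨ih, h⟩

@[simp] theorem eval_sumE (f : Fin d → Expr) : (sumE f).eval s = ∑ k, (f k).eval s := by
  have : ∀ l : List Expr, (l.foldr add (const 0)).eval s = (l.map (eval s)).sum := by
    intro l
    induction l with
    | nil => simp [eval]
    | cons a l ih => simp [eval, ih]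
  rw [sumE, this, List.map_ofFn, List.sum_ofFn]
  rfl

@[simp] theorem ok_sumE (f : Fin d → Expr) : (sumE f).Ok S s ↔ ∀ k, (f k).Ok S s := by
  have : ∀ l : List Expr, (l.foldr add (const 0)).Ok S s ↔ ∀ e ∈ l, e.Ok S s := by
    intro l
    induction l with
    | nil => simp [Ok]
    | cons a l ih => simp [Ok, ih]
  rw [sumE, this, List.forall_mem_ofFn_iff]

@[simp] theorem below_sumE (f : Fin d → Expr) : (sumE f).Below W ↔ ∀ k, (f k).Below W := by
  have : ∀ l : List Expr, (l.foldr add (const 0)).Below W ↔ ∀ e ∈ l, e.Below W := by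
    intro l
    induction l with
    | nil => simp [Below]
    | cons a l ih => simp [Below, ih]
  rw [sumE, this, List.forall_mem_ofFn_iff]

end Expr

/-- Expressions for the coordinates of a point. -/
abbrev VExpr (d : ℕ) := Fin d → Expr

namespace VExpr

open RealRAM.Expr

/-- The point with the given coordinates. -/
def eval (s : Config) (V : VExpr d) : EuclideanSpace ℝ (Fin d) :=
  WithLp.toLp 2 fun k => (V k).eval s

/-- The evaluation of the coordinates does not fault. -/
def Ok (S : ℕ) (s : Config) (V : VExpr d) : Prop := ∀ k, (V k).Ok S s

/-- All registers of the coordinates are below `W`. -/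
def Below (W : ℕ) (V : VExpr d) : Prop := ∀ k, (V k).Below W

theorem eval_apply (V : VExpr d) (k : Fin d) : V.eval s k = (V k).eval s := rfl

theorem eval_congr {V : VExpr d} {s' : Config} (h : Agree W s s') (hV : V.Below W) :
    V.eval s = V.eval s' := by
  simp only [eval, fun k => Expr.eval_congr h (V k) (hV k)]

theorem ok_congr {V : VExpr d} {s' : Config} (h : Agree W s s') (hV : V.Below W) :
    V.Ok S s ↔ V.Ok S s' :=
  forall_congr' fun k => Expr.ok_congr h (V k) (hV k)

theorem Below.mono {V : VExpr d} {W' : ℕ} (hV : V.Below W) (h : W ≤ W') : V.Below W' :=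
  fun k => Expr.Below.mono h _ (hV k)

theorem eval_setReg {V : VExpr d} (hV : V.Below W) {a : ℕ} (ha : W ≤ a) (x : ℝ) :
    V.eval (s.setReg a x) = V.eval s :=
  eval_congr (agree_setReg ha s x) hV

theorem ok_setReg {V : VExpr d} (hV : V.Below W) {a : ℕ} (ha : W ≤ a) (x : ℝ) :
    V.Ok S (s.setReg a x) ↔ V.Ok S s :=
  ok_congr (agree_setReg ha s x) hV

/-- Difference of points. -/
def sub (V U : VExpr d) : VExpr d := fun k => .sub (V k) (U k)

/-- Inner product. -/
def dot (V U : VExpr d) : Expr := sumE fun k => .mul (V k) (U k)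

/-- The point with parameter `t` on the line through `V` and `U`. -/
def lerp (V U : VExpr d) (t : Expr) : VExpr d :=
  fun k => .add (V k) (.mul t (.sub (U k) (V k)))

/-- Distance of points. -/
def distE (V U : VExpr d) : Expr := .sqrt (dot (sub V U) (sub V U))

@[simp] theorem eval_sub (V U : VExpr d) : (sub V U).eval s = V.eval s - U.eval s := by
  ext k; simp [sub, eval, Expr.eval]

@[simp] theorem eval_dot (V U : VExpr d) :
    (dot V U).eval s = inner ℝ (V.eval s) (U.eval s) := by
  simp [dot, eval, Expr.eval, PiLp.inner_apply, mul_comm]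

@[simp] theorem eval_lerp (V U : VExpr d) (t : Expr) :
    (lerp V U t).eval s = AffineMap.lineMap (V.eval s) (U.eval s) (t.eval s) := by
  ext k
  simp [lerp, eval, Expr.eval, AffineMap.lineMap_apply_module']
  ring

@[simp] theorem eval_distE (V U : VExpr d) :
    (distE V U).eval s = dist (V.eval s) (U.eval s) := by
  rw [distE, Expr.eval, eval_dot, eval_sub, real_inner_self_eq_norm_sq,
    Real.sqrt_sq (norm_nonneg _), dist_eq_norm]

theorem ok_sub {V U : VExpr d} (hV : V.Ok S s) (hU : U.Ok S s) : (sub V U).Ok S s :=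
  fun k => ⟨hV k, hU k⟩

theorem ok_dot {V U : VExpr d} (hV : V.Ok S s) (hU : U.Ok S s) : (dot V U).Ok S s :=
  (ok_sumE _).2 fun k => ⟨hV k, hU k⟩

theorem ok_lerp {V U : VExpr d} {t : Expr} (hV : V.Ok S s) (hU : U.Ok S s) (ht : t.Ok S s) :
    (lerp V U t).Ok S s :=
  fun k => ⟨hV k, ht, hU k, hV k⟩

theorem ok_distE {V U : VExpr d} (hV : V.Ok S s) (hU : U.Ok S s) : (distE V U).Ok S s :=
  ⟨ok_dot (ok_sub hV hU) (ok_sub hV hU), by rw [eval_dot]; exact real_inner_self_nonneg⟩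

theorem below_sub {V U : VExpr d} (hV : V.Below W) (hU : U.Below W) : (sub V U).Below W :=
  fun k => ⟨hV k, hU k⟩

theorem below_dot {V U : VExpr d} (hV : V.Below W) (hU : U.Below W) : (dot V U).Below W :=
  (below_sumE _).2 fun k => ⟨hV k, hU k⟩

theorem below_lerp {V U : VExpr d} {t : Expr} (hV : V.Below W) (hU : U.Below W)
    (ht : t.Below W) : (lerp V U t).Below W :=
  fun k => ⟨hV k, ht, hU k, hV k⟩

theorem below_distE {V U : VExpr d} (hV : V.Below W) (hU : U.Below W) : (distE V U).Below W :=
  below_dot (below_sub hV hU) (below_sub hV hU)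

/-- The projection parameter of a point on a segment. -/
def projE (p q z : VExpr d) : Expr :=
  .ite (.const 0) (dot (sub q p) (sub q p))
    (maxE (.const 0) (minE (.const 1)
      (.div (dot (sub z p) (sub q p)) (dot (sub q p) (sub q p)))))
    (.const 0)

@[simp] theorem eval_projE (p q z : VExpr d) :
    (projE p q z).eval s = projParam (p.eval s) (q.eval s) (z.eval s) := by
  simp [projE, projParam, Expr.eval]

theorem ok_projE {p q z : VExpr d} (hp : p.Ok S s) (hq : q.Ok S s) (hz : z.Ok S s) :
    (projE p q z).Ok S s := by
  have h := ok_dot (ok_sub hq hp) (ok_sub hq hp)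
  refine ⟨trivial, h, fun hlt => ?_, fun _ => trivial⟩
  rw [ok_maxE, ok_minE]
  refine ⟨trivial, trivial, ok_dot (ok_sub hz hp) (ok_sub hq hp), h, ?_⟩
  simp only [Expr.eval, Rat.cast_zero] at hlt
  exact hlt.ne'

theorem below_projE {p q z : VExpr d} (hp : p.Below W) (hq : q.Below W) (hz : z.Below W) :
    (projE p q z).Below W := by
  have h := below_dot (below_sub hq hp) (below_sub hq hp)
  refine ⟨trivial, h, ?_, trivial⟩
  rw [below_maxE, below_minE]
  exact ⟨trivial, trivial, below_dot (below_sub hz hp) (below_sub hq hp), h⟩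

/-- The discriminant in the computation of `reach`. -/
def discE (p q z : VExpr d) (δ : Expr) : Expr :=
  .sub (powE (dot (sub z p) (sub q p)) 2) (.mul (dot (sub q p) (sub q p))
    (.sub (dot (sub z p) (sub z p)) (powE δ 2)))

/-- The next parameter in the exact greedy matching. -/
def reachE (p q z : VExpr d) (δ t : Expr) : Expr :=
  .ite (.const 0) (dot (sub q p) (sub q p))
    (.ite (discE p q z δ) (.const 0) t
      (maxE t (.div (.sub (dot (sub z p) (sub q p)) (.sqrt (discE p q z δ)))
        (dot (sub q p) (sub q p)))))
    t

@[simp] theorem eval_reachE (p q z : VExpr d) (δ t : Expr) : (reachE p q z δ t).eval s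
    = reach (p.eval s) (q.eval s) (z.eval s) (δ.eval s) (t.eval s) := by
  simp [reachE, discE, reach, Expr.eval]

theorem ok_reachE {p q z : VExpr d} {δ t : Expr} (hp : p.Ok S s) (hq : q.Ok S s) (hz : z.Ok S s)
    (hδ : δ.Ok S s) (ht : t.Ok S s) : (reachE p q z δ t).Ok S s := by
  have h := ok_dot (ok_sub hq hp) (ok_sub hq hp)
  have h' := ok_dot (ok_sub hz hp) (ok_sub hq hp)
  have hd : (discE p q z δ).Ok S s :=
    ⟨ok_powE h' 2, h, ok_dot (ok_sub hz hp) (ok_sub hz hp), ok_powE hδ 2⟩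
  refine ⟨trivial, h, fun hlt => ⟨hd, trivial, fun _ => ht, fun hn => ?_⟩, fun _ => ht⟩
  rw [ok_maxE]
  simp only [Expr.eval, Rat.cast_zero] at hlt hn
  exact ⟨ht, ⟨h', hd, not_lt.1 hn⟩, h, hlt.ne'⟩

theorem below_reachE {p q z : VExpr d} {δ t : Expr} (hp : p.Below W) (hq : q.Below W)
    (hz : z.Below W) (hδ : δ.Below W) (ht : t.Below W) : (reachE p q z δ t).Below W := by
  have h := below_dot (below_sub hq hp) (below_sub hq hp)
  have h' := below_dot (below_sub hz hp) (below_sub hq hp)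
  have hd : (discE p q z δ).Below W :=
    ⟨below_powE h' 2, h, below_dot (below_sub hz hp) (below_sub hz hp), below_powE hδ 2⟩
  refine ⟨trivial, h, ⟨hd, trivial, ht, ?_⟩, ht⟩
  rw [below_maxE]
  exact ⟨ht, ⟨h', hd⟩, h⟩

/-- The vertex with the given index of a curve that is stored at `base`. -/
def vertex (d : ℕ) (base idx : Expr) : VExpr d :=
  fun k => .load (.add (.add base (.mul idx (.const d))) (.const (k : ℕ)))

theorem below_vertex {base idx : Expr} (h : base.Below W) (h' : idx.Below W) :
    (vertex d base idx).Below W :=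
  fun _ => ⟨⟨h, h', trivial⟩, trivial⟩

/-- The point `x + ρ (y / N - 11)`, where `y` are the digits of `i` in base `G`. -/
def grid (x : VExpr d) (ρ N G i : Expr) : VExpr d := fun k =>
  .add (x k) (.mul ρ (.sub (.div (.sub (.floor (.div i (powE G k)))
    (.mul G (.floor (.div i (powE G (k + 1)))))) N) (.const 11)))

theorem below_grid {x : VExpr d} {ρ N G i : Expr} (hx : x.Below W) (hρ : ρ.Below W)
    (hN : N.Below W) (hG : G.Below W) (hi : i.Below W) : (grid x ρ N G i).Below W :=
  fun k => ⟨hx k, hρ, ⟨⟨⟨hi, below_powE hG _⟩, hG, hi, below_powE hG _⟩, hN⟩, trivial⟩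

/-- The machine has no remainder; the digit `k` of `i` is computed as `⌊i / G ^ k⌋ - G * ⌊i / G ^ (k
+ 1)⌋`. -/
theorem eval_grid {x : VExpr d} {ρ N G i : Expr} {N' G' i' : ℕ} (hN : N.eval s = N')
    (hG : G.eval s = G') (hi : i.eval s = i') :
    (grid x ρ N G i).eval s = gridPt (x.eval s) (ρ.eval s) N' G' i' := by
  ext k
  have e : ∀ m : ℕ, ⌊(i' : ℝ) / (G' : ℝ) ^ m⌋₊ = i' / G' ^ m := fun m => by
    rw [← Nat.cast_pow, Nat.floor_div_eq_div]
  have e' : ((i' / G' ^ (k : ℕ) % G' : ℕ) : ℝ)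
      = (i' / G' ^ (k : ℕ) : ℕ) - G' * (i' / G' ^ ((k : ℕ) + 1) : ℕ) := by
    rw [pow_succ, ← Nat.div_div_eq_div_mul, eq_sub_iff_add_eq]
    exact_mod_cast Nat.mod_add_div _ _
  simp only [eval, grid, Expr.eval, eval_powE, hN, hG, hi, e, gridPt, e', Rat.cast_ofNat]

theorem ok_grid {x : VExpr d} {ρ N G i : Expr} {N' G' i' : ℕ} (hx : x.Ok S s) (hρ : ρ.Ok S s)
    (oN : N.Ok S s) (oG : G.Ok S s) (oi : i.Ok S s) (hN : N.eval s = N')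
    (hG : G.eval s = G') (hi : i.eval s = i') (hN0 : 0 < N') (hG0 : 0 < G') (hiS : i' < S) :
    (grid x ρ N G i).Ok S s := by
  have h : ∀ m : ℕ, (Expr.floor (.div i (powE G m))).Ok S s := fun m => by
    refine ⟨⟨oi, ok_powE oG m, ?_⟩, ?_⟩
    · rw [eval_powE, hG]; positivity
    · simp only [Expr.eval, eval_powE, hG, hi]
      refine ⟨by positivity, lt_of_le_of_lt ?_ (Nat.cast_lt.2 hiS)⟩
      refine div_le_self (Nat.cast_nonneg _) (one_le_pow₀ ?_)
      exact_mod_cast hG0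
  refine fun k => ⟨hx k, hρ, ⟨⟨h _, oG, h _⟩, oN, ?_⟩, trivial⟩
  rw [hN]
  exact_mod_cast hN0.ne'

/-- The index of a grid point near `P`. -/
def gridIndex (x : VExpr d) (ρ N G : Expr) (P : VExpr d) : Expr :=
  sumE fun k => .mul (.floor (.mul (.add (.div (.sub (P k) (x k)) ρ) (.const 11)) N)) (powE G k)

theorem below_gridIndex {x P : VExpr d} {ρ N G : Expr} (hx : x.Below W) (hρ : ρ.Below W)
    (hN : N.Below W) (hG : G.Below W) (hP : P.Below W) : (gridIndex x ρ N G P).Below W :=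
  (below_sumE _).2 fun k => ⟨⟨⟨⟨⟨hP k, hx k⟩, hρ⟩, trivial⟩, hN⟩, below_powE hG _⟩

theorem eval_gridIndex {x P : VExpr d} {ρ N G : Expr} {N' G' : ℕ} (hN : N.eval s = N')
    (hG : G.eval s = G') : (gridIndex x ρ N G P).eval s
      = gridIdx (x.eval s) (ρ.eval s) N' G' (P.eval s) := by
  simp [gridIndex, gridIdx, Expr.eval, hN, hG, eval_apply]

/-- Rounding is allowed only in `[0, S)`, so the index may be computed only for points within the
extent of the grid. -/
theorem ok_gridIndex {x P : VExpr d} {ρ N G : Expr} {N' : ℕ} (hx : x.Ok S s) (oρ : ρ.Ok S s)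
    (oN : N.Ok S s) (oG : G.Ok S s) (hP : P.Ok S s) (hN : N.eval s = N')
    (hρ : 0 < ρ.eval s) (hd : dist (x.eval s) (P.eval s) ≤ 11 * ρ.eval s) (hS : 22 * N' < S) :
    (gridIndex x ρ N G P).Ok S s := by
  refine (ok_sumE _).2 fun k => ⟨⟨⟨⟨⟨⟨hP k, hx k⟩, oρ, hρ.ne'⟩, trivial⟩, oN⟩, ?_⟩, ok_powE oG _⟩
  have := gridCoord_mem hρ hd (N := N') k
  simp only [eval_apply] at this
  simp only [Expr.eval, hN, Rat.cast_ofNat]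
  refine ⟨this.1, this.2.trans_lt ?_⟩
  exact_mod_cast hS

end VExpr

/-- The curve with vertices `z 0, …, z (n - 1)` is stored at address `b`. -/
def Holds (s : Config) (b n : ℕ) (z : ℕ → EuclideanSpace ℝ (Fin d)) : Prop :=
  ∀ i < n, ∀ k : Fin d, s.mem (b + i * d + k) = z i k

theorem VExpr.vertex_spec {z : ℕ → EuclideanSpace ℝ (Fin d)} {b n i : ℕ} {base idx : Expr}
    (h : Holds s b n z) (hb : base.eval s = b) (hi : idx.eval s = i) (hin : i < n)
    (ob : base.Ok S s) (oi : idx.Ok S s) (hS : b + n * d ≤ S) :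
    (VExpr.vertex d base idx).Ok S s ∧ (VExpr.vertex d base idx).eval s = z i := by
  have e : ∀ k : Fin d, (Expr.add (.add base (.mul idx (.const d))) (.const (k : ℕ))).eval s
      = ((b + i * d + k : ℕ) : ℝ) := fun k => by
    simp [Expr.eval, hb, hi]
  constructor
  · refine fun k => ⟨⟨⟨ob, oi, trivial⟩, trivial⟩, _, ?_, e k⟩
    have : i * d + d ≤ n * d := by rw [← Nat.succ_mul]; exact Nat.mul_le_mul_right d hin
    have := k.2
    omega
  · ext k
    rw [VExpr.eval_apply, VExpr.vertex, Expr.eval, e, Nat.floor_natCast, h i hin k]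

/-! ### Blocks for the passes over the vertices -/

open VExpr in
/-- One step of the pass that computes the constant-factor approximation: `M`, `B`, `D` are in the
registers `c`, `c + 1`, `c + 2`. -/
def scanList (c : ℕ) (p q z : VExpr d) : List (ℕ × Expr) :=
  [(rv d (c + 3), projE p q z),
    (rv d (c + 2), .maxE (rg d (c + 2)) (distE z (lerp p q (rg d (c + 3))))),
    (rv d c, .maxE (rg d c) (rg d (c + 3))),
    (rv d (c + 1), .maxE (rg d (c + 1))
      (.mul (.sub (rg d c) (rg d (c + 3))) (distE p q)))]

-- The points are evaluated again after some of the registers `c`, …, `c + 3` have been assigned,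
-- hence they may only read registers below `c`.
open VExpr in
theorem runs_scanList {c : ℕ} {p q z : VExpr d} {Q : Config → Prop} (hp : p.Below (rv d c))
    (hq : q.Below (rv d c)) (hz : z.Below (rv d c)) (op : p.Ok S s) (oq : q.Ok S s)
    (oz : z.Ok S s) (hcW : rv d (c + 4) ≤ W)
    (hQ : ∀ s' t, t = projParam (p.eval s) (q.eval s) (z.eval s) → Agree (rv d c) s' s →
      s'.reg (rv d c) = max (s.reg (rv d c)) t →
      s'.reg (rv d (c + 1)) = max (s.reg (rv d (c + 1)))
        ((max (s.reg (rv d c)) t - t) * dist (p.eval s) (q.eval s)) →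
      s'.reg (rv d (c + 2)) = max (s.reg (rv d (c + 2)))
        (dist (z.eval s) (AffineMap.lineMap (p.eval s) (q.eval s) t)) → Q s') :
    Runs S W (assigns W (scanList c p q z)) s (costList (scanList c p q z)) Q := by
  have hW : rv d c ≤ W := le_trans (by simp) hcW
  have hr : ∀ j < 4, rv d (c + j) < W := fun j hj => lt_of_lt_of_le (by simpa using hj) hcW
  refine Runs.assigns ?_ ?_ (hQ _ _ rfl ?_ ?_ ?_ ?_)
  · have hp' := hp.mono hW
    have hq' := hq.mono hW
    have hz' := hz.mono hW
    refine ⟨below_projE hp' hq' hz', ?_, ?_, ?_, trivial⟩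
    · exact (Expr.below_maxE _ _).2 ⟨hr 2 (by omega), below_distE hz'
        (below_lerp hp' hq' (hr 3 (by omega)))⟩
    · exact (Expr.below_maxE _ _).2 ⟨hr 0 (by omega), hr 3 (by omega)⟩
    · exact (Expr.below_maxE _ _).2 ⟨hr 1 (by omega), ⟨hr 0 (by omega), hr 3 (by omega)⟩,
        below_distE hp' hq'⟩
  · have h : ∀ {V : VExpr d} {s : Config} {j : ℕ} {x : ℝ}, V.Below (rv d c) → V.Ok S s →
        V.Ok S (s.setReg (rv d (c + j)) x) := fun hV hs => (ok_setReg hV (by simp) _).2 hs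
    have op₁ := h (j := 3) (x := (projE p q z).eval s) hp op
    have oq₁ := h (j := 3) (x := (projE p q z).eval s) hq oq
    have oz₁ := h (j := 3) (x := (projE p q z).eval s) hz oz
    refine ⟨ok_projE op oq oz, ?_, ?_, ?_, trivial⟩
    · exact (Expr.ok_maxE _ _).2 ⟨trivial, ok_distE oz₁ (ok_lerp op₁ oq₁ trivial)⟩
    · exact (Expr.ok_maxE _ _).2 ⟨trivial, trivial⟩
    · exact (Expr.ok_maxE _ _).2 ⟨trivial, ⟨trivial, trivial⟩, ok_distE
        (h (j := 0) hp (h hp op₁)) (h (j := 0) hq (h hq oq₁))⟩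
  · refine ⟨fun a ha => ?_, rfl⟩
    have : ∀ j, a ≠ rv d (c + j) := fun j => (ha.trans_le (by simp)).ne
    simp [scanList, evalList, Config.setReg_reg, this, ha.ne]
  · simp [scanList, evalList, Config.setReg_reg, Expr.eval]
  · simp [scanList, evalList, Config.setReg_reg, Expr.eval, eval_setReg hp, eval_setReg hq]
  · simp [scanList, evalList, Config.setReg_reg, Expr.eval, eval_setReg hp, eval_setReg hq,
      eval_setReg hz]

open VExpr in
/-- One step of the exact greedy matching: the parameter is in register `c`, and register `c + 1`
becomes `1` on a failure. -/
def greedyList (c : ℕ) (p q z : VExpr d) (δ : Expr) : List (ℕ × Expr) :=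
  [(rv d c, reachE p q z δ (rg d c)),
    (rv d (c + 1), .ite (.const 1) (rg d c) (.const 1)
      (.ite δ (distE z (lerp p q (rg d c))) (.const 1) (rg d (c + 1))))]

-- A failure sets register `c + 1` to `1`, and nothing resets it. After a failure the computation
-- continues with a meaningless parameter, but it cannot fault, since `reach` takes a root only of a
-- nonnegative discriminant.
open VExpr in
theorem runs_greedyList {c : ℕ} {p q z : VExpr d} {δ : Expr} {Q : Config → Prop}
    (hp : p.Below (rv d c)) (hq : q.Below (rv d c)) (hz : z.Below (rv d c))
    (hδ : δ.Below (rv d c)) (op : p.Ok S s) (oq : q.Ok S s) (oz : z.Ok S s) (oδ : δ.Ok S s)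
    (hcW : rv d (c + 2) ≤ W)
    (hQ : ∀ s' t, t = reach (p.eval s) (q.eval s) (z.eval s) (δ.eval s) (s.reg (rv d c)) →
      Agree (rv d c) s' s → s'.reg (rv d c) = t →
      s'.reg (rv d (c + 1)) = (if 1 < t ∨ δ.eval s <
        dist (z.eval s) (AffineMap.lineMap (p.eval s) (q.eval s) t) then 1
        else s.reg (rv d (c + 1))) → Q s') :
    Runs S W (assigns W (greedyList c p q z δ)) s (costList (greedyList c p q z δ)) Q := by
  have hW : rv d c ≤ W := le_trans (by simp) hcW
  have hr : ∀ j < 2, rv d (c + j) < W := fun j hj => lt_of_lt_of_le (by simpa using hj) hcW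
  have eδ : ∀ x, δ.eval (s.setReg (rv d c) x) = δ.eval s := fun x =>
    Expr.eval_congr (agree_setReg le_rfl _ _) _ hδ
  refine Runs.assigns ?_ ?_ (hQ _ _ rfl ?_ ?_ ?_)
  · have hp' := hp.mono hW
    have hq' := hq.mono hW
    have hz' := hz.mono hW
    have hδ' := Expr.Below.mono hW _ hδ
    exact ⟨below_reachE hp' hq' hz' hδ' (hr 0 (by omega)), ⟨trivial, hr 0 (by omega), trivial, hδ',
      below_distE hz' (below_lerp hp' hq' (hr 0 (by omega))), trivial, hr 1 (by omega)⟩, trivial⟩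
  · refine ⟨ok_reachE op oq oz oδ trivial, ⟨trivial, trivial, fun _ => trivial, fun _ => ?_⟩,
      trivial⟩
    exact ⟨(Expr.ok_congr (agree_setReg le_rfl _ _) _ hδ).2 oδ,
      ok_distE ((ok_setReg hz le_rfl _).2 oz) (ok_lerp ((ok_setReg hp le_rfl _).2 op)
        ((ok_setReg hq le_rfl _).2 oq) trivial), fun _ => trivial, fun _ => trivial⟩
  · refine ⟨fun a ha => ?_, rfl⟩
    have : a ≠ rv d (c + 1) := (ha.trans (by simp)).ne
    simp [greedyList, evalList, Config.setReg_reg, this, ha.ne]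
  · simp [greedyList, evalList, Config.setReg_reg, Expr.eval]
  · simp only [greedyList, evalList, Config.setReg_reg, Expr.eval, eval_setReg hp le_rfl,
      eval_setReg hq le_rfl, eval_setReg hz le_rfl, eδ, eval_reachE, eval_distE, eval_lerp]
    simp only [if_true, Rat.cast_one, rv_inj]
    generalize reach (p.eval s) (q.eval s) (z.eval s) (δ.eval s) (s.reg (rv d c)) = t
    by_cases h₁ : 1 < t
    · simp [h₁]
    · by_cases h₂ : δ.eval s < dist (z.eval s) (AffineMap.lineMap (p.eval s) (q.eval s) t) <;>
        simp [h₁, h₂]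

end RealRAM

end
noncomputable section

open Set

namespace RealRAM

variable {d : ℕ} {S n N J : ℕ} {s : Config} {z : ℕ → EuclideanSpace ℝ (Fin d)}

/-! ### The layout of the data structure -/

/-- The number of grid points around a vertex. -/
def gridCard (d N : ℕ) : ℕ := (22 * N + 1) ^ d

/-- The number of cells that describe one canonical piece of the curve. -/
def nodeCells (d N J : ℕ) : ℕ := 1 + (J + 1) * (gridCard d N * gridCard d N)

/-- The address of the vertices. -/
def vertexBase (d n : ℕ) : ℕ := n * d + 8

/-- The address of the descriptions of the canonical pieces. -/
def nodeBase (d n : ℕ) : ℕ := vertexBase d n + n * d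

/-- The total number of memory cells. -/
def cells (d n N J : ℕ) : ℕ := nodeBase d n + 2 * n * nodeCells d N J

/-- The address of the description of the piece from vertex `x` to vertex `x + m`. -/
def nodeAddr (d n N J x m : ℕ) : ℕ := nodeBase d n + (2 * x + m) * nodeCells d N J

/-- The first registers that are used by our programs contain the parameters of the layout. -/
structure Globals (n N J : ℕ) (d : ℕ) (s : Config) : Prop where
  vb : s.reg (rv d 0) = vertexBase d n
  nb : s.reg (rv d 1) = nodeBase d n
  hN : s.reg (rv d 2) = N
  hG : s.reg (rv d 3) = (22 * N + 1 : ℕ)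
  hJ : s.reg (rv d 4) = J
  hL : s.reg (rv d 5) = Nat.clog 2 n
  ns : s.reg (rv d 6) = nodeCells d N J
  gc : s.reg (rv d 7) = gridCard d N

theorem Globals.congr {s' : Config} (h : Globals n N J d s)
    (h' : ∀ r < rv d 8, s'.reg r = s.reg r) : Globals n N J d s' := by
  constructor <;> rw [h' _ (by simp)]
  exacts [h.vb, h.nb, h.hN, h.hG, h.hJ, h.hL, h.ns, h.gc]

/-- The value `v` approximates the distance of the piece from vertex `x` to vertex `x + m` from the
segment between the grid points that are encoded by `i`, at scale `ρ`. -/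
def EntryOK (N : ℕ) (z : ℕ → EuclideanSpace ℝ (Fin d)) (x m : ℕ) (ρ : ℝ) (i : ℕ) (v : ℝ) : Prop :=
  Traverse z x (x + m) (gridPt (z x) ρ N (22 * N + 1) (i / gridCard d N))
      (gridPt (z (x + m)) ρ N (22 * N + 1) (i % gridCard d N)) 0 1 v ∧
    ∀ δ, Traverse z x (x + m) (gridPt (z x) ρ N (22 * N + 1) (i / gridCard d N))
      (gridPt (z (x + m)) ρ N (22 * N + 1) (i % gridCard d N)) 0 1 δ → v ≤ δ + ρ / N

/-- The number `R` approximates the distance of a piece of the curve from its chord. -/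
def ChordOK (z : ℕ → EuclideanSpace ℝ (Fin d)) (x m : ℕ) (R : ℝ) : Prop :=
  Traverse z x (x + m) (z x) (z (x + m)) 0 1 R ∧
    ∀ p q δ, Traverse z x (x + m) p q 0 1 δ → R ≤ 6 * δ

/-- The cells at the address `a` describe the piece from vertex `x` to vertex `x + m`. -/
def NodeOK (N J : ℕ) (z : ℕ → EuclideanSpace ℝ (Fin d)) (mem : ℕ → ℝ) (a x m : ℕ) : Prop :=
  ChordOK z x m (mem a) ∧ ∀ e < (J + 1) * (gridCard d N * gridCard d N),
    EntryOK N z x m (2 ^ (e / (gridCard d N * gridCard d N)) * mem a)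
      (e % (gridCard d N * gridCard d N)) (mem (a + 1 + e))

theorem vertexBase_le_cells : vertexBase d n + n * d ≤ cells d n N J := Nat.le_add_right _ _

/-- As `0 < m`, the slot number satisfies `2 * x + m + 1 ≤ 2 * (x + m) < 2 * n`, so `2 * n` slots
suffice. -/
theorem nodeAddr_lt {x m : ℕ} (h : x + m < n) (hm : 0 < m) {k : ℕ} (hk : k < nodeCells d N J) :
    nodeAddr d n N J x m + k < cells d n N J := by
  have : (2 * x + m + 1) * nodeCells d N J ≤ 2 * n * nodeCells d N J :=
    Nat.mul_le_mul_right _ (by omega)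
  rw [Nat.succ_mul] at this
  unfold nodeAddr cells
  omega

theorem gridCard_pos : 0 < gridCard d N := Nat.pow_pos (Nat.succ_pos _)

theorem le_nodeCells : (J + 1) * (gridCard d N * gridCard d N) < nodeCells d N J := by
  unfold nodeCells; omega

theorem nodeCells_le_cells (hn : 0 < n) : 2 * nodeCells d N J ≤ cells d n N J := by
  unfold cells
  have : 2 * 1 * nodeCells d N J ≤ 2 * n * nodeCells d N J :=
    Nat.mul_le_mul_right _ (Nat.mul_le_mul_left 2 hn)
  omega

/-- The number of working registers. -/
abbrev top (d : ℕ) : ℕ := rv d 40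

/-- The state in which the piece from vertex `x` to vertex `x + m` is processed. -/
structure PieceState (n N J : ℕ) (z : ℕ → EuclideanSpace ℝ (Fin d)) (x m : ℕ) (s : Config) :
    Prop where
  globals : Globals n N J d s
  holds : Holds s (vertexBase d n) n z
  hm : s.reg (rv d 11) = m
  hx : s.reg (rv d 12) = x
  pos : 0 < m
  lt : x + m < n

theorem PieceState.congr {x m : ℕ} {s' : Config} (h : PieceState n N J z x m s)
    (h' : Agree (rv d 13) s' s) : PieceState n N J z x m s' :=
  ⟨h.globals.congr fun r hr => h'.1 r (hr.trans (by simp)),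
    fun i hi k => by rw [h'.2]; exact h.holds i hi k,
    by rw [h'.1 _ (by simp), h.hm], by rw [h'.1 _ (by simp), h.hx], h.pos, h.lt⟩

/-- The vertex with the given index. -/
abbrev vx (d : ℕ) (e : Expr) : VExpr d := VExpr.vertex d (rg d 0) e

theorem vx_spec {i : ℕ} {e : Expr} (hg : Globals n N J d s)
    (hh : Holds s (vertexBase d n) n z) (he : e.eval s = i) (hi : i < n) (oe : e.Ok (cells d n N J) s) :
    (vx d e).Ok (cells d n N J) s ∧ (vx d e).eval s = z i :=
  VExpr.vertex_spec hh hg.vb he hi trivial oe vertexBase_le_cells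

/-- The first vertex of the current piece. -/
abbrev firstV (d : ℕ) : VExpr d := vx d (rg d 12)

/-- The last vertex of the current piece. -/
abbrev lastV (d : ℕ) : VExpr d := vx d (.add (rg d 12) (rg d 11))

/-- The vertex of the current piece that is selected by register `23`. -/
abbrev innerV (d : ℕ) : VExpr d := vx d (.add (.add (rg d 12) (rg d 23)) (.const 1))

theorem PieceState.firstV {x m : ℕ} (h : PieceState n N J z x m s) :
    (firstV d).Ok (cells d n N J) s ∧ (RealRAM.firstV d).eval s = z x :=
  vx_spec h.globals h.holds h.hx (by have := h.lt; omega) trivial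

theorem PieceState.lastV {x m : ℕ} (h : PieceState n N J z x m s) :
    (lastV d).Ok (cells d n N J) s ∧ (RealRAM.lastV d).eval s = z (x + m) :=
  vx_spec h.globals h.holds (by simp [Expr.eval, h.hx, h.hm]) h.lt ⟨trivial, trivial⟩

theorem PieceState.innerV {x m k : ℕ} (h : PieceState n N J z x m s)
    (hk : s.reg (rv d 23) = k) (hkm : k + 1 < m) :
    (innerV d).Ok (cells d n N J) s ∧ (RealRAM.innerV d).eval s = z (x + k + 1) :=
  vx_spec h.globals h.holds (by simp [Expr.eval, h.hx, hk]) (by have := h.lt; omega)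
    ⟨⟨trivial, trivial⟩, trivial⟩

theorem below_vx {e : Expr} {c : ℕ} (hc : 0 < c) (h : e.Below (rv d c)) :
    (vx d e).Below (rv d c) :=
  VExpr.below_vertex (by simpa [Expr.Below] using hc) h

/-! ### The distance of a piece from its chord -/

/-- The initial assignments of the pass along the chord. -/
def chordInit (d : ℕ) : List (ℕ × Expr) :=
  [(rv d 24, .const 0), (rv d 25, .const 0), (rv d 26, .const 0)]

/-- Compute an approximation of the distance of the current piece from its chord in register
`13`. -/
def chordProg (d : ℕ) : Program :=
  .seq (assigns (top d) (chordInit d))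
    (.seq (forLt (top d) (rv d 23) (.sub (rg d 11) (.const 1))
      (assigns (top d) (scanList 24 (firstV d) (lastV d) (innerV d))))
      (assign (top d) (rv d 13) (.add (rg d 26) (rg d 25))))

/-- The scan along the chord itself, with edges as steps and hence without shortcut error. The
result `D + B` is attained by `ScanInv.finish`, and `ScanInv.le_of_traverse` compares it with
arbitrary segments. -/
theorem runs_chordProg (d : ℕ) : ∃ K : ℕ, ∀ {n N J x m : ℕ} {z : ℕ → EuclideanSpace ℝ (Fin d)}
    {s : Config}, PieceState n N J z x m s →
    Runs (cells d n N J) (top d) (chordProg d) s (K * m)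
      (fun s' => Agree (rv d 13) s' s ∧ ChordOK z x m (s'.reg (rv d 13))) := by
  refine ⟨costList (chordInit d) +
    (costList (scanList 24 (firstV d) (lastV d) (innerV d)) +
      (Expr.sub (rg d 11) (.const 1)).cost + 8) + ((Expr.add (rg d 26) (rg d 25)).cost + 1),
    fun {n N J x m z s} H => ?_⟩
  have hm := H.pos
  refine Runs.le (T := costList (chordInit d) + ((m - 1 + 1) *
    (costList (scanList 24 (firstV d) (lastV d) (innerV d)) +
      (Expr.sub (rg d 11) (.const 1)).cost + 8) + ((Expr.add (rg d 26) (rg d 25)).cost + 1)))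
    ?key ?bound
  case key =>
    refine Runs.seq (Runs.assigns ⟨trivial, trivial, trivial, trivial⟩
      ⟨trivial, trivial, trivial, trivial⟩ (Runs.seq ?_))
    refine Runs.forLt (m := m - 1) (fun k s' => Agree (rv d 13) s' s ∧ s'.reg (rv d 23) = k ∧
      ScanInv z x (x + m) (z x) (z (x + m)) (x + k) (s'.reg (rv d 24)) (s'.reg (rv d 25))
        (s'.reg (rv d 26)) 0) (by simp) (by simp [Expr.Below]) ?_ ?_ ?_ ?_
    · refine ⟨⟨fun r hr => ?_, rfl⟩, by simp [evalList, chordInit, Config.setReg_reg], ?_⟩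
      · have : ∀ j, r ≠ rv d (13 + j) := fun j => (hr.trans_le (by simp)).ne
        simp [evalList, chordInit, Config.setReg_reg, this 10, this 11, this 12, this 13]
      · simpa [evalList, chordInit, Config.setReg_reg, Expr.eval] using
          ScanInv.start (z := z) (p := z x) (q := z (x + m)) (D := 0) (Nat.le_add_right x m)
            (by simp)
    · intro k s' h
      refine ⟨h.2.1, ⟨trivial, trivial⟩, ?_⟩
      simp [Expr.eval, h.1.1 (rv d 11) (by simp), H.hm, Nat.cast_sub hm]
    · intro k s' hk h
      have P := H.congr h.1
      have v := P.innerV h.2.1 (by omega)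
      refine runs_scanList (below_vx (by simp) (by simp [Expr.Below]))
        (below_vx (by simp) (by simp [Expr.Below])) (below_vx (by simp) (by simp [Expr.Below]))
        P.firstV.1 P.lastV.1 v.1 (by simp) fun s'' t ht hA h₁ h₂ h₃ => ?_
      have h23 : s''.reg (rv d 23) = k := by rw [hA.1 _ (by simp), h.2.1]
      rw [P.firstV.2, P.lastV.2] at ht h₂ h₃
      rw [v.2] at ht h₃
      refine ⟨h23, ⟨fun r hr => ?_, (hA.2.trans h.1.2)⟩, by simp [Config.setReg_reg], ?_⟩
      · have : r ≠ rv d 23 := (hr.trans (by simp)).ne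
        rw [Config.setReg_reg, if_neg this, hA.1 r (hr.trans (by simp)), h.1.1 r hr]
      · have := h.2.2.step (k := x + k + 1) (r := 0) (by omega) (by omega) (by omega) ht
          (traverse_edge z _) (fun p' q' δ hT => by have := hT.nonneg (by omega); linarith)
        rw [max_self] at this
        simp only [Nat.reduceAdd] at h₂ h₃
        rw [← h₂, ← h₃, ← h₁] at this
        simpa [Config.setReg_reg, ← add_assoc] using this
    · intro s' h
      refine Runs.assign (by simp [Expr.Below]) ⟨trivial, trivial⟩ ⟨⟨fun r hr => ?_, h.1.2⟩, ?_⟩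
      · rw [Config.setReg_reg, if_neg hr.ne, h.1.1 r hr]
      · have h' := h.2.2
        -- Only the `m - 1` inner vertices are scanned; the last vertex is left to `finish`.
        obtain ⟨m, rfl⟩ : ∃ m', m = m' + 1 := ⟨m - 1, by omega⟩
        simp only [Nat.add_sub_cancel] at h'
        simp only [Config.setReg_reg, if_true, Expr.eval]
        refine ⟨(h'.finish (Nat.le_add_right _ _)).mono (by linarith), fun p q δ hT => ?_⟩
        exact h'.le_of_traverse (by omega) hT
  case bound =>
    rw [Nat.sub_add_cancel hm, add_mul, add_mul, mul_comm m]
    have h₁ := Nat.le_mul_of_pos_right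
      (costList (chordInit d)) hm
    have h₂ := Nat.le_mul_of_pos_right ((Expr.add (rg d 26) (rg d 25)).cost + 1) hm
    omega

/-! ### The decision procedure -/

/-- The initial assignments of the decision procedure. -/
def decideInit (p q : VExpr d) : List (ℕ × Expr) :=
  [(rv d 24, .const 0),
    (rv d 25, .ite (rg d 22) (VExpr.distE (firstV d) p) (.const 1)
      (.ite (rg d 22) (VExpr.distE (lastV d) q) (.const 1) (.const 0)))]

/-- Decide whether the distance of the current piece from the segment from `p` to `q` is at most
the threshold in register `22`; the result `0` in register `25` means yes. -/
def decideProg (p q : VExpr d) : Program :=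
  .seq (assigns (top d) (decideInit p q))
    (forLt (top d) (rv d 23) (.sub (rg d 11) (.const 1))
      (assigns (top d) (greedyList 24 p q (innerV d) (rg d 22))))

/-- The invariant of the loop is a disjunction: either the flag is `0` and the greedy matching has
reached vertex `x + k`, or the flag is `1` and there is no matching at all. -/
theorem runs_decideProg {p q : VExpr d} (hp : p.Below (rv d 23)) (hq : q.Below (rv d 23)) :
    ∃ K : ℕ, ∀ {n N J x m : ℕ} {z : ℕ → EuclideanSpace ℝ (Fin d)} {s : Config},
      PieceState n N J z x m s → p.Ok (cells d n N J) s → q.Ok (cells d n N J) s →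
      Runs (cells d n N J) (top d) (decideProg p q) s (K * m)
        (fun s' => Agree (rv d 23) s' s ∧
          (s'.reg (rv d 25) = 0 ∧
              Traverse z x (x + m) (p.eval s) (q.eval s) 0 1 (s.reg (rv d 22)) ∨
            s'.reg (rv d 25) = 1 ∧
              ¬ Traverse z x (x + m) (p.eval s) (q.eval s) 0 1 (s.reg (rv d 22)))) := by
  refine ⟨costList (decideInit p q) + (costList (greedyList 24 p q (innerV d) (rg d 22)) +
    (Expr.sub (rg d 11) (.const 1)).cost + 8), fun {n N J x m z s} H op oq => ?_⟩
  have hm := H.pos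
  set δ := s.reg (rv d 22) with hδ
  set P := p.eval s with hP
  set Q := q.eval s with hQ
  have hp' : p.Below (top d) := hp.mono (by simp)
  have hq' : q.Below (top d) := hq.mono (by simp)
  have b₁ : (firstV d).Below (top d) := below_vx (by simp) (by simp [Expr.Below])
  have b₂ : (lastV d).Below (top d) := below_vx (by simp) (by simp [Expr.Below])
  have ag : Agree (rv d 23) (s.setReg (rv d 24) 0) s := agree_setReg (by simp) _ _
  have H' := H.congr (ag.mono (by simp))
  refine Runs.le (T := costList (decideInit p q) + (m - 1 + 1) *
    (costList (greedyList 24 p q (innerV d) (rg d 22)) +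
      (Expr.sub (rg d 11) (.const 1)).cost + 8)) ?key ?bound
  case key =>
    refine Runs.seq (Runs.assigns ?_ ?_ ?_)
    · exact ⟨trivial, ⟨by simp [Expr.Below], VExpr.below_distE b₁ hp', trivial,
        by simp [Expr.Below], VExpr.below_distE b₂ hq', trivial, trivial⟩, trivial⟩
    · refine ⟨trivial, ⟨trivial, VExpr.ok_distE ?_ ?_, fun _ => trivial, fun _ => ⟨trivial,
        VExpr.ok_distE ?_ ?_, fun _ => trivial, fun _ => trivial⟩⟩, trivial⟩
      all_goals simp only [Expr.eval, Rat.cast_zero]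
      · exact H'.firstV.1
      · exact (VExpr.ok_congr ag hp).2 op
      · exact H'.lastV.1
      · exact (VExpr.ok_congr ag hq).2 oq
    refine Runs.forLt (m := m - 1) (fun k s' => Agree (rv d 23) s' s ∧ s'.reg (rv d 23) = k ∧
      (s'.reg (rv d 25) = 0 ∧ GreedyInv z x (x + m) P Q δ (x + k) (s'.reg (rv d 24)) ∨
        s'.reg (rv d 25) = 1 ∧ ¬ Traverse z x (x + m) P Q 0 1 δ))
      (by simp) (by simp [Expr.Below]) ?_ ?_ ?_ ?_
    · refine ⟨⟨fun r hr => ?_, rfl⟩, by simp [evalList, decideInit, Config.setReg_reg], ?_⟩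
      · have : ∀ j, r ≠ rv d (23 + j) := fun j => (hr.trans_le (by simp)).ne
        simp [evalList, decideInit, Config.setReg_reg, this 0, this 1, this 2]
      · have e : (evalList (decideInit p q) s).reg (rv d 25) =
            if δ < dist (z x) P then 1 else if δ < dist (z (x + m)) Q then 1 else 0 := by
          simp [evalList, decideInit, Config.setReg_reg, Expr.eval, H'.firstV.2, H'.lastV.2,
            VExpr.eval_congr ag hp, VExpr.eval_congr ag hq, hδ, hP, hQ]
        have e' : (evalList (decideInit p q) s).reg (rv d 24) = 0 := by
          simp [evalList, decideInit, Config.setReg_reg, Expr.eval]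
        simp only [Config.setReg_reg, rv_inj, Nat.reduceEqDiff, if_false, e,
          e']
        by_cases c₁ : δ < dist (z x) P
        · refine .inr ⟨by simp [c₁], ?_⟩
          rintro ⟨σ, hσ⟩
          exact not_le.2 c₁ (hσ.first (by omega))
        · by_cases c₂ : δ < dist (z (x + m)) Q
          · refine .inr ⟨by simp [c₂], ?_⟩
            rintro ⟨σ, hσ⟩
            exact not_le.2 c₂ (hσ.last (by omega))
          · exact .inl ⟨by simp [c₁, c₂], .start (not_lt.1 c₁) (not_lt.1 c₂)⟩
    · intro k s' h
      refine ⟨h.2.1, ⟨trivial, trivial⟩, ?_⟩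
      simp [Expr.eval, h.1.1 (rv d 11) (by simp), H.hm, Nat.cast_sub hm]
    · intro k s' hk h
      have P' := H.congr (h.1.mono (by simp))
      have v := P'.innerV h.2.1 (by omega)
      refine runs_greedyList (hp.mono (by simp)) (hq.mono (by simp))
        (below_vx (by simp) (by simp [Expr.Below])) (by simp [Expr.Below])
        ((VExpr.ok_congr h.1 hp).2 op) ((VExpr.ok_congr h.1 hq).2 oq) v.1 trivial (by simp)
        fun s'' t ht hA h₁ h₂ => ?_
      have h23 : s''.reg (rv d 23) = k := by rw [hA.1 _ (by simp), h.2.1]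
      rw [VExpr.eval_congr h.1 hp, VExpr.eval_congr h.1 hq, v.2, Expr.eval,
        h.1.1 _ (by simp)] at ht h₂
      refine ⟨h23, ⟨fun r hr => ?_, (hA.2.trans h.1.2)⟩, by simp [Config.setReg_reg], ?_⟩
      · rw [Config.setReg_reg, if_neg hr.ne, hA.1 r (hr.trans (by simp)), h.1.1 r hr]
      · simp only [Config.setReg_reg, rv_inj, Nat.reduceEqDiff, if_false,
          h₁, h₂, ← add_assoc]
        rcases h.2.2 with ⟨f, g⟩ | ⟨f, g⟩
        · by_cases c : 1 < t ∨ δ < dist (z (x + k + 1)) (AffineMap.lineMap P Q t)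
          · rw [if_pos c]
            refine .inr ⟨rfl, g.fail (by omega) (by omega) ?_⟩
            rwa [← ht]
          · rw [if_neg c, f]
            rw [not_or, not_lt, not_lt] at c
            refine .inl ⟨rfl, ?_⟩
            rw [ht] at c ⊢
            exact g.step (by omega) (by omega) c.1 c.2
        · refine .inr ⟨?_, g⟩
          rw [f, ite_self]
    · intro s' h
      refine ⟨h.1, ?_⟩
      rcases h.2.2 with ⟨f, g⟩ | h'
      · obtain ⟨m, rfl⟩ : ∃ m', m = m' + 1 := ⟨m - 1, by omega⟩
        exact .inl ⟨f, GreedyInv.finish g (Nat.le_add_right _ _)⟩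
      · exact .inr h'
  case bound =>
    rw [Nat.sub_add_cancel hm, add_mul, mul_comm m]
    have h₁ := Nat.le_mul_of_pos_right (costList (decideInit p q)) hm
    omega

end RealRAM

end
noncomputable section

open Set

namespace RealRAM

variable {d : ℕ} {S n N J : ℕ} {s : Config} {z : ℕ → EuclideanSpace ℝ (Fin d)}

/-! ### The entries of the tables -/

/-- The grid point near the first vertex of the current piece. -/
abbrev gridFirst (d : ℕ) : VExpr d := VExpr.grid (firstV d) (rg d 15) (rg d 2) (rg d 3) (rg d 17)

/-- The grid point near the last vertex of the current piece. -/
abbrev gridLast (d : ℕ) : VExpr d := VExpr.grid (lastV d) (rg d 15) (rg d 2) (rg d 3) (rg d 18)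

/-- The state in which an entry of a table is computed. -/
structure EntryState (n N J : ℕ) (z : ℕ → EuclideanSpace ℝ (Fin d)) (x m : ℕ) (ρ : ℝ) (i : ℕ)
    (s : Config) : Prop where
  piece : PieceState n N J z x m s
  hρ : s.reg (rv d 15) = ρ
  h₁ : s.reg (rv d 17) = (i / gridCard d N : ℕ)
  h₂ : s.reg (rv d 18) = (i % gridCard d N : ℕ)
  lt : i < gridCard d N * gridCard d N
  pos : 0 < N

theorem EntryState.congr {x m i : ℕ} {ρ : ℝ} {s' : Config} (h : EntryState n N J z x m ρ i s)
    (h' : Agree (rv d 19) s' s) : EntryState n N J z x m ρ i s' :=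
  ⟨h.piece.congr (h'.mono (by simp)), by rw [h'.1 _ (by simp), h.hρ],
    by rw [h'.1 _ (by simp), h.h₁], by rw [h'.1 _ (by simp), h.h₂], h.lt, h.pos⟩

/-- Decoding an index rounds numbers up to this size, which must be below the number of cells. -/
theorem gridCard_le_cells (hn : 0 < n) : gridCard d N * gridCard d N < cells d n N J := by
  have h₁ := nodeCells_le_cells (d := d) (N := N) (J := J) hn
  have h₂ : 1 * (gridCard d N * gridCard d N) ≤ (J + 1) * (gridCard d N * gridCard d N) :=
    Nat.mul_le_mul_right _ (by omega)
  have h₃ := le_nodeCells (d := d) (N := N) (J := J)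
  omega

theorem EntryState.gridFirst {x m i : ℕ} {ρ : ℝ} (h : EntryState n N J z x m ρ i s) :
    (gridFirst d).Ok (cells d n N J) s ∧ (RealRAM.gridFirst d).eval s
      = gridPt (z x) ρ N (22 * N + 1) (i / gridCard d N) := by
  have hc := gridCard_le_cells (d := d) (N := N) (J := J) (n := n)
    (by have := h.piece.lt; omega)
  refine ⟨VExpr.ok_grid h.piece.firstV.1 trivial trivial trivial trivial h.piece.globals.hN
    h.piece.globals.hG h.h₁ h.pos (Nat.succ_pos _)
    ((Nat.div_le_self _ _).trans_lt (h.lt.trans hc)), ?_⟩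
  refine (VExpr.eval_grid (N := rg d 2) (G := rg d 3) (i := rg d 17)
    h.piece.globals.hN h.piece.globals.hG h.h₁).trans ?_
  rw [h.piece.firstV.2, Expr.eval, h.hρ]

theorem EntryState.gridLast {x m i : ℕ} {ρ : ℝ} (h : EntryState n N J z x m ρ i s) :
    (gridLast d).Ok (cells d n N J) s ∧ (RealRAM.gridLast d).eval s
      = gridPt (z (x + m)) ρ N (22 * N + 1) (i % gridCard d N) := by
  have hc := gridCard_le_cells (d := d) (N := N) (J := J) (n := n)
    (by have := h.piece.lt; omega)
  refine ⟨VExpr.ok_grid h.piece.lastV.1 trivial trivial trivial trivial h.piece.globals.hN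
    h.piece.globals.hG h.h₂ h.pos (Nat.succ_pos _)
    ((Nat.mod_le _ _).trans_lt (h.lt.trans hc)), ?_⟩
  refine (VExpr.eval_grid (N := rg d 2) (G := rg d 3) (i := rg d 18)
    h.piece.globals.hN h.piece.globals.hG h.h₂).trans ?_
  rw [h.piece.lastV.2, Expr.eval, h.hρ]

theorem below_gridFirst : (gridFirst d).Below (rv d 23) :=
  VExpr.below_grid (below_vx (by simp) (by simp [Expr.Below])) (by simp [Expr.Below])
    (by simp [Expr.Below]) (by simp [Expr.Below]) (by simp [Expr.Below])

theorem below_gridLast : (gridLast d).Below (rv d 23) :=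
  VExpr.below_grid (below_vx (by simp) (by simp [Expr.Below])) (by simp [Expr.Below])
    (by simp [Expr.Below]) (by simp [Expr.Below]) (by simp [Expr.Below])

/-- One step of the bisection: the bounds are in the registers `19` and `20`. -/
def bisectStep (d : ℕ) : Program :=
  .seq (assign (top d) (rv d 22) (.div (.add (rg d 19) (rg d 20)) (.const 2)))
    (.seq (decideProg (gridFirst d) (gridLast d))
      (assigns (top d) [(rv d 19, .ite (.const 0) (rg d 25) (rg d 22) (rg d 19)),
        (rv d 20, .ite (.const 0) (rg d 25) (rg d 20) (rg d 22))]))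

/-- The upper bound stays feasible and the lower bound stays below all feasible values: feasibility
is monotone in the threshold, and the decision at the midpoint is exact. -/
theorem runs_bisectStep (d : ℕ) : ∃ K : ℕ, ∀ {n N J x m : ℕ} {z : ℕ → EuclideanSpace ℝ (Fin d)}
    {s : Config} {ρ : ℝ} {i : ℕ}, EntryState n N J z x m ρ i s →
    Traverse z x (x + m) (gridPt (z x) ρ N (22 * N + 1) (i / gridCard d N))
      (gridPt (z (x + m)) ρ N (22 * N + 1) (i % gridCard d N)) 0 1 (s.reg (rv d 20)) →
    (∀ δ, Traverse z x (x + m) (gridPt (z x) ρ N (22 * N + 1) (i / gridCard d N))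
      (gridPt (z (x + m)) ρ N (22 * N + 1) (i % gridCard d N)) 0 1 δ → s.reg (rv d 19) ≤ δ) →
    Runs (cells d n N J) (top d) (bisectStep d) s (K * m)
      (fun s' => Agree (rv d 19) s' s ∧ s'.reg (rv d 21) = s.reg (rv d 21) ∧
        Traverse z x (x + m) (gridPt (z x) ρ N (22 * N + 1) (i / gridCard d N))
          (gridPt (z (x + m)) ρ N (22 * N + 1) (i % gridCard d N)) 0 1 (s'.reg (rv d 20)) ∧
        (∀ δ, Traverse z x (x + m) (gridPt (z x) ρ N (22 * N + 1) (i / gridCard d N))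
          (gridPt (z (x + m)) ρ N (22 * N + 1) (i % gridCard d N)) 0 1 δ →
            s'.reg (rv d 19) ≤ δ) ∧
        s'.reg (rv d 20) - s'.reg (rv d 19) = (s.reg (rv d 20) - s.reg (rv d 19)) / 2) := by
  obtain ⟨K, hK⟩ := runs_decideProg (below_gridFirst (d := d)) below_gridLast
  refine ⟨((Expr.div (.add (rg d 19) (rg d 20)) (.const 2)).cost + 1) + K +
    costList [(rv d 19, .ite (.const 0) (rg d 25) (rg d 22) (rg d 19)),
        (rv d 20, .ite (.const 0) (rg d 25) (rg d 20) (rg d 22))],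
    fun {n N J x m z s ρ i} H hhi hlo => ?_⟩
  set P := gridPt (z x) ρ N (22 * N + 1) (i / gridCard d N)
  set Q := gridPt (z (x + m)) ρ N (22 * N + 1) (i % gridCard d N)
  have hm := H.piece.pos
  refine Runs.le (T := ((Expr.div (.add (rg d 19) (rg d 20)) (.const 2)).cost + 1) + (K * m +
    costList [(rv d 19, .ite (.const 0) (rg d 25) (rg d 22) (rg d 19)),
        (rv d 20, .ite (.const 0) (rg d 25) (rg d 20) (rg d 22))])) ?key ?bound
  case key =>
    refine Runs.seq (Runs.assign (by simp [Expr.Below]) (by simp [Expr.Ok, Expr.eval]) ?_)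
    set s₁ := s.setReg (rv d 22) ((Expr.div (.add (rg d 19) (rg d 20)) (.const 2)).eval s) with hs₁
    have hA₁ : Agree (rv d 22) s₁ s := agree_setReg le_rfl _ _
    have r₁ : s₁.reg (rv d 22) = (s.reg (rv d 19) + s.reg (rv d 20)) / 2 := by
      simp [hs₁, Config.setReg_reg, Expr.eval]
    have H₁ := H.congr (hA₁.mono (by simp))
    refine Runs.seq ((hK H₁.piece H₁.gridFirst.1 H₁.gridLast.1).imp fun s₂ h₂ => ?_)
    rw [H₁.gridFirst.2, H₁.gridLast.2, r₁] at h₂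
    obtain ⟨hA₂, h₂⟩ := h₂
    have r₂ : s₂.reg (rv d 22) = (s.reg (rv d 19) + s.reg (rv d 20)) / 2 := by
      rw [hA₂.1 _ (by simp), r₁]
    have hA : Agree (rv d 22) s₂ s := (hA₂.mono (by simp)).trans hA₁
    refine Runs.assigns (by simp [BelowList, Expr.Below]) (by simp [OkList, Expr.Ok]) ?_
    have e₁ := hA.1 (rv d 19) (by simp)
    have e₂ := hA.1 (rv d 20) (by simp)
    have e₃ := hA.1 (rv d 21) (by simp)
    refine ⟨⟨fun r hr => ?_, hA.2⟩, ?_, ?_⟩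
    · have h19 : r ≠ rv d 19 := hr.ne
      have h20 : r ≠ rv d 20 := (hr.trans (by simp)).ne
      simp [evalList, Config.setReg_reg, h19, h20, hA.1 r (hr.trans (by simp))]
    · simp [evalList, Config.setReg_reg, e₃]
    · rcases h₂ with ⟨f, g⟩ | ⟨f, g⟩
      · simp only [evalList, Config.setReg_reg, Expr.eval, f, rv_inj, Nat.reduceEqDiff, if_false,
          if_true, Rat.cast_zero, lt_irrefl, e₁, r₂]
        exact ⟨g, hlo, by ring⟩
      · simp only [evalList, Config.setReg_reg, Expr.eval, f, rv_inj, Nat.reduceEqDiff, if_false,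
          if_true, Rat.cast_zero, zero_lt_one, e₂, r₂]
        refine ⟨hhi, fun δ hδ => ?_, by ring⟩
        by_contra! hc
        exact g (hδ.mono hc.le)
  case bound =>
    rw [add_mul, add_mul]
    have h₁ := Nat.le_mul_of_pos_right
      ((Expr.div (.add (rg d 19) (rg d 20)) (.const 2)).cost + 1) hm
    have h₂ := Nat.le_mul_of_pos_right
      (costList [(rv d 19, .ite (.const 0) (rg d 25) (rg d 22) (rg d 19)),
        (rv d 20, .ite (.const 0) (rg d 25) (rg d 20) (rg d 22))]) hm
    omega

/-- Decode the index of an entry in register `14`. -/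
def entryInit (d : ℕ) : List (ℕ × Expr) :=
  [(rv d 16, .floor (.div (rg d 14) (.mul (rg d 7) (rg d 7)))),
    (rv d 19, .sub (rg d 14) (.mul (.mul (rg d 7) (rg d 7)) (rg d 16))),
    (rv d 17, .floor (.div (rg d 19) (rg d 7))),
    (rv d 18, .sub (rg d 19) (.mul (rg d 7) (rg d 17))),
    (rv d 15, rg d 13)]

theorem natCast_sub_mul_div (a b : ℕ) : (a : ℝ) - b * (a / b : ℕ) = (a % b : ℕ) := by
  rw [sub_eq_iff_eq_add]
  exact_mod_cast (Nat.mod_add_div a b).symm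

/-- The index of an entry is a number in mixed radix: the scale, then the first and the last grid
point. Register 19 holds the remainder only temporarily, before it is used for the bisection. -/
theorem runs_entryInit {x m e : ℕ} {R : ℝ} {Q : Config → Prop} (H : PieceState n N J z x m s)
    (hN : 0 < N) (he : s.reg (rv d 14) = e) (hR : s.reg (rv d 13) = R)
    (hlt : e < (J + 1) * (gridCard d N * gridCard d N))
    (hQ : ∀ s', Agree (rv d 15) s' s →
      s'.reg (rv d 16) = (e / (gridCard d N * gridCard d N) : ℕ) →
      EntryState n N J z x m R (e % (gridCard d N * gridCard d N)) s' → Q s') :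
    Runs (cells d n N J) (top d) (assigns (top d) (entryInit d)) s (costList (entryInit d)) Q := by
  have hgc : 0 < gridCard d N := gridCard_pos
  set gc := gridCard d N with hgc_def
  have hgg : 0 < gc * gc := Nat.mul_pos hgc hgc
  have hn : 0 < n := by have := H.lt; omega
  have heS : e < cells d n N J := by
    have h₁ := nodeCells_le_cells (d := d) (N := N) (J := J) hn
    have h₃ : (J + 1) * (gc * gc) < nodeCells d N J := le_nodeCells
    omega
  have hmod := Nat.mod_lt e hgg
  have hgS : gc * gc < cells d n N J := gridCard_le_cells hn
  have hG := H.globals.gc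
  rw [← hgc_def] at hG
  have f₁ : ⌊(e : ℝ) / ((gc : ℝ) * gc)⌋₊ = e / (gc * gc) := by
    rw [← Nat.cast_mul, Nat.floor_div_eq_div]
  have f₂ : (e : ℝ) - gc * gc * (e / (gc * gc) : ℕ) = (e % (gc * gc) : ℕ) := by
    rw [← Nat.cast_mul, natCast_sub_mul_div]
  have f₃ : ⌊((e % (gc * gc) : ℕ) : ℝ) / (gc : ℝ)⌋₊ = e % (gc * gc) / gc := by
    rw [Nat.floor_div_eq_div]
  have hgc' : (1 : ℝ) ≤ gc := by exact_mod_cast hgc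
  have hgc0 : (gc : ℝ) ≠ 0 := by positivity
  refine Runs.assigns (by simp [entryInit, BelowList, Expr.Below]) ?_ ?_
  · simp only [entryInit, OkList, Expr.Ok, Expr.eval, Config.setReg_reg, rv_inj, Nat.reduceEqDiff,
      if_true, if_false, he, hG, f₁, f₂, true_and, and_true]
    refine ⟨⟨by positivity, by positivity, ?_⟩, hgc0, by positivity, ?_⟩
    · exact (div_le_self (by positivity) (by nlinarith)).trans_lt (by exact_mod_cast heS)
    · refine (div_le_self (by positivity) hgc').trans_lt ?_
      exact_mod_cast hmod.trans hgS
  · have hA : Agree (rv d 15) (evalList (entryInit d) s) s := by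
      refine ⟨fun r hr => ?_, rfl⟩
      have : ∀ j, r ≠ rv d (15 + j) := fun j => (hr.trans_le (by simp)).ne
      simp [entryInit, evalList, Config.setReg_reg, this 0, this 1, this 2, this 3, this 4]
    refine hQ _ hA ?_ ⟨H.congr (hA.mono (by simp)), ?_, ?_, ?_, hmod, hN⟩
    · simp only [entryInit, evalList, Expr.eval, Config.setReg_reg, rv_inj, Nat.reduceEqDiff,
        if_true, if_false, he, hG, f₁]
    · simp only [entryInit, evalList, Expr.eval, Config.setReg_reg, rv_inj, Nat.reduceEqDiff,
        if_true, if_false, hR]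
    · simp only [entryInit, evalList, Expr.eval, Config.setReg_reg, rv_inj, Nat.reduceEqDiff,
        if_true, if_false, he, hG, f₁, f₂, f₃, ← hgc_def]
    · simp only [entryInit, evalList, Expr.eval, Config.setReg_reg, rv_inj, Nat.reduceEqDiff,
        if_true, if_false, he, hG, f₁, f₂, f₃, ← hgc_def]
      exact natCast_sub_mul_div _ _

/-- Initialize the bisection. -/
def bisectInit (d : ℕ) : List (ℕ × Expr) :=
  [(rv d 19, .const 0), (rv d 20, .mul (.const ((1 + 11 * d : ℕ) : ℚ)) (rg d 15))]

/-- Compute the entry with the index in register `14` of the table of the current piece; the result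
is in register `20`. -/
def entryProg (d : ℕ) : Program :=
  .seq (assigns (top d) (entryInit d))
    (.seq (forLt (top d) (rv d 21) (rg d 16)
      (assign (top d) (rv d 15) (.add (rg d 15) (rg d 15))))
    (.seq (assigns (top d) (bisectInit d))
      (forLt (top d) (rv d 21) (rg d 4) (bisectStep d))))

theorem runs_entryProg (d : ℕ) (hd : 0 < d) : ∃ K : ℕ, ∀ {n N J x m : ℕ}
    {z : ℕ → EuclideanSpace ℝ (Fin d)} {s : Config} {e : ℕ}, PieceState n N J z x m s → 0 < N →
    12 * d * N ≤ 2 ^ J → s.reg (rv d 14) = e → e < (J + 1) * (gridCard d N * gridCard d N) →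
    ChordOK z x m (s.reg (rv d 13)) →
    Runs (cells d n N J) (top d) (entryProg d) s (K * ((J + 1) * m))
      (fun s' => Agree (rv d 15) s' s ∧ EntryOK N z x m
        (2 ^ (e / (gridCard d N * gridCard d N)) * s.reg (rv d 13))
        (e % (gridCard d N * gridCard d N)) (s'.reg (rv d 20))) := by
  obtain ⟨K, hK⟩ := runs_bisectStep d
  refine ⟨costList (entryInit d) + (((Expr.add (rg d 15) (rg d 15)).cost + 1) +
    (rg d 16).cost + 8) + costList (bisectInit d) + (K + (rg d 4).cost + 8),
    fun {n N J x m z s e} H hN hJ he hlt hR => ?_⟩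
  have hm := H.pos
  set gg := gridCard d N * gridCard d N with hgg
  set R := s.reg (rv d 13) with hRdef
  set ρ := 2 ^ (e / gg) * R with hρdef
  have hR0 : 0 ≤ R := hR.1.nonneg (Nat.le_add_right _ _)
  have hρ0 : 0 ≤ ρ := by positivity
  have hRρ : R ≤ ρ := by
    have : (1 : ℝ) ≤ 2 ^ (e / gg) := one_le_pow₀ (by norm_num)
    nlinarith
  have heJ : e / gg ≤ J := Nat.lt_succ_iff.1 (Nat.div_lt_of_lt_mul (by rwa [mul_comm]))
  refine Runs.le (T := costList (entryInit d) + ((e / gg + 1) *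
    (((Expr.add (rg d 15) (rg d 15)).cost + 1) + (rg d 16).cost + 8) + (costList (bisectInit d) +
      (J + 1) * (K * m + (rg d 4).cost + 8)))) ?key ?bound
  case key =>
    refine Runs.seq (runs_entryInit H hN he rfl hlt fun s₁ hA₁ h16 E₁ => Runs.seq ?_)
    -- The scale `2 ^ (e / gg) * R` is produced by repeated doubling.
    refine Runs.forLt (m := e / gg) (fun k s' => Agree (rv d 15) s' s ∧ s'.reg (rv d 21) = k ∧
      s'.reg (rv d 16) = (e / gg : ℕ) ∧ EntryState n N J z x m (2 ^ k * R) (e % gg) s')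
      (by simp) (by simp [Expr.Below]) ?_ ?_ ?_ ?_
    · refine ⟨(agree_setReg (by simp) _ _).trans hA₁, by simp [Config.setReg_reg],
        by simpa [Config.setReg_reg] using h16, ?_⟩
      rw [pow_zero, one_mul]
      exact E₁.congr (agree_setReg (by simp) _ _)
    · exact fun k s' h => ⟨h.2.1, trivial, h.2.2.1⟩
    · intro k s' hk h
      obtain ⟨hA, h21, h16, E'⟩ := h
      refine Runs.assign (by simp [Expr.Below]) ⟨trivial, trivial⟩ ?_
      refine ⟨by simpa [Config.setReg_reg] using h21, ?_, by simp [Config.setReg_reg],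
        by simpa [Config.setReg_reg] using h16, ?_⟩
      · exact ((agree_setReg (by simp) _ _).trans (agree_setReg (by simp) _ _)).trans hA
      · refine ⟨E'.piece.congr ((agree_setReg (by simp) _ _).trans (agree_setReg (by simp) _ _)),
          ?_, ?_, ?_, E'.lt, E'.pos⟩
        · simp [Config.setReg_reg, Expr.eval, E'.hρ, pow_succ]; ring
        · simpa [Config.setReg_reg] using E'.h₁
        · simpa [Config.setReg_reg] using E'.h₂
    · intro s₂ h
      obtain ⟨hA₂, -, -, E₂⟩ := h
      refine Runs.seq (Runs.assigns (by simp [bisectInit, BelowList, Expr.Below])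
        (by simp [bisectInit, OkList, Expr.Ok]) ?_)
      set P := gridPt (z x) ρ N (22 * N + 1) (e % gg / gridCard d N) with hP
      set Q := gridPt (z (x + m)) ρ N (22 * N + 1) (e % gg % gridCard d N) with hQ
      refine (Runs.forLt (m := J) (fun k s' => Agree (rv d 19) s' s₂ ∧ s'.reg (rv d 21) = k ∧
        Traverse z x (x + m) P Q 0 1 (s'.reg (rv d 20)) ∧
        (∀ δ, Traverse z x (x + m) P Q 0 1 δ → s'.reg (rv d 19) ≤ δ) ∧
        s'.reg (rv d 20) - s'.reg (rv d 19) = (1 + 11 * d) * ρ / 2 ^ k)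
        (by simp) (by simp [Expr.Below]) ?_ ?_ ?_ ?_)
      · have r₁₉ : ((evalList (bisectInit d) s₂).setReg (rv d 21) 0).reg (rv d 19) = 0 := by
          simp [evalList, bisectInit, Config.setReg_reg, Expr.eval]
        have r₂₀ : ((evalList (bisectInit d) s₂).setReg (rv d 21) 0).reg (rv d 20)
            = (1 + 11 * d) * ρ := by
          simp [evalList, bisectInit, Config.setReg_reg, Expr.eval, E₂.hρ, hρdef]
        refine ⟨⟨fun r hr => ?_, rfl⟩, by simp [Config.setReg_reg], ?_, fun δ hδ => ?_, ?_⟩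
        · have : ∀ j, r ≠ rv d (19 + j) := fun j => (hr.trans_le (by simp)).ne
          simp [evalList, bisectInit, Config.setReg_reg, this 0, this 1, this 2]
        · rw [r₂₀]
          -- The initial upper bound: the chord is at distance at most `R ≤ ρ`, and the grid points
          -- are within `11 * d * ρ` of its ends.
          refine (hR.1.move (e := d * (11 * ρ)) (Nat.le_add_right _ _) ?_ ?_).mono ?_
          · exact dist_gridPt_le _ hρ0 hN _
          · exact dist_gridPt_le _ hρ0 hN _
          · linarith
        · rw [r₁₉]; exact hδ.nonneg (Nat.le_add_right _ _)
        · rw [r₁₉, r₂₀]; simp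
      · intro k s' h
        exact ⟨h.2.1, trivial, by rw [Expr.eval, h.1.1 _ (by simp), E₂.piece.globals.hJ]⟩
      · intro k s' hk h
        obtain ⟨hA, h21, h20, h19, hdiff⟩ := h
        refine (hK (E₂.congr hA) h20 h19).imp fun s'' h'' => ?_
        obtain ⟨hA'', h21'', h20'', h19'', hdiff''⟩ := h''
        refine ⟨by rw [h21'', h21], ?_, by simp [Config.setReg_reg], ?_, ?_, ?_⟩
        · exact ((agree_setReg (by simp) _ _).trans hA'').trans hA
        · simpa [Config.setReg_reg] using h20''
        · simpa [Config.setReg_reg] using h19''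
        · simp only [Config.setReg_reg, rv_inj, Nat.reduceEqDiff, if_false, hdiff'', hdiff]
          rw [pow_succ]; field_simp
      · intro s' h
        obtain ⟨hA, -, h20, h19, hdiff⟩ := h
        refine ⟨(hA.mono (by simp)).trans hA₂, h20, fun δ hδ => ?_⟩
        have h₁ := h19 δ hδ
        -- The condition on `J` is chosen for this: `1 + 11 * d ≤ 12 * d` because `d` is positive,
        -- and `J` halvings shrink the interval to `ρ / N`.
        have h₂ : (1 + 11 * d) * ρ / 2 ^ J ≤ ρ / N := by
          have hN' : (0 : ℝ) < N := by exact_mod_cast hN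
          have hd' : (1 : ℝ) ≤ d := by exact_mod_cast hd
          have hJ' : (12 * d * N : ℝ) ≤ 2 ^ J := by exact_mod_cast hJ
          rw [div_le_div_iff₀ (by positivity) hN']
          have : (1 + 11 * (d : ℝ)) * N ≤ 2 ^ J := by nlinarith
          nlinarith
        linarith
  case bound =>
    have h1 : 1 ≤ (J + 1) * m := Nat.mul_pos (Nat.succ_pos J) hm
    have h₁ := Nat.le_mul_of_pos_right (costList (entryInit d)) h1
    have h₂ := Nat.le_mul_of_pos_right (costList (bisectInit d)) h1
    have h₃ : (e / gg + 1) * (((Expr.add (rg d 15) (rg d 15)).cost + 1) + (rg d 16).cost + 8) ≤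
        (((Expr.add (rg d 15) (rg d 15)).cost + 1) + (rg d 16).cost + 8) * ((J + 1) * m) := by
      rw [mul_comm]
      refine Nat.mul_le_mul_left _ ((Nat.succ_le_succ heJ).trans ?_)
      exact Nat.le_mul_of_pos_right _ hm
    have h₄ : (J + 1) * (K * m + (rg d 4).cost + 8) ≤ (K + (rg d 4).cost + 8) * ((J + 1) * m) := by
      have : K * m + (rg d 4).cost + 8 ≤ (K + (rg d 4).cost + 8) * m := by
        rw [add_mul, add_mul]
        have a₁ := Nat.le_mul_of_pos_right (rg d 4).cost hm
        have a₂ := Nat.le_mul_of_pos_right 8 hm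
        omega
      calc _ ≤ (J + 1) * ((K + (rg d 4).cost + 8) * m) := Nat.mul_le_mul_left _ this
        _ = _ := by ring
    exact (Nat.add_le_add h₁ (Nat.add_le_add h₃ (Nat.add_le_add h₂ h₄))).trans_eq (by ring)

/-! ### The description of a piece -/

/-- The address of the description of the current piece. -/
abbrev addrE (d : ℕ) : Expr :=
  .add (rg d 1) (.mul (.add (.mul (.const 2) (rg d 12)) (rg d 11)) (rg d 6))

/-- Compute and store the description of the current piece. -/
def nodeProg (d : ℕ) : Program :=
  .seq (chordProg d) (.seq (storeAt (top d) (addrE d) (rg d 13))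
    (forLt (top d) (rv d 14) (.mul (.add (rg d 4) (.const 1)) (.mul (rg d 7) (rg d 7)))
      (.seq (entryProg d)
        (storeAt (top d) (.add (.add (addrE d) (.const 1)) (rg d 14)) (rg d 20)))))

theorem Holds.congr {s' : Config} (h : Holds s (vertexBase d n) n z)
    (h' : ∀ a < nodeBase d n, s'.mem a = s.mem a) : Holds s' (vertexBase d n) n z := by
  intro i hi k
  rw [h' _ ?_, h i hi k]
  have : i * d + d ≤ n * d := by rw [← Nat.succ_mul]; exact Nat.mul_le_mul_right d hi
  have := k.2
  unfold nodeBase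
  omega

theorem PieceState.congr' {x m : ℕ} {s' : Config} (h : PieceState n N J z x m s)
    (h' : ∀ r < rv d 13, s'.reg r = s.reg r) (h'' : ∀ a < nodeBase d n, s'.mem a = s.mem a) :
    PieceState n N J z x m s' :=
  ⟨h.globals.congr fun r hr => h' r (hr.trans (by simp)), h.holds.congr h'',
    by rw [h' _ (by simp), h.hm], by rw [h' _ (by simp), h.hx], h.pos, h.lt⟩

theorem PieceState.addrE {x m : ℕ} (h : PieceState n N J z x m s) :
    (addrE d).eval s = nodeAddr d n N J x m := by
  simp [Expr.eval, h.globals.nb, h.globals.ns, h.hx, h.hm, nodeAddr]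

theorem nodeBase_le_nodeAddr {x m : ℕ} : nodeBase d n ≤ nodeAddr d n N J x m := Nat.le_add_right _ _

/-- The frame condition, that only the cells of this node change, protects the nodes that have been
computed before. -/
theorem runs_nodeProg (d : ℕ) (hd : 0 < d) : ∃ K : ℕ, ∀ {n N J x m : ℕ}
    {z : ℕ → EuclideanSpace ℝ (Fin d)} {s : Config}, PieceState n N J z x m s → 0 < N →
    12 * d * N ≤ 2 ^ J →
    Runs (cells d n N J) (top d) (nodeProg d) s (K * (nodeCells d N J * ((J + 1) * m)))
      (fun s' => (∀ r < rv d 13, s'.reg r = s.reg r) ∧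
        (∀ a, a < nodeAddr d n N J x m ∨ nodeAddr d n N J x m + nodeCells d N J ≤ a →
          s'.mem a = s.mem a) ∧
        NodeOK N J z s'.mem (nodeAddr d n N J x m) x m) := by
  obtain ⟨K₁, hK₁⟩ := runs_chordProg d
  obtain ⟨K₂, hK₂⟩ := runs_entryProg d hd
  set lim : Expr := .mul (.add (rg d 4) (.const 1)) (.mul (rg d 7) (rg d 7))
  set ad : Expr := .add (.add (addrE d) (.const 1)) (rg d 14)
  refine ⟨K₁ + ((addrE d).cost + (rg d 13).cost + 1) +
    (K₂ + (ad.cost + (rg d 20).cost + 1) + lim.cost + 8), fun {n N J x m z s} H hN hJ => ?_⟩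
  have hm := H.pos
  set gg := gridCard d N * gridCard d N with hgg
  set A := nodeAddr d n N J x m with hA
  have hNC : nodeCells d N J = 1 + (J + 1) * gg := rfl
  refine Runs.le (T := K₁ * m + (((addrE d).cost + (rg d 13).cost + 1) + ((J + 1) * gg + 1) *
    ((K₂ * ((J + 1) * m) + (ad.cost + (rg d 20).cost + 1)) + lim.cost + 8))) ?key ?bound
  case key =>
    refine Runs.seq ((hK₁ H).imp fun s₁ h₁ => Runs.seq ?_)
    obtain ⟨hA₁, hR⟩ := h₁
    have H₁ := H.congr hA₁
    set R := s₁.reg (rv d 13) with hRdef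
    refine Runs.storeAt (k := A) (by simp [Expr.Below]) (by simp [Expr.Below])
      (by simp [Expr.Ok]) trivial H₁.addrE
      (nodeAddr_lt (k := 0) H.lt hm (by omega)) ?_
    refine (Runs.forLt (m := (J + 1) * gg) (fun k s' => (∀ r < rv d 13, s'.reg r = s.reg r) ∧
      s'.reg (rv d 13) = R ∧ s'.reg (rv d 14) = k ∧
      (∀ a, a < A ∨ A + nodeCells d N J ≤ a → s'.mem a = s.mem a) ∧ s'.mem A = R ∧
      ∀ e < k, EntryOK N z x m (2 ^ (e / gg) * R) (e % gg) (s'.mem (A + 1 + e)))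
      (by simp) (by simp [Expr.Below]) ?_ ?_ ?_ ?_)
    · refine ⟨fun r hr => ?_, ?_, by simp [Config.setReg_reg], fun a ha => ?_, ?_, by simp⟩
      · have : r ≠ rv d 14 := (hr.trans (by simp)).ne
        simp [Config.setReg_reg, this, hA₁.1 r hr]
      · simp [Config.setReg_reg, hRdef]
      · rw [Config.setReg_mem, Config.setMem_mem, if_neg (by omega), hA₁.2]
      · simp [Config.setMem_mem, Expr.eval, hRdef]
    · intro k s' h
      obtain ⟨hreg, -, h14, -⟩ := h
      refine ⟨h14, by simp [Expr.Ok], ?_⟩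
      simp [Expr.eval, hreg (rv d 4) (by simp), hreg (rv d 7) (by simp), H.globals.hJ,
        H.globals.gc, hgg]
    · intro k s' hk h
      obtain ⟨hreg, h13, h14, hmem, hR', hent⟩ := h
      have hmemb : ∀ a < nodeBase d n, s'.mem a = s.mem a := fun a ha =>
        hmem a (.inl (ha.trans_le nodeBase_le_nodeAddr))
      have H' := H.congr' hreg hmemb
      refine Runs.seq ((hK₂ H' hN hJ h14 hk (h13 ▸ hR)).imp fun s'' h'' => ?_)
      obtain ⟨hA'', hE⟩ := h''
      rw [h13] at hE
      have H'' := H'.congr (hA''.mono (by simp))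
      have h14'' : s''.reg (rv d 14) = k := by rw [hA''.1 _ (by simp), h14]
      refine Runs.storeAt (k := A + 1 + k) (by simp [Expr.Below]) (by simp [Expr.Below])
        (by simp [Expr.Ok]) trivial ?_ ?_ ?_
      · change (addrE d).eval s'' + ((1 : ℚ) : ℝ) + s''.reg (rv d 14) = _
        rw [H''.addrE, h14'']
        push_cast; ring
      · rw [add_assoc]
        exact nodeAddr_lt H.lt hm (by omega)
      · refine ⟨h14'', fun r hr => ?_, ?_, by simp [Config.setReg_reg], fun a ha => ?_, ?_,
          fun e he => ?_⟩
        · have : r ≠ rv d 14 := (hr.trans (by simp)).ne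
          simp [Config.setReg_reg, this, hA''.1 r (hr.trans (by simp)), hreg r hr]
        · simp [Config.setReg_reg, hA''.1 (rv d 13) (by simp), h13]
        · rw [Config.setReg_mem, Config.setMem_mem, if_neg (by omega), hA''.2, hmem a ha]
        · rw [Config.setReg_mem, Config.setMem_mem, if_neg (by omega), hA''.2, hR']
        · rw [Config.setReg_mem, Config.setMem_mem]
          rcases (Nat.lt_succ_iff.1 he).eq_or_lt with rfl | hlt
          · rw [if_pos rfl]; exact hE
          · rw [if_neg (by omega), hA''.2]; exact hent e hlt
    · intro s' h
      obtain ⟨hreg, -, -, hmem, hR', hent⟩ := h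
      refine ⟨hreg, hmem, ?_, fun e he => ?_⟩
      · rw [hR']; exact hR
      · rw [hR']; exact hent e he
  case bound =>
    have hJm : 1 ≤ (J + 1) * m := Nat.mul_pos (Nat.succ_pos J) hm
    have hC : 1 ≤ nodeCells d N J := by omega
    have hmm : m ≤ (J + 1) * m := Nat.le_mul_of_pos_left m (Nat.succ_pos J)
    set M := (J + 1) * m with hM
    rw [show (J + 1) * gg + 1 = nodeCells d N J by rw [hNC, add_comm]]
    set C := nodeCells d N J
    generalize ((addrE d).cost + (rg d 13).cost + 1) = c₁
    generalize hc₂ : (ad.cost + (rg d 20).cost + 1) = c₂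
    rw [← hc₂]
    generalize ad.cost + (rg d 20).cost + 1 = c₂
    have a₁ : K₁ * m ≤ K₁ * (C * M) :=
      Nat.mul_le_mul_left _ (hmm.trans (Nat.le_mul_of_pos_left _ hC))
    have a₂ : c₁ ≤ c₁ * (C * M) := Nat.le_mul_of_pos_right _ (Nat.mul_pos hC hJm)
    have a₃ : K₂ * M + c₂ + lim.cost + 8 ≤ (K₂ + c₂ + lim.cost + 8) * M := by
      have b₁ := Nat.le_mul_of_pos_right c₂ hJm
      have b₂ := Nat.le_mul_of_pos_right lim.cost hJm
      have b₃ := Nat.le_mul_of_pos_right 8 hJm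
      rw [add_mul, add_mul, add_mul]
      omega
    have a₄ : C * (K₂ * M + c₂ + lim.cost + 8) ≤ (K₂ + c₂ + lim.cost + 8) * (C * M) := by
      calc _ ≤ C * ((K₂ + c₂ + lim.cost + 8) * M) := Nat.mul_le_mul_left _ a₃
        _ = _ := by ring
    rw [add_mul, add_mul]
    omega

end RealRAM

end
noncomputable section

open Set

namespace RealRAM

variable {d : ℕ} {S n N J : ℕ} {s : Config} {z : ℕ → EuclideanSpace ℝ (Fin d)}

/-! ### All canonical pieces -/

/-- Since `2 ^ t ∣ x`, the exact power of two in `2 * x + 2 ^ t` is `2 ^ t`. So the slot number of a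
canonical piece determines its length, and then its start. -/
theorem dyadic_eq {t t' x x' : ℕ} (hx : 2 ^ t ∣ x) (hx' : 2 ^ t' ∣ x')
    (h : 2 * x + 2 ^ t = 2 * x' + 2 ^ t') : t = t' ∧ x = x' := by
  have aux : ∀ {t t' x x' : ℕ}, 2 ^ t ∣ x → 2 ^ t' ∣ x' → 2 * x + 2 ^ t = 2 * x' + 2 ^ t' →
      ¬ t < t' := by
    intro t t' x x' hx hx' h hlt
    obtain ⟨a, rfl⟩ := hx
    have h₁ : 2 ^ (t + 1) ∣ 2 * x' + 2 ^ t' :=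
      dvd_add (dvd_mul_of_dvd_right ((pow_dvd_pow 2 hlt).trans hx') 2) (pow_dvd_pow 2 hlt)
    rw [← h, pow_succ, show 2 * (2 ^ t * a) + 2 ^ t = 2 ^ t * (2 * a + 1) by ring] at h₁
    have := Nat.dvd_of_mul_dvd_mul_left (Nat.pow_pos two_pos) h₁
    omega
  have ht : t = t' := le_antisymm (not_lt.1 (aux hx' hx h.symm)) (not_lt.1 (aux hx hx' h))
  subst ht
  exact ⟨rfl, by omega⟩

theorem nodeAddr_disjoint {t t' x x' : ℕ} (hx : 2 ^ t ∣ x) (hx' : 2 ^ t' ∣ x')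
    (h : ¬ (t = t' ∧ x = x')) :
    nodeAddr d n N J x (2 ^ t) + nodeCells d N J ≤ nodeAddr d n N J x' (2 ^ t') ∨
      nodeAddr d n N J x' (2 ^ t') + nodeCells d N J ≤ nodeAddr d n N J x (2 ^ t) := by
  have hne : 2 * x + 2 ^ t ≠ 2 * x' + 2 ^ t' := fun e => h (dyadic_eq hx hx' e)
  unfold nodeAddr
  rcases lt_or_gt_of_ne hne with hlt | hlt
  · left
    have := Nat.mul_le_mul_right (nodeCells d N J) hlt
    rw [Nat.succ_mul] at this
    omega
  · right
    have := Nat.mul_le_mul_right (nodeCells d N J) hlt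
    rw [Nat.succ_mul] at this
    omega

theorem NodeOK.congr {mem mem' : ℕ → ℝ} {a x m : ℕ} (h : NodeOK N J z mem a x m)
    (h' : ∀ b, a ≤ b → b < a + nodeCells d N J → mem' b = mem b) : NodeOK N J z mem' a x m := by
  have hC : nodeCells d N J = 1 + (J + 1) * (gridCard d N * gridCard d N) := rfl
  have e : mem' a = mem a := h' a le_rfl (by omega)
  refine ⟨by rw [e]; exact h.1, fun e' he' => ?_⟩
  rw [e, h' (a + 1 + e') (by omega) (by omega)]
  exact h.2 e' he'

/-- The canonical pieces of length less than `2 ^ t`, and the first `k` ones of length `2 ^ t`, have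
been described. -/
def Built (n N J : ℕ) (z : ℕ → EuclideanSpace ℝ (Fin d)) (t k : ℕ) (mem : ℕ → ℝ) : Prop :=
  ∀ t' x, 2 ^ t' ∣ x → x + 2 ^ t' < n → (t' < t ∨ t' = t ∧ x < k * 2 ^ t) →
    NodeOK N J z mem (nodeAddr d n N J x (2 ^ t')) x (2 ^ t')

/-- The loop over the canonical pieces of one length. -/
def levelProg (d : ℕ) : Program :=
  .seq (assign (top d) (rv d 12) (.const 0))
    (.seq (whileLt (top d) (.add (rg d 12) (rg d 11)) (rg d 8)
      (.seq (nodeProg d) (assign (top d) (rv d 12) (.add (rg d 12) (rg d 11)))))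
      (assign (top d) (rv d 11) (.add (rg d 11) (rg d 11))))

/-- At most `n / 2 ^ t` pieces are processed, each at a cost proportional to `2 ^ t`, so a level
costs as much as a single pass over the curve. -/
theorem runs_levelProg (d : ℕ) (hd : 0 < d) : ∃ K : ℕ, ∀ {n N J t : ℕ}
    {z : ℕ → EuclideanSpace ℝ (Fin d)} {s : Config}, Globals n N J d s →
    Holds s (vertexBase d n) n z → s.reg (rv d 8) = n → s.reg (rv d 11) = (2 ^ t : ℕ) →
    2 ^ t < n → 0 < N → 12 * d * N ≤ 2 ^ J → Built n N J z t 0 s.mem →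
    Runs (cells d n N J) (top d) (levelProg d) s (K * (nodeCells d N J * ((J + 1) * n)))
      (fun s' => (∀ r < rv d 11, s'.reg r = s.reg r) ∧
        (∀ a < nodeBase d n, s'.mem a = s.mem a) ∧ s'.reg (rv d 11) = (2 ^ (t + 1) : ℕ) ∧
        Built n N J z (t + 1) 0 s'.mem) := by
  obtain ⟨K, hK⟩ := runs_nodeProg d hd
  set ca := (Expr.add (rg d 12) (rg d 11)).cost + 1 with hca
  refine ⟨2 * (K + ca + (Expr.add (rg d 12) (rg d 11)).cost + (rg d 8).cost + 1) + 20,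
    fun {n N J t z s} G H hn hm hlt hN hJ hB => ?_⟩
  have h2 : 0 < 2 ^ t := Nat.pow_pos two_pos
  refine Runs.le (T := ((Expr.const 0).cost + 1) + ((n / 2 ^ t + 1) *
    ((K * (nodeCells d N J * ((J + 1) * 2 ^ t)) + ca) + (Expr.add (rg d 12) (rg d 11)).cost +
      (rg d 8).cost + 1) + ((Expr.add (rg d 11) (rg d 11)).cost + 1))) ?key ?bound
  case key =>
    refine Runs.seq (Runs.assign trivial trivial (Runs.seq ?_))
    refine Runs.whileLt (m := n / 2 ^ t) (fun k s' => (∀ r < rv d 12, s'.reg r = s.reg r) ∧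
      (∀ a < nodeBase d n, s'.mem a = s.mem a) ∧ s'.reg (rv d 12) = (k * 2 ^ t : ℕ) ∧
      Built n N J z t k s'.mem) (by simp [Expr.Below]) (by simp [Expr.Below]) ?_ ?_ ?_ ?_
    · refine ⟨fun r hr => ?_, fun _ _ => rfl, by simp [Config.setReg_reg, Expr.eval], hB⟩
      rw [Config.setReg_reg, if_neg hr.ne]
    · exact fun k s' _ => ⟨⟨trivial, trivial⟩, trivial⟩
    · intro k s' h hc
      obtain ⟨hreg, hmem, hx, hB'⟩ := h
      have hlt' : k * 2 ^ t + 2 ^ t < n := by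
        simp only [Expr.eval, hx, hreg (rv d 11) (by simp), hreg (rv d 8) (by simp), hm, hn] at hc
        exact_mod_cast hc
      have hk : k < n / 2 ^ t := by
        rw [Nat.lt_iff_add_one_le, Nat.le_div_iff_mul_le h2, Nat.succ_mul]
        exact hlt'.le
      refine ⟨hk, ?_⟩
      have P : PieceState n N J z (k * 2 ^ t) (2 ^ t) s' :=
        ⟨G.congr fun r hr => hreg r (hr.trans (by simp)), H.congr hmem,
          by rw [hreg _ (by simp), hm], hx, h2, hlt'⟩
      refine Runs.seq ((hK P hN hJ).imp fun s'' h'' => ?_)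
      obtain ⟨hreg'', hmem'', hN''⟩ := h''
      refine Runs.assign (by simp [Expr.Below]) ⟨trivial, trivial⟩
        ⟨fun r hr => ?_, fun a ha => ?_, ?_, ?_⟩
      · rw [Config.setReg_reg, if_neg hr.ne, hreg'' r (hr.trans (by simp)), hreg r hr]
      · rw [Config.setReg_mem, hmem'' a (.inl (ha.trans_le nodeBase_le_nodeAddr)), hmem a ha]
      · simp only [Config.setReg_reg, if_true, Expr.eval, hreg'' (rv d 12) (by simp),
          hreg'' (rv d 11) (by simp), hx, hreg (rv d 11) (by simp), hm]
        push_cast; ring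
      · intro t' x hx' hxn hcase
        rw [Config.setReg_mem]
        -- The new piece has just been described. Any other one occupies disjoint cells and is
        -- preserved by the frame condition.
        by_cases hsame : t' = t ∧ x = k * 2 ^ t
        · obtain ⟨rfl, rfl⟩ := hsame
          exact hN''
        · have hold : t' < t ∨ t' = t ∧ x < k * 2 ^ t := by
            rcases hcase with hc' | ⟨rfl, hc'⟩
            · exact .inl hc'
            · refine .inr ⟨rfl, ?_⟩
              obtain ⟨y, rfl⟩ := hx'
              rw [mul_comm] at hc' hsame ⊢
              have := lt_of_mul_lt_mul_right hc' (Nat.zero_le _)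
              rcases (Nat.lt_succ_iff.1 this).eq_or_lt with rfl | hyk
              · exact absurd ⟨rfl, rfl⟩ hsame
              · exact Nat.mul_lt_mul_of_pos_right hyk h2
          refine (hB' t' x hx' hxn hold).congr fun b hb hb' => hmem'' b ?_
          rcases nodeAddr_disjoint (d := d) (n := n) (N := N) (J := J) hx' (Dvd.intro_left k rfl)
            hsame with h₁ | h₁
          · left; omega
          · right; omega
    · intro k s' h hc
      obtain ⟨hreg, hmem, hx, hB'⟩ := h
      have hge : n ≤ k * 2 ^ t + 2 ^ t := by
        simp only [Expr.eval, hx, hreg (rv d 11) (by simp), hreg (rv d 8) (by simp), hm, hn,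
          not_lt] at hc
        exact_mod_cast hc
      refine Runs.assign (by simp [Expr.Below]) ⟨trivial, trivial⟩
        ⟨fun r hr => ?_, hmem, ?_, ?_⟩
      · rw [Config.setReg_reg, if_neg hr.ne, hreg r (hr.trans (by simp))]
      · simp only [Config.setReg_reg, if_true, Expr.eval, hreg (rv d 11) (by simp), hm]
        push_cast; ring
      · intro t' x hx' hxn hcase
        refine hB' t' x hx' hxn ?_
        rcases hcase with hc' | ⟨-, hc'⟩
        · rcases (Nat.lt_succ_iff.1 hc').eq_or_lt with rfl | h
          · exact .inr ⟨rfl, by omega⟩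
          · exact .inl h
        · omega
  case bound =>
    -- This lets `n / 2 ^ t + 1` be bounded by `2 * (n / 2 ^ t)`, which absorbs the final test of
    -- the loop.
    have hdiv : 1 ≤ n / 2 ^ t := (Nat.le_div_iff_mul_le h2).2 (by omega)
    have hdm : n / 2 ^ t * 2 ^ t ≤ n := Nat.div_mul_le_self n _
    set e₁ := (Expr.add (rg d 12) (rg d 11)).cost
    set e₂ := (rg d 8).cost
    set C := nodeCells d N J
    have hC : 1 ≤ C := by simp only [C, nodeCells]; omega
    have hw : 1 ≤ C * ((J + 1) * 2 ^ t) := Nat.mul_pos hC (Nat.mul_pos (Nat.succ_pos J) h2)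
    have hw' : 1 ≤ C * ((J + 1) * n) :=
      Nat.mul_pos hC (Nat.mul_pos (Nat.succ_pos J) (by omega))
    have a₁ : K * (C * ((J + 1) * 2 ^ t)) + ca + e₁ + e₂ + 1 ≤
        (K + ca + e₁ + e₂ + 1) * (C * ((J + 1) * 2 ^ t)) := by
      have b := Nat.le_mul_of_pos_right (ca + e₁ + e₂ + 1) hw
      calc _ = K * (C * ((J + 1) * 2 ^ t)) + (ca + e₁ + e₂ + 1) := by ring
        _ ≤ _ := Nat.add_le_add_left b _
        _ = _ := by ring
    have a₂ : (n / 2 ^ t + 1) * (K * (C * ((J + 1) * 2 ^ t)) + ca + e₁ + e₂ + 1) ≤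
        2 * (K + ca + e₁ + e₂ + 1) * (C * ((J + 1) * n)) := by
      calc _ ≤ (2 * (n / 2 ^ t)) * ((K + ca + e₁ + e₂ + 1) * (C * ((J + 1) * 2 ^ t))) :=
            Nat.mul_le_mul (by omega) a₁
        _ = 2 * (K + ca + e₁ + e₂ + 1) * (C * ((J + 1) * (n / 2 ^ t * 2 ^ t))) := by ring
        _ ≤ _ := by gcongr
    have a₃ : ((Expr.const 0).cost + 1) + ((Expr.add (rg d 11) (rg d 11)).cost + 1) ≤ 20 := by
      simp [Expr.cost]
    have a₄ := Nat.le_mul_of_pos_right 20 hw'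
    calc _ ≤ 20 + 2 * (K + ca + e₁ + e₂ + 1) * (C * ((J + 1) * n)) := by
          generalize (n / 2 ^ t + 1) * (K * (C * ((J + 1) * 2 ^ t)) + ca + e₁ + e₂ + 1) = X at *
          omega
      _ ≤ 20 * (C * ((J + 1) * n)) + 2 * (K + ca + e₁ + e₂ + 1) * (C * ((J + 1) * n)) :=
          Nat.add_le_add_right a₄ _
      _ = _ := by ring

/-- Compute the descriptions of all canonical pieces. -/
def nodesProg (d : ℕ) : Program :=
  .seq (assign (top d) (rv d 11) (.const 1)) (forLt (top d) (rv d 10) (rg d 5) (levelProg d))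

theorem runs_nodesProg (d : ℕ) (hd : 0 < d) : ∃ K : ℕ, ∀ {n N J : ℕ}
    {z : ℕ → EuclideanSpace ℝ (Fin d)} {s : Config}, Globals n N J d s →
    Holds s (vertexBase d n) n z → s.reg (rv d 8) = n → 1 < n → 0 < N → 12 * d * N ≤ 2 ^ J →
    Runs (cells d n N J) (top d) (nodesProg d) s
      (K * ((Nat.clog 2 n + 1) * (nodeCells d N J * ((J + 1) * n))))
      (fun s' => (∀ a < nodeBase d n, s'.mem a = s.mem a) ∧
        ∀ t x, 2 ^ t ∣ x → x + 2 ^ t < n →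
          NodeOK N J z s'.mem (nodeAddr d n N J x (2 ^ t)) x (2 ^ t)) := by
  obtain ⟨K, hK⟩ := runs_levelProg d hd
  refine ⟨2 + (K + (rg d 5).cost + 8), fun {n N J z s} G H hn hn1 hN hJ => ?_⟩
  refine Runs.le (T := ((Expr.const 1).cost + 1) + (Nat.clog 2 n + 1) *
    (K * (nodeCells d N J * ((J + 1) * n)) + (rg d 5).cost + 8)) ?key ?bound
  case key =>
    refine Runs.seq (Runs.assign trivial trivial ?_)
    refine Runs.forLt (m := Nat.clog 2 n) (fun t s' => (∀ r < rv d 10, s'.reg r = s.reg r) ∧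
      (∀ a < nodeBase d n, s'.mem a = s.mem a) ∧ s'.reg (rv d 10) = t ∧
      s'.reg (rv d 11) = (2 ^ t : ℕ) ∧ Built n N J z t 0 s'.mem)
      (by simp) (by simp [Expr.Below]) ?_ ?_ ?_ ?_
    · refine ⟨fun r hr => ?_, fun _ _ => rfl, by simp [Config.setReg_reg],
        by simp [Config.setReg_reg, Expr.eval], fun t' x _ _ h => by omega⟩
      have : r ≠ rv d 11 := (hr.trans (by simp)).ne
      simp [Config.setReg_reg, hr.ne, this]
    · exact fun t s' h => ⟨h.2.2.1, trivial, by rw [Expr.eval, h.1 _ (by simp), G.hL]⟩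
    · intro t s' ht h
      obtain ⟨hreg, hmem, h10, h11, hB⟩ := h
      refine (hK (G.congr fun r hr => hreg r (hr.trans (by simp))) (H.congr hmem)
        (by rw [hreg _ (by simp), hn]) h11 ((Nat.lt_clog_iff_pow_lt one_lt_two).1 ht) hN hJ
        hB).imp fun s'' h'' => ?_
      obtain ⟨hreg'', hmem'', h11'', hB''⟩ := h''
      refine ⟨by rw [hreg'' _ (by simp), h10], fun r hr => ?_, fun a ha => ?_,
        by simp [Config.setReg_reg], by simpa [Config.setReg_reg] using h11'', hB''⟩
      · rw [Config.setReg_reg, if_neg hr.ne, hreg'' r (hr.trans (by simp)), hreg r hr]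
      · rw [Config.setReg_mem, hmem'' a ha, hmem a ha]
    · intro s' h
      obtain ⟨-, hmem, -, -, hB⟩ := h
      refine ⟨hmem, fun t x hx hxn => hB t x hx hxn (.inl ?_)⟩
      -- A canonical piece has `2 ^ t < n`, so no length beyond the levels of the loop occurs.
      exact (Nat.lt_clog_iff_pow_lt one_lt_two).2 (by omega)
  case bound =>
    set C := nodeCells d N J * ((J + 1) * n)
    have hC : 1 ≤ C := Nat.mul_pos (by simp only [nodeCells]; omega)
      (Nat.mul_pos (Nat.succ_pos J) (by omega))
    have hL : 1 ≤ (Nat.clog 2 n + 1) * C := Nat.mul_pos (Nat.succ_pos _) hC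
    have a₁ : K * C + (rg d 5).cost + 8 ≤ (K + (rg d 5).cost + 8) * C := by
      have b := Nat.le_mul_of_pos_right ((rg d 5).cost + 8) hC
      calc _ = K * C + ((rg d 5).cost + 8) := by ring
        _ ≤ _ := Nat.add_le_add_left b _
        _ = _ := by ring
    have a₂ : (Nat.clog 2 n + 1) * (K * C + (rg d 5).cost + 8) ≤
        (K + (rg d 5).cost + 8) * ((Nat.clog 2 n + 1) * C) :=
      (Nat.mul_le_mul_left _ a₁).trans_eq (by ring)
    have a₃ : ((Expr.const 1).cost + 1) ≤ 2 * ((Nat.clog 2 n + 1) * C) := by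
      simp only [Expr.cost]; omega
    exact (Nat.add_le_add a₃ a₂).trans_eq (by ring)

/-! ### Initialization -/

/-- Compute the logarithm of `f`, rounded up, in register `c`. -/
def clogProg (d c : ℕ) (f : Expr) : Program :=
  .seq (assigns (top d) [(rv d c, .const 0), (rv d 9, .const 1)])
    (whileLt (top d) (rg d 9) f
      (assigns (top d) [(rv d c, .add (rg d c) (.const 1)), (rv d 9, .add (rg d 9) (rg d 9))]))

/-- The powers of two are run through until they reach `f`. As `f` is evaluated in each round, its
value must not depend on the two registers that the loop changes. -/
theorem runs_clogProg (d c : ℕ) (f : Expr) (hc : c < 9) (hf : f.Below (top d)) : ∃ K : ℕ,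
    ∀ {S m : ℕ} {s : Config},
    (∀ s' : Config, (∀ r, r ≠ rv d c → r ≠ rv d 9 → s'.reg r = s.reg r) → s'.mem = s.mem →
      f.Ok S s' ∧ f.eval s' = m) →
    Runs S (top d) (clogProg d c f) s (K * (Nat.clog 2 m + 1))
      (fun s' => (∀ r, r ≠ rv d c → r ≠ rv d 9 → s'.reg r = s.reg r) ∧ s'.mem = s.mem ∧
        s'.reg (rv d c) = Nat.clog 2 m) := by
  refine ⟨5 + (costList [(rv d c, .add (rg d c) (.const 1)), (rv d 9, .add (rg d 9) (rg d 9))] +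
    (rg d 9).cost + f.cost + 1), fun {S m s} hm => ?_⟩
  have h9 : c ≠ 9 := hc.ne
  refine Runs.le (T := costList [(rv d c, .const 0), (rv d 9, .const 1)] + (Nat.clog 2 m + 1) *
    (costList [(rv d c, .add (rg d c) (.const 1)), (rv d 9, .add (rg d 9) (rg d 9))] +
    (rg d 9).cost + f.cost + 1)) ?key ?bound
  case key =>
    refine Runs.seq (Runs.assigns (by simp [BelowList, Expr.Below])
      (by simp [OkList, Expr.Ok]) ?_)
    refine Runs.whileLt (m := Nat.clog 2 m) (fun k s' =>
      (∀ r, r ≠ rv d c → r ≠ rv d 9 → s'.reg r = s.reg r) ∧ s'.mem = s.mem ∧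
        s'.reg (rv d c) = k ∧ s'.reg (rv d 9) = (2 ^ k : ℕ) ∧ k ≤ Nat.clog 2 m)
      (by simp [Expr.Below]) hf ?_ ?_ ?_ ?_
    · refine ⟨fun r h₁ h₂ => ?_, rfl, ?_, ?_, Nat.zero_le _⟩
      · simp [evalList, Config.setReg_reg, h₁, h₂]
      · simp [evalList, Config.setReg_reg, Expr.eval, h9]
      · simp [evalList, Config.setReg_reg, Expr.eval]
    · exact fun k s' h => ⟨trivial, (hm s' h.1 h.2.1).1⟩
    · intro k s' h hlt
      obtain ⟨hreg, hmem, hc', h9', hk⟩ := h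
      rw [(hm s' hreg hmem).2, Expr.eval, h9'] at hlt
      have hlt' : k < Nat.clog 2 m := by
        rw [Nat.lt_clog_iff_pow_lt one_lt_two]
        exact_mod_cast hlt
      refine ⟨hlt', Runs.assigns (by simp [BelowList, Expr.Below]; omega)
        (by simp [OkList, Expr.Ok]) ⟨fun r h₁ h₂ => ?_, hmem, ?_, ?_, hlt'⟩⟩
      · simp [evalList, Config.setReg_reg, h₁, h₂, hreg r h₁ h₂]
      · simp [evalList, Config.setReg_reg, Expr.eval, h9, hc']
      · simp [evalList, Config.setReg_reg, Expr.eval, h9.symm, h9', pow_succ]; ring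
    · intro k s' h hlt
      obtain ⟨hreg, hmem, hc', h9', hk⟩ := h
      rw [(hm s' hreg hmem).2, Expr.eval, h9', not_lt] at hlt
      refine ⟨hreg, hmem, ?_⟩
      rw [hc', le_antisymm hk ((Nat.clog_le_iff_le_pow one_lt_two).2 (by exact_mod_cast hlt))]
  case bound =>
    have : costList [(rv d c, Expr.const 0), (rv d 9, .const 1)] = 5 := rfl
    rw [this]
    have h₁ : 5 ≤ 5 * (Nat.clog 2 m + 1) := by omega
    exact (Nat.add_le_add_right h₁ _).trans_eq (by ring)

/-- Store the first `k` working registers in the first `k` cells. -/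
def headerProg (d : ℕ) : ℕ → Program
  | 0 => assigns (top d) []
  | k + 1 => .seq (headerProg d k) (storeAt (top d) (.const k) (rg d k))

theorem runs_headerProg (d k : ℕ) (hk : k ≤ 8) : ∃ K : ℕ, ∀ {S : ℕ} {s : Config}, 8 ≤ S →
    Runs S (top d) (headerProg d k) s K (fun s' => s'.reg = s.reg ∧
      (∀ j < k, s'.mem j = s.reg (rv d j)) ∧ ∀ j, k ≤ j → s'.mem j = s.mem j) := by
  induction k with
  | zero => exact ⟨_, fun _ => Runs.assigns trivial trivial
      ⟨rfl, fun j hj => absurd hj (Nat.not_lt_zero j), fun _ _ => rfl⟩⟩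
  | succ k ih =>
    obtain ⟨K, hK⟩ := ih (by omega)
    refine ⟨K + ((Expr.const k).cost + (rg d k).cost + 1), fun {S s} hS =>
      Runs.seq ((hK hS).imp fun s' h => ?_)⟩
    obtain ⟨hreg, h₁, h₂⟩ := h
    refine Runs.storeAt (k := k) trivial (by simp [Expr.Below]; omega) trivial trivial
      (by simp [Expr.eval]) (by omega) ⟨hreg, fun j hj => ?_, fun j hj => ?_⟩
    · rw [Config.setMem_mem]
      rcases (Nat.lt_succ_iff.1 hj).eq_or_lt with rfl | hlt
      · rw [if_pos rfl, Expr.eval, hreg]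
      · rw [if_neg hlt.ne, h₁ j hlt]
    · rw [Config.setMem_mem, if_neg (by omega), h₂ j (by omega)]

/-- The number of steps between grid points. -/
def resolution (d : ℕ) (ε : ℝ) : ℕ := ⌊120 * ((d : ℝ) + 1) / ε⌋₊ + 1

/-- The number of scales. -/
def scales (d : ℕ) (ε : ℝ) : ℕ := Nat.clog 2 (12 * d * resolution d ε)

/-- The first assignments of the preprocessing. -/
def setupList (d : ℕ) : List (ℕ × Expr) :=
  [(rv d 8, .reg 0),
    (rv d 2, .add (.floor (.div (.const ((120 * (d + 1) : ℕ) : ℚ)) (.reg 1))) (.const 1)),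
    (rv d 3, .add (.mul (.const 22) (rg d 2)) (.const 1)),
    (rv d 7, .powE (rg d 3) d),
    (rv d 0, .add (.mul (rg d 8) (.const d)) (.const 8)),
    (rv d 1, .add (rg d 0) (.mul (rg d 8) (.const d)))]

/-- Copy the vertices to their final place. -/
def copyProg (d : ℕ) : Program :=
  forLt (top d) (rv d 10) (.mul (rg d 8) (.const d))
    (storeAt (top d) (.add (rg d 0) (rg d 10)) (.load (rg d 10)))

/-- The preprocessing program. -/
def buildProg (d : ℕ) : Program :=
  .seq (assigns (top d) (setupList d))
    (.seq (clogProg d 4 (.mul (.const ((12 * d : ℕ) : ℚ)) (rg d 2)))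
    (.seq (clogProg d 5 (rg d 8))
    (.seq (assign (top d) (rv d 6) (.add (.const 1) (.mul (.add (rg d 4) (.const 1))
      (.mul (rg d 7) (rg d 7)))))
    (.seq (copyProg d)
    (.seq (headerProg d 8) (nodesProg d))))))

theorem Globals.congr_rv {s' : Config} (h : Globals n N J d s)
    (h' : ∀ k < 8, s'.reg (rv d k) = s.reg (rv d k)) : Globals n N J d s' := by
  constructor <;> rw [h' _ (by omega)]
  exacts [h.vb, h.nb, h.hN, h.hG, h.hJ, h.hL, h.ns, h.gc]

/-- The memory contains the complete data structure. -/
structure DataOK (n N J : ℕ) (z : ℕ → EuclideanSpace ℝ (Fin d)) (mem : ℕ → ℝ) : Prop where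
  header : ∀ s : Config, (∀ k < 8, s.reg (rv d k) = mem k) → Globals n N J d s
  holds : ∀ s : Config, s.mem = mem → Holds s (vertexBase d n) n z
  nodes : ∀ t x, 2 ^ t ∣ x → x + 2 ^ t < n →
    NodeOK N J z mem (nodeAddr d n N J x (2 ^ t)) x (2 ^ t)

/-- All cells of the structure lie below `cells d n N J`; a query is guaranteed the contents of
these cells only. -/
theorem DataOK.congr {mem mem' : ℕ → ℝ} (h : DataOK n N J z mem)
    (h' : ∀ a < cells d n N J, mem' a = mem a) : DataOK n N J z mem' := by
  have hb : nodeBase d n ≤ cells d n N J := Nat.le_add_right _ _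
  have h8 : 8 ≤ nodeBase d n := by unfold nodeBase vertexBase; omega
  refine ⟨fun s hs => h.header s fun k hk => ?_, fun s hs => ?_, fun t x hx hxn => ?_⟩
  · rw [hs k hk, h' k (by omega)]
  · exact (h.holds ⟨s.reg, mem⟩ rfl).congr fun a ha => by rw [hs, h' a (by omega)]
  · refine (h.nodes t x hx hxn).congr fun b hb hb' => h' b ?_
    have := nodeAddr_lt (d := d) (N := N) (J := J) hxn (Nat.pow_pos two_pos)
      (k := b - nodeAddr d n N J x (2 ^ t)) (by omega)
    omega

@[simp] theorem one_ne_rv {a : ℕ} : (1 = rv d a) = False := by simp [rv]; omega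

/-- This is what makes a tolerance of about `(108 * d + 56) * (A / N)` smaller than `ε * A`, with
room to spare; see `IsDist.approx`. -/
theorem le_resolution {ε : ℝ} (hε : 0 < ε) : 120 * ((d : ℝ) + 1) ≤ ε * resolution d ε := by
  have := (Nat.lt_floor_add_one (120 * ((d : ℝ) + 1) / ε)).le
  rw [div_le_iff₀ hε] at this
  rw [resolution]; push_cast; linarith

/-- The dominant term is the computation of the nodes; every other phase costs at most a constant
multiple of it. -/
theorem runs_buildProg (d : ℕ) (hd : 0 < d) : ∃ K : ℕ, ∀ {n : ℕ} {ε : ℝ}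
    {Z : Fin n → EuclideanSpace ℝ (Fin d)} {s : Config}, 1 < n → 0 < ε → IsCurveInput s Z ε →
    Runs (cells d n (resolution d ε) (scales d ε)) (top d) (buildProg d) s
      (K * ((Nat.clog 2 n + 1) * (nodeCells d (resolution d ε) (scales d ε) *
        ((scales d ε + 1) * n))))
      (fun s' => DataOK n (resolution d ε) (scales d ε) (polyVertex Z) s'.mem) := by
  obtain ⟨K₁, hK₁⟩ := runs_clogProg d 4 (.mul (.const ((12 * d : ℕ) : ℚ)) (rg d 2)) (by omega)
    (by simp [Expr.Below])
  obtain ⟨K₂, hK₂⟩ := runs_clogProg d 5 (rg d 8) (by omega) (by simp [Expr.Below])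
  obtain ⟨K₃, hK₃⟩ := runs_headerProg d 8 le_rfl
  obtain ⟨K₄, hK₄⟩ := runs_nodesProg d hd
  set nsE : Expr := .add (.const 1) (.mul (.add (rg d 4) (.const 1)) (.mul (rg d 7) (rg d 7)))
  set ce := (Expr.add (rg d 0) (rg d 10)).cost + (Expr.load (rg d 10)).cost + 1
  set ce' := (Expr.mul (rg d 8) (.const d)).cost
  refine ⟨costList (setupList d) + K₁ + K₂ + (nsE.cost + 1) + (d + 1) * (ce + ce' + 8) + K₃ + K₄,
    fun {n ε Z s} hn hε hin => ?_⟩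
  obtain ⟨hr0, hr1, hmem⟩ := hin
  set N := resolution d ε with hN
  set J := scales d ε with hJ
  have hN0 : 0 < N := Nat.succ_pos _
  have hJ' : 12 * d * N ≤ 2 ^ J := Nat.le_pow_clog one_lt_two _
  have hGS : 22 * N + 1 ≤ cells d n N J := by
    have h₁ := gridCard_le_cells (d := d) (N := N) (J := J) (n := n) (by omega)
    have h₂ : 22 * N + 1 ≤ gridCard d N := Nat.le_self_pow hd.ne' _
    have h₃ : gridCard d N ≤ gridCard d N * gridCard d N := Nat.le_mul_self _
    omega
  refine Runs.le (T := costList (setupList d) + (K₁ * (J + 1) + (K₂ * (Nat.clog 2 n + 1) +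
    ((nsE.cost + 1) + ((n * d + 1) * (ce + ce' + 8) + (K₃ + K₄ * ((Nat.clog 2 n + 1) *
      (nodeCells d N J * ((J + 1) * n))))))))) ?key ?bound
  case key =>
    have fl : ⌊120 * ((d : ℝ) + 1) / ε⌋₊ + 1 = N := rfl
    have flr : ((⌊120 * ((d : ℝ) + 1) / ε⌋₊ : ℕ) : ℝ) + 1 = N := by exact_mod_cast fl
    refine Runs.seq (Runs.assigns ?_ ?_ ?_)
    · simp [setupList, BelowList, Expr.Below]
      exact ⟨by simp [rv], by simp [rv], Expr.below_powE (by simp [Expr.Below]) d⟩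
    · simp only [setupList, OkList, Expr.Ok, Expr.eval, Config.setReg_reg, one_ne_rv,
        if_false, hr1, true_and, and_true]
      -- The rounding that defines `N` must itself be legal, so its argument must be below the
      -- number of cells.
      have : ⌊120 * ((d : ℝ) + 1) / ε⌋₊ + 1 ≤ cells d n N J := by rw [fl]; omega
      push_cast
      refine ⟨⟨hε.ne', by positivity, ?_⟩, Expr.ok_powE (by trivial) d⟩
      refine (Nat.lt_floor_add_one _).trans_le ?_
      exact_mod_cast this
    set s₁ := evalList (setupList d) s with hs₁
    have m₁ : s₁.mem = s.mem := rfl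
    have a8 : s₁.reg (rv d 8) = n := by
      simp [hs₁, setupList, evalList, Config.setReg_reg, Expr.eval, hr0]
    have a2 : s₁.reg (rv d 2) = N := by
      simp [hs₁, setupList, evalList, Config.setReg_reg, Expr.eval, hr1, flr]
    have a3 : s₁.reg (rv d 3) = (22 * N + 1 : ℕ) := by
      simp [hs₁, setupList, evalList, Config.setReg_reg, Expr.eval, hr1, flr]
    have a7 : s₁.reg (rv d 7) = gridCard d N := by
      simp [hs₁, setupList, evalList, Config.setReg_reg, Expr.eval, hr1, flr, gridCard]
    have a0 : s₁.reg (rv d 0) = vertexBase d n := by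
      simp [hs₁, setupList, evalList, Config.setReg_reg, Expr.eval, hr0, vertexBase]
    have a1 : s₁.reg (rv d 1) = nodeBase d n := by
      simp [hs₁, setupList, evalList, Config.setReg_reg, Expr.eval, hr0, vertexBase, nodeBase]
    clear_value s₁
    refine Runs.seq ((hK₁ (m := 12 * d * N) fun s' hreg _ => ⟨⟨trivial, trivial⟩, ?_⟩).imp
      fun s₂ h₂ => ?_)
    · rw [Expr.eval, Expr.eval, Expr.eval, hreg _ (by simp) (by simp), a2]
      push_cast; ring
    obtain ⟨reg₂, mem₂, b4⟩ := h₂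
    refine Runs.seq ((hK₂ (m := n) fun s' hreg _ => ⟨trivial, ?_⟩).imp fun s₃ h₃ => ?_)
    · rw [Expr.eval, hreg _ (by simp) (by simp), reg₂ _ (by simp) (by simp), a8]
    obtain ⟨reg₃, mem₃, b5⟩ := h₃
    have c4 : s₃.reg (rv d 4) = J := by rw [reg₃ _ (by simp) (by simp), b4]; rfl
    have c7 : s₃.reg (rv d 7) = gridCard d N := by
      rw [reg₃ _ (by simp) (by simp), reg₂ _ (by simp) (by simp), a7]
    refine Runs.seq (Runs.assign (by simp [Expr.Below]) (by simp [Expr.Ok]) ?_)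
    set s₄ := s₃.setReg (rv d 6) (nsE.eval s₃) with hs₄
    have G₄ : Globals n N J d s₄ := by
      constructor
      · simp [hs₄, Config.setReg_reg, reg₃, reg₂, a0]
      · simp [hs₄, Config.setReg_reg, reg₃, reg₂, a1]
      · simp [hs₄, Config.setReg_reg, reg₃, reg₂, a2]
      · simp [hs₄, Config.setReg_reg, reg₃, reg₂, a3]
      · simp [hs₄, Config.setReg_reg, c4]
      · simp [hs₄, Config.setReg_reg, b5]
      · simp [hs₄, Config.setReg_reg, Expr.eval, nsE, c4, c7, nodeCells]
      · simp [hs₄, Config.setReg_reg, c7]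
    have d8 : s₄.reg (rv d 8) = n := by simp [hs₄, Config.setReg_reg, reg₃, reg₂, a8]
    have m₄ : s₄.mem = s.mem := by rw [hs₄, Config.setReg_mem, mem₃, mem₂, m₁]
    clear_value s₄
    have hvS : vertexBase d n + n * d ≤ cells d n N J := vertexBase_le_cells
    have hv8 : vertexBase d n = n * d + 8 := rfl
    -- The target of the copy starts at `n * d + 8`, beyond the source, so the source stays intact
    -- during the copy. Afterwards the first eight cells are free for the header.
    refine Runs.seq (Runs.forLt (m := n * d) (fun k s' => (∀ r < rv d 10, s'.reg r = s₄.reg r) ∧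
      s'.reg (rv d 10) = k ∧ (∀ a < n * d, s'.mem a = s.mem a) ∧
      ∀ a < k, s'.mem (vertexBase d n + a) = s.mem a) (by simp) (by simp [Expr.Below]) ?_ ?_ ?_ ?_)
    · refine ⟨fun r hr => ?_, by simp [Config.setReg_reg], fun a _ => ?_, by simp⟩
      · rw [Config.setReg_reg, if_neg hr.ne]
      · rw [Config.setReg_mem, m₄]
    · intro k s' h
      exact ⟨h.2.1, ⟨trivial, trivial⟩, by simp [Expr.eval, h.1 (rv d 8) (by simp), d8]⟩
    · intro k s' hk h
      obtain ⟨hreg, h10, hsrc, hdst⟩ := h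
      refine Runs.storeAt (k := vertexBase d n + k) (by simp [Expr.Below]) (by simp [Expr.Below])
        ⟨trivial, trivial⟩ ⟨trivial, k, by omega, h10⟩ ?_ (by omega) ?_
      · simp [Expr.eval, hreg (rv d 0) (by simp), G₄.vb, h10]
      · refine ⟨h10, fun r hr => ?_, by simp [Config.setReg_reg], fun a ha => ?_, fun a ha => ?_⟩
        · rw [Config.setReg_reg, if_neg hr.ne, Config.setMem_reg, hreg r hr]
        · rw [Config.setReg_mem, Config.setMem_mem, if_neg (by omega), hsrc a ha]
        · rw [Config.setReg_mem, Config.setMem_mem]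
          rcases (Nat.lt_succ_iff.1 ha).eq_or_lt with rfl | hlt
          · rw [if_pos rfl, Expr.eval, Expr.eval, h10, Nat.floor_natCast, hsrc a hk]
          · rw [if_neg (by omega), hdst a hlt]
    intro s₅ h₅
    obtain ⟨reg₅, -, -, dst₅⟩ := h₅
    refine Runs.seq ((hK₃ (by omega)).imp fun s₆ h₆ => ?_)
    obtain ⟨reg₆, hdr, oth⟩ := h₆
    have G₆ : Globals n N J d s₆ := G₄.congr fun r hr => by
      rw [reg₆, reg₅ r (hr.trans (by simp))]
    have H₆ : Holds s₆ (vertexBase d n) n (polyVertex Z) := by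
      intro i hi k
      have : i * d + d ≤ n * d := by rw [← Nat.succ_mul]; exact Nat.mul_le_mul_right d hi
      have hk := k.2
      rw [oth _ (by omega), add_assoc, dst₅ _ (by omega), hmem ⟨i, hi⟩ k, polyVertex, dif_pos hi]
    refine (hK₄ G₆ H₆ (by rw [reg₆, reg₅ _ (by simp), d8]) hn hN0 hJ').imp fun s₇ h₇ => ?_
    obtain ⟨low, nodes⟩ := h₇
    have h8 : 8 ≤ nodeBase d n := by unfold nodeBase vertexBase; omega
    refine ⟨fun s' hs' => ?_, fun s' hs' => ?_, nodes⟩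
    · refine G₆.congr_rv fun k hk => ?_
      rw [hs' k hk, low k (by omega), hdr k hk, reg₆]
    · exact H₆.congr fun a ha => by rw [hs', low a ha]
  case bound =>
    set B := (Nat.clog 2 n + 1) * (nodeCells d N J * ((J + 1) * n)) with hB
    have hC : 1 ≤ nodeCells d N J := by simp only [nodeCells]; omega
    have p₁ : 1 ≤ Nat.clog 2 n + 1 := by omega
    have q₁ : J + 1 ≤ B := by
      calc J + 1 = 1 * (1 * ((J + 1) * 1)) := by ring
        _ ≤ B := by rw [hB]; gcongr
    have q₂ : Nat.clog 2 n + 1 ≤ B := by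
      calc Nat.clog 2 n + 1 = (Nat.clog 2 n + 1) * (1 * (1 * 1)) := by ring
        _ ≤ B := by rw [hB]; gcongr <;> omega
    have q₃ : n ≤ B := by
      calc n = 1 * (1 * (1 * n)) := by ring
        _ ≤ B := by rw [hB]; gcongr; omega
    have q₄ : 1 ≤ B := by omega
    have r₁ := Nat.mul_le_mul_left K₁ q₁
    have r₂ := Nat.mul_le_mul_left K₂ q₂
    have r₃ : (n * d + 1) * (ce + ce' + 8) ≤ (d + 1) * (ce + ce' + 8) * B := by
      calc _ ≤ (n * d + n) * (ce + ce' + 8) := by gcongr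
        _ = (d + 1) * (ce + ce' + 8) * n := by ring
        _ ≤ _ := by gcongr
    have r₄ := Nat.le_mul_of_pos_right (costList (setupList d)) q₄
    have r₅ := Nat.le_mul_of_pos_right (nsE.cost + 1) q₄
    have r₆ := Nat.le_mul_of_pos_right K₃ q₄
    calc _ ≤ costList (setupList d) * B + (K₁ * B + (K₂ * B + ((nsE.cost + 1) * B +
          ((d + 1) * (ce + ce' + 8) * B + (K₃ * B + K₄ * B))))) := by omega
      _ = _ := by ring

end RealRAM

end
noncomputable section

open Set

namespace RealRAM

variable {d : ℕ} {S n N J : ℕ} {s : Config} {z : ℕ → EuclideanSpace ℝ (Fin d)}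

theorem Runs.skip {W T : ℕ} {Q : Config → Prop} (hT : 1 ≤ T) (h : Q s) :
    Runs S W (RealRAM.assigns W []) s T Q :=
  (Runs.assigns (l := []) trivial trivial h).le hT

/-! ### The decomposition of an interval into canonical pieces -/

/-- Process the piece of length `m` that starts at vertex `x`, and move on, unless `x + m > e`;
here `x` and `m` are in the registers `16` and `17`. -/
def takeProg (d : ℕ) (e : Expr) (P : Program) : Program :=
  ifLt (top d) e (.add (rg d 16) (rg d 17)) (assigns (top d) [])
    (.seq P (assign (top d) (rv d 16) (.add (rg d 16) (rg d 17))))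

/-- The largest multiple of `2 m` that is at most `x`. -/
abbrev roundE (d : ℕ) : Expr :=
  .mul (.add (rg d 17) (rg d 17)) (.floor (.div (rg d 16) (.add (rg d 17) (rg d 17))))

/-- One step with pieces of increasing length. -/
def upProg (d : ℕ) (e : Expr) (P : Program) : Program :=
  .seq (ifLt (top d) (roundE d) (rg d 16) (takeProg d e P) (assigns (top d) []))
    (ifLt (top d) (roundE d) (rg d 16) (assigns (top d) [])
      (assign (top d) (rv d 17) (.add (rg d 17) (rg d 17))))

/-- One step with pieces of decreasing length. -/
def downProg (d : ℕ) (e : Expr) (P : Program) : Program :=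
  ifLt (top d) (.const 1) (rg d 17)
    (.seq (assign (top d) (rv d 17) (.div (rg d 17) (.const 2))) (takeProg d e P))
    (assigns (top d) [])

/-- Run `P` for the pieces of a decomposition of the interval from `a` to `e`. -/
def piecesProg (d : ℕ) (a e : Expr) (P : Program) : Program :=
  .seq (assigns (top d) [(rv d 16, a), (rv d 17, .const 1)])
    (.seq (forLt (top d) (rv d 18) (rg d 5) (upProg d e P))
      (forLt (top d) (rv d 18) (rg d 5) (downProg d e P)))

/-- A loop body `P` that processes the pieces of an interval that ends at vertex `j`. -/
structure PieceRule (S n d : ℕ) (a j : ℕ) (e : Expr) (P : Program) (T : ℕ)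
    (Inv : ℕ → Config → Prop) : Prop where
  below : e.Below (top d)
  setReg : ∀ x s r v, Inv x s → 16 ≤ r → r < 19 → Inv x (s.setReg (rv d r) v)
  params : ∀ x s, Inv x s → s.reg (rv d 5) = Nat.clog 2 n ∧ e.Ok S s ∧ e.eval s = j
  run : ∀ x t s, Inv x s → a ≤ x → 2 ^ t ∣ x → x + 2 ^ t ≤ j → s.reg (rv d 16) = x →
    s.reg (rv d 17) = (2 ^ t : ℕ) → Runs S (top d) P s T (fun s' => Inv (x + 2 ^ t) s' ∧
      ∀ r, 16 ≤ r → r < 19 → s'.reg (rv d r) = s.reg (rv d r))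

/-- The state between the pieces. -/
structure PieceInv (d : ℕ) (a j : ℕ) (Inv : ℕ → Config → Prop) (x t : ℕ) (s : Config) : Prop where
  inv : Inv x s
  hx : s.reg (rv d 16) = x
  hm : s.reg (rv d 17) = (2 ^ t : ℕ)
  dvd : 2 ^ t ∣ x
  ge : a ≤ x
  le : x ≤ j

section Pieces

variable {a j T : ℕ} {e : Expr} {P : Program} {Inv : ℕ → Config → Prop}

theorem PieceInv.setCounter (R : PieceRule S n d a j e P T Inv) {x t : ℕ}
    (H : PieceInv d a j Inv x t s) (v : ℝ) :
    PieceInv d a j Inv x t (s.setReg (rv d 18) v) :=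
  ⟨R.setReg _ _ _ _ H.inv (by omega) (by omega), by simp [Config.setReg_reg, H.hx],
    by simp [Config.setReg_reg, H.hm], H.dvd, H.ge, H.le⟩

theorem runs_takeProg (R : PieceRule S n d a j e P T Inv) {x t : ℕ}
    (H : PieceInv d a j Inv x t s) :
    Runs S (top d) (takeProg d e P) s (e.cost + 3 + (T + 4) + 1) (fun s' => ∃ x',
      PieceInv d a j Inv x' t s' ∧ s'.reg (rv d 18) = s.reg (rv d 18) ∧
      (x' = x ∧ j < x + 2 ^ t ∨ x' = x + 2 ^ t)) := by
  obtain ⟨-, oe, he⟩ := R.params x s H.inv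
  refine Runs.ifLt R.below (by simp [Expr.Below]) oe ⟨trivial, trivial⟩ (fun hlt => ?_)
    (fun hge => ?_)
  · simp only [Expr.eval, he, H.hx, H.hm] at hlt
    refine Runs.skip (by omega) ?_
    exact ⟨x, H, rfl, .inl ⟨rfl, by exact_mod_cast hlt⟩⟩
  · simp only [Expr.eval, he, H.hx, H.hm, not_lt] at hge
    have hle : x + 2 ^ t ≤ j := by exact_mod_cast hge
    refine Runs.seq ((R.run x t s H.inv H.ge H.dvd hle H.hx H.hm).imp fun s' h => ?_)
    refine Runs.assign (by simp [Expr.Below]) ⟨trivial, trivial⟩ ⟨x + 2 ^ t, ⟨?_, ?_, ?_, ?_, ?_,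
      hle⟩, ?_, .inr rfl⟩
    · exact R.setReg _ _ _ _ h.1 le_rfl (by omega)
    · simp [Config.setReg_reg, Expr.eval, h.2, H.hx, H.hm]
    · simp [Config.setReg_reg, h.2, H.hm]
    · exact dvd_add H.dvd dvd_rfl
    · exact H.ge.trans (Nat.le_add_right _ _)
    · simp [Config.setReg_reg, h.2]

/-- Rounding `x` down to a multiple of `2 ^ (t + 1)` changes it exactly if it is not such a
multiple; the machine has no other test of divisibility. -/
theorem PieceInv.round (hS : j < S) {x t : ℕ} (H : PieceInv d a j Inv x t s) :
    (roundE d).Ok S s ∧ ((roundE d).eval s < (rg d 16).eval s ↔ ¬ 2 ^ (t + 1) ∣ x) := by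
  have e₁ : (Expr.add (rg d 17) (rg d 17)).eval s = (2 ^ (t + 1) : ℕ) := by
    simp [Expr.eval, H.hm, pow_succ]; ring
  have e₂ : (Expr.div (rg d 16) (.add (rg d 17) (rg d 17))).eval s = (x : ℝ) / (2 ^ (t + 1) : ℕ) := by
    rw [Expr.eval, e₁, Expr.eval, H.hx]
  have e₃ : (roundE d).eval s = (2 ^ (t + 1) * (x / 2 ^ (t + 1)) : ℕ) := by
    rw [Expr.eval, e₁, Expr.eval, e₂, Nat.floor_div_eq_div]
    push_cast; rfl
  have hpos : 0 < 2 ^ (t + 1) := Nat.pow_pos two_pos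
  refine ⟨⟨⟨trivial, trivial⟩, ⟨trivial, ⟨trivial, trivial⟩, ?_⟩, ?_⟩, ?_⟩
  · rw [e₁]; exact_mod_cast hpos.ne'
  · rw [e₂]
    refine ⟨by positivity, (div_le_self (Nat.cast_nonneg _) ?_).trans_lt ?_⟩
    · exact_mod_cast hpos
    · exact_mod_cast H.le.trans_lt hS
  · rw [e₃, Expr.eval, H.hx, Nat.cast_lt, Nat.dvd_iff_mod_eq_zero]
    have := Nat.div_add_mod x (2 ^ (t + 1))
    omega

/-- If `x` is an odd multiple of `2 ^ t`, one piece makes it divisible by `2 ^ (t + 1)`, and then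
the length doubles. If the piece does not fit, the length stays, and this remains so in later
rounds. -/
theorem runs_upProg (R : PieceRule S n d a j e P T Inv) (hS : j < S) {x t : ℕ}
    (H : PieceInv d a j Inv x t s) :
    Runs S (top d) (upProg d e P) s
      (((roundE d).cost + 1 + (e.cost + 3 + (T + 4) + 1) + 1) + ((roundE d).cost + (rg d 16).cost + 4 + 1))
      (fun s' => ∃ x' t', PieceInv d a j Inv x' t' s' ∧ s'.reg (rv d 18) = s.reg (rv d 18) ∧
        x ≤ x' ∧ (t' = t + 1 ∨ t' = t ∧ j < x' + 2 ^ t')) := by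
  have hb : (roundE d).Below (top d) := by simp [Expr.Below]
  refine Runs.seq (Runs.imp (Q := fun s' => ∃ x', PieceInv d a j Inv x' t s' ∧
    s'.reg (rv d 18) = s.reg (rv d 18) ∧ x ≤ x' ∧ (2 ^ (t + 1) ∣ x' ∨ j < x' + 2 ^ t)) ?_ ?_)
  · refine Runs.ifLt hb (by simp [Expr.Below]) (H.round hS).1 trivial (fun hlt => ?_)
      (fun hge => ?_)
    · rw [(H.round hS).2] at hlt
      refine (runs_takeProg R H).imp fun s' h => ?_
      obtain ⟨x', H', h18, hcase⟩ := h
      rcases hcase with ⟨rfl, hj⟩ | rfl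
      · exact ⟨x', H', h18, le_rfl, .inr hj⟩
      · refine ⟨_, H', h18, by omega, .inl ?_⟩
        obtain ⟨y, rfl⟩ := H.dvd
        rw [pow_succ] at hlt ⊢
        rw [Nat.mul_dvd_mul_iff_left (Nat.pow_pos two_pos)] at hlt
        rw [← Nat.mul_succ, Nat.mul_dvd_mul_iff_left (Nat.pow_pos two_pos)]
        omega
    · rw [(H.round hS).2, not_not] at hge
      refine Runs.skip (by omega) ?_
      exact ⟨x, H, rfl, le_rfl, .inl hge⟩
  · rintro s' ⟨x', H', h18, hxx, hcase⟩
    refine Runs.ifLt (e := roundE d) (f := rg d 16) (T := 4) hb (by simp [Expr.Below]) (H'.round hS).1 trivial (fun hlt => ?_)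
      (fun hge => ?_)
    · rw [(H'.round hS).2] at hlt
      refine Runs.skip (by omega) ?_
      exact ⟨x', t, H', h18, hxx, .inr ⟨rfl, hcase.resolve_left hlt⟩⟩
    · rw [(H'.round hS).2, not_not] at hge
      refine Runs.assign (by simp [Expr.Below]) ⟨trivial, trivial⟩ ⟨x', t + 1, ⟨?_, ?_, ?_, hge,
        H'.ge, H'.le⟩, ?_, hxx, .inl rfl⟩
      · exact R.setReg _ _ _ _ H'.inv (by omega) (by omega)
      · simp [Config.setReg_reg, H'.hx]
      · simp [Config.setReg_reg, Expr.eval, H'.hm, pow_succ]; ring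
      · simp [Config.setReg_reg, h18]

/-- As less than `2 ^ t` remains, at most one piece of half that length fits, and after it less than
half remains. -/
theorem runs_downProg (R : PieceRule S n d a j e P T Inv) {x t : ℕ}
    (H : PieceInv d a j Inv x t s) (hj : j < x + 2 ^ t) :
    Runs S (top d) (downProg d e P) s (2 + (4 + (e.cost + 3 + (T + 4) + 1)) + 1)
      (fun s' => ∃ x' t', PieceInv d a j Inv x' t' s' ∧ s'.reg (rv d 18) = s.reg (rv d 18) ∧
        t' = t - 1 ∧ j < x' + 2 ^ t') := by
  refine Runs.ifLt trivial (by simp [Expr.Below]) trivial trivial (fun hlt => ?_) (fun hge => ?_)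
  · simp only [Expr.eval, H.hm, Rat.cast_one] at hlt
    obtain ⟨t, rfl⟩ : ∃ t', t = t' + 1 := by
      refine ⟨t - 1, (Nat.sub_add_cancel (Nat.one_le_iff_ne_zero.2 ?_)).symm⟩
      rintro rfl
      simp at hlt
    refine Runs.seq (Runs.assign (by simp [Expr.Below]) ⟨trivial, trivial, by simp [Expr.eval]⟩ ?_)
    set s₁ := s.setReg (rv d 17) ((Expr.div (rg d 17) (.const 2)).eval s) with hs₁
    have H₁ : PieceInv d a j Inv x t s₁ := by
      refine ⟨R.setReg _ _ _ _ H.inv (by omega) (by omega), by simp [hs₁, Config.setReg_reg, H.hx],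
        ?_, (pow_dvd_pow 2 (Nat.le_succ t)).trans H.dvd, H.ge, H.le⟩
      simp [hs₁, Config.setReg_reg, Expr.eval, H.hm, pow_succ]
    have h18₁ : s₁.reg (rv d 18) = s.reg (rv d 18) := by simp [hs₁, Config.setReg_reg]
    refine (runs_takeProg R H₁).imp fun s' h => ?_
    obtain ⟨x', H', h18, hcase⟩ := h
    refine ⟨x', t, H', h18.trans h18₁, rfl, ?_⟩
    rw [pow_succ] at hj
    rcases hcase with ⟨rfl, hj'⟩ | rfl
    · exact hj'
    · omega
  · refine Runs.skip (by omega) ?_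
    have : t = 0 := by
      by_contra h0
      refine hge ?_
      simp only [Expr.eval, H.hm, Rat.cast_one]
      exact_mod_cast Nat.one_lt_two_pow h0
    subst this
    exact ⟨x, 0, H, rfl, rfl, hj⟩

/-- Growing lengths align `x`, and shrinking lengths exhaust the rest, as in a binary expansion.
Each round takes at most one piece, so there are at most `2 * Nat.clog 2 n` of them. -/
theorem runs_piecesProg (d : ℕ) (b e : Expr) : ∃ K : ℕ, ∀ {S n a j T : ℕ} {P : Program}
    {Inv : ℕ → Config → Prop} {s : Config} {Q : Config → Prop},
    PieceRule S n d a j e P T Inv → j < S → j < n → a ≤ j → b.Below (top d) → b.Ok S s →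
    b.eval s = a → Inv a s → (∀ s', Inv j s' → Q s') →
    Runs S (top d) (piecesProg d b e P) s (K * ((Nat.clog 2 n + 1) * (T + 1))) Q := by
  refine ⟨costList [(rv d 16, b), (rv d 17, .const 1)] + (((roundE d).cost + 1 +
    (e.cost + 3 + 4 + 1) + 1) + ((roundE d).cost + 1 + 4 + 1) + 2 + (rg d 5).cost + 8) +
    (2 + (4 + (e.cost + 3 + 4 + 1)) + 2 + (rg d 5).cost + 8),
    fun {S n a j T P Inv s Q} R hS hn haj hb ob he h₀ hQ => ?_⟩
  refine Runs.le (T := costList [(rv d 16, b), (rv d 17, .const 1)] +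
    ((Nat.clog 2 n + 1) * ((((roundE d).cost + 1 + (e.cost + 3 + (T + 4) + 1) + 1) +
      ((roundE d).cost + 1 + 4 + 1)) + (rg d 5).cost + 8) +
    (Nat.clog 2 n + 1) * ((2 + (4 + (e.cost + 3 + (T + 4) + 1)) + 1) + (rg d 5).cost + 8)))
    ?key ?bound
  case key =>
    refine Runs.seq (Runs.assigns ⟨hb, trivial, trivial⟩ ⟨ob, trivial, trivial⟩ (Runs.seq ?_))
    refine Runs.forLt (m := Nat.clog 2 n) (fun k s' => s'.reg (rv d 18) = k ∧
      ∃ x t, PieceInv d a j Inv x t s' ∧ t ≤ k ∧ (t = k ∨ j < x + 2 ^ t))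
      (by simp) (by simp [Expr.Below]) ?_ ?_ ?_ ?_
    · refine ⟨by simp [Config.setReg_reg], a, 0, PieceInv.setCounter R ?_ _, le_rfl, .inl rfl⟩
      refine ⟨R.setReg _ _ _ _ (R.setReg _ _ _ _ h₀ le_rfl (by omega)) (by omega) (by omega), ?_, ?_,
        by simp, le_rfl, haj⟩
      · simp [evalList, Config.setReg_reg, he]
      · simp [evalList, Config.setReg_reg, Expr.eval]
    · rintro k s' ⟨hk, x, t, H, -⟩
      exact ⟨hk, trivial, (R.params x s' H.inv).1⟩
    · rintro k s' hk ⟨h18, x, t, H, htk, hcase⟩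
      refine (runs_upProg R hS H).imp ?_
      rintro s'' ⟨x', t', H', h18', hxx, hcase'⟩
      refine ⟨h18'.trans h18, by simp [Config.setReg_reg], x', t', H'.setCounter R _, ?_, ?_⟩
      · rcases hcase' with rfl | ⟨rfl, -⟩ <;> omega
      · rcases hcase' with rfl | ⟨rfl, hj⟩
        · rcases hcase with rfl | hj
          · exact .inl rfl
          · rw [pow_succ]; right; omega
        · exact .inr hj
    rintro s₁ ⟨-, x, t, H, htk, hcase⟩
    -- Either a piece has failed to fit, or all rounds have doubled the length, which is then at
    -- least `n > j`.
    have hj : j < x + 2 ^ t := by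
      rcases hcase with rfl | hj
      · exact (hn.trans_le (Nat.le_pow_clog one_lt_two n)).trans_le (Nat.le_add_left _ _)
      · exact hj
    refine Runs.forLt (m := Nat.clog 2 n) (fun k s' => s'.reg (rv d 18) = k ∧
      ∃ x t, PieceInv d a j Inv x t s' ∧ t ≤ Nat.clog 2 n - k ∧ j < x + 2 ^ t)
      (by simp) (by simp [Expr.Below]) ?_ ?_ ?_ ?_
    · exact ⟨by simp [Config.setReg_reg], x, t, H.setCounter R _, by omega, hj⟩
    · rintro k s' ⟨hk, x, t, H, -⟩
      exact ⟨hk, trivial, (R.params x s' H.inv).1⟩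
    · rintro k s' hk ⟨h18, x, t, H, htk, hj⟩
      refine (runs_downProg R H hj).imp ?_
      rintro s'' ⟨x', t', H', h18', ht', hj'⟩
      exact ⟨h18'.trans h18, by simp [Config.setReg_reg], x', t', H'.setCounter R _, by omega, hj'⟩
    · rintro s' ⟨-, x, t, H, htk, hj⟩
      -- Then `x ≤ j < x + 1`.
      obtain rfl : t = 0 := by omega
      have := H.le
      obtain rfl : x = j := by omega
      exact hQ s' H.inv
  case bound =>
    generalize (roundE d).cost = c₁
    generalize (rg d 5).cost = c₂
    generalize costList [(rv d 16, b), (rv d 17, .const 1)] = c₃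
    generalize Nat.clog 2 n = L
    have h₁ : c₃ ≤ c₃ * ((L + 1) * (T + 1)) :=
      Nat.le_mul_of_pos_right _ (Nat.mul_pos (Nat.succ_pos _) (Nat.succ_pos _))
    have h₂ : ∀ {c c'}, c' ≤ c * (T + 1) → (L + 1) * c' ≤ c * ((L + 1) * (T + 1)) := by
      intro c c' h
      calc (L + 1) * c' ≤ (L + 1) * (c * (T + 1)) := Nat.mul_le_mul_left _ h
        _ = _ := by ring
    refine (Nat.add_le_add h₁ (Nat.add_le_add (h₂ ?_) (h₂ ?_))).trans_eq
      (b := c₃ * ((L + 1) * (T + 1)) + (((c₁ + 1 + (e.cost + 3 + 4 + 1) + 1) + (c₁ + 1 + 4 + 1) + 2 + c₂ +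
        8) * ((L + 1) * (T + 1)) + (2 + (4 + (e.cost + 3 + 4 + 1)) + 2 + c₂ + 8) *
          ((L + 1) * (T + 1)))) (by ring) <;> nlinarith

end Pieces

/-! ### The search for the next parameter -/

/-- One step of the search. -/
def searchList (d : ℕ) (acc : Expr) : List (ℕ × Expr) :=
  [(rv d 33, .minE (.const 1) (.add (rg d 29) (.mul (rg d 32) (rg d 8)))), (rv d 34, acc),
    (rv d 30, .ite (rg d 31) (rg d 34) (rg d 33) (rg d 30)),
    (rv d 31, .maxE (rg d 31) (rg d 34))]

/-- The initial assignments of the search. -/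
def searchInit (p q y : VExpr d) : List (ℕ × Expr) :=
  [(rv d 29, .maxE (rg d 20) (.sub (VExpr.projE p q y)
      (.mul (.mul (.const 11) (rg d 2)) (rg d 8)))), (rv d 30, rg d 20), (rv d 31, .const 0)]

/-- Search for the first candidate that is accepted by the expression `acc`; the current parameter is
in register `20`, and register `21` becomes `1` if there is none. -/
def searchProg (p q y : VExpr d) (acc : Expr) : Program :=
  .seq (assigns (top d) (searchInit p q y))
    (.seq (forLt (top d) (rv d 32) (.add (.mul (.const 21) (rg d 2)) (.const 1))
      (assigns (top d) (searchList d acc)))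
    (assigns (top d) [(rv d 20, rg d 30), (rv d 21, .sub (.const 1) (rg d 31))]))

-- Register 31 records whether a candidate has been accepted. Register 30 is assigned only at the
-- first acceptance, when register 34 exceeds register 31. The loop always inspects all `21 * N + 1`
-- candidates.
open Classical in
theorem runs_searchProg {p q y : VExpr d} {acc : Expr} (hp : p.Below (rv d 29))
    (hq : q.Below (rv d 29)) (hy : y.Below (rv d 29)) (ha : acc.Below (rv d 34)) :
    ∃ K : ℕ, ∀ {S N : ℕ} {s : Config} {A : ℝ → Prop}, s.reg (rv d 2) = N → p.Ok S s → q.Ok S s →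
    y.Ok S s → (∀ s', Agree (rv d 29) s' s → acc.Ok S s' ∧
      acc.eval s' = if A (s'.reg (rv d 33)) then 1 else 0) →
    Runs S (top d) (searchProg p q y acc) s (K * (N + 1)) (fun s' => Agree (rv d 20) s' s ∧
      ((∃ a : ℕ, A (candidate (s.reg (rv d 8)) (max (s.reg (rv d 20))
          (projParam (p.eval s) (q.eval s) (y.eval s) - 11 * N * s.reg (rv d 8))) a) ∧
        (∀ b < a, ¬ A (candidate (s.reg (rv d 8)) (max (s.reg (rv d 20))
          (projParam (p.eval s) (q.eval s) (y.eval s) - 11 * N * s.reg (rv d 8))) b)) ∧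
        s'.reg (rv d 20) = candidate (s.reg (rv d 8)) (max (s.reg (rv d 20))
          (projParam (p.eval s) (q.eval s) (y.eval s) - 11 * N * s.reg (rv d 8))) a ∧
        s'.reg (rv d 21) = 0) ∨
      (∀ a < 21 * N + 1, ¬ A (candidate (s.reg (rv d 8)) (max (s.reg (rv d 20))
          (projParam (p.eval s) (q.eval s) (y.eval s) - 11 * N * s.reg (rv d 8))) a)) ∧
        s'.reg (rv d 21) = 1)) := by
  set cnt : Expr := .add (.mul (.const 21) (rg d 2)) (.const 1)
  set fin : List (ℕ × Expr) := [(rv d 20, rg d 30), (rv d 21, .sub (.const 1) (rg d 31))]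
  refine ⟨costList (searchInit p q y) + 22 * (costList (searchList d acc) + cnt.cost + 8) +
    costList fin, fun {S N s A} hN op oq oy hacc => ?_⟩
  set st := s.reg (rv d 8) with hst
  set base := max (s.reg (rv d 20)) (projParam (p.eval s) (q.eval s) (y.eval s) - 11 * N * st)
    with hbase
  refine Runs.le (T := costList (searchInit p q y) + ((21 * N + 1 + 1) *
    (costList (searchList d acc) + cnt.cost + 8) + costList fin)) ?key ?bound
  case key =>
    have hp' := hp.mono (show rv d 29 ≤ top d by simp)
    have hq' := hq.mono (show rv d 29 ≤ top d by simp)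
    have hy' := hy.mono (show rv d 29 ≤ top d by simp)
    have ha' := Expr.Below.mono (show rv d 34 ≤ top d by simp) _ ha
    refine Runs.seq (Runs.assigns ?_ ?_ (Runs.seq ?_))
    · simp [searchInit, BelowList, Expr.Below, VExpr.below_projE hp' hq' hy']
    · simp [searchInit, OkList, Expr.Ok, VExpr.ok_projE op oq oy]
    refine Runs.forLt (m := 21 * N + 1) (fun k s' => Agree (rv d 29) s' s ∧ s'.reg (rv d 32) = k ∧
      s'.reg (rv d 29) = base ∧ ((s'.reg (rv d 31) = 1 ∧ ∃ a : ℕ, A (candidate st base a) ∧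
        (∀ b < a, ¬ A (candidate st base b)) ∧ s'.reg (rv d 30) = candidate st base a) ∨
        s'.reg (rv d 31) = 0 ∧ ∀ a < k, ¬ A (candidate st base a)))
      (by simp) (by simp [Expr.Below]) ?_ ?_ ?_ ?_
    · refine ⟨⟨fun r hr => ?_, rfl⟩, by simp [Config.setReg_reg], ?_, .inr ⟨?_, by simp⟩⟩
      · have : ∀ j, r ≠ rv d (29 + j) := fun j => (hr.trans_le (by simp)).ne
        simp [searchInit, evalList, Config.setReg_reg, this 0, this 1, this 2, this 3]
      · simp [searchInit, evalList, Config.setReg_reg, Expr.eval, hN, hbase, hst]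
      · simp [searchInit, evalList, Config.setReg_reg, Expr.eval]
    · rintro k s' ⟨hA, h32, -⟩
      refine ⟨h32, by simp [Expr.Ok], ?_⟩
      simp [Expr.eval, hA.1 (rv d 2) (by simp), hN]
    · rintro k s' hk ⟨hA, h32, h29, hcase⟩
      set s₁ := s'.setReg (rv d 33) ((Expr.minE (.const 1) (.add (rg d 29)
        (.mul (rg d 32) (rg d 8)))).eval s') with hs₁
      have hA₁ : Agree (rv d 29) s₁ s := (agree_setReg (by simp) _ _).trans hA
      have hc : s₁.reg (rv d 33) = candidate st base k := by
        simp [hs₁, Config.setReg_reg, Expr.eval, candidate, h29, h32, hA.1 (rv d 8) (by simp), hst]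
      obtain ⟨oacc, eacc⟩ := hacc s₁ hA₁
      rw [hc] at eacc
      refine Runs.assigns ?_ ?_ ?_
      · simp [searchList, BelowList, Expr.Below, ha']
      · simp only [searchList, OkList, Expr.Ok, Expr.ok_minE, Expr.ok_maxE, true_and, and_true,
          implies_true]
        exact oacc
      have ev : ∀ r, (evalList (searchList d acc) s').reg (rv d r) =
          if r = 31 then max (s'.reg (rv d 31)) (if A (candidate st base k) then 1 else 0)
          else if r = 30 then (if s'.reg (rv d 31) < (if A (candidate st base k) then 1 else 0)
            then candidate st base k else s'.reg (rv d 30))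
          else if r = 34 then (if A (candidate st base k) then 1 else 0)
          else if r = 33 then candidate st base k else s'.reg (rv d r) := by
        intro r
        have : evalList (searchList d acc) s' = (((s₁.setReg (rv d 34) (acc.eval s₁)).setReg
          (rv d 30) ((Expr.ite (rg d 31) (rg d 34) (rg d 33) (rg d 30)).eval
          (s₁.setReg (rv d 34) (acc.eval s₁))))).setReg (rv d 31) (max (s'.reg (rv d 31))
            (acc.eval s₁)) := by
          simp [searchList, evalList, Config.setReg_reg, Expr.eval, hs₁]
        rw [this, eacc]
        simp only [Config.setReg_reg, rv_inj, Expr.eval, Nat.reduceEqDiff, if_true, if_false, hc]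
        split_ifs <;> simp_all [Config.setReg_reg]
      have h32' : (evalList (searchList d acc) s').reg (rv d 32) = k := by
        rw [ev]; simpa using h32
      refine ⟨h32', ⟨fun r hr => ?_, hA.2⟩, by simp [Config.setReg_reg], ?_, ?_⟩
      · have : ∀ j, r ≠ rv d (29 + j) := fun j => (hr.trans_le (by simp)).ne
        simp [searchList, evalList, Config.setReg_reg, this 1, this 2, this 3, this 4, this 5,
          hA.1 r hr]
      · simp [Config.setReg_reg, ev, h29]
      · simp only [Config.setReg_reg, rv_inj, Nat.reduceEqDiff, if_false, ev, if_true]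
        rcases hcase with ⟨h31, a, h₁, h₂, h₃⟩ | ⟨h31, hno⟩
        · refine .inl ⟨?_, a, h₁, h₂, ?_⟩
          · rw [h31]; split_ifs <;> simp
          · rw [h31, if_neg ?_, h₃]
            split_ifs <;> simp
        · by_cases hk' : A (candidate st base k)
          · refine .inl ⟨by simp [hk', h31], k, hk', hno, by simp [hk', h31]⟩
          · refine .inr ⟨by simp [hk', h31], fun a ha => ?_⟩
            rcases (Nat.lt_succ_iff.1 ha).eq_or_lt with rfl | hlt
            · exact hk'
            · exact hno a hlt
    · rintro s' ⟨hA, -, -, hcase⟩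
      refine Runs.assigns (by simp [BelowList, Expr.Below]) (by simp [OkList, Expr.Ok])
        ⟨⟨fun r hr => ?_, hA.2⟩, ?_⟩
      · have : ∀ j, r ≠ rv d (20 + j) := fun j => (hr.trans_le (by simp)).ne
        simp [evalList, Config.setReg_reg, this 0, this 1, hA.1 r (hr.trans (by simp))]
      · rcases hcase with ⟨h31, a, h₁, h₂, h₃⟩ | ⟨h31, hno⟩
        · refine .inl ⟨a, h₁, h₂, ?_, ?_⟩
          · simp [evalList, Config.setReg_reg, Expr.eval, h₃]
          · simp [evalList, Config.setReg_reg, Expr.eval, h31]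
        · exact .inr ⟨hno, by simp [evalList, Config.setReg_reg, Expr.eval, h31]⟩
  case bound =>
    have h₁ : costList (searchInit p q y) ≤ costList (searchInit p q y) * (N + 1) :=
      Nat.le_mul_of_pos_right _ (Nat.succ_pos N)
    have h₂ : costList fin ≤ costList fin * (N + 1) := Nat.le_mul_of_pos_right _ (Nat.succ_pos N)
    have h₃ : (21 * N + 1 + 1) * (costList (searchList d acc) + cnt.cost + 8) ≤
        22 * (costList (searchList d acc) + cnt.cost + 8) * (N + 1) := by
      calc _ ≤ (22 * (N + 1)) * (costList (searchList d acc) + cnt.cost + 8) :=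
            Nat.mul_le_mul_right _ (by omega)
        _ = _ := by ring
    exact (Nat.add_le_add h₁ (Nat.add_le_add h₃ h₂)).trans_eq (by ring)

end RealRAM

end
noncomputable section

open Set

namespace RealRAM

variable {d : ℕ} {S n N J : ℕ} {s : Config} {z : ℕ → EuclideanSpace ℝ (Fin d)}

/-! ### The state of a query -/

/-- The registers that hold the input of a query. -/
structure Role (d : ℕ) where
  (i j u v p q : ℕ)
  hi : i < rv d 0
  hj : j < rv d 0
  hu : u + d ≤ rv d 0
  hv : v + d ≤ rv d 0
  hp : p + d ≤ rv d 0
  hq : q + d ≤ rv d 0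

/-- The point whose coordinates are in the registers from `c` on. -/
abbrev VExpr.regs (d c : ℕ) : VExpr d := fun k => .reg (c + k)

theorem VExpr.below_regs {c W : ℕ} (h : c + d ≤ W) : (VExpr.regs d c).Below W := fun k => by
  have := k.2
  change c + (k : ℕ) < W
  omega

theorem VExpr.ok_regs {c : ℕ} : (VExpr.regs d c).Ok S s := fun _ => trivial

/-- A query for the subcurve from a point `u` on the edge `i` to a point `v` on the edge `j`. -/
structure Query (n N J : ℕ) (z : ℕ → EuclideanSpace ℝ (Fin d)) (r : Role d) (i j : ℕ)
    (u v p q : EuclideanSpace ℝ (Fin d)) (s : Config) : Prop where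
  globals : Globals n N J d s
  data : DataOK n N J z s.mem
  hi : s.reg r.i = i
  hj : s.reg r.j = j
  hu : (VExpr.regs d r.u).eval s = u
  hv : (VExpr.regs d r.v).eval s = v
  hp : (VExpr.regs d r.p).eval s = p
  hq : (VExpr.regs d r.q).eval s = q
  hij : i < j
  hjn : j + 1 < n
  hN : 0 < N
  hJ : 12 * d * N ≤ 2 ^ J
  hd : 0 < d

section

variable {r : Role d} {i j : ℕ} {u v p q : EuclideanSpace ℝ (Fin d)}

theorem Query.congr (H : Query n N J z r i j u v p q s) {s' : Config} (h : Agree (rv d 8) s' s) :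
    Query n N J z r i j u v p q s' := by
  have h0 : rv d 0 ≤ rv d 8 := by simp
  refine ⟨H.globals.congr fun a ha => h.1 a ha, h.2 ▸ H.data, ?_, ?_, ?_, ?_, ?_, ?_, H.hij, H.hjn,
    H.hN, H.hJ, H.hd⟩
  · rw [h.1 _ (r.hi.trans_le h0), H.hi]
  · rw [h.1 _ (r.hj.trans_le h0), H.hj]
  · rw [VExpr.eval_congr h (VExpr.below_regs (r.hu.trans h0)), H.hu]
  · rw [VExpr.eval_congr h (VExpr.below_regs (r.hv.trans h0)), H.hv]
  · rw [VExpr.eval_congr h (VExpr.below_regs (r.hp.trans h0)), H.hp]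
  · rw [VExpr.eval_congr h (VExpr.below_regs (r.hq.trans h0)), H.hq]

theorem Role.below_p (r : Role d) {c : ℕ} : (VExpr.regs d r.p).Below (rv d c) :=
  VExpr.below_regs (r.hp.trans (by simp))

theorem Role.below_q (r : Role d) {c : ℕ} : (VExpr.regs d r.q).Below (rv d c) :=
  VExpr.below_regs (r.hq.trans (by simp))

theorem Role.below_i (r : Role d) {c : ℕ} : r.i < rv d c := r.hi.trans_le (by simp)

theorem Role.below_j (r : Role d) {c : ℕ} : r.j < rv d c := r.hj.trans_le (by simp)

theorem Query.holds (H : Query n N J z r i j u v p q s) : Holds s (vertexBase d n) n z :=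
  H.data.holds s rfl

theorem Query.lt_cells (H : Query n N J z r i j u v p q s) : n < cells d n N J := by
  have h₁ := Nat.le_mul_of_pos_right n H.hd
  unfold cells nodeBase vertexBase
  omega

theorem subVertex_eq {E : Type*} {z : ℕ → E} {i j k : ℕ} {u v : E} (h₁ : i < k) (h₂ : k ≤ j) :
    subVertex z i j u v k = z k := by
  rw [subVertex, if_neg (by omega), if_pos h₂]

theorem subVertex_first {E : Type*} {z : ℕ → E} {i j : ℕ} {u v : E} :
    subVertex z i j u v i = u := by
  rw [subVertex, if_pos le_rfl]

theorem subVertex_last {E : Type*} {z : ℕ → E} {i j : ℕ} {u v : E} (h : i < j) :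
    subVertex z i j u v (j + 1) = v := by
  rw [subVertex, if_neg (by omega), if_neg (by omega)]

/-- The vertex after the first edge. -/
abbrev startV (r : Role d) : VExpr d := vx d (.add (.reg r.i) (.const 1))

/-- The vertex in register `16`. -/
abbrev oldV (d : ℕ) : VExpr d := vx d (rg d 16)

/-- The last vertex of the current piece. -/
abbrev newV (d : ℕ) : VExpr d := vx d (.add (rg d 16) (rg d 17))

/-- The address of the description of the current piece. -/
abbrev nodeE (d : ℕ) : Expr :=
  .add (rg d 1) (.mul (.add (.mul (.const 2) (rg d 16)) (rg d 17)) (rg d 6))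

theorem below_startV {c : ℕ} (hc : 0 < c) : (startV r).Below (rv d c) :=
  below_vx hc ⟨r.below_i, trivial⟩

theorem Query.startV (H : Query n N J z r i j u v p q s) :
    (startV r).Ok (cells d n N J) s ∧ (RealRAM.startV r).eval s = z (i + 1) :=
  vx_spec H.globals H.holds (by simp [Expr.eval, H.hi]) (by have := H.hij; have := H.hjn; omega)
    ⟨trivial, trivial⟩

theorem Query.oldV (H : Query n N J z r i j u v p q s) {x : ℕ} (hx : s.reg (rv d 16) = x)
    (hj : x ≤ j) : (oldV d).Ok (cells d n N J) s ∧ (RealRAM.oldV d).eval s = z x :=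
  vx_spec H.globals H.holds hx (by have := H.hjn; omega) trivial

theorem Query.newV (H : Query n N J z r i j u v p q s) {x m : ℕ} (hx : s.reg (rv d 16) = x)
    (hm : s.reg (rv d 17) = m) (hj : x + m ≤ j) :
    (newV d).Ok (cells d n N J) s ∧ (RealRAM.newV d).eval s = z (x + m) :=
  vx_spec H.globals H.holds (by simp [Expr.eval, hx, hm]) (by have := H.hjn; omega)
    ⟨trivial, trivial⟩

theorem Query.nodeE (H : Query n N J z r i j u v p q s) {x m : ℕ} (hx : s.reg (rv d 16) = x)
    (hm : s.reg (rv d 17) = m) : (nodeE d).eval s = nodeAddr d n N J x m := by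
  simp [Expr.eval, H.globals.nb, H.globals.ns, hx, hm, nodeAddr]

theorem Query.ok_loadNode (H : Query n N J z r i j u v p q s) {x m : ℕ}
    (hx : s.reg (rv d 16) = x) (hm : s.reg (rv d 17) = m) (hm0 : 0 < m) (hj : x + m ≤ j) :
    (Expr.load (RealRAM.nodeE d)).Ok (cells d n N J) s :=
  ⟨by simp [Expr.Ok], _, nodeAddr_lt (k := 0) (by have := H.hjn; omega) hm0
    (by unfold nodeCells; omega), H.nodeE hx hm⟩

theorem Query.nodeOK (H : Query n N J z r i j u v p q s) {x t : ℕ} (ht : 2 ^ t ∣ x)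
    (hj : x + 2 ^ t ≤ j) : NodeOK N J z s.mem (nodeAddr d n N J x (2 ^ t)) x (2 ^ t) :=
  H.data.nodes t x ht (by have := H.hjn; omega)

/-! ### A constant-factor approximation -/

/-- The initial assignments of the computation of the approximation. -/
def boundInit (r : Role d) : List (ℕ × Expr) :=
  [(rv d 20, .const 0), (rv d 21, .const 0),
    (rv d 22, .maxE (VExpr.distE (VExpr.regs d r.u) (VExpr.regs d r.p))
      (VExpr.distE (VExpr.regs d r.v) (VExpr.regs d r.q))), (rv d 19, .const 0)]

/-- The final result of the computation of the approximation. -/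
def boundE (r : Role d) : Expr :=
  .maxE (VExpr.distE (VExpr.regs d r.u) (VExpr.regs d r.p)) (.maxE (rg d 22)
    (.maxE (.div (rg d 21) (.const 2)) (.div (rg d 19) (.const 6))))

/-- Process one piece. -/
def boundPiece (r : Role d) : Program :=
  .seq (assign (top d) (rv d 19) (.maxE (rg d 19) (.load (nodeE d))))
    (assigns (top d) (scanList 20 (VExpr.regs d r.p) (VExpr.regs d r.q) (newV d)))

/-- Compute a lower bound of the distance, which is tight up to a constant, in register `9`. -/
def boundProg (r : Role d) : Program :=
  .seq (assigns (top d) (boundInit r))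
    (.seq (assigns (top d) (scanList 20 (VExpr.regs d r.p) (VExpr.regs d r.q) (startV r)))
    (.seq (piecesProg d (.add (.reg r.i) (.const 1)) (.reg r.j) (boundPiece r))
      (assign (top d) (rv d 9) (boundE r))))

/-- The number `A` is a lower bound of the distance, which is tight up to a constant. -/
structure IsBound (w : ℕ → EuclideanSpace ℝ (Fin d)) (i j : ℕ) (p q : EuclideanSpace ℝ (Fin d))
    (A : ℝ) : Prop where
  first : dist (w i) p ≤ A
  last : dist (w (j + 1)) q ≤ A
  upper : Traverse w i (j + 1) p q 0 1 (9 * A)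
  lower : ∀ δ, Traverse w i (j + 1) p q 0 1 δ → A ≤ δ

/-- Each of the numbers `D`, `B / 2` and `R / 6` is a lower bound, while the scan attains `D + B + R
≤ A + 2 * A + 6 * A`; hence 9. -/
theorem ScanInv.isBound {w : ℕ → EuclideanSpace ℝ (Fin d)} {M B D R : ℝ}
    (H : ScanInv w i (j + 1) p q j M B D R) (hij : i ≤ j) :
    IsBound w i j p q (max (dist (w i) p) (max D (max (B / 2) (R / 6)))) := by
  set A := max (dist (w i) p) (max D (max (B / 2) (R / 6)))
  have h₁ : D ≤ A := (le_max_left _ _).trans (le_max_right _ _)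
  have h₂ : B / 2 ≤ A := (le_max_left _ _).trans ((le_max_right _ _).trans (le_max_right _ _))
  have h₃ : R / 6 ≤ A := (le_max_right _ _).trans ((le_max_right _ _).trans (le_max_right _ _))
  refine ⟨le_max_left _ _, H.last.trans h₁, (H.finish hij).mono (by linarith), ?_⟩
  rintro δ ⟨σ, hσ⟩
  obtain ⟨a, b, c, -⟩ := H.lower δ σ hσ
  refine max_le (hσ.first (by omega)) (max_le a (max_le ?_ ?_)) <;> linarith

/-- The scan over piece ends only: a canonical piece counts as a single step with the stored `R` as
its shortcut error. The partial edges at `u` and `v` are handled by one extra step at the start and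
by `finish`. -/
theorem runs_boundProg (r : Role d) : ∃ K : ℕ, ∀ {n N J : ℕ}
    {z : ℕ → EuclideanSpace ℝ (Fin d)} {i j : ℕ} {u v p q : EuclideanSpace ℝ (Fin d)}
    {s : Config}, Query n N J z r i j u v p q s →
    Runs (cells d n N J) (top d) (boundProg r) s (K * (Nat.clog 2 n + 1)) (fun s' =>
      Agree (rv d 8) s' s ∧
        IsBound (subVertex z i j u v) i j p q (s'.reg (rv d 9))) := by
  obtain ⟨K, hK⟩ := runs_piecesProg d (.add (.reg r.i) (.const 1)) (.reg r.j)
  set cp := ((Expr.maxE (rg d 19) (.load (nodeE d))).cost + 1) +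
    costList (scanList 20 (VExpr.regs d r.p) (VExpr.regs d r.q) (newV d))
  set cs := costList (scanList 20 (VExpr.regs d r.p) (VExpr.regs d r.q) (startV r))
  refine ⟨costList (boundInit r) + cs + K * (cp + 1) + ((boundE r).cost + 1),
    fun {n N J z i j u v p q s} H => ?_⟩
  refine Runs.le (T := costList (boundInit r) + (cs + (K * ((Nat.clog 2 n + 1) * (cp + 1)) +
    ((boundE r).cost + 1)))) ?key ?bound
  case key =>
    have bu : (VExpr.regs d r.u).Below (top d) := VExpr.below_regs (r.hu.trans (by simp))
    have bv : (VExpr.regs d r.v).Below (top d) := VExpr.below_regs (r.hv.trans (by simp))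
    have hij := H.hij
    have hjn := H.hjn
    set w := subVertex z i j u v with hw
    have wi : w i = u := subVertex_first
    have wj : w (j + 1) = v := subVertex_last hij
    have wk : ∀ {k}, i < k → k ≤ j → w k = z k := fun h₁ h₂ => subVertex_eq h₁ h₂
    refine Runs.seq (Runs.assigns ?_ ?_ (Runs.seq ?_))
    · simp [boundInit, BelowList, Expr.Below, VExpr.below_distE bu r.below_p,
        VExpr.below_distE bv r.below_q]
    · simp [boundInit, OkList, Expr.Ok, VExpr.ok_distE VExpr.ok_regs VExpr.ok_regs]
    set s₁ := evalList (boundInit r) s with hs₁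
    have A₁ : Agree (rv d 16) s₁ s := by
      refine ⟨fun a ha => ?_, rfl⟩
      have : ∀ j, a ≠ rv d (16 + j) := fun j => (ha.trans_le (by simp)).ne
      simp [hs₁, boundInit, evalList, Config.setReg_reg, this 3, this 4, this 5, this 6]
    have H₁ := H.congr (A₁.mono (by simp))
    have e20 : s₁.reg (rv d 20) = 0 := by
      simp [hs₁, boundInit, evalList, Config.setReg_reg, Expr.eval]
    have e21 : s₁.reg (rv d 21) = 0 := by
      simp [hs₁, boundInit, evalList, Config.setReg_reg, Expr.eval]
    have e19 : s₁.reg (rv d 19) = 0 := by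
      simp [hs₁, boundInit, evalList, Config.setReg_reg, Expr.eval]
    have e22 : s₁.reg (rv d 22) = max (dist (w i) p) (dist (w (j + 1)) q) := by
      have ag : Agree (rv d 0) ((s.setReg (rv d 20) 0).setReg (rv d 21) 0) s :=
        (agree_setReg (by simp) _ _).trans (agree_setReg (by simp) _ _)
      have : s₁.reg (rv d 22) = max (dist ((VExpr.regs d r.u).eval
          ((s.setReg (rv d 20) 0).setReg (rv d 21) 0)) ((VExpr.regs d r.p).eval
          ((s.setReg (rv d 20) 0).setReg (rv d 21) 0))) (dist ((VExpr.regs d r.v).eval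
          ((s.setReg (rv d 20) 0).setReg (rv d 21) 0)) ((VExpr.regs d r.q).eval
          ((s.setReg (rv d 20) 0).setReg (rv d 21) 0))) := by
        simp [hs₁, boundInit, evalList, Config.setReg_reg, Expr.eval]
      rw [this, VExpr.eval_congr ag (VExpr.below_regs r.hu),
        VExpr.eval_congr ag (VExpr.below_regs r.hv), VExpr.eval_congr ag (VExpr.below_regs r.hp),
        VExpr.eval_congr ag (VExpr.below_regs r.hq), H.hu, H.hv, H.hp, H.hq, wi, wj]
    clear_value s₁
    have I₁ := ScanInv.start (z := w) (l := i) (h := j + 1) (p := p) (q := q) (by omega) e22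
    refine runs_scanList r.below_p r.below_q (below_startV (by simp)) VExpr.ok_regs VExpr.ok_regs
      H₁.startV.1 (by simp) fun s₂ t ht hA h₁ h₂ h₃ => ?_
    rw [H₁.hp, H₁.hq, H₁.startV.2] at ht h₃
    rw [H₁.hp, H₁.hq] at h₂
    -- The step from `u` to the next vertex is a straight edge and has no shortcut error.
    have I₂ := I₁.step (k := i + 1) (t := t) (r := 0) le_rfl (by omega) (by omega)
      (by rw [wk (by omega) hij]; exact ht) (traverse_edge w i)
      (fun p' q' δ hT => by have := hT.nonneg (by omega); linarith)
    rw [wk (by omega) hij, max_self] at I₂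
    rw [e20] at h₁ h₂
    rw [e21] at h₂
    simp only [Nat.reduceAdd] at h₂ h₃
    rw [← h₃, ← h₂, ← h₁] at I₂
    refine Runs.seq ?_
    refine hK (n := n) (a := i + 1) (j := j) (T := cp) (Inv := fun x s' => Agree (rv d 8) s' s ∧
      ScanInv w i (j + 1) p q x (s'.reg (rv d 20)) (s'.reg (rv d 21)) (s'.reg (rv d 22))
        (s'.reg (rv d 19))) ⟨?_, ?_, ?_, ?_⟩ (by have := H.lt_cells; omega) (by omega) hij
      ⟨r.below_i, trivial⟩ ⟨trivial, trivial⟩ ?_ ?_ ?_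
    · exact r.below_j
    · rintro x s' a c ⟨hA', I⟩ ha ha'
      refine ⟨(agree_setReg (by simp; omega) _ _).trans hA', ?_⟩
      have h19 : 19 ≠ a := by omega
      have h20 : 20 ≠ a := by omega
      have h21 : 21 ≠ a := by omega
      have h22 : 22 ≠ a := by omega
      simpa [Config.setReg_reg, h19, h20, h21, h22] using I
    · rintro x s' ⟨hA', -⟩
      have H' := H.congr hA'
      exact ⟨H'.globals.hL, trivial, H'.hj⟩
    · rintro x t' s' ⟨hA', I⟩ hax hdvd hxj hx hm
      have H' := H.congr hA'
      have h2 : 0 < 2 ^ t' := Nat.pow_pos two_pos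
      refine Runs.seq (Runs.assign (by simp [Expr.Below]) ?_ ?_)
      · exact (Expr.ok_maxE _ _).2 ⟨trivial, H'.ok_loadNode hx hm h2 hxj⟩
      set R := s'.mem (nodeAddr d n N J x (2 ^ t')) with hR
      have eR : (Expr.maxE (rg d 19) (.load (nodeE d))).eval s' = max (s'.reg (rv d 19)) R := by
        rw [Expr.eval_maxE, Expr.eval, Expr.eval, H'.nodeE hx hm, Nat.floor_natCast]
      rw [eR]
      set s₃ := s'.setReg (rv d 19) (max (s'.reg (rv d 19)) R) with hs₃
      have A₃ : Agree (rv d 19) s₃ s' := agree_setReg (by simp) _ _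
      have H₃ := H'.congr (A₃.mono (by simp))
      have hx₃ : s₃.reg (rv d 16) = x := by rw [A₃.1 _ (by simp), hx]
      have hm₃ : s₃.reg (rv d 17) = (2 ^ t' : ℕ) := by rw [A₃.1 _ (by simp), hm]
      have v₃ := H₃.newV hx₃ hm₃ hxj
      have hC := (H'.nodeOK hdvd hxj).1
      refine runs_scanList r.below_p r.below_q (below_vx (by simp) (by simp [Expr.Below]))
        VExpr.ok_regs VExpr.ok_regs v₃.1 (by simp) fun s₄ t ht hA₄ h₁ h₂ h₃ => ⟨⟨?_, ?_⟩, ?_⟩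
      · exact ((hA₄.mono (by simp)).trans (A₃.mono (by simp))).trans hA'
      · rw [H₃.hp, H₃.hq, v₃.2] at ht h₃
        rw [H₃.hp, H₃.hq] at h₂
        have hcg : ∀ k ∈ Icc x (x + 2 ^ t'), z k = w k := fun k hk =>
          (wk (by have := hk.1; omega) (hk.2.trans hxj)).symm
        have I₄ := I.step (k := x + 2 ^ t') (t := t) (r := R) (by omega) (by omega) (by omega)
          (by rw [wk (by omega) hxj]; exact ht)
          (by
            rw [← hcg x ⟨le_rfl, by omega⟩, ← hcg (x + 2 ^ t') ⟨by omega, le_rfl⟩]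
            exact hC.1.congr hcg)
          (fun p' q' δ hT => hC.2 p' q' δ (hT.congr fun k hk => (hcg k hk).symm))
        rw [wk (by omega) hxj] at I₄
        have e0 : ∀ {a}, 19 ≠ a → s₃.reg (rv d a) = s'.reg (rv d a) := fun ha => by
          simp [hs₃, Config.setReg_reg, ha.symm]
        have e9 : s₄.reg (rv d 19) = max (s'.reg (rv d 19)) R := by
          rw [hA₄.1 _ (by simp)]; simp [hs₃, Config.setReg_reg]
        simp only [Nat.reduceAdd] at h₂ h₃
        rw [e0 (by omega)] at h₁ h₃
        rw [e0 (by omega), e0 (by omega)] at h₂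
        rwa [← h₃, ← h₂, ← h₁, ← e9] at I₄
      · intro a ha ha'
        rw [hA₄.1 _ (by simp; omega), A₃.1 _ (by simp; omega)]
    · rw [Expr.eval, Expr.eval, (H₁.congr (hA.mono (by simp))).hi]
      simp [Expr.eval]
    · refine ⟨(hA.mono (by simp)).trans (A₁.mono (by simp)), ?_⟩
      rwa [hA.1 (rv d 19) (by simp), e19]
    · rintro s₅ ⟨hA₅, I₅⟩
      have H₅ := H.congr hA₅
      refine Runs.assign ?_ ?_ ⟨(agree_setReg (by simp) _ _).trans hA₅, ?_⟩
      · simp [boundE, Expr.Below, VExpr.below_distE bu r.below_p]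
      · simp [boundE, Expr.Ok, VExpr.ok_distE VExpr.ok_regs VExpr.ok_regs, Expr.eval]
      · have : (boundE r).eval s₅ = max (dist (w i) p) (max (s₅.reg (rv d 22))
            (max (s₅.reg (rv d 21) / 2) (s₅.reg (rv d 19) / 6))) := by
          simp only [boundE, Expr.eval_maxE, VExpr.eval_distE, H₅.hu, H₅.hp, Expr.eval, wi]
          norm_num
        rw [Config.setReg_reg, if_pos rfl, this]
        exact ScanInv.isBound I₅ hij.le
  case bound =>
    generalize Nat.clog 2 n = L
    generalize hb : (boundE r).cost + 1 = c₁
    have h₁ : costList (boundInit r) ≤ costList (boundInit r) * (L + 1) :=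
      Nat.le_mul_of_pos_right _ (Nat.succ_pos _)
    have h₂ : cs ≤ cs * (L + 1) := Nat.le_mul_of_pos_right _ (Nat.succ_pos _)
    have h₃ : c₁ ≤ c₁ * (L + 1) := Nat.le_mul_of_pos_right _ (Nat.succ_pos _)
    calc _ ≤ costList (boundInit r) * (L + 1) + (cs * (L + 1) + (K * ((L + 1) * (cp + 1)) +
          c₁ * (L + 1))) := by omega
      _ = _ := by ring

end

end RealRAM

end
noncomputable section

open Set

namespace RealRAM

variable {d : ℕ} {S n N J : ℕ} {s : Config} {z : ℕ → EuclideanSpace ℝ (Fin d)}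

section

variable {r : Role d} {i j : ℕ} {u v p q : EuclideanSpace ℝ (Fin d)}

/-! ### The test of a piece -/

/-- Double the scale in register `25`, and count in register `26`, until the bound in register `9`
has been reached. -/
def scaleProg (d : ℕ) : Program :=
  .seq (assigns (top d) [(rv d 25, rg d 24), (rv d 26, .const 0)])
    (forLt (top d) (rv d 27) (rg d 4) (assigns (top d)
      [(rv d 26, .ite (rg d 25) (rg d 9) (.add (rg d 26) (.const 1)) (rg d 26)),
        (rv d 25, .ite (rg d 25) (rg d 9) (.add (rg d 25) (rg d 25)) (rg d 25))]))

/-- The scale is doubled only while it is below `A`, so it ends up at least `A`, unless the scales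
are exhausted. A doubled value is below `2 * A`, and the initial `R` is at most `54 * A`. -/
theorem runs_scaleProg (d : ℕ) : ∃ K : ℕ, ∀ {S J : ℕ} {s : Config} {R A : ℝ},
    s.reg (rv d 4) = J → s.reg (rv d 24) = R → s.reg (rv d 9) = A → 0 ≤ A → R ≤ 54 * A →
    Runs S (top d) (scaleProg d) s (K * (J + 1)) (fun s' => Agree (rv d 25) s' s ∧
      ∃ l ≤ J, s'.reg (rv d 26) = l ∧ s'.reg (rv d 25) = 2 ^ l * R ∧ 2 ^ l * R ≤ 54 * A ∧
        (A ≤ 2 ^ l * R ∨ l = J)) := by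
  set li : List (ℕ × Expr) := [(rv d 25, rg d 24), (rv d 26, .const 0)]
  set lb : List (ℕ × Expr) :=
      [(rv d 26, .ite (rg d 25) (rg d 9) (.add (rg d 26) (.const 1)) (rg d 26)),
        (rv d 25, .ite (rg d 25) (rg d 9) (.add (rg d 25) (rg d 25)) (rg d 25))]
  refine ⟨costList li + (costList lb + (rg d 4).cost + 8), fun {S J s R A} hJ hR hA hA0 hRA => ?_⟩
  refine Runs.le (T := costList li + (J + 1) * (costList lb + (rg d 4).cost + 8)) ?key ?bound
  case key =>
    refine Runs.seq (Runs.assigns (by simp [BelowList, Expr.Below])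
      (by simp [OkList, Expr.Ok]) ?_)
    refine Runs.forLt (m := J) (fun k s' => Agree (rv d 25) s' s ∧ s'.reg (rv d 27) = k ∧
      ∃ l ≤ k, s'.reg (rv d 26) = l ∧ s'.reg (rv d 25) = 2 ^ l * R ∧ 2 ^ l * R ≤ 54 * A ∧
        (A ≤ 2 ^ l * R ∨ l = k)) (by simp) (by simp [Expr.Below]) ?_ ?_ ?_ ?_
    · refine ⟨⟨fun a ha => ?_, rfl⟩, by simp [Config.setReg_reg], 0, le_rfl, ?_, ?_, by simpa,
        .inr rfl⟩
      · have : ∀ j, a ≠ rv d (25 + j) := fun j => (ha.trans_le (by simp)).ne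
        simp [evalList, Config.setReg_reg, this 0, this 1, this 2]
      · simp [evalList, Config.setReg_reg, Expr.eval]
      · simp [evalList, Config.setReg_reg, Expr.eval, hR]
    · rintro k s' ⟨hA', h27, -⟩
      exact ⟨h27, trivial, by rw [Expr.eval, hA'.1 _ (by simp), hJ]⟩
    · rintro k s' hk ⟨hA', h27, l, hl, h26, h25, h6, hcase⟩
      have h9 : s'.reg (rv d 9) = A := by rw [hA'.1 _ (by simp), hA]
      refine Runs.assigns (by simp [BelowList, Expr.Below]) (by simp [OkList, Expr.Ok])
        ⟨by simp [evalList, Config.setReg_reg, h27], ⟨fun a ha => ?_, hA'.2⟩,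
          by simp [Config.setReg_reg], ?_⟩
      · have : ∀ j, a ≠ rv d (25 + j) := fun j => (ha.trans_le (by simp)).ne
        simp [evalList, Config.setReg_reg, this 0, this 1, this 2, hA'.1 a ha]
      · by_cases hlt : 2 ^ l * R < A
        · refine ⟨l + 1, by omega, ?_, ?_, ?_, .inr ?_⟩
          · simp [evalList, Config.setReg_reg, Expr.eval, h26, h25, h9, hlt]
          · simp [evalList, Config.setReg_reg, Expr.eval, h25, h9, hlt, pow_succ]; ring
          · rw [pow_succ]; linarith
          · rw [hcase.resolve_left (not_le.2 hlt)]
        · refine ⟨l, by omega, ?_, ?_, h6, .inl (not_lt.1 hlt)⟩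
          · simp [evalList, Config.setReg_reg, Expr.eval, h26, h25, h9, hlt]
          · simp [evalList, Config.setReg_reg, Expr.eval, h25, h9, hlt]
    · rintro s' ⟨hA', -, h⟩
      exact ⟨hA', h⟩
  case bound =>
    have h₁ : costList li ≤ costList li * (J + 1) := Nat.le_mul_of_pos_right _ (Nat.succ_pos J)
    exact (Nat.add_le_add_right h₁ _).trans_eq (by ring)

/-- The tolerance. -/
abbrev tolE (d : ℕ) : Expr := .div (rg d 9) (rg d 2)

/-- The threshold with its tolerance. -/
abbrev thrE (d : ℕ) : Expr := .add (rg d 10) (tolE d)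

/-- The point of the segment with the parameter in register `c`. -/
abbrev pointV (r : Role d) (c : ℕ) : VExpr d :=
  VExpr.lerp (VExpr.regs d r.p) (VExpr.regs d r.q) (rg d c)

/-- Test whether the first edge can be matched. -/
def firstAcc (r : Role d) : Expr :=
  .ite (thrE d) (VExpr.distE (startV r) (pointV r 33)) (.const 0) (.const 1)

/-- The position of an entry in the description of the current piece. -/
def entryE (r : Role d) : Expr :=
  .add (.mul (rg d 26) (.mul (rg d 7) (rg d 7)))
    (.add (.mul (VExpr.gridIndex (oldV d) (rg d 25) (rg d 2) (rg d 3) (pointV r 20)) (rg d 7))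
      (VExpr.gridIndex (newV d) (rg d 25) (rg d 2) (rg d 3) (pointV r 33)))

/-- Test whether the current piece can be matched. -/
def pieceAcc (r : Role d) : Expr :=
  .ite (thrE d) (VExpr.distE (newV d) (pointV r 33)) (.const 0)
    (.ite (tolE d) (rg d 24)
      (.ite (.add (.add (thrE d) (.mul (.const d) (.div (rg d 25) (rg d 2))))
        (.div (rg d 25) (rg d 2))) (.load (.add (.add (nodeE d) (.const 1)) (entryE r)))
        (.const 0) (.const 1)) (.const 1))

theorem below_pointV (r : Role d) {c W : ℕ} (h : c < W) : (pointV r c).Below (rv d W) :=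
  VExpr.below_lerp r.below_p r.below_q (by simpa [Expr.Below])

theorem ok_pointV (r : Role d) {c : ℕ} : (pointV r c).Ok S s :=
  VExpr.ok_lerp VExpr.ok_regs VExpr.ok_regs trivial

theorem Query.pointV (H : Query n N J z r i j u v p q s) {c : ℕ} :
    (pointV r c).eval s = AffineMap.lineMap p q (s.reg (rv d c)) := by
  rw [VExpr.eval_lerp, H.hp, H.hq, Expr.eval]

/-- The parameters of the test for a threshold `δ`. -/
structure TestParams (N : ℕ) (p q : EuclideanSpace ℝ (Fin d)) (A st δ : ℝ) : Prop where
  pos : 0 < A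
  st_pos : 0 < st
  st_mul : st * dist p q ≤ A / N
  st_cases : dist p q = 0 ∧ st = 1 ∨ A ≤ N * st * dist p q ∧ 0 < dist p q
  ge : A ≤ δ
  le : δ ≤ 10 * A

/-- The state of the test for a threshold `δ`. -/
structure TestState (n N J : ℕ) (z : ℕ → EuclideanSpace ℝ (Fin d)) (r : Role d) (i j : ℕ)
    (u v p q : EuclideanSpace ℝ (Fin d)) (A st δ : ℝ) (s : Config) : Prop where
  query : Query n N J z r i j u v p q s
  params : TestParams N p q A st δ
  hst : s.reg (rv d 8) = st
  hA : s.reg (rv d 9) = A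
  hδ : s.reg (rv d 10) = δ

variable {A st δ : ℝ}

theorem TestState.congr (H : TestState n N J z r i j u v p q A st δ s) {s' : Config}
    (h : Agree (rv d 11) s' s) : TestState n N J z r i j u v p q A st δ s' :=
  ⟨H.query.congr (h.mono (by simp)), H.params, by rw [h.1 _ (by simp), H.hst],
    by rw [h.1 _ (by simp), H.hA], by rw [h.1 _ (by simp), H.hδ]⟩

theorem TestState.tol (H : TestState n N J z r i j u v p q A st δ s) :
    (tolE d).eval s = A / N := by
  rw [Expr.eval, Expr.eval, Expr.eval, H.hA, H.query.globals.hN]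

theorem TestState.thr (H : TestState n N J z r i j u v p q A st δ s) :
    (thrE d).eval s = δ + A / N := by
  rw [Expr.eval, H.tol, Expr.eval, H.hδ]

theorem TestState.ok_tol (H : TestState n N J z r i j u v p q A st δ s) : (tolE d).Ok S s := by
  refine ⟨trivial, trivial, ?_⟩
  rw [Expr.eval, H.query.globals.hN]
  exact_mod_cast H.query.hN.ne'

theorem TestParams.tol_le (H : TestParams N p q A st δ) (hN : 0 < N) :
    0 < A / N ∧ A / N ≤ A := by
  have : (1 : ℝ) ≤ N := by exact_mod_cast hN
  exact ⟨div_pos H.pos (by linarith), div_le_self H.pos.le this⟩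

open Classical in
theorem TestState.firstAcc (H : TestState n N J z r i j u v p q A st δ s) :
    (firstAcc r).Ok (cells d n N J) s ∧ (RealRAM.firstAcc r).eval s =
      if dist (z (i + 1)) (AffineMap.lineMap p q (s.reg (rv d 33))) ≤ δ + A / N
        then 1 else 0 := by
  have v := H.query.startV
  refine ⟨⟨⟨trivial, H.ok_tol⟩, VExpr.ok_distE v.1 (ok_pointV r), fun _ => trivial,
    fun _ => trivial⟩, ?_⟩
  rw [RealRAM.firstAcc, Expr.eval, H.thr, VExpr.eval_distE, v.2, H.query.pointV]
  by_cases h : dist (z (i + 1)) (AffineMap.lineMap p q (s.reg (rv d 33))) ≤ δ + A / N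
  · rw [if_pos h, if_neg (not_lt.2 h)]; simp [Expr.eval]
  · rw [if_neg h, if_pos (not_le.1 h)]; simp [Expr.eval]

/-- The entry of the table for the candidate `c`. -/
def tableIndex (N : ℕ) (z : ℕ → EuclideanSpace ℝ (Fin d)) (p q : EuclideanSpace ℝ (Fin d))
    (x m l : ℕ) (ρ b c : ℝ) : ℕ :=
  l * (gridCard d N * gridCard d N) +
    (gridIdx (z x) ρ N (22 * N + 1) (AffineMap.lineMap p q b) * gridCard d N +
      gridIdx (z (x + m)) ρ N (22 * N + 1) (AffineMap.lineMap p q c))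

/-- The condition that is tested for the candidate `c`. -/
def Accepts (N : ℕ) (z : ℕ → EuclideanSpace ℝ (Fin d)) (p q : EuclideanSpace ℝ (Fin d))
    (mem : ℕ → ℝ) (a x m l : ℕ) (A δ b c : ℝ) : Prop :=
  dist (z (x + m)) (AffineMap.lineMap p q c) ≤ δ + A / N ∧
    (A / N < mem a → mem (a + 1 + tableIndex N z p q x m l (2 ^ l * mem a) b c) ≤
      δ + A / N + d * (2 ^ l * mem a / N) + 2 ^ l * mem a / N)

/-- The state of the test of a piece. -/
structure ScaleState (n N J : ℕ) (z : ℕ → EuclideanSpace ℝ (Fin d)) (r : Role d) (i j : ℕ)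
    (u v p q : EuclideanSpace ℝ (Fin d)) (A st δ : ℝ) (x t l : ℕ) (s : Config) : Prop where
  test : TestState n N J z r i j u v p q A st δ s
  hx : s.reg (rv d 16) = x
  hm : s.reg (rv d 17) = (2 ^ t : ℕ)
  dvd : 2 ^ t ∣ x
  lt : i < x
  le : x + 2 ^ t ≤ j
  hR : s.reg (rv d 24) = s.mem (nodeAddr d n N J x (2 ^ t))
  hl : s.reg (rv d 26) = l
  hρ : s.reg (rv d 25) = 2 ^ l * s.mem (nodeAddr d n N J x (2 ^ t))
  l_le : l ≤ J
  ρ_le : 2 ^ l * s.mem (nodeAddr d n N J x (2 ^ t)) ≤ 54 * A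
  ρ_ge : A ≤ 2 ^ l * s.mem (nodeAddr d n N J x (2 ^ t)) ∨ l = J
  near : dist (z x) (AffineMap.lineMap p q (s.reg (rv d 20))) ≤ δ + A / N

theorem ScaleState.congr {x t l : ℕ} (H : ScaleState n N J z r i j u v p q A st δ x t l s)
    {s' : Config} (h : Agree (rv d 29) s' s) :
    ScaleState n N J z r i j u v p q A st δ x t l s' :=
  ⟨H.test.congr (h.mono (by simp)), by rw [h.1 _ (by simp), H.hx], by rw [h.1 _ (by simp), H.hm],
    H.dvd, H.lt, H.le, by rw [h.1 _ (by simp), h.2, H.hR], by rw [h.1 _ (by simp), H.hl],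
    by rw [h.1 _ (by simp), h.2, H.hρ], H.l_le, by rw [h.2]; exact H.ρ_le,
    by rw [h.2]; exact H.ρ_ge, by rw [h.1 _ (by simp)]; exact H.near⟩

/-- Even the exhausted case is harmless: at `l = J` the factor `2 ^ J` is at least `N`, and `N * R >
A` since `R > A / N`. -/
theorem ScaleState.ρ_ge' {x t l : ℕ} (H : ScaleState n N J z r i j u v p q A st δ x t l s)
    (h : A / N < s.mem (nodeAddr d n N J x (2 ^ t))) :
    A ≤ 2 ^ l * s.mem (nodeAddr d n N J x (2 ^ t)) := by
  rcases H.ρ_ge with h' | h'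
  · exact h'
  · have hN : (0 : ℝ) < N := by exact_mod_cast H.test.query.hN
    rw [div_lt_iff₀ hN] at h
    refine h.le.trans ?_
    rw [mul_comm]
    have hJ : (N : ℝ) ≤ 2 ^ l := by
      have h₁ := h' ▸ H.test.query.hJ
      have h₂ : 1 * N ≤ 12 * d * N :=
        Nat.mul_le_mul_right _ (by have := H.test.query.hd; omega)
      exact_mod_cast (by omega : N ≤ 2 ^ l)
    have : 0 ≤ s.mem (nodeAddr d n N J x (2 ^ t)) :=
      (H.test.query.nodeOK H.dvd H.le).1.1.nonneg (Nat.le_add_right _ _)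
    gcongr

/-- Both end points of the matched part of the segment have grid points nearby. -/
theorem ScaleState.grid {x t l : ℕ} (H : ScaleState n N J z r i j u v p q A st δ x t l s)
    (h : A / N < s.mem (nodeAddr d n N J x (2 ^ t))) :
    0 < 2 ^ l * s.mem (nodeAddr d n N J x (2 ^ t)) ∧ ∀ {y : ℕ} {b : ℝ},
      dist (z y) (AffineMap.lineMap p q b) ≤ δ + A / N →
      dist (z y) (AffineMap.lineMap p q b) ≤
        11 * (2 ^ l * s.mem (nodeAddr d n N J x (2 ^ t))) := by
  -- This fixes the extent of the grids: `δ + A / N ≤ 10 * A + A ≤ 11 * ρ`.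
  have h₁ := H.ρ_ge' h
  have h₂ := (H.test.params.tol_le H.test.query.hN).2
  have h₃ := H.test.params.pos
  have h₄ := H.test.params.le
  exact ⟨by linarith, fun hy => by linarith⟩

theorem ScaleState.tableIndex_spec {x t l : ℕ}
    (H : ScaleState n N J z r i j u v p q A st δ x t l s)
    (h : A / N < s.mem (nodeAddr d n N J x (2 ^ t))) {c : ℝ}
    (hc : dist (z (x + 2 ^ t)) (AffineMap.lineMap p q c) ≤ δ + A / N) :
    tableIndex N z p q x (2 ^ t) l (2 ^ l * s.mem (nodeAddr d n N J x (2 ^ t)))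
        (s.reg (rv d 20)) c < (J + 1) * (gridCard d N * gridCard d N) ∧
      tableIndex N z p q x (2 ^ t) l (2 ^ l * s.mem (nodeAddr d n N J x (2 ^ t)))
        (s.reg (rv d 20)) c / (gridCard d N * gridCard d N) = l ∧
      tableIndex N z p q x (2 ^ t) l (2 ^ l * s.mem (nodeAddr d n N J x (2 ^ t)))
        (s.reg (rv d 20)) c % (gridCard d N * gridCard d N) / gridCard d N =
        gridIdx (z x) (2 ^ l * s.mem (nodeAddr d n N J x (2 ^ t))) N (22 * N + 1)
          (AffineMap.lineMap p q (s.reg (rv d 20))) ∧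
      tableIndex N z p q x (2 ^ t) l (2 ^ l * s.mem (nodeAddr d n N J x (2 ^ t)))
        (s.reg (rv d 20)) c % (gridCard d N * gridCard d N) % gridCard d N =
        gridIdx (z (x + 2 ^ t)) (2 ^ l * s.mem (nodeAddr d n N J x (2 ^ t))) N (22 * N + 1)
          (AffineMap.lineMap p q c) := by
  obtain ⟨hρ, hg⟩ := H.grid h
  have h₁ : _ < gridCard d N := (gridIdx_spec hρ (hg H.near) H.test.query.hN).1
  have h₂ : _ < gridCard d N := (gridIdx_spec hρ (hg hc) H.test.query.hN).1
  unfold tableIndex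
  generalize gridIdx (z x) _ N _ _ = a at *
  generalize gridIdx (z (x + 2 ^ t)) _ N _ _ = b at *
  have hl := H.l_le
  generalize gridCard d N = g at *
  have h₃ : a * g + b < g * g := by
    have : (a + 1) * g ≤ g * g := Nat.mul_le_mul_right _ h₁
    rw [Nat.succ_mul] at this
    omega
  have e₁ : (l * (g * g) + (a * g + b)) / (g * g) = l := by
    rw [mul_comm, Nat.mul_add_div (by omega), Nat.div_eq_of_lt h₃, add_zero]
  have e₂ : (l * (g * g) + (a * g + b)) % (g * g) = a * g + b := by
    rw [mul_comm l, Nat.mul_add_mod, Nat.mod_eq_of_lt h₃]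
  refine ⟨?_, e₁, ?_, ?_⟩
  · have : (l + 1) * (g * g) ≤ (J + 1) * (g * g) := Nat.mul_le_mul_right _ (by omega)
    rw [Nat.succ_mul] at this
    omega
  · rw [e₂, mul_comm a, Nat.mul_add_div (by omega), Nat.div_eq_of_lt h₂, add_zero]
  · rw [e₂, mul_comm a, Nat.mul_add_mod, Nat.mod_eq_of_lt h₂]

-- The order of the conditionals matters for the absence of faults: a grid index is computed only
-- after the distance test has succeeded and `R > A / N`, and then the point lies within the extent
-- of the grid.
open Classical in
theorem ScaleState.pieceAcc {x t l : ℕ}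
    (H : ScaleState n N J z r i j u v p q A st δ x t l s) :
    (pieceAcc r).Ok (cells d n N J) s ∧ (RealRAM.pieceAcc r).eval s =
      if Accepts N z p q s.mem (nodeAddr d n N J x (2 ^ t)) x (2 ^ t) l A δ (s.reg (rv d 20))
        (s.reg (rv d 33)) then 1 else 0 := by
  have G := H.test.query.globals
  have vo := H.test.query.oldV H.hx ((Nat.le_add_right _ _).trans H.le)
  have vn := H.test.query.newV H.hx H.hm H.le
  have hjn := H.test.query.hjn
  have hle := H.le
  set a := nodeAddr d n N J x (2 ^ t) with ha
  set ρ := 2 ^ l * s.mem a with hρ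
  set b := s.reg (rv d 20)
  set c := s.reg (rv d 33)
  have hN0 : (rg d 2).eval s ≠ 0 := by
    rw [Expr.eval, G.hN]; exact_mod_cast H.test.query.hN.ne'
  have e₀ : (entryE r).eval s = tableIndex N z p q x (2 ^ t) l ρ b c := by
    simp only [entryE, Expr.eval, VExpr.eval_gridIndex (N := rg d 2) (G := rg d 3) G.hN G.hG,
      vo.2, vn.2, H.test.query.pointV, H.hl, H.hρ, G.gc, tableIndex]
    push_cast; rfl
  have e₁ : (Expr.add (.add (nodeE d) (.const 1)) (entryE r)).eval s =
      (a + 1 + tableIndex N z p q x (2 ^ t) l ρ b c : ℕ) := by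
    rw [Expr.eval, e₀, Expr.eval, H.test.query.nodeE H.hx H.hm]
    simp [Expr.eval, ha]
  have e₂ : (Expr.load (.add (.add (nodeE d) (.const 1)) (entryE r))).eval s =
      s.mem (a + 1 + tableIndex N z p q x (2 ^ t) l ρ b c) := by
    rw [Expr.eval, e₁, Nat.floor_natCast]
  have e₃ : (Expr.add (.add (thrE d) (.mul (.const d) (.div (rg d 25) (rg d 2))))
      (.div (rg d 25) (rg d 2))).eval s = δ + A / N + d * (ρ / N) + ρ / N := by
    rw [Expr.eval, Expr.eval, H.test.thr]
    simp [Expr.eval, H.hρ, G.hN, hρ, ha]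
  have eR : (rg d 24).eval s = s.mem a := H.hR
  constructor
  · refine ⟨⟨trivial, H.test.ok_tol⟩, VExpr.ok_distE vn.1 (ok_pointV r), fun _ => trivial,
      fun h => ⟨H.test.ok_tol, trivial, fun h' => ?_, fun _ => trivial⟩⟩
    rw [H.test.thr, VExpr.eval_distE, vn.2, H.test.query.pointV, not_lt] at h
    rw [H.test.tol, eR] at h'
    obtain ⟨hρ0, hg⟩ := H.grid h'
    have hS : 22 * N < cells d n N J := by
      have h₁ := gridCard_le_cells (d := d) (N := N) (J := J) (n := n) (by omega)
      have h₂ : 22 * N + 1 ≤ gridCard d N := Nat.le_self_pow H.test.query.hd.ne' _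
      have h₃ : gridCard d N ≤ gridCard d N * gridCard d N := Nat.le_mul_self _
      omega
    refine ⟨⟨⟨⟨trivial, H.test.ok_tol⟩, trivial, trivial, trivial, hN0⟩, trivial, trivial, hN0⟩,
      ⟨⟨⟨by simp [Expr.Ok], trivial⟩, ⟨trivial, trivial, trivial⟩, ⟨?_, trivial⟩, ?_⟩, _, ?_, e₁⟩,
      fun _ => trivial, fun _ => trivial⟩
    · refine VExpr.ok_gridIndex vo.1 trivial trivial trivial (ok_pointV r) G.hN ?_ ?_ hS
      · rw [Expr.eval, H.hρ]; exact hρ0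
      · rw [Expr.eval, H.hρ, vo.2, H.test.query.pointV]; exact hg H.near
    · refine VExpr.ok_gridIndex vn.1 trivial trivial trivial (ok_pointV r) G.hN ?_ ?_ hS
      · rw [Expr.eval, H.hρ]; exact hρ0
      · rw [Expr.eval, H.hρ, vn.2, H.test.query.pointV]; exact hg h
    · have h₁ : tableIndex N z p q x (2 ^ t) l ρ b c < (J + 1) * (gridCard d N * gridCard d N) :=
        (H.tableIndex_spec h' h).1
      rw [add_assoc]
      refine nodeAddr_lt (by omega) (Nat.pow_pos two_pos) ?_
      unfold nodeCells
      omega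
  · have ev : ∀ a b c e : Expr, (Expr.ite a b c e).eval s =
        if a.eval s < b.eval s then c.eval s else e.eval s := fun _ _ _ _ => rfl
    rw [RealRAM.pieceAcc, ev, H.test.thr, VExpr.eval_distE, vn.2, H.test.query.pointV,
      ev, H.test.tol, eR, ev, e₂, e₃]
    simp only [Expr.eval, Rat.cast_zero, Rat.cast_one]
    have hacc : Accepts N z p q s.mem a x (2 ^ t) l A δ b c ↔
        ¬ δ + A / N < dist (z (x + 2 ^ t)) (AffineMap.lineMap p q c) ∧ (A / N < s.mem a →
          ¬ δ + A / N + d * (ρ / N) + ρ / N <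
            s.mem (a + 1 + tableIndex N z p q x (2 ^ t) l ρ b c)) := by
      simp only [not_lt]; rfl
    simp only [hacc]
    change (if _ < dist _ (AffineMap.lineMap p q c) then _ else _) = _
    generalize s.mem (a + 1 + tableIndex N z p q x (2 ^ t) l ρ b c) = V
    by_cases h₁ : δ + A / N < dist (z (x + 2 ^ t)) (AffineMap.lineMap p q c)
    · simp [h₁]
    · by_cases h₂ : A / N < s.mem a
      · by_cases h₃ : δ + A / N + d * (ρ / N) + ρ / N < V <;> simp [h₁, h₂, h₃]
      · simp [h₁, h₂]

theorem AcceptRule.congr {E : Type*} [NormedAddCommGroup E] [InnerProductSpace ℝ E]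
    {z w : ℕ → E} {p q : E} {δ α β b : ℝ} {i k : ℕ} {acc : ℝ → Prop} (hik : i ≤ k)
    (H : AcceptRule z p q δ α β i k b acc) (h : ∀ x ∈ Icc i k, z x = w x) :
    AcceptRule w p q δ α β i k b acc := by
  have hk := h k ⟨hik, le_rfl⟩
  refine ⟨fun c hc => hk ▸ H.near c hc, fun c hc hb => (H.sound c hc hb).congr h,
    fun c hb hc hT => H.complete c hb (hk ▸ hc) (hT.congr fun x hx => (h x hx).symm)⟩

/-- A piece with `R ≤ A / N` may be replaced by its chord within the tolerance. For any other piece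
the scale is between `A` and `54 * A`, so the table has a precision of order `A / N`. -/
theorem ScaleState.acceptRule {x t l : ℕ}
    (H : ScaleState n N J z r i j u v p q A st δ x t l s) :
    AcceptRule (subVertex z i j u v) p q δ (A / N) ((108 * d + 55) * (A / N)) x (x + 2 ^ t)
      (s.reg (rv d 20)) (Accepts N z p q s.mem (nodeAddr d n N J x (2 ^ t)) x (2 ^ t) l A δ
        (s.reg (rv d 20))) := by
  have hpos : 0 < 2 ^ t := Nat.pow_pos two_pos
  have hα := (H.test.params.tol_le H.test.query.hN).1
  refine AcceptRule.congr (Nat.le_add_right _ _) (z := z) ?_ fun k hk =>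
    (subVertex_eq (by have := H.lt; have := hk.1; omega) (hk.2.trans H.le)).symm
  obtain ⟨hC, hE⟩ := H.test.query.nodeOK H.dvd H.le
  by_cases h : A / N < s.mem (nodeAddr d n N J x (2 ^ t))
  · obtain ⟨hρ, hg⟩ := H.grid h
    have hN : (0 : ℝ) < N := by exact_mod_cast H.test.query.hN
    have hρle : 2 ^ l * s.mem (nodeAddr d n N J x (2 ^ t)) / N ≤ 54 * (A / N) := by
      rw [← mul_div_assoc]
      exact div_le_div_of_nonneg_right H.ρ_le hN.le
    set ρ := 2 ^ l * s.mem (nodeAddr d n N J x (2 ^ t)) with hρdef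
    have key := AcceptRule.of_table (z := z) (p := p) (q := q) (δ := δ) (α := A / N)
      (β := (108 * d + 55) * (A / N)) (e := d * (ρ / N)) (e' := ρ / N) (i := x) (k := x + 2 ^ t)
      (s := s.reg (rv d 20)) (by omega)
      (g := gridPt (z x) ρ N (22 * N + 1) (gridIdx (z x) ρ N (22 * N + 1)
        (AffineMap.lineMap p q (s.reg (rv d 20)))))
      (g' := fun c => gridPt (z (x + 2 ^ t)) ρ N (22 * N + 1)
        (gridIdx (z (x + 2 ^ t)) ρ N (22 * N + 1) (AffineMap.lineMap p q c)))
      (V := fun c => s.mem (nodeAddr d n N J x (2 ^ t) + 1 +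
        tableIndex N z p q x (2 ^ t) l ρ (s.reg (rv d 20)) c))
      (gridIdx_spec hρ (hg H.near) H.test.query.hN).2
      (fun c hc => (gridIdx_spec hρ (hg hc) H.test.query.hN).2) ?_ ?_
    · refine ⟨fun c hc => hc.1, fun c hc => key.sound c ⟨hc.1, hc.2 h⟩,
        fun c hb hc hT => ⟨hc, fun _ => (key.complete c hb hc hT).2⟩⟩
    · intro c hc
      obtain ⟨h₁, h₂, h₃, h₄⟩ := H.tableIndex_spec h hc
      have := hE _ h₁
      rw [EntryOK, h₂, h₃, h₄] at this
      exact this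
    -- The total tolerance is `A / N + 2 * e + e'` with `e = d * ρ / N`, `e' = ρ / N` and `ρ ≤ 54 *
    -- A`, that is, at most `(1 + 108 * d + 54) * (A / N)`.
    · have hd : (0 : ℝ) ≤ d := Nat.cast_nonneg d
      nlinarith
  · have key := AcceptRule.of_chord (z := z) (p := p) (q := q) (δ := δ) (α := A / N)
      (β := (108 * d + 55) * (A / N)) (i := x) (k := x + 2 ^ t) (s := s.reg (rv d 20))
      (Nat.le_add_right _ _) H.near hC.1 (not_lt.1 h)
      (by have hd : (0 : ℝ) ≤ d := Nat.cast_nonneg d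
          nlinarith)
    exact ⟨fun c hc => hc.1, fun c hc => key.sound c hc.1,
      fun c hb hc hT => ⟨hc, fun h' => absurd h' h⟩⟩

end

end RealRAM

end
noncomputable section

open Set

namespace RealRAM

variable {d : ℕ} {S n N J : ℕ} {s : Config} {z : ℕ → EuclideanSpace ℝ (Fin d)}

section

variable {r : Role d} {i j : ℕ} {u v p q : EuclideanSpace ℝ (Fin d)} {A st δ : ℝ}

/-! ### The test of a threshold -/

/-- The outcome of the search is a new state of the approximate greedy matching, or the threshold is
too small. -/
theorem ApproxInv.of_search {w : ℕ → EuclideanSpace ℝ (Fin d)} {l h x k : ℕ} {α β b b' f : ℝ}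
    {acc : ℝ → Prop} (H : ApproxInv w l h p q δ α β x b)
    (hacc : AcceptRule w p q δ α β x k b acc) (P : TestParams N p q A st δ) (hN : 0 < N)
    (hα : α = A / N) (hlx : l ≤ x) (hxk : x < k) (hkh : k ≤ h)
    (hs : (∃ a : ℕ, acc (candidate st (max b (projParam p q (w k) - 11 * N * st)) a) ∧
        (∀ a' < a, ¬ acc (candidate st (max b (projParam p q (w k) - 11 * N * st)) a')) ∧
        b' = candidate st (max b (projParam p q (w k) - 11 * N * st)) a ∧ f = 0) ∨
      (∀ a < 21 * N + 1, ¬ acc (candidate st (max b (projParam p q (w k) - 11 * N * st)) a)) ∧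
        f = 1) :
    (f = 0 ∧ ApproxInv w l h p q δ α β k b') ∨ (f = 1 ∧ ¬ Traverse w l h p q 0 1 δ) := by
  subst hα
  rcases hs with ⟨a, h₁, h₂, rfl, hf⟩ | ⟨hno, hf⟩
  · exact .inl ⟨hf, H.step hacc P.st_pos P.st_mul hN P.st_cases P.le hlx hxk hkh h₁ h₂⟩
  · refine .inr ⟨hf, ?_⟩
    rintro ⟨σ, hσ⟩
    obtain ⟨a, ha, ha', -⟩ := H.exists_candidate hacc P.st_pos P.st_mul hN P.st_cases P.le hlx hxk
      hkh hσ
    exact hno a ha ha'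

/-- Test whether the current piece can be matched. -/
def pieceProg (r : Role d) : Program :=
  ifLt (top d) (rg d 21) (.const 1)
    (.seq (assign (top d) (rv d 24) (.load (nodeE d)))
      (.seq (scaleProg d)
        (searchProg (VExpr.regs d r.p) (VExpr.regs d r.q) (newV d) (pieceAcc r))))
    (assigns (top d) [])

/-- Test whether the distance is at most the threshold in register `10`; the result `0` in register
`21` means yes. -/
def testProg (r : Role d) : Program :=
  .seq (assign (top d) (rv d 20) (.const 0))
    (.seq (searchProg (VExpr.regs d r.p) (VExpr.regs d r.q) (startV r) (firstAcc r))
      (piecesProg d (.add (.reg r.i) (.const 1)) (.reg r.j) (pieceProg r)))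

/-- The state of the test after the vertex `x`. -/
structure TestInv (N : ℕ) (w : ℕ → EuclideanSpace ℝ (Fin d)) (i j : ℕ)
    (p q : EuclideanSpace ℝ (Fin d)) (A δ : ℝ) (s₀ : Config) (x : ℕ) (s : Config) : Prop where
  agree : Agree (rv d 16) s s₀
  inv : (s.reg (rv d 21) = 0 ∧ ApproxInv w i (j + 1) p q δ (A / N)
      ((108 * d + 55) * (A / N)) x (s.reg (rv d 20))) ∨
    (s.reg (rv d 21) = 1 ∧ ¬ Traverse w i (j + 1) p q 0 1 δ)

theorem Traverse.piece {w : ℕ → EuclideanSpace ℝ (Fin d)} {l h x k : ℕ}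
    (H : Traverse w l h p q 0 1 δ) (hlx : l ≤ x) (hxk : x < k) (hkh : k ≤ h) :
    ∃ p' q', Traverse w x k p' q' 0 1 δ := by
  obtain ⟨σ, hσ⟩ := H
  exact ⟨_, _, Traverse.to_subsegment hxk ⟨σ, hσ.restrict hlx hkh⟩⟩

theorem below_pieceAcc (r : Role d) : (pieceAcc r).Below (rv d 34) := by
  have h₁ : (newV d).Below (rv d 34) := below_vx (by simp) (by simp [Expr.Below])
  have h₂ : (oldV d).Below (rv d 34) := below_vx (by simp) (by simp [Expr.Below])
  have h₃ : ∀ {a}, a < 34 → (rg d a).Below (rv d 34) := fun h => by simpa [Expr.Below]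
  have h₄ : (entryE r).Below (rv d 34) :=
    ⟨by simp [Expr.Below], ⟨VExpr.below_gridIndex h₂ (h₃ (by omega)) (h₃ (by omega))
      (h₃ (by omega)) (below_pointV r (by omega)), h₃ (by omega)⟩,
      VExpr.below_gridIndex h₁ (h₃ (by omega)) (h₃ (by omega)) (h₃ (by omega))
        (below_pointV r (by omega))⟩
  have h₅ : (VExpr.distE (newV d) (pointV r 33)).Below (rv d 34) :=
    VExpr.below_distE h₁ (below_pointV r (by omega))
  simp [pieceAcc, Expr.Below, h₄, h₅]

theorem below_firstAcc (r : Role d) : (firstAcc r).Below (rv d 34) := by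
  have h₅ : (VExpr.distE (startV r) (pointV r 33)).Below (rv d 34) :=
    VExpr.below_distE (below_startV (by simp)) (below_pointV r (by omega))
  simp [firstAcc, Expr.Below, h₅]

/-- The cost does not depend on the length of the piece: `J` steps for the scale and `N` for the
candidates, up to constants. Once the threshold has been refuted, pieces are skipped. -/
theorem runs_pieceProg (r : Role d) : ∃ K : ℕ, ∀ {n N J : ℕ}
    {z : ℕ → EuclideanSpace ℝ (Fin d)} {i j x t : ℕ} {u v p q : EuclideanSpace ℝ (Fin d)}
    {A st δ : ℝ} {s₀ s : Config}, TestState n N J z r i j u v p q A st δ s →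
    IsBound (subVertex z i j u v) i j p q A →
    TestInv N (subVertex z i j u v) i j p q A δ s₀ x s → i < x → 2 ^ t ∣ x → x + 2 ^ t ≤ j →
    s.reg (rv d 16) = x → s.reg (rv d 17) = (2 ^ t : ℕ) →
    Runs (cells d n N J) (top d) (pieceProg r) s (K * (N + J + 1)) (fun s' =>
      Agree (rv d 20) s' s ∧
      TestInv N (subVertex z i j u v) i j p q A δ s₀ (x + 2 ^ t) s') := by
  obtain ⟨K₁, hK₁⟩ := runs_scaleProg d
  obtain ⟨K₂, hK₂⟩ := runs_searchProg (r.below_p (c := 29)) (r.below_q (c := 29))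
    (y := newV d) (below_vx (by simp) (by simp [Expr.Below])) (below_pieceAcc r)
  refine ⟨(Expr.load (nodeE d)).cost + 1 + K₁ + K₂ + 3,
    fun {n N J z i j x t u v p q A st δ s₀ s} T B I hix hdvd hxj hx hm => ?_⟩
  have hpos : 0 < 2 ^ t := Nat.pow_pos two_pos
  refine Runs.le (T := (rg d 21).cost + (Expr.const 1).cost + ((Expr.load (nodeE d)).cost + 1 +
    (K₁ * (J + 1) + K₂ * (N + 1))) + 1) ?key ?bound
  case key =>
    refine Runs.ifLt (by simp [Expr.Below]) trivial trivial trivial (fun hlt => ?_) (fun hge => ?_)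
    · rcases I.inv with ⟨h21, H⟩ | ⟨h21, -⟩
      swap
      · simp [Expr.eval, h21] at hlt
      have hC := (T.query.nodeOK hdvd hxj).1
      set R := s.mem (nodeAddr d n N J x (2 ^ t)) with hR
      -- The matching at `9 * A` restricts to the piece, and `R` is at most six times the distance
      -- from any segment.
      have hR6 : R ≤ 54 * A := by
        obtain ⟨p', q', hT⟩ := RealRAM.Traverse.piece (x := x) (k := x + 2 ^ t) B.upper
          hix.le (by omega) (by omega)
        have := hC.2 p' q' _ (hT.congr fun k hk =>
          subVertex_eq (hix.trans_le hk.1) (hk.2.trans hxj))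
        linarith
      refine Runs.seq (Runs.assign (by simp [Expr.Below]) (T.query.ok_loadNode hx hm hpos hxj) ?_)
      have eR : (Expr.load (nodeE d)).eval s = R := by
        rw [Expr.eval, T.query.nodeE hx hm, Nat.floor_natCast]
      rw [eR]
      set s₁ := s.setReg (rv d 24) R with hs₁
      have A₁ : Agree (rv d 24) s₁ s := agree_setReg le_rfl _ _
      have T₁ := T.congr (A₁.mono (by simp))
      have e24 : s₁.reg (rv d 24) = R := by simp [hs₁, Config.setReg_reg]
      refine Runs.seq ((hK₁ T₁.query.globals.hJ e24 T₁.hA T.params.pos.le hR6).imp fun s₂ h₂ => ?_)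
      obtain ⟨A₂, l, hl, h26, h25, hρ, hρ'⟩ := h₂
      have A₂' : Agree (rv d 24) s₂ s := (A₂.mono (by simp)).trans A₁
      have C : ScaleState n N J z r i j u v p q A st δ x t l s₂ := by
        refine ⟨T.congr (A₂'.mono (by simp)), by rw [A₂'.1 _ (by simp), hx],
          by rw [A₂'.1 _ (by simp), hm], hdvd, hix, hxj, ?_, h26, ?_, hl, ?_, ?_, ?_⟩
        · rw [A₂.1 _ (by simp), e24, A₂'.2]
        · rw [h25, A₂'.2]
        · rw [A₂'.2]; exact hρ
        · rw [A₂'.2]; exact hρ'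
        · rw [A₂'.1 _ (by simp), ← subVertex_eq (z := z) (u := u) (v := v) hix (by omega : x ≤ j)]
          exact H.near
      have v₂ := C.test.query.newV C.hx C.hm hxj
      refine (hK₂ (A := Accepts N z p q s₂.mem (nodeAddr d n N J x (2 ^ t)) x (2 ^ t) l A δ
        (s₂.reg (rv d 20))) C.test.query.globals.hN VExpr.ok_regs VExpr.ok_regs v₂.1
          fun s' hA' => ?_).imp fun s₃ h₃ => ?_
      · have := (C.congr hA').pieceAcc
        rwa [hA'.2, hA'.1 (rv d 20) (by simp)] at this
      · obtain ⟨A₃, h₃⟩ := h₃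
        have A₃' : Agree (rv d 20) s₃ s := A₃.trans (A₂'.mono (by simp))
        refine ⟨A₃', (A₃'.mono (by simp)).trans I.agree, ?_⟩
        rw [C.test.query.hp, C.test.query.hq, v₂.2, C.test.hst,
          ← subVertex_eq (z := z) (u := u) (v := v) (k := x + 2 ^ t) (by omega : i < x + 2 ^ t) hxj] at h₃
        refine ApproxInv.of_search (b := s₂.reg (rv d 20)) ?_ C.acceptRule T.params T.query.hN rfl
          hix.le (by omega) (by omega) h₃
        rwa [A₂'.1 _ (by simp)]
    · refine Runs.skip (by omega) ⟨Agree.refl _ _, I.agree, ?_⟩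
      rcases I.inv with ⟨h21, -⟩ | h
      · simp [Expr.eval, h21] at hge
      · exact .inr h
  case bound =>
    have h₁ : K₁ * (J + 1) ≤ K₁ * (N + J + 1) := Nat.mul_le_mul_left _ (by omega)
    have h₂ : K₂ * (N + 1) ≤ K₂ * (N + J + 1) := Nat.mul_le_mul_left _ (by omega)
    have h₃ : (Expr.load (nodeE d)).cost + 1 + 3 ≤
        ((Expr.load (nodeE d)).cost + 1 + 3) * (N + J + 1) :=
      Nat.le_mul_of_pos_right _ (by omega)
    calc _ = ((Expr.load (nodeE d)).cost + 1 + 3) + (K₁ * (J + 1) + K₂ * (N + 1)) := by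
          change 1 + 1 + _ + 1 = _
          omega
      _ ≤ ((Expr.load (nodeE d)).cost + 1 + 3) * (N + J + 1) +
          (K₁ * (N + J + 1) + K₂ * (N + J + 1)) := by omega
      _ = _ := by ring

/-- A test with a gap: a positive answer certifies `δ` plus the tolerance, a negative one refutes
`δ` itself. -/
theorem runs_testProg (r : Role d) : ∃ K : ℕ, ∀ {n N J : ℕ}
    {z : ℕ → EuclideanSpace ℝ (Fin d)} {i j : ℕ} {u v p q : EuclideanSpace ℝ (Fin d)}
    {A st δ : ℝ} {s : Config}, TestState n N J z r i j u v p q A st δ s →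
    IsBound (subVertex z i j u v) i j p q A →
    Runs (cells d n N J) (top d) (testProg r) s (K * ((Nat.clog 2 n + 1) * (N + J + 1)))
      (fun s' => Agree (rv d 16) s' s ∧
        (s'.reg (rv d 21) = 0 ∧ Traverse (subVertex z i j u v) i (j + 1) p q 0 1
            (δ + (108 * d + 55) * (A / N)) ∨
          s'.reg (rv d 21) = 1 ∧ ¬ Traverse (subVertex z i j u v) i (j + 1) p q 0 1 δ)) := by
  obtain ⟨K₁, hK₁⟩ := runs_searchProg (r.below_p (c := 29)) (r.below_q (c := 29))
    (y := startV r) (below_startV (by simp)) (below_firstAcc r)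
  obtain ⟨K₂, hK₂⟩ := runs_pieceProg r
  obtain ⟨K₃, hK₃⟩ := runs_piecesProg d (.add (.reg r.i) (.const 1)) (.reg r.j)
  refine ⟨2 + K₁ + K₃ * (K₂ + 1), fun {n N J z i j u v p q A st δ s} T B => ?_⟩
  have hij := T.query.hij
  have hjn := T.query.hjn
  refine Runs.le (T := (Expr.const 0).cost + 1 + (K₁ * (N + 1) + K₃ * ((Nat.clog 2 n + 1) *
    (K₂ * (N + J + 1) + 1)))) ?key ?bound
  case key =>
    set w := subVertex z i j u v with hw
    have wi : w i = u := subVertex_first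
    obtain ⟨hα, hα'⟩ := T.params.tol_le T.query.hN
    have hβ : A / N ≤ (108 * d + 55) * (A / N) := by
      have hd : (0 : ℝ) ≤ d := Nat.cast_nonneg d
      nlinarith
    refine Runs.seq (Runs.assign trivial trivial ?_)
    set s₁ := s.setReg (rv d 20) ((Expr.const 0).eval s) with hs₁
    have A₁ : Agree (rv d 20) s₁ s := agree_setReg le_rfl _ _
    have T₁ := T.congr (A₁.mono (by simp))
    have e20 : s₁.reg (rv d 20) = 0 := by simp [hs₁, Config.setReg_reg, Expr.eval]
    have I₁ : ApproxInv w i (j + 1) p q δ (A / N) ((108 * d + 55) * (A / N)) i 0 :=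
      ApproxInv.start hα.le (hα.le.trans hβ) (B.first.trans T.params.ge)
    have hw1 : w (i + 1) = z (i + 1) := subVertex_eq (by omega) (by omega)
    have v₁ := T₁.query.startV
    -- The partial edge from `u` coincides with its chord, so the rule for chords applies with `r =
    -- 0`.
    have R₁ : AcceptRule w p q δ (A / N) ((108 * d + 55) * (A / N)) i (i + 1) 0
        (fun c => dist (w (i + 1)) (AffineMap.lineMap p q c) ≤ δ + A / N) :=
      AcceptRule.of_chord (Nat.le_succ i) I₁.near (traverse_edge w i) hα.le (by
        have hd : (0 : ℝ) ≤ d := Nat.cast_nonneg d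
        nlinarith)
    rw [hw1] at R₁
    refine Runs.seq ((hK₁ (A := fun c => dist (z (i + 1)) (AffineMap.lineMap p q c) ≤ δ + A / N)
      T₁.query.globals.hN VExpr.ok_regs VExpr.ok_regs v₁.1 fun s' hA' => ?_).imp
      fun s₂ h₂ => ?_)
    · exact (T₁.congr (hA'.mono (by simp))).firstAcc
    obtain ⟨A₂, h₂⟩ := h₂
    rw [T₁.query.hp, T₁.query.hq, v₁.2, T₁.hst, ← hw1, e20] at h₂
    have A₂' : Agree (rv d 20) s₂ s := A₂.trans A₁
    have I₂ : TestInv N w i j p q A δ s (i + 1) s₂ := by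
      refine ⟨A₂'.mono (by simp), ?_⟩
      rw [← hw1] at R₁
      exact RealRAM.ApproxInv.of_search I₁ R₁ T.params T.query.hN rfl le_rfl (by omega) (by omega) h₂
    refine hK₃ (n := n) (a := i + 1) (j := j) (T := K₂ * (N + J + 1))
      (Inv := TestInv N w i j p q A δ s) ⟨r.below_j, ?_, ?_, ?_⟩
      (by have := T.query.lt_cells; omega) (by omega) hij ⟨r.below_i, trivial⟩ ⟨trivial, trivial⟩
      ?_ I₂ ?_
    · rintro x s' a c I ha ha'
      refine ⟨(agree_setReg (by simpa using ha) _ _).trans I.agree, ?_⟩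
      have h20 : 20 ≠ a := by omega
      have h21 : 21 ≠ a := by omega
      simpa [Config.setReg_reg, h20, h21] using I.inv
    · intro x s' I
      have H' := (T.congr (I.agree.mono (by simp))).query
      exact ⟨H'.globals.hL, trivial, H'.hj⟩
    · intro x t s' I hax hdvd hxj hx hm
      refine (hK₂ (T.congr (I.agree.mono (by simp))) B I (by omega) hdvd hxj hx hm).imp
        fun s'' h => ⟨h.2, fun a ha ha' => h.1.1 _ (by simp; omega)⟩
    · rw [Expr.eval, Expr.eval, (T.query.congr (A₂'.mono (by simp))).hi]
      simp [Expr.eval]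
    · intro s' I
      refine ⟨I.agree, ?_⟩
      rcases I.inv with ⟨h21, H⟩ | h
      · exact .inl ⟨h21, H.finish hij.le hβ hα.le (B.last.trans T.params.ge)⟩
      · exact .inr h
  case bound =>
    set M := (Nat.clog 2 n + 1) * (N + J + 1) with hM
    have h₀ : N + J + 1 ≤ M := Nat.le_mul_of_pos_left _ (Nat.succ_pos _)
    have h₁ : 2 ≤ 2 * M := by omega
    have h₂ : K₁ * (N + 1) ≤ K₁ * M := Nat.mul_le_mul_left _ (by omega)
    have h₃ : (Nat.clog 2 n + 1) * (K₂ * (N + J + 1) + 1) ≤ (K₂ + 1) * M := by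
      calc _ ≤ (Nat.clog 2 n + 1) * (K₂ * (N + J + 1) + (N + J + 1)) := by
            gcongr; omega
        _ = _ := by rw [hM]; ring
    calc _ ≤ 2 * M + (K₁ * M + K₃ * ((K₂ + 1) * M)) :=
          Nat.add_le_add h₁ (Nat.add_le_add h₂ (Nat.mul_le_mul_left _ h₃))
      _ = _ := by ring

/-! ### The query -/

/-- One step of the search for the threshold. -/
def thresholdStep (r : Role d) : Program :=
  .seq (assign (top d) (rv d 10) (.add (rg d 9) (.mul (rg d 13) (tolE d))))
    (.seq (testProg r) (assigns (top d)
      [(rv d 11, .ite (.maxE (rg d 12) (rg d 21)) (.const 1) (.sub (rg d 10) (tolE d)) (rg d 11)),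
        (rv d 12, .ite (rg d 21) (.const 1) (.const 1) (rg d 12))]))

/-- The initial assignments of the search for the threshold. -/
def thresholdInit (r : Role d) : List (ℕ × Expr) :=
  [(rv d 8, .ite (.const 0) (VExpr.distE (VExpr.regs d r.p) (VExpr.regs d r.q))
    (.div (tolE d) (VExpr.distE (VExpr.regs d r.p) (VExpr.regs d r.q))) (.const 1)),
    (rv d 12, .const 0)]

/-- Search for the threshold. -/
def thresholdProg (r : Role d) : Program :=
  .seq (assigns (top d) (thresholdInit r))
    (.seq (forLt (top d) (rv d 13) (.add (.mul (.const 9) (rg d 2)) (.const 1)) (thresholdStep r))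
      (assign (top d) 0 (rg d 11)))

/-- The query program for a subcurve that is not contained in an edge. -/
def queryProg (r : Role d) : Program :=
  .seq (boundProg r) (ifLt (top d) (.const 0) (rg d 9) (thresholdProg r)
    (assign (top d) 0 (.const 0)))

/-- The number `D` is the distance. -/
structure IsDist (w : ℕ → EuclideanSpace ℝ (Fin d)) (i j : ℕ) (p q : EuclideanSpace ℝ (Fin d))
    (D : ℝ) : Prop where
  le : ∀ δ, Traverse w i (j + 1) p q 0 1 δ → D ≤ δ
  traverse : ∀ δ, D < δ → Traverse w i (j + 1) p q 0 1 δ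

theorem IsDist.ge {w : ℕ → EuclideanSpace ℝ (Fin d)} {D : ℝ} (H : IsDist w i j p q D)
    (h : ¬ Traverse w i (j + 1) p q 0 1 δ) : δ ≤ D :=
  not_lt.1 fun h' => h (H.traverse δ h')

theorem IsDist.bound_le {w : ℕ → EuclideanSpace ℝ (Fin d)} {D : ℝ} (H : IsDist w i j p q D)
    (B : IsBound w i j p q A) : A ≤ D :=
  le_of_forall_gt_imp_ge_of_dense fun δ hδ => B.lower δ (H.traverse δ hδ)

end

end RealRAM

end
noncomputable section

open Set

namespace RealRAM

variable {d : ℕ} {N : ℕ}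

section

variable {i j : ℕ} {p q : EuclideanSpace ℝ (Fin d)} {A D ε : ℝ}

/-- With `α = A / N`, the output is `A + (k - 1) * α` for the first accepted `k`. The previous
threshold was refuted, which gives the lower bound. Acceptance leaves a gap of `(108 * d + 56) * α`,
while `ε` times the output is at least `ε * (A - α) ≥ (120 * (d + 1) - 1) * α`. -/
theorem IsDist.approx {w : ℕ → EuclideanSpace ℝ (Fin d)} (H : IsDist w i j p q D)
    (B : IsBound w i j p q A) (hA : 0 < A) (hN : 0 < N) (hε : 0 < ε) (hε' : ε ≤ 1)
    (hεN : 120 * ((d : ℝ) + 1) ≤ ε * N) {k : ℕ}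
    (hT : Traverse w i (j + 1) p q 0 1 (A + k * (A / N) + (108 * d + 55) * (A / N)))
    (hno : ∀ k' < k, ¬ Traverse w i (j + 1) p q 0 1 (A + (k' : ℕ) * (A / N))) :
    A + k * (A / N) - A / N ≤ D ∧ D ≤ (1 + ε) * (A + k * (A / N) - A / N) := by
  have hN' : (0 : ℝ) < N := by exact_mod_cast hN
  have hd : (0 : ℝ) ≤ d := Nat.cast_nonneg d
  have hα : 0 < A / N := div_pos hA hN'
  have eA : A = N * (A / N) := by field_simp
  constructor
  -- For `k = 0` nothing has been refuted, but the output `A - A / N` is below the lower bound `A`.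
  · rcases k with _ | k
    · have := H.bound_le B
      simp only [Nat.cast_zero, zero_mul, add_zero]
      linarith
    · have := H.ge (hno k (Nat.lt_succ_self k))
      push_cast
      linarith
  · have h₁ := H.le _ hT
    set α := A / N
    have h₂ : 120 * ((d : ℝ) + 1) * α ≤ ε * A := by
      rw [eA, ← mul_assoc]
      exact mul_le_mul_of_nonneg_right hεN hα.le
    have h₃ : ε * α ≤ α := mul_le_of_le_one_left hα.le hε'
    have h₄ : 0 ≤ ε * (k * α) := by positivity
    have h₅ : 0 ≤ d * α := by positivity
    nlinarith

/-- A linear search suffices: `9 * N + 1` thresholds at a cost of order `log n * (N + J)` each.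
Register 12 freezes the result after the first success. -/
theorem runs_thresholdProg (r : Role d) : ∃ K : ℕ, ∀ {n N J : ℕ}
    {z : ℕ → EuclideanSpace ℝ (Fin d)} {i j : ℕ} {u v p q : EuclideanSpace ℝ (Fin d)}
    {A D ε : ℝ} {s : Config}, Query n N J z r i j u v p q s → s.reg (rv d 9) = A → 0 < A →
    IsBound (subVertex z i j u v) i j p q A → IsDist (subVertex z i j u v) i j p q D →
    0 < ε → ε ≤ 1 → 120 * ((d : ℝ) + 1) ≤ ε * N →
    Runs (cells d n N J) (top d) (thresholdProg r) s
      (K * ((N + 1) * ((Nat.clog 2 n + 1) * (N + J + 1))))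
      (fun s' => s'.mem = s.mem ∧ s'.reg 0 ≤ D ∧ D ≤ (1 + ε) * s'.reg 0) := by
  obtain ⟨K, hK⟩ := runs_testProg r
  set lb : List (ℕ × Expr) :=
    [(rv d 11, .ite (.maxE (rg d 12) (rg d 21)) (.const 1) (.sub (rg d 10) (tolE d)) (rg d 11)),
        (rv d 12, .ite (rg d 21) (.const 1) (.const 1) (rg d 12))] with hlb
  set ca := (Expr.add (rg d 9) (.mul (rg d 13) (tolE d))).cost + 1 with hca
  set cf := (Expr.add (.mul (.const 9) (rg d 2)) (.const 1)).cost + 8 with hcf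
  refine ⟨costList (thresholdInit r) + 11 * (ca + K + costList lb + cf) + 2,
    fun {n N J z i j u v p q A D ε s} H h9 hA B HD hε hε' hεN => ?_⟩
  set M := (Nat.clog 2 n + 1) * (N + J + 1) with hM
  refine Runs.le (T := costList (thresholdInit r) + ((9 * N + 1 + 1) * ((ca + (K * M +
    costList lb)) + (Expr.add (.mul (.const 9) (rg d 2)) (.const 1)).cost + 8) + 2)) ?key ?bound
  case key =>
    set w := subVertex z i j u v with hw
    have hN := H.hN
    have hN' : (0 : ℝ) < N := by exact_mod_cast hN
    have hα : 0 < A / N := div_pos hA hN'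
    have tol : ∀ {s' : Config}, Agree (rv d 8) s' s → s'.reg (rv d 9) = A →
        (tolE d).eval s' = A / N ∧ (∀ {S}, (tolE d).Ok S s') := fun {s'} h h' => by
      have hN2 := (H.congr h).globals.hN
      refine ⟨by rw [Expr.eval, Expr.eval, Expr.eval, h', hN2], trivial, trivial, ?_⟩
      rw [Expr.eval, hN2]
      exact hN'.ne'
    have t₀ := tol (Agree.refl _ s) h9
    have eL : ∀ {s' : Config}, Agree (rv d 8) s' s →
        (VExpr.distE (VExpr.regs d r.p) (VExpr.regs d r.q)).eval s' = dist p q := fun {s'} h => by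
      rw [VExpr.eval_distE, (H.congr h).hp, (H.congr h).hq]
    refine Runs.seq (Runs.assigns ?_ ?_ ?_)
    · simp [thresholdInit, BelowList, Expr.Below, VExpr.below_distE r.below_p r.below_q]
    · simp only [thresholdInit, OkList, Expr.Ok, and_true, true_and]
      have ol : (VExpr.distE (VExpr.regs d r.p) (VExpr.regs d r.q)).Ok (cells d n N J) s :=
        VExpr.ok_distE VExpr.ok_regs VExpr.ok_regs
      refine ⟨ol, fun h => ⟨?_, ol, ?_⟩, fun _ => trivial⟩
      · exact (t₀.2 (S := 0)).2.2
      · have : (Expr.const 0).eval s = 0 := by simp [Expr.eval]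
        rw [this] at h
        exact h.ne'
    -- One parameter step corresponds to the length `A / N` on the segment; for a degenerate segment
    -- the value is immaterial, and `1` satisfies the requirements.
    set st : ℝ := if 0 < dist p q then A / N / dist p q else 1 with hst
    set s₁ := evalList (thresholdInit r) s with hs₁
    have A₁ : Agree (rv d 8) s₁ s := by
      refine ⟨fun a ha => ?_, rfl⟩
      have : ∀ j, a ≠ rv d (8 + j) := fun j => (ha.trans_le (by simp)).ne
      simp [hs₁, thresholdInit, evalList, Config.setReg_reg, this 0, this 4]
    have e8 : s₁.reg (rv d 8) = st := by
      have ev : ∀ a b c e, (Expr.ite a b c e).eval s =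
        if a.eval s < b.eval s then c.eval s else e.eval s := fun _ _ _ _ => rfl
      have ed : ∀ a b, (Expr.div a b).eval s = a.eval s / b.eval s := fun _ _ => rfl
      have ec : (Expr.const 0).eval s = 0 := by simp [Expr.eval]
      have ec' : (Expr.const 1).eval s = 1 := by simp [Expr.eval]
      have : s₁.reg (rv d 8) = (Expr.ite (.const 0)
          (VExpr.distE (VExpr.regs d r.p) (VExpr.regs d r.q))
          (.div (tolE d) (VExpr.distE (VExpr.regs d r.p) (VExpr.regs d r.q)))
          (.const 1)).eval s := by
        simp [hs₁, thresholdInit, evalList, Config.setReg_reg]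
      rw [this, ev, ed (tolE d), t₀.1, eL (Agree.refl _ s), ec, ec']
    have e9 : s₁.reg (rv d 9) = A := by
      rw [← h9]; simp [hs₁, thresholdInit, evalList, Config.setReg_reg]
    have e12 : s₁.reg (rv d 12) = 0 := by
      simp [hs₁, thresholdInit, evalList, Config.setReg_reg, Expr.eval]
    clear_value s₁
    have par : ∀ k ≤ 9 * N, TestParams N p q A st (A + (k : ℕ) * (A / N)) := fun k hk => by
      have hk' : (k : ℝ) ≤ 9 * N := by exact_mod_cast hk
      have eA : N * (A / N) = A := by field_simp
      have h₁ : k * (A / N) ≤ 9 * A := by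
        have := mul_le_mul_of_nonneg_right hk' hα.le
        rwa [mul_assoc, eA] at this
      have h₂ : 0 ≤ k * (A / N) := by positivity
      rcases (dist_nonneg (x := p) (y := q)).eq_or_lt with h | h
      · refine ⟨hA, ?_, ?_, ?_, by linarith, by linarith⟩ <;> simp [hst, ← h, hα.le]
      · have est : st * dist p q = A / N := by rw [hst, if_pos h]; field_simp
        refine ⟨hA, ?_, est.le, .inr ⟨?_, h⟩, by linarith, by linarith⟩
        · rw [hst, if_pos h]; exact div_pos hα h
        · rw [mul_assoc, est, eA]
    refine Runs.seq ?_
    refine Runs.forLt (m := 9 * N + 1) (fun k s' => Agree (rv d 10) s' s₁ ∧ s'.reg (rv d 13) = k ∧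
      ((s'.reg (rv d 12) = 0 ∧ ∀ k' < k, ¬ Traverse w i (j + 1) p q 0 1 (A + (k' : ℕ) * (A / N))) ∨
        (s'.reg (rv d 12) = 1 ∧ s'.reg (rv d 11) ≤ D ∧ D ≤ (1 + ε) * s'.reg (rv d 11))))
      (by simp) (by simp [Expr.Below]) ?_ ?_ ?_ ?_
    · refine ⟨agree_setReg (by simp) _ _, by simp [Config.setReg_reg], .inl ⟨?_, by simp⟩⟩
      simp [Config.setReg_reg, e12]
    · rintro k s' ⟨hA', h13, -⟩
      refine ⟨h13, ⟨⟨trivial, trivial⟩, trivial⟩, ?_⟩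
      have := (H.congr ((hA'.mono (by simp)).trans A₁)).globals.hN
      simp [Expr.eval, this]
    · rintro k s' hk ⟨hA', h13, hc⟩
      have A₂ : Agree (rv d 8) s' s := (hA'.mono (by simp)).trans A₁
      have t₂ := tol A₂ (by rw [hA'.1 _ (by simp), e9])
      refine Runs.seq (Runs.assign (by simp [Expr.Below]) ⟨trivial, trivial, t₂.2⟩ ?_)
      have eδ : (Expr.add (rg d 9) (.mul (rg d 13) (tolE d))).eval s' = A + k * (A / N) := by
        change s'.reg (rv d 9) + s'.reg (rv d 13) * (tolE d).eval s' = _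
        rw [t₂.1, h13, hA'.1 _ (by simp), e9]
      rw [eδ]
      set s₃ := s'.setReg (rv d 10) (A + k * (A / N)) with hs₃
      have A₃ : Agree (rv d 10) s₃ s' := agree_setReg le_rfl _ _
      have T₃ : TestState n N J z r i j u v p q A st (A + (k : ℕ) * (A / N)) s₃ := by
        refine ⟨H.congr ((A₃.mono (by simp)).trans A₂), par k (by omega), ?_, ?_, ?_⟩
        · rw [A₃.1 _ (by simp), hA'.1 _ (by simp), e8]
        · rw [A₃.1 _ (by simp), hA'.1 _ (by simp), e9]
        · simp [hs₃, Config.setReg_reg]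
      refine Runs.seq ((hK T₃ B).imp fun s₄ h₄ => ?_)
      obtain ⟨A₄, h₄⟩ := h₄
      have T₄ := T₃.congr (A₄.mono (by simp))
      have e11 : s₄.reg (rv d 11) = s'.reg (rv d 11) := by
        rw [A₄.1 _ (by simp)]; simp [hs₃, Config.setReg_reg]
      have e12' : s₄.reg (rv d 12) = s'.reg (rv d 12) := by
        rw [A₄.1 _ (by simp)]; simp [hs₃, Config.setReg_reg]
      have e13 : s₄.reg (rv d 13) = k := by
        rw [A₄.1 _ (by simp), ← h13]; simp [hs₃, Config.setReg_reg]
      have A₄' : Agree (rv d 10) s₄ s₁ := ((A₄.mono (by simp)).trans A₃).trans hA'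
      have ok4 : ∀ {x}, (tolE d).Ok (cells d n N J) (s₄.setReg (rv d 12) x) := fun {x} =>
        (tol (((agree_setReg (W := rv d 10) (by simp) _ _).trans A₄').mono
          (by simp) |>.trans A₁) (by simp [Config.setReg_reg, T₄.hA])).2
      refine Runs.assigns ?_ ?_ ?_
      · simp [BelowList, Expr.Below]
      · refine ⟨⟨(Expr.ok_maxE _ _).2 ⟨trivial, trivial⟩, trivial, fun _ => ⟨trivial, T₄.ok_tol⟩,
          fun _ => trivial⟩, ⟨trivial, trivial, fun _ => trivial, fun _ => trivial⟩, trivial⟩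
      have ev : ∀ a b c e, (Expr.ite a b c e).eval s₄ =
        if a.eval s₄ < b.eval s₄ then c.eval s₄ else e.eval s₄ := fun _ _ _ _ => rfl
      have ex : (Expr.ite (.maxE (rg d 12) (rg d 21)) (.const 1) (.sub (rg d 10) (tolE d))
          (rg d 11)).eval s₄ = if max (s₄.reg (rv d 12)) (s₄.reg (rv d 21)) < 1 then
            A + k * (A / N) - A / N else s₄.reg (rv d 11) := by
        have es : (Expr.sub (rg d 10) (tolE d)).eval s₄ = A + k * (A / N) - A / N := by
          rw [Expr.eval, T₄.tol, Expr.eval, T₄.hδ]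
        have ec' : (Expr.const 1).eval s₄ = 1 := by simp [Expr.eval]
        rw [ev, es, ec', Expr.eval_maxE]
        rfl
      set s₅ := evalList lb s₄ with hs₅
      have f11 : s₅.reg (rv d 11) = if max (s₄.reg (rv d 12)) (s₄.reg (rv d 21)) < 1 then
            A + k * (A / N) - A / N else s₄.reg (rv d 11) := by
        rw [← ex]; simp [hs₅, hlb, evalList, Config.setReg_reg]
      have f12 : s₅.reg (rv d 12) = if s₄.reg (rv d 21) < 1 then 1 else s₄.reg (rv d 12) := by
        simp [hs₅, hlb, evalList, Config.setReg_reg, Expr.eval]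
      have f13 : s₅.reg (rv d 13) = k := by
        rw [← e13]; simp [hs₅, hlb, evalList, Config.setReg_reg]
      have A₅ : Agree (rv d 10) s₅ s₄ := by
        refine ⟨fun a ha => ?_, rfl⟩
        have : ∀ j, a ≠ rv d (10 + j) := fun j => (ha.trans_le (by simp)).ne
        simp [hs₅, hlb, evalList, Config.setReg_reg, this 1, this 2]
      clear_value s₅
      refine ⟨f13, (agree_setReg (by simp) _ _).trans (A₅.trans A₄'), by simp [Config.setReg_reg],
        ?_⟩
      have g11 : ∀ x, (s₅.setReg (rv d 13) x).reg (rv d 11) = s₅.reg (rv d 11) := fun x => by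
        simp [Config.setReg_reg]
      have g12 : ∀ x, (s₅.setReg (rv d 13) x).reg (rv d 12) = s₅.reg (rv d 12) := fun x => by
        simp [Config.setReg_reg]
      rw [g11, g12, f11, f12, e11, e12']
      rcases hc with ⟨c₁, c₂⟩ | ⟨c₁, c₂⟩
      · rcases h₄ with ⟨h21, hT⟩ | ⟨h21, hT⟩
        · right
          rw [c₁, h21]
          simpa using HD.approx B hA hN hε hε' hεN hT c₂
        · left
          rw [c₁, h21]
          refine ⟨by simp, fun k' hk' => ?_⟩
          rcases Nat.lt_succ_iff_lt_or_eq.1 hk' with h | rfl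
          · exact c₂ k' h
          · exact hT
      · right
        rw [c₁, if_neg (not_lt.2 (le_max_left _ _))]
        exact ⟨by simp, c₂⟩
    · rintro s' ⟨hA', -, hc⟩
      rcases hc with ⟨-, c₂⟩ | ⟨-, c₂⟩
      -- The last threshold is `10 * A` and cannot be refuted, as there is a matching at `9 * A`.
      · refine absurd (B.upper.mono ?_) (c₂ (9 * N) (Nat.lt_succ_self _))
        have : ((9 * N : ℕ) : ℝ) * (A / N) = 9 * A := by push_cast; field_simp
        linarith
      · refine Runs.assign (by simp [Expr.Below]) trivial ⟨?_, ?_⟩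
        · rw [Config.setReg_mem, hA'.2, A₁.2]
        · simpa [Config.setReg_reg, Expr.eval] using c₂
  case bound =>
    have hM0 : 1 ≤ M := Nat.mul_pos (Nat.succ_pos _) (Nat.succ_pos _)
    have h₀ : 1 ≤ (N + 1) * M := Nat.mul_pos (Nat.succ_pos _) hM0
    have h₁ : costList (thresholdInit r) ≤ costList (thresholdInit r) * ((N + 1) * M) :=
      Nat.le_mul_of_pos_right _ h₀
    have h₂ : (ca + (K * M + costList lb)) + (Expr.add (.mul (.const 9) (rg d 2)) (.const 1)).cost
        + 8 ≤ (ca + K + costList lb + cf) * M := by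
      have a₁ : ca ≤ ca * M := Nat.le_mul_of_pos_right _ hM0
      have a₂ : costList lb ≤ costList lb * M := Nat.le_mul_of_pos_right _ hM0
      have a₃ : cf ≤ cf * M := Nat.le_mul_of_pos_right _ hM0
      calc _ = ca + (K * M + costList lb) + cf := by rw [hcf]; ring
        _ ≤ ca * M + (K * M + costList lb * M) + cf * M := by omega
        _ = _ := by ring
    calc _ ≤ costList (thresholdInit r) * ((N + 1) * M) +
          ((11 * (N + 1)) * ((ca + K + costList lb + cf) * M) + 2 * ((N + 1) * M)) :=
          Nat.add_le_add h₁ (Nat.add_le_add (Nat.mul_le_mul (by omega) h₂) (by omega))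
      _ = _ := by ring

theorem runs_queryProg (r : Role d) : ∃ K : ℕ, ∀ {n N J : ℕ}
    {z : ℕ → EuclideanSpace ℝ (Fin d)} {i j : ℕ} {u v p q : EuclideanSpace ℝ (Fin d)}
    {D ε : ℝ} {s : Config}, Query n N J z r i j u v p q s →
    IsDist (subVertex z i j u v) i j p q D →
    0 < ε → ε ≤ 1 → 120 * ((d : ℝ) + 1) ≤ ε * N →
    Runs (cells d n N J) (top d) (queryProg r) s
      (K * ((N + 1) * ((Nat.clog 2 n + 1) * (N + J + 1))))
      (fun s' => s'.mem = s.mem ∧ s'.reg 0 ≤ D ∧ D ≤ (1 + ε) * s'.reg 0) := by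
  obtain ⟨K₁, hK₁⟩ := runs_boundProg r
  obtain ⟨K₂, hK₂⟩ := runs_thresholdProg r
  refine ⟨K₁ + K₂ + 5, fun {n N J z i j u v p q D ε s} H HD hε hε' hεN => ?_⟩
  set X := (N + 1) * ((Nat.clog 2 n + 1) * (N + J + 1)) with hX
  have hX0 : 1 ≤ X := Nat.mul_pos (Nat.succ_pos _) (Nat.mul_pos (Nat.succ_pos _) (Nat.succ_pos _))
  refine Runs.le (T := K₁ * (Nat.clog 2 n + 1) + ((Expr.const 0).cost + (rg d 9).cost +
    (K₂ * X + 2) + 1)) ?key ?bound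
  case key =>
    refine Runs.seq ((hK₁ H).imp fun s₁ h₁ => ?_)
    obtain ⟨A₁, B⟩ := h₁
    have e0 : (Expr.const 0).eval s₁ = 0 := by simp [Expr.eval]
    refine Runs.ifLt trivial (by simp [Expr.Below]) trivial trivial (fun h => ?_) (fun h => ?_)
    · rw [e0] at h
      refine ((hK₂ (H.congr A₁) rfl h B HD hε hε' hεN).le (Nat.le_add_right _ _)).imp
        fun s' h' => ?_
      rwa [← A₁.2]
    -- If the bound is `0`, the distance lies between `0` and `9 * 0`, and the answer is exact; the
    -- thresholds would be useless here.
    · rw [e0] at h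
      have hA : s₁.reg (rv d 9) = 0 := le_antisymm (not_lt.1 h) (dist_nonneg.trans B.first)
      refine Runs.le (T := (Expr.const 0).cost + 1)
        (Runs.assign (e := .const 0) trivial trivial ⟨?_, ?_, ?_⟩) (Nat.le_add_left _ _)
      · rw [Config.setReg_mem, A₁.2]
      · have := HD.bound_le B
        rw [hA] at this
        simpa [Config.setReg_reg, Expr.eval] using this
      · have := HD.le _ B.upper
        rw [hA] at this
        simpa [Config.setReg_reg, Expr.eval] using this
  case bound =>
    have h₁ : Nat.clog 2 n + 1 ≤ X := by
      rw [hX]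
      exact (Nat.le_mul_of_pos_right _ (Nat.succ_pos _)).trans
        (Nat.le_mul_of_pos_left _ (Nat.succ_pos _))
    calc _ = K₁ * (Nat.clog 2 n + 1) + K₂ * X + 5 := by simp only [Expr.cost]; omega
      _ ≤ K₁ * X + K₂ * X + 5 * X := by
          have := Nat.mul_le_mul_left K₁ h₁
          omega
      _ = _ := by ring

end

end RealRAM

end
noncomputable section

open Set

/-! ### Reversal, and subcurves of an edge -/

/-- The reversal of a reparametrization. -/
def Reparam.reverse (f : Reparam) : Reparam where
  toFun x := unitInterval.symm (f.toFun (unitInterval.symm x))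
  continuous' := unitInterval.continuous_symm.comp
    (f.continuous'.comp unitInterval.continuous_symm)
  injective' := unitInterval.symm_bijective.injective.comp
    (f.injective'.comp unitInterval.symm_bijective.injective)
  map_zero' := by simp [f.map_one']
  map_one' := by simp [f.map_zero']

/-- Conjugation with the reversal maps reparametrizations to reparametrizations of the same width.
It is an involution, so one inequality suffices. -/
theorem frechetDist_reverse {E : Type*} [PseudoMetricSpace E] (X Y : unitInterval → E) :
    frechetDist (X ∘ unitInterval.symm) (Y ∘ unitInterval.symm) = frechetDist X Y := by
  have key : ∀ X Y : unitInterval → E,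
      frechetDist (X ∘ unitInterval.symm) (Y ∘ unitInterval.symm) ≤ frechetDist X Y := fun X Y => by
    refine le_ciInf fun f => (frechetDist_le_reparamWidth f.reverse _ _).trans_eq ?_
    simp only [reparamWidth, Reparam.reverse, Function.comp_apply, unitInterval.symm_symm]
    exact unitInterval.symm_bijective.surjective.iSup_comp fun α => dist (X (f.toFun α)) (Y α)
  refine le_antisymm (key X Y) ?_
  have := key (X ∘ unitInterval.symm) (Y ∘ unitInterval.symm)
  have e : ∀ X : unitInterval → E, (X ∘ unitInterval.symm) ∘ unitInterval.symm = X := fun X => by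
    ext; simp
  rwa [e, e] at this

section Curve

variable {d n : ℕ} {Z : Fin n → EuclideanSpace ℝ (Fin d)}

theorem subCurve_symm (a b : ℝ) : subCurve Z a b ∘ unitInterval.symm = subCurve Z b a := by
  ext1 t
  simp only [subCurve, Function.comp_apply, unitInterval.coe_symm_eq]
  congr 1
  ring

theorem segmentCurve_symm (p q : EuclideanSpace ℝ (Fin d)) :
    segmentCurve p q ∘ unitInterval.symm = segmentCurve q p := by
  ext1 t
  simp [segmentCurve, AffineMap.lineMap_apply_one_sub]

/-- A backward query becomes a forward query for the segment from `q` to `p`. -/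
theorem frechetDist_subCurve_swap (a b : ℝ) (p q : EuclideanSpace ℝ (Fin d)) :
    frechetDist (subCurve Z a b) (segmentCurve p q) =
      frechetDist (subCurve Z b a) (segmentCurve q p) := by
  rw [← frechetDist_reverse, subCurve_symm, segmentCurve_symm]

theorem subCurve_edge {i : ℕ} {a b : ℝ} (ha : a ∈ Icc (i : ℝ) (i + 1))
    (hb : b ∈ Icc (i : ℝ) (i + 1)) :
    subCurve Z a b = segmentCurve (polyCurve Z a) (polyCurve Z b) := by
  ext1 t
  have h₀ := t.2.1
  have h₁ := t.2.2
  have ht : a + (t : ℝ) * (b - a) ∈ Icc (i : ℝ) (i + 1) := by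
    have := (convex_Icc (i : ℝ) (i + 1)).lineMap_mem ha hb t.2
    rwa [AffineMap.lineMap_apply_module', smul_eq_mul, add_comm ((t : ℝ) * (b - a))] at this
  rw [subCurve, segmentCurve, polyCurve_eq Z ht.1 ht.2, polyCurve_eq Z ha.1 ha.2,
    polyCurve_eq Z hb.1 hb.2, lineMap_lineMap_lineMap]
  congr 1
  rw [AffineMap.lineMap_apply_module', smul_eq_mul]
  ring

/-- The endpoints are matched in any case, and the linear matching attains their larger distance by
convexity. This is the answer if `u` and `v` lie on the same edge. -/
theorem frechetDist_segmentCurve (u v p q : EuclideanSpace ℝ (Fin d)) :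
    frechetDist (segmentCurve u v) (segmentCurve p q) = max (dist u p) (dist v q) := by
  refine le_antisymm ?_ (le_ciInf fun f => max_le ?_ ?_)
  · refine frechetDist_le_of_pair (continuous_segmentCurve u v) (continuous_segmentCurve p q)
      continuous_id continuous_id monotone_id monotone_id rfl rfl rfl rfl fun t => ?_
    exact dist_lineMap_lineMap_le t.2 (le_max_left _ _) (le_max_right _ _)
  all_goals
    have hc : Continuous fun α => dist (segmentCurve u v (f.toFun α)) (segmentCurve p q α) :=
      ((continuous_segmentCurve u v).comp f.continuous').dist (continuous_segmentCurve p q)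
    have := le_ciSup (isCompact_range hc).bddAbove
  · have := this 0
    simpa [f.map_zero', segmentCurve, reparamWidth] using this
  · have := this 1
    simpa [f.map_one', segmentCurve, reparamWidth] using this

end Curve

namespace RealRAM

variable {d : ℕ} {S n : ℕ} {s : Config}

theorem isDist_frechetDist {Z : Fin n → EuclideanSpace ℝ (Fin d)} {i j : ℕ} (hij : i < j) {a b : ℝ}
    (ha : a ∈ Icc (i : ℝ) (i + 1)) (hb : b ∈ Icc (j : ℝ) (j + 1))
    (p q : EuclideanSpace ℝ (Fin d)) :
    IsDist (subVertex (polyVertex Z) i j (polyCurve Z a) (polyCurve Z b)) i j p q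
      (frechetDist (subCurve Z a b) (segmentCurve p q)) :=
  ⟨fun _ => frechetDist_le_of_traverse hij ha hb, fun _ => traverse_of_frechetDist_lt hij ha hb⟩

/-! ### The complete query program -/

/-- The role of the input registers if the first point precedes the second one. -/
def Role.forward (d : ℕ) : Role d where
  i := 0
  j := 1
  u := 2
  v := 2 + d
  p := 2 + 2 * d
  q := 2 + 3 * d
  hi := by simp [rv]
  hj := by simp [rv]; omega
  hu := by simp [rv]; omega
  hv := by simp [rv]; omega
  hp := by simp [rv]; omega
  hq := by simp [rv]; omega

/-- The same query for the reversed curves. -/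
def Role.reverse (r : Role d) : Role d :=
  ⟨r.j, r.i, r.v, r.u, r.q, r.p, r.hj, r.hi, r.hv, r.hu, r.hq, r.hp⟩

/-- Load the parameters of the layout. -/
def loadList (d : ℕ) : List (ℕ × Expr) :=
  [(rv d 0, .load (.const 0)), (rv d 1, .load (.const 1)), (rv d 2, .load (.const 2)),
    (rv d 3, .load (.const 3)), (rv d 4, .load (.const 4)), (rv d 5, .load (.const 5)),
    (rv d 6, .load (.const 6)), (rv d 7, .load (.const 7))]

/-- The distance of two segments. -/
def edgeE (d : ℕ) : Expr :=
  .maxE (VExpr.distE (VExpr.regs d 2) (VExpr.regs d (2 + 2 * d)))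
    (VExpr.distE (VExpr.regs d (2 + d)) (VExpr.regs d (2 + 3 * d)))

/-- The query program. -/
def answerProg (d : ℕ) : Program :=
  .seq (assigns (top d) (loadList d))
    (ifLt (top d) (.reg 0) (.reg 1) (queryProg (Role.forward d))
      (ifLt (top d) (.reg 1) (.reg 0) (queryProg (Role.forward d).reverse)
        (assign (top d) 0 (edgeE d))))

theorem runs_loadList {P : Config → Prop} (hS : 8 ≤ S)
    (h : ∀ s', Agree (rv d 0) s' s → (∀ k < 8, s'.reg (rv d k) = s'.mem k) → P s') :
    Runs S (top d) (assigns (top d) (loadList d)) s (costList (loadList d)) P := by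
  refine Runs.assigns ?_ ?_ (h _ ⟨fun a ha => ?_, rfl⟩ fun k hk => ?_)
  · simp [loadList, BelowList, Expr.Below]
  · have : ∀ {s' : Config} (k : ℕ), k < 8 →
        (Expr.load (.const (k : ℚ))).Ok S s' := fun k hk =>
      ⟨trivial, k, by omega, by simp [Expr.eval]⟩
    exact ⟨by simpa using this 0 (by omega), by simpa using this 1 (by omega),
      by simpa using this 2 (by omega), by simpa using this 3 (by omega),
      by simpa using this 4 (by omega), by simpa using this 5 (by omega),
      by simpa using this 6 (by omega), by simpa using this 7 (by omega), trivial⟩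
  · have : ∀ k, a ≠ rv d k := fun k => (ha.trans_le (by simp)).ne
    simp [loadList, evalList, Config.setReg_reg, this]
  · interval_cases k <;> simp [loadList, evalList, Config.setReg_reg, Expr.eval]

theorem VExpr.eval_regs {c : ℕ} {x : EuclideanSpace ℝ (Fin d)}
    (h : ∀ k : Fin d, s.reg (c + (k : ℕ)) = x k) : (VExpr.regs d c).eval s = x := by
  ext k
  exact h k

/-- The edge indices decide between a forward query, the same query with exchanged roles of the
input registers, and the exact formula for two segments. -/
theorem runs_answerProg (d : ℕ) (hd : 0 < d) : ∃ K : ℕ, ∀ {n N J : ℕ}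
    {Z : Fin n → EuclideanSpace ℝ (Fin d)} {i j : ℕ} {a b : ℝ}
    {p q : EuclideanSpace ℝ (Fin d)} {ε : ℝ} {s : Config}, DataOK n N J (polyVertex Z) s.mem →
    i + 1 < n → j + 1 < n → a ∈ Icc (i : ℝ) (i + 1) → b ∈ Icc (j : ℝ) (j + 1) →
    IsQueryInput s i j (polyCurve Z a) (polyCurve Z b) p q → 0 < N → 12 * d * N ≤ 2 ^ J →
    0 < ε → ε ≤ 1 → 120 * ((d : ℝ) + 1) ≤ ε * N →
    Runs (cells d n N J) (top d) (answerProg d) s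
      (K * ((N + 1) * ((Nat.clog 2 n + 1) * (N + J + 1))))
      (fun s' => s'.mem = s.mem ∧
        s'.reg 0 ≤ frechetDist (subCurve Z a b) (segmentCurve p q) ∧
        frechetDist (subCurve Z a b) (segmentCurve p q) ≤ (1 + ε) * s'.reg 0) := by
  obtain ⟨K₁, hK₁⟩ := runs_queryProg (Role.forward d)
  obtain ⟨K₂, hK₂⟩ := runs_queryProg (Role.forward d).reverse
  refine ⟨costList (loadList d) + K₁ + K₂ + (edgeE d).cost + 7,
    fun {n N J Z i j a b p q ε s} hD hin hjn ha hb hs hN hJ hε hε' hεN => ?_⟩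
  set X := (N + 1) * ((Nat.clog 2 n + 1) * (N + J + 1)) with hX
  have hX0 : 1 ≤ X :=
    Nat.mul_pos (Nat.succ_pos _) (Nat.mul_pos (Nat.succ_pos _) (Nat.succ_pos _))
  refine Runs.le (T := costList (loadList d) + (1 + 1 + (K₁ * X + (1 + 1 + (K₂ * X +
    ((edgeE d).cost + 1)) + 1)) + 1)) ?key ?bound
  case key =>
    refine Runs.seq (runs_loadList (by unfold cells nodeBase vertexBase; omega)
      fun s₁ A₁ h₁ => ?_)
    have G : Globals n N J d s₁ := by
      rw [← A₁.2] at hD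
      exact hD.header s₁ h₁
    rw [← A₁.2] at hD ⊢
    obtain ⟨hi, hj, hv⟩ := hs
    have r0 : s₁.reg 0 = i := by rw [A₁.1 _ (by simp [rv]), hi]
    have r1 : s₁.reg 1 = j := by rw [A₁.1 _ (by simp [rv]; omega), hj]
    have eu : (VExpr.regs d 2).eval s₁ = polyCurve Z a := VExpr.eval_regs fun k => by
      rw [A₁.1 _ (by have := k.2; simp [rv]; omega), (hv k).1]
    have ev : (VExpr.regs d (2 + d)).eval s₁ = polyCurve Z b := VExpr.eval_regs fun k => by
      rw [A₁.1 _ (by have := k.2; simp [rv]; omega), (hv k).2.1]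
    have ep : (VExpr.regs d (2 + 2 * d)).eval s₁ = p := VExpr.eval_regs fun k => by
      rw [A₁.1 _ (by have := k.2; simp [rv]; omega), (hv k).2.2.1]
    have eq : (VExpr.regs d (2 + 3 * d)).eval s₁ = q := VExpr.eval_regs fun k => by
      rw [A₁.1 _ (by have := k.2; simp [rv]; omega), (hv k).2.2.2]
    have b0 : (Expr.reg 0).Below (top d) := by simp [Expr.Below, rv]
    have b1 : (Expr.reg 1).Below (top d) := by simp only [Expr.Below, rv]; omega
    refine Runs.ifLt (e := .reg 0) (f := .reg 1) b0 b1 trivial trivial (fun h => ?_) (fun h => ?_)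
    · simp only [Expr.eval, r0, r1, Nat.cast_lt] at h
      exact (hK₁ ⟨G, hD, r0, r1, eu, ev, ep, eq, h, hjn, hN, hJ, hd⟩
        (isDist_frechetDist h ha hb p q) hε hε' hεN).le (Nat.le_add_right _ _)
    · simp only [Expr.eval, r0, r1, Nat.cast_lt] at h
      refine Runs.le (T := 1 + 1 + (K₂ * X + ((edgeE d).cost + 1)) + 1) ?_ (Nat.le_add_left _ _)
      refine Runs.ifLt (e := .reg 1) (f := .reg 0) b1 b0 trivial trivial (fun h => ?_)
        (fun h' => ?_)
      · simp only [Expr.eval, r0, r1, Nat.cast_lt] at h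
        rw [frechetDist_subCurve_swap]
        exact (hK₂ ⟨G, hD, r1, r0, ev, eu, eq, ep, h, hin, hN, hJ, hd⟩
          (isDist_frechetDist h hb ha q p) hε hε' hεN).le (Nat.le_add_right _ _)
      · simp only [Expr.eval, r0, r1, Nat.cast_lt] at h'
        obtain rfl : i = j := by omega
        have ed : (edgeE d).eval s₁ = frechetDist (subCurve Z a b) (segmentCurve p q) := by
          rw [subCurve_edge ha hb, frechetDist_segmentCurve, edgeE, Expr.eval_maxE,
            VExpr.eval_distE, VExpr.eval_distE, eu, ev, ep, eq]
        have below : ∀ k, k + d ≤ rv d 0 → (VExpr.regs d k).Below (top d) := fun k hk =>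
          VExpr.below_regs (hk.trans (by simp))
        refine Runs.le (T := (edgeE d).cost + 1) (Runs.assign (e := edgeE d) ?_ ?_ ⟨rfl, ?_, ?_⟩)
          (Nat.le_add_left _ _)
        · refine (Expr.below_maxE _ _).2 ⟨VExpr.below_distE (below _ ?_) (below _ ?_),
            VExpr.below_distE (below _ ?_) (below _ ?_)⟩ <;> (simp [rv]; omega)
        · exact (Expr.ok_maxE _ _).2 ⟨VExpr.ok_distE VExpr.ok_regs VExpr.ok_regs,
            VExpr.ok_distE VExpr.ok_regs VExpr.ok_regs⟩
        · rw [Config.setReg_reg, if_pos rfl, ed]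
        · rw [Config.setReg_reg, if_pos rfl, ed]
          have : 0 ≤ frechetDist (subCurve Z a b) (segmentCurve p q) :=
            Real.iInf_nonneg fun f => reparamWidth_nonneg f _ _
          nlinarith
  case bound =>
    have h₁ : costList (loadList d) + ((edgeE d).cost + 7) ≤
        (costList (loadList d) + ((edgeE d).cost + 7)) * X := Nat.le_mul_of_pos_right _ hX0
    calc _ = K₁ * X + K₂ * X + (costList (loadList d) + ((edgeE d).cost + 7)) := by ring
      _ ≤ K₁ * X + K₂ * X + (costList (loadList d) + ((edgeE d).cost + 7)) * X := by omega
      _ = _ := by ring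

end RealRAM

end
noncomputable section

open Set

/-! ### Resource bounds -/

theorem one_le_lg (x : ℝ) : 1 ≤ lg x := le_max_left _ _

theorem clog_le {m : ℕ} {x : ℝ} (h : (m : ℝ) ≤ x) (hx : 1 ≤ x) :
    (Nat.clog 2 m : ℝ) ≤ Real.logb 2 x + 1 := by
  have h₀ : 0 ≤ Real.logb 2 x := Real.logb_nonneg one_lt_two hx
  rcases Nat.eq_zero_or_pos (Nat.clog 2 m) with h₁ | h₁
  · rw [h₁]; push_cast; linarith
  · have hm : 1 < m := by
      by_contra hm
      rw [Nat.clog_of_right_le_one (not_lt.1 hm)] at h₁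
      exact absurd h₁ (lt_irrefl 0)
    have h₂ := Nat.pow_pred_clog_lt_self one_lt_two hm
    obtain ⟨k, hk⟩ := Nat.exists_eq_add_of_le' h₁
    rw [hk] at h₂ ⊢
    have h₃ : (2 : ℝ) ^ (k : ℝ) ≤ x := by
      rw [Real.rpow_natCast]
      refine le_trans ?_ h
      exact_mod_cast h₂.le
    have := (Real.le_logb_iff_rpow_le one_lt_two (by linarith)).2 h₃
    push_cast
    linarith

namespace RealRAM

theorem resolution_le (d : ℕ) {ε : ℝ} (hε : 0 < ε) (hε' : ε ≤ 1) :
    (resolution d ε : ℝ) ≤ (120 * (d + 1) + 1) * (1 / ε) := by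
  have h₁ : 1 ≤ 1 / ε := (le_div_iff₀ hε).2 (by linarith)
  have h₂ := Nat.floor_le (a := 120 * ((d : ℝ) + 1) / ε) (by positivity)
  rw [resolution]
  push_cast
  calc _ ≤ 120 * ((d : ℝ) + 1) / ε + 1 / ε := add_le_add h₂ h₁
    _ = _ := by ring

/-- The number of scales is the logarithm of a constant multiple of `N`, and `N` is of order `1 /
ε`. -/
theorem scales_le (d : ℕ) (hd : 0 < d) : ∃ C : ℝ, 0 ≤ C ∧ ∀ {ε : ℝ}, 0 < ε → ε ≤ 1 →
    (scales d ε : ℝ) + 1 ≤ C * lg (1 / ε) := by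
  have hd' : (1 : ℝ) ≤ d := by exact_mod_cast hd
  set c : ℝ := 12 * d * (120 * (d + 1) + 1) with hc
  have hc1 : 1 ≤ c := by nlinarith
  have hlc : 0 ≤ Real.logb 2 c := Real.logb_nonneg one_lt_two hc1
  refine ⟨Real.logb 2 c + 3, by linarith, fun {ε} hε hε' => ?_⟩
  have h₁ : 1 ≤ 1 / ε := (le_div_iff₀ hε).2 (by linarith)
  have h₂ : ((12 * d * resolution d ε : ℕ) : ℝ) ≤ c * (1 / ε) := by
    push_cast
    rw [hc, mul_assoc (12 * (d : ℝ))]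
    exact mul_le_mul_of_nonneg_left (resolution_le d hε hε') (by positivity)
  have h₃ := clog_le h₂ (by nlinarith)
  rw [Real.logb_mul (by linarith) (by linarith)] at h₃
  have h₄ : Real.logb 2 (1 / ε) ≤ lg (1 / ε) := le_max_right _ _
  have h₅ := one_le_lg (1 / ε)
  rw [scales]
  nlinarith

/-- A node has of order `(J + 1) * N ^ (2 * d)` cells, and its time bound contains another factor `J
+ 1`: together `ε ^ (-2 * d)` times a squared logarithm, which is the square of `chi`. -/
theorem nodeCells_le (d : ℕ) (hd : 0 < d) : ∃ C : ℝ, 0 ≤ C ∧ ∀ {ε : ℝ}, 0 < ε → ε ≤ 1 →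
    (nodeCells d (resolution d ε) (scales d ε) : ℝ) * (scales d ε + 1) ≤ C * chi d ε ^ 2 := by
  obtain ⟨C, hC, h⟩ := scales_le d hd
  set c : ℝ := 23 * (120 * (d + 1) + 1) with hc
  refine ⟨(1 + C * (c ^ d * c ^ d)) * C, by positivity, fun {ε} hε hε' => ?_⟩
  have hx : 1 ≤ 1 / ε := (le_div_iff₀ hε).2 (by linarith)
  have hL := one_le_lg (1 / ε)
  have hJ := h hε hε'
  set x := 1 / ε
  set L := lg x
  have hN := resolution_le d hε hε'
  have hN1 : (1 : ℝ) ≤ resolution d ε := by exact_mod_cast Nat.succ_pos _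
  have hg : ((gridCard d (resolution d ε) : ℕ) : ℝ) ≤ c ^ d * x ^ d := by
    rw [gridCard, ← mul_pow]
    push_cast
    gcongr
    rw [hc]
    linarith
  have hxd : 1 ≤ x ^ d * x ^ d := by
    have := one_le_pow₀ hx (n := d)
    nlinarith
  have hn : (nodeCells d (resolution d ε) (scales d ε) : ℝ) ≤
      (1 + C * (c ^ d * c ^ d)) * (L * (x ^ d * x ^ d)) := by
    rw [nodeCells]
    push_cast
    have h₁ : (1 : ℝ) ≤ L * (x ^ d * x ^ d) := by nlinarith
    calc _ ≤ L * (x ^ d * x ^ d) + C * L * (c ^ d * x ^ d * (c ^ d * x ^ d)) := by gcongr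
      _ = _ := by ring
  calc _ ≤ (1 + C * (c ^ d * c ^ d)) * (L * (x ^ d * x ^ d)) * (C * L) := by gcongr
    _ = _ := by rw [chi]; ring

theorem cells_le (d : ℕ) (hd : 0 < d) : ∃ C : ℝ, 0 ≤ C ∧ ∀ {n : ℕ} {ε : ℝ}, 2 ≤ n → 0 < ε →
    ε ≤ 1 → (cells d n (resolution d ε) (scales d ε) : ℝ) ≤ C * (n * chi d ε ^ 2) := by
  obtain ⟨C, hC, h⟩ := nodeCells_le d hd
  refine ⟨2 * d + 8 + 2 * C, by positivity, fun {n ε} hn hε hε' => ?_⟩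
  have hx : 1 ≤ 1 / ε := (le_div_iff₀ hε).2 (by linarith)
  have hn' : (1 : ℝ) ≤ n := by exact_mod_cast one_le_two.trans hn
  have hχ : 1 ≤ chi d ε ^ 2 := one_le_pow₀ (by
    rw [chi]
    have := one_le_pow₀ hx (n := d)
    have := one_le_lg (1 / ε)
    nlinarith)
  have h₁ : (nodeCells d (resolution d ε) (scales d ε) : ℝ) ≤ C * chi d ε ^ 2 :=
    le_trans (le_mul_of_one_le_right (Nat.cast_nonneg _) (by simp)) (h hε hε')
  rw [cells, nodeBase, vertexBase]
  push_cast
  have h₂ : (n : ℝ) ≤ n * chi d ε ^ 2 := le_mul_of_one_le_right (by linarith) hχ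
  have hd' : (0 : ℝ) ≤ d := Nat.cast_nonneg d
  calc (n : ℝ) * d + 8 + n * d + 2 * n * (nodeCells d (resolution d ε) (scales d ε) : ℝ)
      = (2 * d) * n + 8 + 2 * n * (nodeCells d (resolution d ε) (scales d ε) : ℝ) := by ring
    _ ≤ (2 * d) * (n * chi d ε ^ 2) + 8 * (n * chi d ε ^ 2) + 2 * n * (C * chi d ε ^ 2) := by
        gcongr
        linarith
    _ = _ := by ring

theorem clog_add_one_le {n : ℕ} (hn : 2 ≤ n) : (Nat.clog 2 n : ℝ) + 1 ≤ 3 * lg n := by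
  have h₁ := clog_le (m := n) le_rfl (by exact_mod_cast one_le_two.trans hn)
  have h₂ : Real.logb 2 n ≤ lg n := le_max_right _ _
  have h₃ := one_le_lg n
  linarith

theorem Runs.exec {S W : ℕ} {P : Program} {s : Config} {T : ℕ} {Q : Config → Prop}
    (h : Runs S W P s T Q) : ∃ t σ' s', Exec S P s t σ' ∧ Agree W σ' s' ∧ t ≤ T ∧ Q s' :=
  h s (Agree.refl _ _)

end RealRAM

/-! ### Proof of the theorem -/

open RealRAM in
theorem mainTheorem2 (d : ℕ) :
    ∃ (build query : RealRAM.Program) (C : ℝ),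
      ∀ (n : ℕ) (_ : 2 ≤ n) (Z : Fin n → EuclideanSpace ℝ (Fin d))
        (ε : ℝ) (_ : 0 < ε) (_ : ε ≤ 1)
        (σ₀ : RealRAM.Config) (_ : IsCurveInput σ₀ Z ε),
        -- `S`: number of memory cells available to preprocessing and queries;
        -- the first `K` cells of `σ₁` are the data structure
        ∃ (S K T : ℕ) (σ₁ : RealRAM.Config),
          (S : ℝ) ≤ C * (n * chi d ε ^ 2) ∧ K ≤ S ∧
          RealRAM.Exec S build σ₀ T σ₁ ∧
          (T : ℝ) ≤ C * (chi d ε ^ 2 * n * lg n ^ 2) ∧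
          ∀ (i j : ℕ) (_ : i + 1 < n) (_ : j + 1 < n)
            (a b : ℝ) (_ : a ∈ Set.Icc (i : ℝ) (i + 1)) (_ : b ∈ Set.Icc (j : ℝ) (j + 1))
            (p q : EuclideanSpace ℝ (Fin d))
            (τ : RealRAM.Config) (_ : ∀ k < K, τ.mem k = σ₁.mem k)
            (_ : IsQueryInput τ i j (polyCurve Z a) (polyCurve Z b) p q),
            ∃ (t : ℕ) (τ' : RealRAM.Config),
              RealRAM.Exec S query τ t τ' ∧
              (t : ℝ) ≤ C * ((1 / ε) ^ 2 * lg n * lg (lg n)) ∧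
              (∀ k < K, τ'.mem k = σ₁.mem k) ∧
              τ'.reg 0 ≤ frechetDist (subCurve Z a b) (segmentCurve p q) ∧
              frechetDist (subCurve Z a b) (segmentCurve p q) ≤ (1 + ε) * τ'.reg 0 := by
  have hlg : ∀ {n : ℕ} {ε : ℝ}, 0 < ε → ε ≤ 1 →
      1 ≤ (1 / ε) ^ 2 * lg n * lg (lg n) ∧ 1 ≤ chi d ε ^ 2 := fun {n ε} hε hε' => by
    have hx : 1 ≤ 1 / ε := (le_div_iff₀ hε).2 (by linarith)
    have h₁ := one_le_pow₀ hx (n := d)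
    have h₂ := one_le_pow₀ hx (n := 2)
    refine ⟨one_le_mul_of_one_le_of_one_le (one_le_mul_of_one_le_of_one_le h₂ (one_le_lg _))
      (one_le_lg _), one_le_pow₀ (one_le_mul_of_one_le_of_one_le h₁ (one_le_lg _))⟩
  rcases Nat.eq_zero_or_pos d with rfl | hd
  -- In dimension `0` all points coincide and the answer is `0`. Treating this case separately
  -- allows `0 < d` in the construction, for instance in the choice of `J`.
  · refine ⟨.instr (.const 0 0), .instr (.const 0 0), 1,
      fun n hn Z ε hε hε' σ₀ _ => ⟨0, 0, 1, _, ?_, le_rfl, .instr (.const 0 0 σ₀), ?_, ?_⟩⟩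
    · push_cast
      positivity
    · have hn' : (1 : ℝ) ≤ n := by exact_mod_cast one_le_two.trans hn
      push_cast
      rw [one_mul]
      exact one_le_mul_of_one_le_of_one_le (one_le_mul_of_one_le_of_one_le
        (hlg (n := n) hε hε').2 hn') (one_le_pow₀ (one_le_lg _))
    · intro i j _ _ a b _ _ p q τ _ _
      have e : frechetDist (subCurve Z a b) (segmentCurve p q) = 0 := by
        have : ∀ f, reparamWidth f (subCurve Z a b) (segmentCurve p q) = 0 := fun f =>
          le_antisymm (Real.iSup_le (fun α => (dist_eq_zero.2 (Subsingleton.elim _ _)).le) le_rfl)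
            (reparamWidth_nonneg f _ _)
        simp [frechetDist, this]
      refine ⟨1, _, .instr (.const 0 0 τ), ?_, by simp, ?_, ?_⟩
      · push_cast
        rw [one_mul]
        exact (hlg hε hε').1
      · simp [e, Config.setReg_reg]
      · simp [e, Config.setReg_reg]
  · obtain ⟨K₁, h₁⟩ := runs_buildProg d hd
    obtain ⟨K₂, h₂⟩ := runs_answerProg d hd
    obtain ⟨C₁, hC₁, hcells⟩ := cells_le d hd
    obtain ⟨C₂, hC₂, hnode⟩ := nodeCells_le d hd
    set c : ℝ := 120 * (d + 1) + 1 with hc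
    have hc0 : 0 ≤ c := by positivity
    set C₃ : ℝ := K₂ * ((c + 1) * (3 * ((12 * d + 1) * c + 1))) with hC₃
    have hC₃0 : 0 ≤ C₃ := by positivity
    refine ⟨buildProg d, answerProg d, C₁ + 3 * K₁ * C₂ + C₃,
      fun n hn Z ε hε hε' σ₀ hσ₀ => ?_⟩
    set N := resolution d ε with hN
    set J := scales d ε with hJ
    obtain ⟨T, σ₁, s₁, hx, hA, hT, hQ⟩ := (h₁ (by omega) hε hσ₀).exec
    rw [← hA.2] at hQ
    have hK : (0 : ℝ) ≤ 3 * K₁ * C₂ := by positivity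
    -- The whole memory counts as the data structure; the query program only reads it.
    refine ⟨cells d n N J, cells d n N J, T, σ₁, ?_, le_rfl, hx, ?_, ?_⟩
    · refine (hcells hn hε hε').trans (mul_le_mul_of_nonneg_right (by linarith) (by positivity))
    · have hT' : (T : ℝ) ≤ K₁ * ((Nat.clog 2 n + 1) * (nodeCells d N J * ((J + 1) * n))) := by
        exact_mod_cast hT
      have hl := one_le_lg n
      calc (T : ℝ) ≤ K₁ * ((Nat.clog 2 n + 1) * ((nodeCells d N J * (J + 1)) * n)) :=
            hT'.trans_eq (by ring)
        _ ≤ K₁ * ((3 * lg n ^ 2) * ((C₂ * chi d ε ^ 2) * n)) := by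
            have := clog_add_one_le hn
            have h₃ : (Nat.clog 2 n : ℝ) + 1 ≤ 3 * lg n ^ 2 := by nlinarith
            have := hnode hε hε'
            gcongr
        _ = 3 * K₁ * C₂ * (chi d ε ^ 2 * n * lg n ^ 2) := by ring
        _ ≤ _ := mul_le_mul_of_nonneg_right (by linarith) (by positivity)
    · intro i j hi hj a b ha hb p q τ hτ hin
      obtain ⟨t, τ', s', hx', hA', ht, hmem, hle, hge⟩ := (h₂ (hQ.congr hτ) hi hj ha hb hin
        (Nat.succ_pos _) (Nat.le_pow_clog one_lt_two _) hε hε' (le_resolution hε)).exec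
      have h0 : τ'.reg 0 = s'.reg 0 := hA'.1 0 (by simp [rv])
      refine ⟨t, τ', hx', ?_, fun k hk => by rw [hA'.2, hmem, hτ k hk], h0 ▸ hle, h0 ▸ hge⟩
      have hx1 : 1 ≤ 1 / ε := (le_div_iff₀ hε).2 (by linarith)
      have ht' : (t : ℝ) ≤ K₂ * ((N + 1) * ((Nat.clog 2 n + 1) * (N + J + 1))) := by
        exact_mod_cast ht
      have hNx : (N : ℝ) ≤ c * (1 / ε) := resolution_le d hε hε'
      -- The crude bound of a logarithm by its argument suffices here: `N + J` is of order `1 / ε`.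
      have hJN : (J : ℝ) ≤ 12 * d * N := by
        exact_mod_cast Nat.clog_le_of_le_pow Nat.lt_two_pow_self.le
      have hl := one_le_lg n
      have hll := one_le_lg (lg n)
      have := clog_add_one_le hn
      calc (t : ℝ) ≤ K₂ * ((c * (1 / ε) + 1 / ε) * ((3 * lg n) *
            (c * (1 / ε) + 12 * d * (c * (1 / ε)) + 1 / ε))) := by
            refine ht'.trans ?_
            have : (J : ℝ) ≤ 12 * d * (c * (1 / ε)) :=
              hJN.trans (mul_le_mul_of_nonneg_left hNx (by positivity))
            gcongr
        _ = C₃ * ((1 / ε) ^ 2 * lg n) := by rw [hC₃]; ring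
        -- The running time obtained is already of order `ε ^ (-2) * lg n`; the last factor is at
        -- least `1` and is only inserted.
        _ ≤ C₃ * ((1 / ε) ^ 2 * lg n * lg (lg n)) := by
            refine mul_le_mul_of_nonneg_left (le_mul_of_one_le_right ?_ hll) hC₃0
            positivity
        _ ≤ _ := mul_le_mul_of_nonneg_right (by linarith) (by positivity)

end
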